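/- Let $N\ge 3$, $2^*=2N/(N-2)$, let $\Omega\subset\mathbb R^N$ be a bounded domain (non-empty, open, connected), let $A:\Omega\to\mathbb R^N$ be a bounded measurable vector field, and let $r>0$, $\kappa\ge 0$. No further assumption on $\partial\Omega$ or on $r$ is needed. **Notation.** Put $\nabla_A u=(-i\partial_j u-A^ju)_{j=1}^N$, and let $E$ be the real Hilbert space obtained as the closure of $C_c^\infty(\Omega,\mathbb C)$ with respect to the norm $\left(\int_\Omega(|\nabla_Au|^2+|u|^2)\,dx\right)^{1/2}$ (equivalent, for each $\kappa\ge0$, to $\left(\int_\Omega(|\nabla_Au|^2+\kappa|u|^2)\,dx\right)^{1/2}$). For $p\in(2,2^*)$ let $$I_{\kappa,p}(u)=\frac12\int_\Omega(|\nabla_Au|^2+\kappa|u|^2)\,dx-\frac1p\int_\Omega|u|^p\,dx\quad(u\in E),\qquad \mathcal M_{\kappa,p}=\{u\in E\setminus\{0\}: I_{\kappa,p}'(u)u=0\},$$ $$\mathcal M_{\kappa,p}^{a}=\{u\in\mathcal M_{\kappa,p}: I_{\kappa,p}(u)\le a\},\qquad \beta(u)=\frac{\int_\Omega x\,|u|^{2^*}dx}{\int_\Omega|u|^{2^*}dx}\quad(u\in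 E\setminus\{0\}),$$ $$S=\inf_{u\in H^1_0(\Omega,\mathbb R)\setminus\{0\}}\frac{\int_\Omega|\nabla u|^2dx}{\left(\int_\Omega|u|^{2^*}dx\right)^{2/2^*}},$$ $$\Omega_r^+=\{x\in\mathbb R^N:\operatorname{dist}(x,\Omega)\le r\},\qquad \Omega_r^-=\{x\in\Omega:\operatorname{dist}(x,\partial\Omega)\ge r\}.$$ On $H^1_0(B_r(0),\mathbb R)$ let $J_{\kappa,p,r}(u)=\frac12\int_{B_r(0)}(|\nabla u|^2+\kappa u^2)\,dx-\frac1p\int_{B_r(0)}|u|^p\,dx$. A *ground state* is an almost everywhere positive, radially symmetric $u\in H_0^1(B_r(0),\mathbb R)\setminus\{0\}$ with $J_{\kappa,p,r}'(u)=0$ at which $J_{\kappa,p,r}$ attains its infimum over the Nehari manifold $\{v\in H_0^1(B_r(0),\mathbb R)\setminus\{0\}:J_{\kappa,p,r}'(v)v=0\}$. Given a ground state $u$, let $\Phi_{\kappa,p}:\Omega_r^-\to\mathcal M_{\kappa,p}$ be the map for which $$[\Phi_{\kappa,p}(y)](x)=\begin{cases}t_y\,e^{i\tau_y(x)}u(x-y),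 & x\in B_r(y),\\ 0,& x\in\Omega\setminus B_r(y),\end{cases}\qquad \tau_y(x)=\sum_{j=1}^NA^j(y)x^j,$$ where $t_y>0$ is the number that puts this function on $\mathcal M_{\kappa,p}$. **Proposition.** There are $\epsilon>0$ and $p^*\in(2,2^*)$ such that, for every $p\in[p^*,2^*)$ and every $u\in\mathcal M_{\kappa,p}$ with $I_{\kappa,p}(u)\le\frac1NS^{N/2}+\epsilon$, one has $\beta(u)\in\Omega_r^+$. **Corollary.** Let $\epsilon>0$ and $p^*\in(2,2^*)$ be as in the Proposition, and put $\epsilon^*=\frac1NS^{N/2}+\epsilon$. There is $\overline p\in(2,2^*)$ such that, for every $p\in[\overline p,2^*)$: a ground state exists; for every ground state $u$, the map $\Phi_{\kappa,p}$ built from $u$ is well defined (it exists and is unique) and $$\Phi_{\kappa,p}(\Omega_r^-)\subset\mathcal M_{\kappa,p}^{\epsilon^*};$$ and $$\beta(\mathcal M_{\kappa,p}^{\epsilon^*})\subset\Omega_r^+.$$ -/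

import Mathlib

open MeasureTheory Set
open scoped ENNReal ContDiff

noncomputable section

namespace MagneticNehari

/-- The space `ℝ^N` with its Euclidean norm. -/
abbrev RN (N : ℕ) := EuclideanSpace ℝ (Fin N)

/-- The critical Sobolev exponent `2* = 2N/(N-2)`. -/
def critExp (N : ℕ) : ℝ := 2 * (N : ℝ) / ((N : ℝ) - 2)

/-- `φ ∈ C_c^∞(Ω, F)`, functions on `Ω` being extended by zero. -/
def IsTest {N : ℕ} {F : Type*} [NormedAddCommGroup F] [NormedSpace ℝ F]
    (Ω : Set (RN N)) (φ : RN N → F) : Prop :=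
  ContDiff ℝ ∞ φ ∧ HasCompactSupport φ ∧ tsupport φ ⊆ Ω

theorem IsTest.zero {N : ℕ} {F : Type*} [NormedAddCommGroup F] [NormedSpace ℝ F]
    (Ω : Set (RN N)) : IsTest Ω (0 : RN N → F) := by
  refine ⟨contDiff_const, HasCompactSupport.zero, ?_⟩
  have h : tsupport (0 : RN N → F) = ∅ := tsupport_eq_empty_iff.mpr rfl
  rw [h]
  exact empty_subset _

theorem IsTest.add {N : ℕ} {F : Type*} [NormedAddCommGroup F] [NormedSpace ℝ F]
    {Ω : Set (RN N)} {φ ψ : RN N → F} (hφ : IsTest Ω φ) (hψ : IsTest Ω ψ) :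
    IsTest Ω (φ + ψ) :=
  ⟨hφ.1.add hψ.1, hφ.2.1.add hψ.2.1,
    (tsupport_add φ ψ).trans (union_subset hφ.2.2 hψ.2.2)⟩

theorem IsTest.smul {N : ℕ} {F : Type*} [NormedAddCommGroup F] [NormedSpace ℝ F]
    {Ω : Set (RN N)} {φ : RN N → F} (c : ℝ) (hφ : IsTest Ω φ) :
    IsTest Ω (c • φ) :=
  ⟨hφ.1.const_smul c, hφ.2.1.smul_left (f := fun _ => c),
    (closure_mono (Function.support_const_smul_subset c φ)).trans hφ.2.2⟩

theorem IsTest.differentiable {N : ℕ} {F : Type*} [NormedAddCommGroup F] [NormedSpace ℝ F]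
    {Ω : Set (RN N)} {φ : RN N → F} (hφ : IsTest Ω φ) : Differentiable ℝ φ :=
  hφ.1.differentiable (by simp)

/-! ### The magnetic space -/

/-- The magnetic gradient `∇_A φ = (-i ∂_j φ - A^j φ)_j` of a differentiable function. -/
def magGrad {N : ℕ} (A : RN N → RN N) (φ : RN N → ℂ) (x : RN N) : EuclideanSpace ℂ (Fin N) :=
  WithLp.toLp 2 fun j =>
    -Complex.I * fderiv ℝ φ x (EuclideanSpace.single j 1) - ((A x j : ℝ) : ℂ) * φ x

/-- Pairs `(u, W)` of square integrable maps `u : Ω → ℂ` and `W : Ω → ℂ^N`. -/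
abbrev MagPair {N : ℕ} (Ω : Set (RN N)) :=
  WithLp 2 (Lp ℂ 2 (volume.restrict Ω) × Lp (EuclideanSpace ℂ (Fin N)) 2 (volume.restrict Ω))

/-- The graph `{(φ, ∇_A φ) : φ ∈ C_c^∞(Ω, ℂ)}`. -/
def magGraph {N : ℕ} (Ω : Set (RN N)) (A : RN N → RN N) : Submodule ℝ (MagPair Ω) where
  carrier := {w | ∃ φ : RN N → ℂ, IsTest Ω φ ∧
    w.fst =ᵐ[volume.restrict Ω] φ ∧ w.snd =ᵐ[volume.restrict Ω] magGrad A φ}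
  zero_mem' := by
    refine ⟨0, IsTest.zero Ω, Lp.coeFn_zero _ _ _, (Lp.coeFn_zero _ _ _).trans ?_⟩
    refine Filter.Eventually.of_forall fun x => ?_
    ext j
    simp [magGrad]
  add_mem' := by
    rintro v w ⟨φ, hφ, hv1, hv2⟩ ⟨ψ, hψ, hw1, hw2⟩
    refine ⟨φ + ψ, hφ.add hψ, (Lp.coeFn_add _ _).trans (hv1.add hw1),
      (Lp.coeFn_add _ _).trans ((hv2.add hw2).trans ?_)⟩
    refine Filter.Eventually.of_forall fun x => ?_
    ext j
    simp only [magGrad, Pi.add_apply, PiLp.add_apply,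
      fderiv_add hφ.differentiable.differentiableAt hψ.differentiable.differentiableAt,
      _root_.add_apply]
    ring
  smul_mem' := by
    rintro c v ⟨φ, hφ, hv1, hv2⟩
    refine ⟨c • φ, hφ.smul c, (Lp.coeFn_smul _ _).trans (hv1.const_smul c),
      (Lp.coeFn_smul _ _).trans ((hv2.const_smul c).trans ?_)⟩
    refine Filter.Eventually.of_forall fun x => ?_
    ext j
    simp only [magGrad, Pi.smul_apply, PiLp.smul_apply,
      fderiv_const_smul hφ.differentiable.differentiableAt c,
      _root_.smul_apply, Complex.real_smul]
    ring

/-- The real Hilbert space `E`: the closure of `C_c^∞(Ω, ℂ)` for the norm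
`(∫_Ω |∇_A u|² + |u|²)^{1/2}`, realised as the closure of the graph of `∇_A`. Its elements are the
pairs `(u, ∇_A u)`. When `Ω` and `A` are bounded this norm is equivalent, for each `κ ≥ 0`, to
`(∫_Ω |∇_A u|² + κ |u|²)^{1/2}` (for `κ = 0` by the Poincaré and diamagnetic inequalities). -/
def magSpace {N : ℕ} (Ω : Set (RN N)) (A : RN N → RN N) : Submodule ℝ (MagPair Ω) :=
  (magGraph Ω A).topologicalClosure

/-- `I_{κ,p,Ω}(u) = 1/2 ∫_Ω (|∇_A u|² + κ |u|²) - 1/p ∫_Ω |u|^p` on `E`. -/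
def magEnergy {N : ℕ} (Ω : Set (RN N)) (A : RN N → RN N) (κ p : ℝ) (u : magSpace Ω A) : ℝ :=
  1 / 2 * (∫ x in Ω, (‖u.1.snd x‖ ^ 2 + κ * ‖u.1.fst x‖ ^ 2))
    - 1 / p * ∫ x in Ω, ‖u.1.fst x‖ ^ p

/-- The Nehari manifold `M_{κ,p,Ω} = {u ∈ E \ {0} : I'(u)u = 0}`. -/
def magNehari {N : ℕ} (Ω : Set (RN N)) (A : RN N → RN N) (κ p : ℝ) : Set (magSpace Ω A) :=
  {u | u ≠ 0 ∧ fderiv ℝ (magEnergy Ω A κ p) u u = 0}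

/-- `M^a = {u ∈ M_{κ,p,Ω} : I_{κ,p,Ω}(u) ≤ a}`. -/
def magNehariSublevel {N : ℕ} (Ω : Set (RN N)) (A : RN N → RN N) (κ p a : ℝ) :
    Set (magSpace Ω A) :=
  {u | u ∈ magNehari Ω A κ p ∧ magEnergy Ω A κ p u ≤ a}

/-- The barycenter `β(u) = ∫_Ω x |u|^{2*} / ∫_Ω |u|^{2*}`. -/
def barycenter {N : ℕ} {Ω : Set (RN N)} {A : RN N → RN N} (u : magSpace Ω A) : RN N :=
  (∫ x in Ω, ‖u.1.fst x‖ ^ critExp N)⁻¹ • ∫ x in Ω, (‖u.1.fst x‖ ^ critExp N) • x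

/-! ### The real Sobolev space, the best constant and the ground states -/

/-- Pairs `(u, W)` of square integrable maps `u : D → ℝ` and `W : D → ℝ^N`. -/
abbrev RealPair {N : ℕ} (D : Set (RN N)) :=
  WithLp 2 (Lp ℝ 2 (volume.restrict D) × Lp (RN N) 2 (volume.restrict D))

/-- The graph `{(φ, ∇φ) : φ ∈ C_c^∞(D, ℝ)}`. -/
def gradGraph {N : ℕ} (D : Set (RN N)) : Submodule ℝ (RealPair D) where
  carrier := {w | ∃ φ : RN N → ℝ, IsTest D φ ∧
    w.fst =ᵐ[volume.restrict D] φ ∧ w.snd =ᵐ[volume.restrict D] gradient φ}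
  zero_mem' := by
    refine ⟨0, IsTest.zero D, Lp.coeFn_zero _ _ _, (Lp.coeFn_zero _ _ _).trans ?_⟩
    refine Filter.Eventually.of_forall fun x => ?_
    simp [gradient]
  add_mem' := by
    rintro v w ⟨φ, hφ, hv1, hv2⟩ ⟨ψ, hψ, hw1, hw2⟩
    refine ⟨φ + ψ, hφ.add hψ, (Lp.coeFn_add _ _).trans (hv1.add hw1),
      (Lp.coeFn_add _ _).trans ((hv2.add hw2).trans ?_)⟩
    refine Filter.Eventually.of_forall fun x => ?_
    simp only [gradient, Pi.add_apply,
      fderiv_add hφ.differentiable.differentiableAt hψ.differentiable.differentiableAt, map_add]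
  smul_mem' := by
    rintro c v ⟨φ, hφ, hv1, hv2⟩
    refine ⟨c • φ, hφ.smul c, (Lp.coeFn_smul _ _).trans (hv1.const_smul c),
      (Lp.coeFn_smul _ _).trans ((hv2.const_smul c).trans ?_)⟩
    refine Filter.Eventually.of_forall fun x => ?_
    simp [gradient, fderiv_const_smul hφ.differentiable.differentiableAt c]

/-- `H^1_0(D, ℝ)`: the closure of `C_c^∞(D, ℝ)` in `H^1`, its elements being the
pairs `(u, ∇u)`. -/
def H10 {N : ℕ} (D : Set (RN N)) : Submodule ℝ (RealPair D) :=
  (gradGraph D).topologicalClosure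

/-- The best constant `S` of `H^1_0(Ω) ↪ L^{2*}(Ω)`: the infimum of
`∫_Ω |∇u|² / (∫_Ω |u|^{2*})^{2/2*}` over `u ∈ H^1_0(Ω) \ {0}`. -/
def sobolevConst {N : ℕ} (Ω : Set (RN N)) : ℝ :=
  sInf {q : ℝ | ∃ u : H10 Ω, u ≠ 0 ∧
    q = (∫ x in Ω, ‖u.1.snd x‖ ^ 2) / (∫ x in Ω, |u.1.fst x| ^ critExp N) ^ (2 / critExp N)}

/-- `J_{κ,p,D}(u) = 1/2 ∫_D (|∇u|² + κ u²) - 1/p ∫_D |u|^p` on `H^1_0(D, ℝ)`. -/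
def realEnergy {N : ℕ} (D : Set (RN N)) (κ p : ℝ) (u : H10 D) : ℝ :=
  1 / 2 * (∫ x in D, (‖u.1.snd x‖ ^ 2 + κ * (u.1.fst x) ^ 2))
    - 1 / p * ∫ x in D, |u.1.fst x| ^ p

/-- The Nehari manifold `N_{κ,p,D} = {u ∈ H^1_0(D, ℝ) \ {0} : J'(u)u = 0}`. -/
def realNehari {N : ℕ} (D : Set (RN N)) (κ p : ℝ) : Set (H10 D) :=
  {u | u ≠ 0 ∧ fderiv ℝ (realEnergy D κ p) u u = 0}

/-- `c_{κ,p,D} = inf J_{κ,p,D}` over the Nehari manifold. -/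
def groundLevel {N : ℕ} (D : Set (RN N)) (κ p : ℝ) : ℝ :=
  sInf (realEnergy D κ p '' realNehari D κ p)

/-- `u` is a positive radially symmetric function on `B_r(0)` in `N_{κ,p,r}`, with
`J_{κ,p,r}(u) = c_{κ,p,r}` and `J_{κ,p,r}'(u) = 0`. -/
def IsGroundState {N : ℕ} (r κ p : ℝ) (u : H10 (Metric.ball (0 : RN N) r)) : Prop :=
  u ∈ realNehari (Metric.ball (0 : RN N) r) κ p ∧
  realEnergy (Metric.ball (0 : RN N) r) κ p u = groundLevel (Metric.ball (0 : RN N) r) κ p ∧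
  fderiv ℝ (realEnergy (Metric.ball (0 : RN N) r) κ p) u = 0 ∧
  (∀ᵐ x ∂(volume.restrict (Metric.ball (0 : RN N) r)), 0 < u.1.fst x) ∧
  ∃ g : ℝ → ℝ, ∀ᵐ x ∂(volume.restrict (Metric.ball (0 : RN N) r)), u.1.fst x = g ‖x‖

/-! ### The sets `Ω_r^±` and the map `Φ` -/

/-- `Ω_r^+ = {x ∈ ℝ^N : dist(x, Ω) ≤ r}`. -/
def outerSet {N : ℕ} (Ω : Set (RN N)) (r : ℝ) : Set (RN N) :=
  {x | Metric.infDist x Ω ≤ r}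

/-- `Ω_r^- = {x ∈ Ω : dist(x, ∂Ω) ≥ r}`. -/
def innerSet {N : ℕ} (Ω : Set (RN N)) (r : ℝ) : Set (RN N) :=
  {x | x ∈ Ω ∧ r ≤ Metric.infDist x (frontier Ω)}

open Classical in
/-- The function equal to `t e^{i τ_y(x)} u(x - y)`, with `τ_y(x) = ∑_j A^j(y) x^j`, on `B_r(y)` and
to `0` elsewhere. -/
def bump {N : ℕ} (A : RN N → RN N) {r : ℝ} (u : H10 (Metric.ball (0 : RN N) r))
    (t : ℝ) (y x : RN N) : ℂ :=
  if x ∈ Metric.ball y r then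
    (t : ℂ) * Complex.exp (Complex.I * ((∑ j, A y j * x j : ℝ) : ℂ)) * ((u.1.fst (x - y) : ℝ) : ℂ)
  else 0

/-- `Φ` is the map `Ω_r^- → M_{κ,p,Ω}` built from `u`: `Φ(y)` is the function `bump A u t y`, where
`t > 0` is such that this function lies on `M_{κ,p,Ω}`. -/
def IsPhi {N : ℕ} (Ω : Set (RN N)) (A : RN N → RN N) (κ p : ℝ) {r : ℝ}
    (u : H10 (Metric.ball (0 : RN N) r)) (Φ : innerSet Ω r → magSpace Ω A) : Prop :=
  ∀ y : innerSet Ω r, Φ y ∈ magNehari Ω A κ p ∧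
    ∃ t : ℝ, 0 < t ∧ (Φ y).1.fst =ᵐ[volume.restrict Ω] bump A u t y

/-- For all `p ∈ [p*, 2*)`, each `u ∈ M_{κ,p,Ω}` with `I_{κ,p,Ω}(u) ≤ S^{N/2}/N + ε` has its
barycenter in `Ω_r^+`. -/
def BarycenterProp {N : ℕ} (Ω : Set (RN N)) (A : RN N → RN N) (r κ ε pstar : ℝ) : Prop :=
  ∀ p ∈ Ico pstar (critExp N), ∀ u ∈ magNehari Ω A κ p,
    magEnergy Ω A κ p u ≤ 1 / (N : ℝ) * sobolevConst Ω ^ ((N : ℝ) / 2) + ε →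
      barycenter u ∈ outerSet Ω r

end MagneticNehari

end

open MagneticNehari

/-!
Write `T(u) = ∫ |∇_A u|² + κ |u|²` and let `s = 2*`. A point of the Nehari manifold satisfies
`T(u) = ∫ |u|^p` and has energy `(1/2 - 1/p) T(u)`. If this energy is close to `S^{N/2}/N` and `p`
is close to `s`, Hölder's inequality makes `u` almost optimal for the Sobolev inequality
(`nehari_asymptotics`).

*Barycenters.* No compactness is used. Two refinements of the Sobolev inequality, valid for `|u|` by
the diamagnetic inequality, show that almost optimal functions concentrate near a point.

* On a bounded domain there is a remainder `c ‖u‖₁²` (`exists_sobolev_remainder`): adding to `u` a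
  small multiple of a fixed function with positive Laplacian raises the critical norm and lowers the
  Dirichlet integral. Hence almost optimal functions tend to `0` in `L¹`, and by interpolation in
  `L²` (`nehari_almost_optimal`).
* For `θ = l x_j + a` the Dirichlet integrals of `cos θ · u` and `sin θ · u` add up to that of `u`
  plus `l² ‖u‖₂²`, so `S (‖cos θ · u‖_s² + ‖sin θ · u‖_s²) ≤ ∫ |∇u|² + l² ‖u‖₂²`
  (`sobolev_cos_sin`). By strong convexity of `t ↦ t^{s/2}` (`exists_variance_bound`), `cos² θ`
  has small variance under the probability measure proportional to `|u|^s`; so does the coordinate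
  `x_j`.

A measure carried by `Ω` with small variance has its barycenter near `Ω`
(`exists_concentration`, `infDist_integral_le`, `exists_barycenterProp`).

*The map `Φ`.* For real `u` the function `e^{iτ_y(x)} u(x - y)` has magnetic energy at most
`∫ |∇u|² + K² u²`, where `K` bounds `|A(y) - A|` (`exists_bump`). A ground state is itself a low
energy Nehari point, because the ground state level is at most `S^{N/2}/N + o(1)`
(`groundLevel_le`), so it is small in `L²` and the term `K² ‖u‖₂²` is negligible
(`exists_phi_level`). Uniqueness holds since `u` determines `∇_A u` and a ray meets the Nehari
manifold once (`existsUnique_bump`).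

*Ground states.* They are multiples of minimisers of `T(u) / ‖u‖_p²` on the ball. Rellich's theorem
gives minimisers (`exists_minimizer`), and among them one with the least second moment
`∫ |x|² u²` (`exists_minimizer_second_moment`). Its modulus is radial and decreasing: the
polarization in a hyperplane, which exchanges the values at mirror points so that the larger one
lies on the side of the origin, preserves the `L^p` norm, does not raise `T`, and lowers the second
moment unless it changes nothing (`IsMinimizer.absExt_map_le`). Comparing Lebesgue points by
reflections shows that the modulus decreases with `|x|` (`ae_antitone_norm`). It is positive, for
otherwise it would vanish outside a smaller ball, and adding a small multiple of a function equal to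
`e^{a x_j}` there, with `a² > κ`, would lower the quotient (`IsMinimizer.ae_pos_of_antitone`).
Test functions are polarized through smoothed positive parts, so that the result is again a test
function and no chain rule for weak derivatives is needed.
-/

set_option linter.unusedSectionVars false

noncomputable section

namespace MagneticNehari

/-! ### Powers of the norm on `L^p` -/

section PowerFunctional

variable {α F : Type*} [MeasurableSpace α] {μ : Measure α} [NormedAddCommGroup F]

theorem add_rpow_le_mul_add {a b p : ℝ} (ha : 0 ≤ a) (hb : 0 ≤ b) (hp : 1 ≤ p) :
    (a + b) ^ p ≤ 2 ^ (p - 1) * (a ^ p + b ^ p) := by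
  lift a to NNReal using ha
  lift b to NNReal using hb
  exact_mod_cast NNReal.rpow_add_le_mul_rpow_add_rpow a b hp

theorem integrable_norm_rpow_of_memLp {f : α → F} {p : ℝ} (hp : 0 < p)
    (hf : MemLp f (ENNReal.ofReal p) μ) : Integrable (fun x => ‖f x‖ ^ p) μ := by
  have := hf.integrable_norm_rpow (by simpa using hp) ENNReal.ofReal_ne_top
  simpa [ENNReal.toReal_ofReal hp.le] using this

theorem eLpNorm_eq_ofReal_integral {f : α → F} {p : ℝ} (hp : 0 < p)
    (hf : MemLp f (ENNReal.ofReal p) μ) :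
    eLpNorm f (ENNReal.ofReal p) μ = ENNReal.ofReal ((∫ x, ‖f x‖ ^ p ∂μ) ^ p⁻¹) := by
  have := hf.eLpNorm_eq_integral_rpow_norm (by simpa using hp) ENNReal.ofReal_ne_top
  simpa [ENNReal.toReal_ofReal hp.le] using this

theorem Lp_norm_rpow {p : ℝ} (hp : 0 < p) (f : Lp F (ENNReal.ofReal p) μ) :
    ‖f‖ ^ p = ∫ x, ‖f x‖ ^ p ∂μ := by
  have h0 : 0 ≤ ∫ x, ‖f x‖ ^ p ∂μ := integral_nonneg fun x => by positivity
  rw [Lp.norm_def, eLpNorm_eq_ofReal_integral hp (Lp.memLp f),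
    ENNReal.toReal_ofReal (by positivity), ← Real.rpow_mul h0, inv_mul_cancel₀ hp.ne',
    Real.rpow_one]

theorem Lp_two_norm_sq (f : Lp F 2 μ) : ‖f‖ ^ 2 = ∫ x, ‖f x‖ ^ 2 ∂μ := by
  have h := (Lp.memLp f).eLpNorm_eq_integral_rpow_norm (by simp) (by simp)
  have h0 : 0 ≤ ∫ x, ‖f x‖ ^ 2 ∂μ := integral_nonneg fun x => by positivity
  rw [Lp.norm_def, h]
  simp only [ENNReal.toReal_ofNat, Real.rpow_two]
  rw [ENNReal.toReal_ofReal (by positivity), ← Real.rpow_natCast, ← Real.rpow_mul h0]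
  simp

variable [InnerProductSpace ℝ F]

/-- The map `w ↦ ‖w‖ ^ q • w` is locally Lipschitz; this is Bernoulli's inequality for the ratio of
the norms. -/
theorem norm_rpow_smul_sub_le_of_le {q : ℝ} (hq : 0 < q) {z w : F} (h : ‖z‖ ≤ ‖w‖) :
    ‖‖w‖ ^ q • w - ‖z‖ ^ q • z‖ ≤ (q + 1) * ‖w‖ ^ q * ‖w - z‖ := by
  rcases (norm_nonneg w).eq_or_lt with hw | hw
  · have hw0 : w = 0 := norm_eq_zero.1 hw.symm
    have hz0 : z = 0 := norm_eq_zero.1 (le_antisymm (h.trans hw.symm.le) (norm_nonneg _))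
    simp [hw0, hz0]
  have h1 : ‖w‖ ^ q • w - ‖z‖ ^ q • z = ‖w‖ ^ q • (w - z) + (‖w‖ ^ q - ‖z‖ ^ q) • z := by
    rw [smul_sub, sub_smul]; abel
  have hmono : ‖z‖ ^ q ≤ ‖w‖ ^ q := Real.rpow_le_rpow (norm_nonneg _) h hq.le
  have key : (‖w‖ ^ q - ‖z‖ ^ q) * ‖z‖ ≤ q * ‖w‖ ^ q * (‖w‖ - ‖z‖) := by
    have hb := one_add_mul_self_le_rpow_one_add (s := ‖z‖ / ‖w‖ - 1) (p := q + 1)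
      (by have : 0 ≤ ‖z‖ / ‖w‖ := by positivity
          linarith) (by linarith)
    have e1 : (1 + (‖z‖ / ‖w‖ - 1)) ^ (q + 1) = ‖z‖ ^ q * ‖z‖ / (‖w‖ ^ q * ‖w‖) := by
      rw [add_sub_cancel, Real.div_rpow (norm_nonneg _) (norm_nonneg _),
        Real.rpow_add_one' (norm_nonneg _) (by linarith), Real.rpow_add_one hw.ne']
    rw [e1, le_div_iff₀ (by positivity)] at hb
    have e2 : (1 + (q + 1) * (‖z‖ / ‖w‖ - 1)) * (‖w‖ ^ q * ‖w‖)
        = ‖w‖ ^ q * ((q + 1) * ‖z‖ - q * ‖w‖) := by field_simp; ring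
    rw [e2] at hb
    linarith
  calc ‖‖w‖ ^ q • w - ‖z‖ ^ q • z‖ ≤ ‖w‖ ^ q * ‖w - z‖ + (‖w‖ ^ q - ‖z‖ ^ q) * ‖z‖ := by
        rw [h1]
        refine (norm_add_le _ _).trans ?_
        rw [norm_smul, norm_smul, Real.norm_of_nonneg (by positivity),
          Real.norm_of_nonneg (by linarith)]
    _ ≤ ‖w‖ ^ q * ‖w - z‖ + q * ‖w‖ ^ q * ‖w - z‖ := by
        refine add_le_add_right (key.trans ?_) _
        gcongr
        exact norm_sub_norm_le w z
    _ = _ := by ring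

theorem norm_rpow_smul_sub_le {q : ℝ} (hq : 0 < q) (z w : F) :
    ‖‖w‖ ^ q • w - ‖z‖ ^ q • z‖ ≤ (q + 1) * max ‖z‖ ‖w‖ ^ q * ‖w - z‖ := by
  rcases le_total ‖z‖ ‖w‖ with h | h
  · rw [max_eq_right h]; exact norm_rpow_smul_sub_le_of_le hq h
  · rw [max_eq_left h, norm_sub_rev, norm_sub_rev w]; exact norm_rpow_smul_sub_le_of_le hq h

/-- Second order Taylor bound for `‖·‖ ^ p`. -/
theorem abs_norm_rpow_taylor_le {p : ℝ} (hp : 2 < p) (z h : F) :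
    |‖z + h‖ ^ p - ‖z‖ ^ p - p * ‖z‖ ^ (p - 2) * inner ℝ z h|
      ≤ p * (p - 1) * (‖z‖ + ‖h‖) ^ (p - 2) * ‖h‖ ^ 2 := by
  have hd : ∀ w ∈ segment ℝ z (z + h), HasFDerivWithinAt
      (fun w : F => ‖w‖ ^ p - p * ‖z‖ ^ (p - 2) * inner ℝ z w)
      (innerSL ℝ (p • (‖w‖ ^ (p - 2) • w - ‖z‖ ^ (p - 2) • z))) (segment ℝ z (z + h)) w := by
    intro w _
    have h1 := hasFDerivAt_norm_rpow w (p := p) (by linarith)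
    have h2 : HasFDerivAt (fun w : F => p * ‖z‖ ^ (p - 2) * inner ℝ z w)
        ((p * ‖z‖ ^ (p - 2)) • innerSL ℝ z) w :=
      ((innerSL ℝ z).hasFDerivAt).const_mul _
    refine ((h1.sub h2).congr_fderiv ?_).hasFDerivWithinAt
    ext v
    simp
    ring
  have hb : ∀ w ∈ segment ℝ z (z + h),
      ‖innerSL ℝ (p • (‖w‖ ^ (p - 2) • w - ‖z‖ ^ (p - 2) • z))‖
        ≤ p * ((p - 1) * (‖z‖ + ‖h‖) ^ (p - 2) * ‖h‖) := by
    intro w hw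
    have hwz : ‖w - z‖ ≤ ‖h‖ := by
      have := norm_sub_le_of_mem_segment hw
      simpa using this
    have hw2 : ‖w‖ ≤ ‖z‖ + ‖h‖ := by
      calc ‖w‖ = ‖z + (w - z)‖ := by congr 1; abel
        _ ≤ ‖z‖ + ‖w - z‖ := norm_add_le _ _
        _ ≤ _ := by gcongr
    rw [innerSL_apply_norm, norm_smul, Real.norm_of_nonneg (by linarith)]
    refine mul_le_mul_of_nonneg_left ?_ (by linarith)
    refine (norm_rpow_smul_sub_le (by linarith : 0 < p - 2) z w).trans ?_
    have : max ‖z‖ ‖w‖ ≤ ‖z‖ + ‖h‖ := max_le (by linarith [norm_nonneg h]) hw2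
    have e : p - 2 + 1 = p - 1 := by ring
    rw [e]
    have : (0 : ℝ) ≤ p - 2 := by linarith
    have : (0 : ℝ) ≤ p - 1 := by linarith
    gcongr
  have := (convex_segment z (z + h)).norm_image_sub_le_of_norm_hasFDerivWithin_le hd hb
    (left_mem_segment ℝ _ _) (right_mem_segment ℝ _ _)
  rw [Real.norm_eq_abs] at this
  have e : ‖z + h‖ ^ p - p * ‖z‖ ^ (p - 2) * inner ℝ z (z + h) -
      (‖z‖ ^ p - p * ‖z‖ ^ (p - 2) * inner ℝ z z)
      = ‖z + h‖ ^ p - ‖z‖ ^ p - p * ‖z‖ ^ (p - 2) * inner ℝ z h := by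
    rw [inner_add_right]; ring
  rw [e] at this
  refine this.trans (le_of_eq ?_)
  simp only [add_sub_cancel_left]
  ring

/-- The functional `f ↦ ∫ ‖f‖ ^ p` is Fréchet differentiable on `L^p`. -/
theorem differentiable_integral_norm_rpow {p : ℝ} (hp : 2 < p)
    [Fact (1 ≤ ENNReal.ofReal p)] :
    Differentiable ℝ (fun f : Lp F (ENNReal.ofReal p) μ => ∫ x, ‖f x‖ ^ p ∂μ) := by
  have hp0 : 0 < p := by linarith
  intro f
  have hI : ∀ g : Lp F (ENNReal.ofReal p) μ, Integrable (fun x => ‖g x‖ ^ p) μ := fun g =>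
    integrable_norm_rpow_of_memLp hp0 (Lp.memLp g)
  have hpt : ∀ a b : ℝ, 0 ≤ a → 0 ≤ b → a ^ (p - 1) * b ≤ a ^ p + b ^ p := by
    intro a b ha hb
    have hm : 0 ≤ max a b := le_max_of_le_left ha
    calc a ^ (p - 1) * b ≤ max a b ^ (p - 1) * max a b := by
          have : 0 ≤ p - 1 := by linarith
          gcongr
          · exact le_max_left _ _
          · exact le_max_right _ _
      _ = max a b ^ p := by
          rw [← Real.rpow_add_one' hm (by linarith)]; congr 1; ring
      _ ≤ a ^ p + b ^ p := by
          rcases max_choice a b with h | h <;> rw [h] <;>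
            linarith [Real.rpow_nonneg ha p, Real.rpow_nonneg hb p]
  have hbd : ∀ g : Lp F (ENNReal.ofReal p) μ, ∀ x,
      ‖p * ‖f x‖ ^ (p - 2) * inner ℝ (f x) (g x)‖ ≤ p * (‖f x‖ ^ p + ‖g x‖ ^ p) := by
    intro g x
    rw [norm_mul, norm_mul, Real.norm_of_nonneg hp0.le,
      Real.norm_of_nonneg (by positivity), mul_assoc]
    gcongr
    refine le_trans ?_ (hpt _ _ (norm_nonneg _) (norm_nonneg _))
    calc ‖f x‖ ^ (p - 2) * ‖(inner ℝ (f x) (g x) : ℝ)‖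
        ≤ ‖f x‖ ^ (p - 2) * (‖f x‖ * ‖g x‖) := by
          gcongr; exact norm_inner_le_norm _ _
      _ = ‖f x‖ ^ (p - 1) * ‖g x‖ := by
          rw [← mul_assoc, ← Real.rpow_add_one' (norm_nonneg _) (by linarith)]
          congr 2; ring
  have hLint : ∀ g : Lp F (ENNReal.ofReal p) μ,
      Integrable (fun x => p * ‖f x‖ ^ (p - 2) * inner ℝ (f x) (g x)) μ := by
    intro g
    refine Integrable.mono' (((hI f).add (hI g)).const_mul p) ?_
      (Filter.Eventually.of_forall (hbd g))
    have h1 := (Lp.aestronglyMeasurable f).norm.aemeasurable.pow_const (p - 2)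
    exact (h1.const_mul p).aestronglyMeasurable.mul
      ((Lp.aestronglyMeasurable f).inner (Lp.aestronglyMeasurable g))
  let L0 : Lp F (ENNReal.ofReal p) μ →ₗ[ℝ] ℝ :=
    { toFun := fun g => ∫ x, p * ‖f x‖ ^ (p - 2) * inner ℝ (f x) (g x) ∂μ
      map_add' := by
        intro g h
        rw [← integral_add (hLint g) (hLint h)]
        refine integral_congr_ae ?_
        filter_upwards [Lp.coeFn_add g h] with x hx
        rw [hx]; simp [inner_add_right]; ring
      map_smul' := by
        intro c g
        simp only [RingHom.id_apply, smul_eq_mul]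
        rw [← integral_const_mul]
        refine integral_congr_ae ?_
        filter_upwards [Lp.coeFn_smul c g] with x hx
        rw [hx]; simp [inner_smul_right]; ring }
  have hL0 : ∀ g : Lp F (ENNReal.ofReal p) μ, ‖g‖ ≤ 1 → ‖L0 g‖ ≤ p * (‖f‖ ^ p + 1) := by
    intro g hg
    calc ‖L0 g‖ ≤ ∫ x, p * (‖f x‖ ^ p + ‖g x‖ ^ p) ∂μ :=
          norm_integral_le_of_norm_le (((hI f).add (hI g)).const_mul p)
            (Filter.Eventually.of_forall (hbd g))
      _ = p * (‖f‖ ^ p + ‖g‖ ^ p) := by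
          rw [integral_const_mul, integral_add (hI f) (hI g), Lp_norm_rpow hp0, Lp_norm_rpow hp0]
      _ ≤ p * (‖f‖ ^ p + 1) := by
          gcongr; exact Real.rpow_le_one (norm_nonneg _) hg hp0.le
  let L : Lp F (ENNReal.ofReal p) μ →L[ℝ] ℝ :=
    L0.mkContinuous (p * (‖f‖ ^ p + 1)) (by
      intro g
      rcases (norm_nonneg g).eq_or_lt with h0 | h0
      · have : g = 0 := norm_eq_zero.1 h0.symm
        simp [this]
      · have h1 := hL0 (‖g‖⁻¹ • g) (by
          rw [norm_smul, norm_inv, norm_norm, inv_mul_cancel₀ h0.ne'])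
        rw [map_smul, norm_smul, norm_inv, norm_norm, inv_mul_le_iff₀ h0] at h1
        linarith)
  refine HasFDerivAt.differentiableAt (f' := L) ?_
  have hO : (fun g : Lp F (ENNReal.ofReal p) μ =>
      (∫ x, ‖g x‖ ^ p ∂μ) - (∫ x, ‖f x‖ ^ p ∂μ) - L (g - f))
      =O[nhds f] fun g => ‖g - f‖ ^ 2 := by
    refine Asymptotics.IsBigO.of_bound (p * (p - 1) * (2 ^ (p - 1) * (‖f‖ ^ p + 1))) ?_
    filter_upwards [Metric.ball_mem_nhds f one_pos] with g hg
    rw [Metric.mem_ball, dist_eq_norm] at hg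
    set h := g - f with hh
    rcases (norm_nonneg h).eq_or_lt with h0 | h0
    · have h1 : h = 0 := norm_eq_zero.1 h0.symm
      have h2 : g = f := sub_eq_zero.1 (hh ▸ h1)
      simp [h1, h2]
    set n := ‖h‖ with hn
    have hpb : ∀ᵐ x ∂μ, ‖‖g x‖ ^ p - ‖f x‖ ^ p - p * ‖f x‖ ^ (p - 2) * inner ℝ (f x) (h x)‖
        ≤ p * (p - 1) * (n ^ 2 * (2 ^ (p - 1) * (‖f x‖ ^ p + (n ^ p)⁻¹ * ‖h x‖ ^ p))) := by
      filter_upwards [Lp.coeFn_sub g f] with x hx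
      have hgx : g x = f x + h x := by rw [hh, hx]; simp
      rw [hgx, Real.norm_eq_abs]
      refine (abs_norm_rpow_taylor_le hp _ _).trans ?_
      rw [mul_assoc]
      have : (0:ℝ) ≤ p - 1 := by linarith
      refine mul_le_mul_of_nonneg_left ?_ (by positivity)
      have hb1 : ‖h x‖ ≤ ‖h x‖ / n := by
        rw [le_div_iff₀ h0]
        nlinarith [norm_nonneg (h x)]
      have hb2 : ‖h x‖ ^ 2 = n ^ 2 * (‖h x‖ / n) ^ 2 := by field_simp
      have hs : 0 ≤ ‖f x‖ + ‖h x‖ / n := by positivity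
      calc (‖f x‖ + ‖h x‖) ^ (p - 2) * ‖h x‖ ^ 2
          = n ^ 2 * ((‖f x‖ + ‖h x‖) ^ (p - 2) * (‖h x‖ / n) ^ 2) := by rw [hb2]; ring
        _ ≤ n ^ 2 * ((‖f x‖ + ‖h x‖ / n) ^ (p - 2) * (‖f x‖ + ‖h x‖ / n) ^ 2) := by
            have : 0 ≤ p - 2 := by linarith
            gcongr
            linarith [norm_nonneg (f x)]
        _ = n ^ 2 * (‖f x‖ + ‖h x‖ / n) ^ p := by
            rw [← Real.rpow_natCast (‖f x‖ + ‖h x‖ / n) 2,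
              ← Real.rpow_add' hs (by norm_num; linarith)]
            norm_num
        _ ≤ n ^ 2 * (2 ^ (p - 1) * (‖f x‖ ^ p + (‖h x‖ / n) ^ p)) := by
            gcongr
            exact add_rpow_le_mul_add (norm_nonneg _) (by positivity) (by linarith)
        _ = _ := by
            rw [Real.div_rpow (norm_nonneg _) (norm_nonneg _)]
            ring
    have hLh : L h = ∫ x, p * ‖f x‖ ^ (p - 2) * inner ℝ (f x) (h x) ∂μ := rfl
    have hsub : (∫ x, ‖g x‖ ^ p ∂μ) - (∫ x, ‖f x‖ ^ p ∂μ) - L h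
        = ∫ x, (‖g x‖ ^ p - ‖f x‖ ^ p - p * ‖f x‖ ^ (p - 2) * inner ℝ (f x) (h x)) ∂μ := by
      rw [hLh, ← integral_sub (hI g) (hI f)]
      exact (integral_sub ((hI g).sub (hI f)) (hLint h)).symm
    rw [hsub]
    refine (norm_integral_le_of_norm_le ((((hI f).add ((hI h).const_mul _)).const_mul
      _).const_mul _ |>.const_mul _) hpb).trans ?_
    simp only [integral_const_mul]
    rw [integral_add' (hI f) ((hI h).const_mul _), integral_const_mul, ← Lp_norm_rpow hp0,
      ← Lp_norm_rpow hp0, ← hn, inv_mul_cancel₀ (by positivity)]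
    rw [Real.norm_of_nonneg (by positivity)]
    apply le_of_eq
    ring
  have := Asymptotics.IsBigO.hasFDerivAt (𝕜 := ℝ) hO (by norm_num)
  have h2 := (this.add (L.hasFDerivAt (x := f) |>.sub_const (L f))).add_const (∫ x, ‖f x‖ ^ p ∂μ)
  rw [zero_add] at h2
  refine h2.congr_of_eventuallyEq (Filter.Eventually.of_forall fun g => ?_)
  simp

end PowerFunctional

/-! ### Energies on spaces of pairs -/

section Pairs

variable {α F G : Type*} [MeasurableSpace α] {μ : Measure α}
  [NormedAddCommGroup F] [InnerProductSpace ℝ F] [NormedAddCommGroup G] [InnerProductSpace ℝ G]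

/-- The quadratic form `∫ |W|² + κ |u|²` of a pair `(u, W)`. -/
def quadForm (κ : ℝ) (w : WithLp 2 (Lp F 2 μ × Lp G 2 μ)) : ℝ := ‖w.snd‖ ^ 2 + κ * ‖w.fst‖ ^ 2

/-- The integral `∫ |u|^p` of a pair `(u, W)`. -/
def powInt (p : ℝ) (w : WithLp 2 (Lp F 2 μ × Lp G 2 μ)) : ℝ := ∫ x, ‖w.fst x‖ ^ p ∂μ

/-- The space `X` of pairs satisfies the Sobolev inequality `‖u‖_s² ≤ C ‖W‖_2²`. -/
def HasSobolev (X : Submodule ℝ (WithLp 2 (Lp F 2 μ × Lp G 2 μ))) (s C : ℝ) : Prop :=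
  ∀ u ∈ X, MemLp u.fst (ENNReal.ofReal s) μ ∧ powInt s u ^ (2 / s) ≤ C * ‖u.snd‖ ^ 2

/-- The functional `½ (∫ |W|² + κ |u|²) - 1/p ∫ |u|^p`. -/
def pairEnergy (κ p : ℝ) (w : WithLp 2 (Lp F 2 μ × Lp G 2 μ)) : ℝ :=
  1 / 2 * quadForm κ w - 1 / p * powInt p w

theorem quadForm_eq_integral (κ : ℝ) (w : WithLp 2 (Lp F 2 μ × Lp G 2 μ)) :
    ∫ x, (‖w.snd x‖ ^ 2 + κ * ‖w.fst x‖ ^ 2) ∂μ = quadForm κ w := by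
  have h1 : Integrable (fun x => ‖w.snd x‖ ^ 2) μ := (Lp.memLp w.snd).integrable_norm_pow (by simp)
  have h2 : Integrable (fun x => ‖w.fst x‖ ^ 2) μ := (Lp.memLp w.fst).integrable_norm_pow (by simp)
  rw [integral_add h1 (h2.const_mul κ), integral_const_mul, ← Lp_two_norm_sq, ← Lp_two_norm_sq]
  rfl

theorem quadForm_nonneg {κ : ℝ} (hκ : 0 ≤ κ) (w : WithLp 2 (Lp F 2 μ × Lp G 2 μ)) :
    0 ≤ quadForm κ w := by
  unfold quadForm; positivity

theorem powInt_nonneg (p : ℝ) (w : WithLp 2 (Lp F 2 μ × Lp G 2 μ)) : 0 ≤ powInt p w :=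
  integral_nonneg fun x => by positivity

theorem quadForm_smul (κ t : ℝ) (w : WithLp 2 (Lp F 2 μ × Lp G 2 μ)) :
    quadForm κ (t • w) = t ^ 2 * quadForm κ w := by
  simp only [quadForm, WithLp.smul_fst, WithLp.smul_snd, norm_smul, mul_pow, Real.norm_eq_abs,
    sq_abs]
  ring

theorem powInt_smul (p : ℝ) {t : ℝ} (ht : 0 ≤ t) (w : WithLp 2 (Lp F 2 μ × Lp G 2 μ)) :
    powInt p (t • w) = t ^ p * powInt p w := by
  unfold powInt
  rw [← integral_const_mul]
  refine integral_congr_ae ?_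
  rw [WithLp.smul_fst]
  filter_upwards [Lp.coeFn_smul t w.fst] with x hx
  rw [hx, Pi.smul_apply, norm_smul, Real.norm_of_nonneg ht, Real.mul_rpow ht (norm_nonneg _)]

theorem quadForm_parallelogram (κ : ℝ) (v w : WithLp 2 (Lp F 2 μ × Lp G 2 μ)) :
    quadForm κ (v + w) + quadForm κ (v - w) = 2 * (quadForm κ v + quadForm κ w) := by
  have h1 := parallelogram_law_with_norm ℝ v.snd w.snd
  have h2 := parallelogram_law_with_norm ℝ v.fst w.fst
  simp only [quadForm, WithLp.add_fst, WithLp.add_snd, WithLp.sub_fst, WithLp.sub_snd]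
  linear_combination h1 + κ * h2

/-- Hölder's inequality on a finite measure space. -/
theorem integral_rpow_le_of_memLp [IsFiniteMeasure μ] {f : α → F} {q s : ℝ} (hq : 0 < q)
    (hqs : q ≤ s) (hf : MemLp f (ENNReal.ofReal s) μ) :
    ∫ x, ‖f x‖ ^ q ∂μ ≤ (∫ x, ‖f x‖ ^ s ∂μ) ^ (q / s) * μ.real univ ^ (1 - q / s) := by
  have hs : 0 < s := hq.trans_le hqs
  have hfq : MemLp f (ENNReal.ofReal q) μ := hf.mono_exponent (ENNReal.ofReal_le_ofReal hqs)
  have h := eLpNorm_le_eLpNorm_mul_rpow_measure_univ (ENNReal.ofReal_le_ofReal hqs)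
    hf.aestronglyMeasurable
  rw [eLpNorm_eq_ofReal_integral hq hfq, eLpNorm_eq_ofReal_integral hs hf,
    ENNReal.toReal_ofReal hq.le, ENNReal.toReal_ofReal hs.le] at h
  have hI : 0 ≤ ∫ x, ‖f x‖ ^ q ∂μ := integral_nonneg fun x => by positivity
  have hJ : 0 ≤ ∫ x, ‖f x‖ ^ s ∂μ := integral_nonneg fun x => by positivity
  have he : 0 ≤ 1 / q - 1 / s := by
    rw [sub_nonneg]; exact one_div_le_one_div_of_le hq hqs
  rw [← ENNReal.ofReal_toReal (measure_ne_top μ univ), ENNReal.ofReal_rpow_of_nonneg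
    ENNReal.toReal_nonneg he, ← ENNReal.ofReal_mul (by positivity),
    ENNReal.ofReal_le_ofReal_iff (by positivity)] at h
  have h2 := Real.rpow_le_rpow (by positivity) h hq.le
  rw [← Real.rpow_mul hI, inv_mul_cancel₀ hq.ne', Real.rpow_one, Real.mul_rpow (by positivity)
    (by positivity), ← Real.rpow_mul hJ, ← Real.rpow_mul ENNReal.toReal_nonneg] at h2
  have e1 : s⁻¹ * q = q / s := by field_simp
  have e2 : (1 / q - 1 / s) * q = 1 - q / s := by field_simp
  rw [e1, e2] at h2
  exact h2

variable {X : Submodule ℝ (WithLp 2 (Lp F 2 μ × Lp G 2 μ))} {s C : ℝ}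

theorem HasSobolev.memLp [IsFiniteMeasure μ] (hX : HasSobolev X s C) {q : ℝ} (hq : q ≤ s)
    {u : WithLp 2 (Lp F 2 μ × Lp G 2 μ)} (hu : u ∈ X) : MemLp u.fst (ENNReal.ofReal q) μ :=
  (hX u hu).1.mono_exponent (ENNReal.ofReal_le_ofReal hq)

/-- The embedding of a Sobolev space of pairs in `L^q`, for subcritical `q`. -/
theorem HasSobolev.exists_embedding [IsFiniteMeasure μ] (hX : HasSobolev X s C) (hC : 0 ≤ C)
    {q : ℝ} (hq : 0 < q) (hqs : q ≤ s) [Fact (1 ≤ ENNReal.ofReal q)] :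
    ∃ j : X →L[ℝ] Lp F (ENNReal.ofReal q) μ, ∀ u : X, j u =ᵐ[μ] u.1.fst := by
  have hs : 0 < s := hq.trans_le hqs
  let j0 : X →ₗ[ℝ] Lp F (ENNReal.ofReal q) μ :=
    { toFun := fun u => (hX.memLp hqs u.2).toLp _
      map_add' := by
        intro u v
        rw [← MemLp.toLp_add]
        exact MemLp.toLp_congr _ _ (by
          rw [Submodule.coe_add, WithLp.add_fst]; exact Lp.coeFn_add _ _)
      map_smul' := by
        intro c u
        rw [RingHom.id_apply, ← MemLp.toLp_const_smul]
        exact MemLp.toLp_congr _ _ (by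
          rw [Submodule.coe_smul, WithLp.smul_fst]; exact Lp.coeFn_smul _ _) }
  have hj0 : ∀ u : X, j0 u =ᵐ[μ] u.1.fst := fun u => MemLp.coeFn_toLp (hX.memLp hqs u.2)
  refine ⟨j0.mkContinuous ((C ^ (1 / 2 : ℝ)) * μ.real univ ^ (1 / q - 1 / s)) ?_, hj0⟩
  intro u
  have h1 : ‖j0 u‖ ^ q ≤ (powInt s u.1) ^ (q / s) * μ.real univ ^ (1 - q / s) := by
    rw [Lp_norm_rpow hq]
    have : ∫ x, ‖j0 u x‖ ^ q ∂μ = ∫ x, ‖u.1.fst x‖ ^ q ∂μ :=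
      integral_congr_ae ((hj0 u).fun_comp fun z => ‖z‖ ^ q)
    rw [this]
    exact integral_rpow_le_of_memLp hq hqs (hX u.1 u.2).1
  have hP := powInt_nonneg s u.1
  have h2 : powInt s u.1 ^ (q / s) ≤ (C ^ (1 / 2 : ℝ) * ‖u‖) ^ q := by
    have h3 : powInt s u.1 ^ (2 / s) ≤ C * ‖u‖ ^ 2 := by
      refine (hX u.1 u.2).2.trans ?_
      gcongr
      exact WithLp.norm_snd_le _ u.1
    have h4 := Real.rpow_le_rpow (by positivity) h3 (by positivity : 0 ≤ q / 2)
    rw [← Real.rpow_mul hP, Real.mul_rpow hC (by positivity), ← Real.rpow_natCast,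
      ← Real.rpow_mul (norm_nonneg _)] at h4
    have e1 : 2 / s * (q / 2) = q / s := by field_simp
    rw [e1] at h4
    refine h4.trans (le_of_eq ?_)
    rw [Real.mul_rpow (by positivity) (norm_nonneg _), ← Real.rpow_mul hC]
    congr 2
    · ring
    · push_cast; ring
  have h5 : ‖j0 u‖ ^ q ≤ (C ^ (1 / 2 : ℝ) * μ.real univ ^ (1 / q - 1 / s) * ‖u‖) ^ q := by
    refine h1.trans ((mul_le_mul_of_nonneg_right h2 (by positivity)).trans (le_of_eq ?_))
    have e2 : 1 - q / s = (1 / q - 1 / s) * q := by field_simp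
    rw [e2, Real.rpow_mul measureReal_nonneg, ← Real.mul_rpow (by positivity) (by positivity)]
    congr 1; ring
  exact (Real.rpow_le_rpow_iff (norm_nonneg _) (by positivity) hq).1 h5

theorem HasSobolev.differentiable_powInt [IsFiniteMeasure μ] (hX : HasSobolev X s C) (hC : 0 ≤ C)
    {p : ℝ} (hp : 2 < p) (hps : p ≤ s) : Differentiable ℝ (fun u : X => powInt p u.1) := by
  have : Fact (1 ≤ ENNReal.ofReal p) := ⟨by
    rw [← ENNReal.ofReal_one]; exact ENNReal.ofReal_le_ofReal (by linarith)⟩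
  obtain ⟨j, hj⟩ := hX.exists_embedding hC (by linarith : 0 < p) hps
  have h := (differentiable_integral_norm_rpow (F := F) (μ := μ) hp).comp j.differentiable
  have e : (fun u : X => powInt p u.1)
      = (fun f : Lp F (ENNReal.ofReal p) μ => ∫ x, ‖f x‖ ^ p ∂μ) ∘ j := by
    funext u
    exact (integral_congr_ae ((hj u).fun_comp fun z => ‖z‖ ^ p)).symm
  rw [e]
  exact h

theorem HasSobolev.continuous_powInt [IsFiniteMeasure μ] (hX : HasSobolev X s C) (hC : 0 ≤ C)
    {q : ℝ} (hq : 1 ≤ q) (hqs : q ≤ s) : Continuous (fun u : X => powInt q u.1) := by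
  have : Fact (1 ≤ ENNReal.ofReal q) := ⟨by
    rw [← ENNReal.ofReal_one]; exact ENNReal.ofReal_le_ofReal hq⟩
  have hq0 : 0 < q := by linarith
  obtain ⟨j, hj⟩ := hX.exists_embedding hC hq0 hqs
  have h : Continuous (fun u => ‖j u‖ ^ q) :=
    (j.continuous.norm).rpow_const fun _ => Or.inr hq0.le
  refine h.congr fun u => ?_
  rw [Lp_norm_rpow hq0]
  exact integral_congr_ae ((hj u).fun_comp fun z => ‖z‖ ^ q)

variable (X) in
theorem differentiable_quadForm (κ : ℝ) : Differentiable ℝ (fun u : X => quadForm κ u.1) := by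
  have h1 : Differentiable ℝ (fun u : X => u.1.snd) :=
    ((WithLp.sndL 2 ℝ (Lp F 2 μ) (Lp G 2 μ)).comp X.subtypeL).differentiable
  have h2 : Differentiable ℝ (fun u : X => u.1.fst) :=
    ((WithLp.fstL 2 ℝ (Lp F 2 μ) (Lp G 2 μ)).comp X.subtypeL).differentiable
  exact (h1.norm_sq ℝ).add ((h2.norm_sq ℝ).const_mul κ)

/-- Euler's identity for positively homogeneous functionals. -/
theorem fderiv_apply_self_of_homogeneous {V : Type*} [NormedAddCommGroup V] [NormedSpace ℝ V]
    {f : V → ℝ} {k : ℝ} {u : V} (hf : DifferentiableAt ℝ f u)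
    (hh : ∀ t : ℝ, 0 < t → f (t • u) = t ^ k * f u) : fderiv ℝ f u u = k * f u := by
  have h1 : HasDerivAt (fun t : ℝ => f (t • u)) (fderiv ℝ f u u) 1 := by
    have h2 : HasDerivAt (fun t : ℝ => t • u) u 1 := by
      simpa using (hasDerivAt_id (1 : ℝ)).smul_const u
    have h3 : HasFDerivAt f (fderiv ℝ f u) ((1 : ℝ) • u) := by
      rw [one_smul]; exact hf.hasFDerivAt
    exact h3.comp_hasDerivAt (1 : ℝ) h2
  have h4 : HasDerivAt (fun t : ℝ => t ^ k * f u) (k * f u) 1 := by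
    simpa using (Real.hasDerivAt_rpow_const (x := (1 : ℝ)) (p := k) (Or.inl one_ne_zero)).mul_const
      (f u)
  refine h1.unique (h4.congr_of_eventuallyEq ?_)
  filter_upwards [lt_mem_nhds (zero_lt_one' ℝ)] with t ht using hh t ht

theorem fderiv_quadForm_self (κ : ℝ) (u : X) :
    fderiv ℝ (fun u : X => quadForm κ u.1) u u = 2 * quadForm κ u.1 :=
  fderiv_apply_self_of_homogeneous (k := 2) (differentiable_quadForm X κ u) fun t _ => by
    rw [Submodule.coe_smul, quadForm_smul]; simp

theorem HasSobolev.fderiv_powInt_self [IsFiniteMeasure μ] (hX : HasSobolev X s C) (hC : 0 ≤ C)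
    {p : ℝ} (hp : 2 < p) (hps : p ≤ s) (u : X) :
    fderiv ℝ (fun u : X => powInt p u.1) u u = p * powInt p u.1 :=
  fderiv_apply_self_of_homogeneous (hX.differentiable_powInt hC hp hps u) fun t ht => by
    rw [Submodule.coe_smul, powInt_smul p ht.le]

theorem HasSobolev.fderiv_pairEnergy [IsFiniteMeasure μ] (hX : HasSobolev X s C)
    (hC : 0 ≤ C) (κ : ℝ) {p : ℝ} (hp : 2 < p) (hps : p ≤ s) (u : X) :
    fderiv ℝ (fun u : X => pairEnergy κ p u.1) u =
      (1 / 2 : ℝ) • fderiv ℝ (fun u : X => quadForm κ u.1) u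
        - (1 / p) • fderiv ℝ (fun u : X => powInt p u.1) u := by
  have h1 := ((differentiable_quadForm X κ u).hasFDerivAt.const_mul (1 / 2)).sub
    ((hX.differentiable_powInt hC hp hps u).hasFDerivAt.const_mul (1 / p))
  exact h1.fderiv

/-- The Nehari identity `I'(u)u = ∫ |W|² + κ |u|² - ∫ |u|^p`. -/
theorem HasSobolev.fderiv_pairEnergy_self [IsFiniteMeasure μ] (hX : HasSobolev X s C)
    (hC : 0 ≤ C) (κ : ℝ) {p : ℝ} (hp : 2 < p) (hps : p ≤ s) (u : X) :
    fderiv ℝ (fun u : X => pairEnergy κ p u.1) u u = quadForm κ u.1 - powInt p u.1 := by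
  rw [hX.fderiv_pairEnergy hC κ hp hps u, _root_.sub_apply, _root_.smul_apply, _root_.smul_apply,
    fderiv_quadForm_self, hX.fderiv_powInt_self hC hp hps]
  have : p ≠ 0 := by linarith
  simp only [smul_eq_mul]
  field_simp

theorem pairEnergy_eq_of_nehari {κ p : ℝ} {w : WithLp 2 (Lp F 2 μ × Lp G 2 μ)}
    (h : quadForm κ w = powInt p w) : pairEnergy κ p w = (1 / 2 - 1 / p) * quadForm κ w := by
  unfold pairEnergy; rw [← h]; ring

/-- The dilation factor that puts `w` on the Nehari manifold. -/
theorem quadForm_smul_eq_powInt_smul_iff {κ p t : ℝ} (hp : 2 < p) (ht : 0 < t)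
    {w : WithLp 2 (Lp F 2 μ × Lp G 2 μ)} (hP : 0 < powInt p w) (hT : 0 < quadForm κ w) :
    quadForm κ (t • w) = powInt p (t • w) ↔ t = (quadForm κ w / powInt p w) ^ (1 / (p - 2)) := by
  have hp2 : p - 2 ≠ 0 := by linarith
  have e : t ^ p = t ^ 2 * t ^ (p - 2) := by
    rw [← Real.rpow_natCast, ← Real.rpow_add ht]; congr 1; push_cast; ring
  rw [quadForm_smul, powInt_smul p ht.le, e, mul_assoc, mul_right_inj' (by positivity)]
  constructor
  · intro h
    rw [h, mul_div_cancel_right₀ _ hP.ne', ← Real.rpow_mul ht.le, mul_one_div_cancel hp2,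
      Real.rpow_one]
  · rintro h
    rw [h, ← Real.rpow_mul (by positivity), one_div_mul_cancel hp2, Real.rpow_one,
      div_mul_cancel₀ _ hP.ne']

/-- The energy of the projection of `w` on the Nehari manifold. -/
theorem quadForm_smul_of_nehari {κ p t : ℝ} (hp : 2 < p) (ht : 0 < t)
    {w : WithLp 2 (Lp F 2 μ × Lp G 2 μ)} (hP : 0 < powInt p w) (hT : 0 < quadForm κ w)
    (h : quadForm κ (t • w) = powInt p (t • w)) :
    quadForm κ (t • w) = (quadForm κ w / powInt p w ^ (2 / p)) ^ (p / (p - 2)) := by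
  have hp2 : p - 2 ≠ 0 := by linarith
  have hp0 : p ≠ 0 := by linarith
  rw [quadForm_smul, (quadForm_smul_eq_powInt_smul_iff hp ht hP hT).1 h]
  rw [← Real.rpow_natCast, ← Real.rpow_mul (by positivity), Real.div_rpow hT.le hP.le,
    Real.div_rpow hT.le (by positivity), ← Real.rpow_mul hP.le]
  have e1 : 1 / (p - 2) * ((2 : ℕ) : ℝ) = 2 / (p - 2) := by push_cast; ring
  have e2 : 2 / p * (p / (p - 2)) = 2 / (p - 2) := by field_simp
  have e3 : p / (p - 2) = 2 / (p - 2) + 1 := by field_simp; ring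
  rw [e1, e2, e3, Real.rpow_add_one hT.ne']
  ring

end Pairs

section Energies

variable {N : ℕ}

theorem magEnergy_eq (Ω : Set (RN N)) (A : RN N → RN N) (κ p : ℝ) :
    magEnergy Ω A κ p = fun u : magSpace Ω A => pairEnergy κ p u.1 := by
  funext u
  rw [pairEnergy, ← quadForm_eq_integral]
  rfl

theorem realEnergy_eq (D : Set (RN N)) (κ p : ℝ) :
    realEnergy D κ p = fun u : H10 D => pairEnergy κ p u.1 := by
  funext u
  rw [pairEnergy, ← quadForm_eq_integral]
  simp only [Real.norm_eq_abs, sq_abs]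
  simp [realEnergy, powInt]

theorem mem_magNehari_iff {Ω : Set (RN N)} (hΩ : volume Ω ≠ ⊤) {A : RN N → RN N} {s C κ p : ℝ}
    (hX : HasSobolev (magSpace Ω A) s C) (hC : 0 ≤ C) (hp : 2 < p) (hps : p ≤ s)
    (u : magSpace Ω A) :
    u ∈ magNehari Ω A κ p ↔ u ≠ 0 ∧ quadForm κ u.1 = powInt p u.1 := by
  have : IsFiniteMeasure (volume.restrict Ω) := ⟨by simpa using hΩ.lt_top⟩
  rw [magNehari, mem_ofPred_eq, magEnergy_eq, hX.fderiv_pairEnergy_self hC κ hp hps, sub_eq_zero]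

theorem mem_realNehari_iff {D : Set (RN N)} (hD : volume D ≠ ⊤) {s C κ p : ℝ}
    (hX : HasSobolev (H10 D) s C) (hC : 0 ≤ C) (hp : 2 < p) (hps : p ≤ s) (u : H10 D) :
    u ∈ realNehari D κ p ↔ u ≠ 0 ∧ quadForm κ u.1 = powInt p u.1 := by
  have : IsFiniteMeasure (volume.restrict D) := ⟨by simpa using hD.lt_top⟩
  rw [realNehari, mem_ofPred_eq, realEnergy_eq, hX.fderiv_pairEnergy_self hC κ hp hps, sub_eq_zero]

end Energies

/-! ### The critical exponent -/

section CritExp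

variable {N : ℕ}

theorem two_lt_critExp (hN : 3 ≤ N) : 2 < critExp N := by
  have : (3 : ℝ) ≤ N := by exact_mod_cast hN
  rw [critExp, lt_div_iff₀ (by linarith)]
  linarith

theorem one_div_critExp (hN : 3 ≤ N) : 1 / critExp N = 1 / 2 - 1 / (N : ℝ) := by
  have : (3 : ℝ) ≤ N := by exact_mod_cast hN
  have h2 : (N : ℝ) - 2 ≠ 0 := by linarith
  have h0 : (N : ℝ) ≠ 0 := by linarith
  rw [critExp]
  field_simp

theorem critExp_div (hN : 3 ≤ N) : critExp N / (critExp N - 2) = N / 2 := by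
  have : (3 : ℝ) ≤ N := by exact_mod_cast hN
  have h2 : (N : ℝ) - 2 ≠ 0 := by linarith
  have h : critExp N - 2 ≠ 0 := by linarith [two_lt_critExp hN]
  rw [div_eq_div_iff h two_ne_zero, critExp]
  field_simp
  ring

theorem two_div_critExp (hN : 3 ≤ N) : 2 / critExp N = 1 - 2 / (N : ℝ) := by
  have := one_div_critExp hN
  have e : 2 / critExp N = 2 * (1 / critExp N) := by ring
  rw [e, this]; ring

end CritExp

/-! ### Test functions -/

section Test

variable {N : ℕ} {F : Type*} [NormedAddCommGroup F] [NormedSpace ℝ F]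
  {D D' : Set (RN N)} {φ : RN N → F}

theorem IsTest.mono (h : IsTest D φ) (hD : D ⊆ D') : IsTest D' φ := ⟨h.1, h.2.1, h.2.2.trans hD⟩

theorem IsTest.eq_zero (h : IsTest D φ) {x : RN N} (hx : x ∉ D) : φ x = 0 :=
  image_eq_zero_of_notMem_tsupport fun hx' => hx (h.2.2 hx')

theorem IsTest.fderiv_eq_zero (h : IsTest D φ) {x : RN N} (hx : x ∉ D) : fderiv ℝ φ x = 0 :=
  image_eq_zero_of_notMem_tsupport fun hx' => hx (h.2.2 (tsupport_fderiv_subset ℝ hx'))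

theorem IsTest.continuous (h : IsTest D φ) : Continuous φ := h.1.continuous

theorem IsTest.memLp (h : IsTest D φ) (q : ℝ≥0∞) : MemLp φ q volume :=
  h.continuous.memLp_of_hasCompactSupport h.2.1

theorem IsTest.contDiff_fderiv (h : IsTest D φ) : ContDiff ℝ ∞ (fderiv ℝ φ) :=
  h.1.fderiv_right (by simp)

theorem IsTest.fderiv_memLp (h : IsTest D φ) (q : ℝ≥0∞) : MemLp (fderiv ℝ φ) q volume :=
  h.contDiff_fderiv.continuous.memLp_of_hasCompactSupport (h.2.1.fderiv ℝ)

theorem IsTest.fderiv_apply (h : IsTest D φ) (v : RN N) : IsTest D (fun x => fderiv ℝ φ x v) := by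
  refine ⟨h.contDiff_fderiv.clm_apply contDiff_const, h.2.1.fderiv_apply ℝ v, ?_⟩
  exact (tsupport_fderiv_apply_subset ℝ v).trans h.2.2

theorem IsTest.integrable_norm_rpow (h : IsTest D φ) {q : ℝ} (hq : 0 < q) :
    Integrable (fun x => ‖φ x‖ ^ q) volume :=
  integrable_norm_rpow_of_memLp hq (h.memLp _)

theorem IsTest.integrable_fderiv_sq (h : IsTest D φ) :
    Integrable (fun x => ‖fderiv ℝ φ x‖ ^ 2) volume :=
  (h.fderiv_memLp 2).integrable_norm_pow (by simp)

theorem norm_gradient (ψ : RN N → ℝ) (x : RN N) : ‖gradient ψ x‖ = ‖fderiv ℝ ψ x‖ :=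
  LinearIsometryEquiv.norm_map _ _

theorem gradient_apply (ψ : RN N → ℝ) (x : RN N) (j : Fin N) :
    gradient ψ x j = fderiv ℝ ψ x (EuclideanSpace.single j 1) := by
  have h : inner ℝ (gradient ψ x) (EuclideanSpace.single j (1 : ℝ))
      = fderiv ℝ ψ x (EuclideanSpace.single j 1) := by
    rw [gradient, InnerProductSpace.toDual_symm_apply]
  rw [← h, EuclideanSpace.inner_single_right]
  simp

theorem continuous_gradient {ψ : RN N → ℝ} (h : IsTest D ψ) : Continuous (gradient ψ) :=
  (LinearIsometryEquiv.continuous _).comp h.contDiff_fderiv.continuous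

theorem IsTest.gradient_memLp {ψ : RN N → ℝ} (h : IsTest D ψ) (q : ℝ≥0∞) :
    MemLp (gradient ψ) q volume :=
  (h.fderiv_memLp q).of_le (continuous_gradient h).aestronglyMeasurable
    (Filter.Eventually.of_forall fun x => (norm_gradient ψ x).le)

theorem IsTest.setIntegral_norm_rpow (h : IsTest D φ) {q : ℝ} (hq : 0 < q) :
    ∫ x in D, ‖φ x‖ ^ q = ∫ x, ‖φ x‖ ^ q :=
  setIntegral_eq_integral_of_forall_compl_eq_zero fun x hx => by
    rw [h.eq_zero hx, norm_zero, Real.zero_rpow hq.ne']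

theorem IsTest.setIntegral_fderiv_sq (h : IsTest D φ) :
    ∫ x in D, ‖fderiv ℝ φ x‖ ^ 2 = ∫ x, ‖fderiv ℝ φ x‖ ^ 2 :=
  setIntegral_eq_integral_of_forall_compl_eq_zero fun x hx => by
    rw [h.fderiv_eq_zero hx]; simp

/-- The Gagliardo–Nirenberg–Sobolev inequality for test functions. -/
theorem exists_sobolev_test (hN : 3 ≤ N) : ∃ C : ℝ, 0 < C ∧ ∀ ψ : RN N → ℝ, IsTest univ ψ →
    (∫ x, ‖ψ x‖ ^ critExp N) ^ (2 / critExp N) ≤ C * ∫ x, ‖fderiv ℝ ψ x‖ ^ 2 := by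
  have hs := two_lt_critExp hN
  have hs0 : 0 < critExp N := by linarith
  set K : NNReal :=
    SNormLESNormFDerivOfEqConst ℝ (volume : Measure (RN N)) ((2 : NNReal) : ℝ) with hK
  refine ⟨(K : ℝ) ^ 2 + 1, by positivity, fun ψ hψ => ?_⟩
  have h := eLpNorm_le_eLpNorm_fderiv_of_eq (volume : Measure (RN N)) (u := ψ) (p := 2)
    (p' := (critExp N).toNNReal) (hψ.1.of_le (by simp)) hψ.2.1 (by norm_num)
    (by simp; omega)
    (by rw [Real.coe_toNNReal _ hs0.le]
        have := one_div_critExp hN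
        simp only [one_div] at this
        simpa using this)
  have e2 : ((2 : NNReal) : ℝ≥0∞) = ENNReal.ofReal 2 := by simp
  rw [← hK, ← ENNReal.ofReal, eLpNorm_eq_ofReal_integral hs0 (hψ.memLp _), e2,
    eLpNorm_eq_ofReal_integral two_pos (hψ.fderiv_memLp _), ← ENNReal.ofReal_coe_nnreal,
    ← ENNReal.ofReal_mul (by positivity), ENNReal.ofReal_le_ofReal_iff (by positivity)] at h
  simp only [Real.rpow_two] at h
  have hI : 0 ≤ ∫ x, ‖ψ x‖ ^ critExp N := integral_nonneg fun x => by positivity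
  have hJ : 0 ≤ ∫ x, ‖fderiv ℝ ψ x‖ ^ 2 := integral_nonneg fun x => by positivity
  have h2 := pow_le_pow_left₀ (by positivity) h 2
  rw [mul_pow, ← Real.rpow_natCast, ← Real.rpow_mul hI, ← Real.rpow_natCast (_ ^ (2⁻¹ : ℝ)),
    ← Real.rpow_mul hJ] at h2
  have e3 : (critExp N)⁻¹ * ((2 : ℕ) : ℝ) = 2 / critExp N := by push_cast; ring
  have e4 : (2 : ℝ)⁻¹ * ((2 : ℕ) : ℝ) = 1 := by norm_num
  rw [e3, e4, Real.rpow_one] at h2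
  nlinarith

end Test

/-! ### Elements of the closures of the graphs -/

section Closure

variable {N : ℕ} {D : Set (RN N)}

theorem IsTest.exists_H10 {φ : RN N → ℝ} (h : IsTest D φ) :
    ∃ u : H10 D, u.1 ∈ gradGraph D ∧ u.1.fst =ᵐ[volume.restrict D] φ ∧
      u.1.snd =ᵐ[volume.restrict D] gradient φ := by
  let w : RealPair D := WithLp.toLp 2 (((h.memLp 2).restrict D).toLp φ,
    ((h.gradient_memLp 2).restrict D).toLp (gradient φ))
  have h1 : w.fst =ᵐ[volume.restrict D] φ := MemLp.coeFn_toLp ((h.memLp 2).restrict D)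
  have h2 : w.snd =ᵐ[volume.restrict D] gradient φ :=
    MemLp.coeFn_toLp ((h.gradient_memLp 2).restrict D)
  have hw : w ∈ gradGraph D := ⟨φ, h, h1, h2⟩
  exact ⟨⟨w, Submodule.le_topologicalClosure _ hw⟩, hw, h1, h2⟩

theorem exists_seq_H10 (u : H10 D) : ∃ (w : ℕ → H10 D) (φ : ℕ → RN N → ℝ),
    Filter.Tendsto w Filter.atTop (nhds u) ∧ ∀ n, IsTest D (φ n) ∧
      (w n).1.fst =ᵐ[volume.restrict D] φ n ∧ (w n).1.snd =ᵐ[volume.restrict D] gradient (φ n) := by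
  obtain ⟨w, hw, hlim⟩ := mem_closure_iff_seq_limit.1 (show u.1 ∈ closure (gradGraph D : Set _) from
    u.2)
  choose φ hφ h1 h2 using hw
  refine ⟨fun n => ⟨w n, Submodule.le_topologicalClosure _ ⟨φ n, hφ n, h1 n, h2 n⟩⟩, φ, ?_,
    fun n => ⟨hφ n, h1 n, h2 n⟩⟩
  exact tendsto_subtype_rng.2 hlim

theorem exists_seq_magSpace {A : RN N → RN N} (u : magSpace D A) :
    ∃ (w : ℕ → magSpace D A) (φ : ℕ → RN N → ℂ),
    Filter.Tendsto w Filter.atTop (nhds u) ∧ ∀ n, IsTest D (φ n) ∧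
      (w n).1.fst =ᵐ[volume.restrict D] φ n ∧
      (w n).1.snd =ᵐ[volume.restrict D] magGrad A (φ n) := by
  obtain ⟨w, hw, hlim⟩ := mem_closure_iff_seq_limit.1
    (show u.1 ∈ closure (magGraph D A : Set _) from u.2)
  choose φ hφ h1 h2 using hw
  refine ⟨fun n => ⟨w n, Submodule.le_topologicalClosure _ ⟨φ n, hφ n, h1 n, h2 n⟩⟩, φ, ?_,
    fun n => ⟨hφ n, h1 n, h2 n⟩⟩
  exact tendsto_subtype_rng.2 hlim

theorem powInt_congr {α F G : Type*} [MeasurableSpace α] {μ : Measure α} [NormedAddCommGroup F]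
    [NormedAddCommGroup G] {q : ℝ} {w : WithLp 2 (Lp F 2 μ × Lp G 2 μ)} {f : α → F}
    (h : w.fst =ᵐ[μ] f) : powInt q w = ∫ x, ‖f x‖ ^ q ∂μ :=
  integral_congr_ae (h.fun_comp fun z => ‖z‖ ^ q)

theorem norm_snd_sq_congr {α F G : Type*} [MeasurableSpace α] {μ : Measure α}
    [NormedAddCommGroup F] [NormedAddCommGroup G] {w : WithLp 2 (Lp F 2 μ × Lp G 2 μ)} {f : α → G}
    (h : w.snd =ᵐ[μ] f) : ‖w.snd‖ ^ 2 = ∫ x, ‖f x‖ ^ 2 ∂μ := by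
  rw [Lp_two_norm_sq]
  exact integral_congr_ae (h.fun_comp fun z => ‖z‖ ^ 2)

theorem norm_fst_sq_congr {α F G : Type*} [MeasurableSpace α] {μ : Measure α}
    [NormedAddCommGroup F] [NormedAddCommGroup G] {w : WithLp 2 (Lp F 2 μ × Lp G 2 μ)} {f : α → F}
    (h : w.fst =ᵐ[μ] f) : ‖w.fst‖ ^ 2 = ∫ x, ‖f x‖ ^ 2 ∂μ := by
  rw [Lp_two_norm_sq]
  exact integral_congr_ae (h.fun_comp fun z => ‖z‖ ^ 2)

/-- A Sobolev inequality passes to the closure, by Fatou's lemma. -/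
theorem hasSobolev_of_dense {α F G : Type*} [MeasurableSpace α] {μ : Measure α}
    [NormedAddCommGroup F] [InnerProductSpace ℝ F] [NormedAddCommGroup G] [InnerProductSpace ℝ G]
    {X : Submodule ℝ (WithLp 2 (Lp F 2 μ × Lp G 2 μ))} {s C : ℝ} (hs : 0 < s) (hC : 0 ≤ C)
    (hX : ∀ u ∈ X, ∃ w : ℕ → WithLp 2 (Lp F 2 μ × Lp G 2 μ),
      Filter.Tendsto w Filter.atTop (nhds u) ∧
      ∀ n, MemLp (w n).fst (ENNReal.ofReal s) μ ∧ powInt s (w n) ^ (2 / s) ≤ C * ‖(w n).snd‖ ^ 2) :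
    HasSobolev X s C := by
  intro u hu
  obtain ⟨w, hw, hb⟩ := hX u hu
  have h1 : Filter.Tendsto (fun n => (w n).fst) Filter.atTop (nhds u.fst) :=
    ((WithLp.continuous_fst 2 _ _).tendsto u).comp hw
  have h2 : Filter.Tendsto (fun n => ‖(w n).snd‖) Filter.atTop (nhds ‖u.snd‖) :=
    (((WithLp.continuous_snd 2 _ _).tendsto u).comp hw).norm
  obtain ⟨ns, hns, hae⟩ := (tendstoInMeasure_of_tendsto_Lp h1).exists_seq_tendsto_ae
  have hF := Lp.eLpNorm_lim_le_liminf_eLpNorm (p := ENNReal.ofReal s)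
    (fun n => Lp.aestronglyMeasurable (w (ns n)).fst) u.fst hae
  have hbn : ∀ n, eLpNorm (w n).fst (ENNReal.ofReal s) μ
      ≤ ENNReal.ofReal (C ^ (1 / 2 : ℝ) * ‖(w n).snd‖) := by
    intro n
    rw [eLpNorm_eq_ofReal_integral hs (hb n).1]
    refine ENNReal.ofReal_le_ofReal ?_
    have hP : 0 ≤ ∫ x, ‖(w n).fst x‖ ^ s ∂μ := powInt_nonneg s (w n)
    have h3 := Real.rpow_le_rpow (by positivity [powInt_nonneg s (w n)]) (hb n).2
      (by norm_num : (0:ℝ) ≤ 1 / 2)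
    rw [Real.mul_rpow hC (by positivity), ← Real.rpow_natCast ‖(w n).snd‖,
      ← Real.rpow_mul (norm_nonneg _), powInt, ← Real.rpow_mul hP] at h3
    convert h3 using 1
    · congr 1; field_simp
    · norm_num
  have hlim : Filter.Tendsto (fun n => ENNReal.ofReal (C ^ (1 / 2 : ℝ) * ‖(w (ns n)).snd‖))
      Filter.atTop (nhds (ENNReal.ofReal (C ^ (1 / 2 : ℝ) * ‖u.snd‖))) :=
    ENNReal.tendsto_ofReal ((h2.comp hns.tendsto_atTop).const_mul _)
  have hfin : eLpNorm u.fst (ENNReal.ofReal s) μ ≤ ENNReal.ofReal (C ^ (1 / 2 : ℝ) * ‖u.snd‖) := by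
    refine hF.trans ?_
    rw [← hlim.liminf_eq]
    exact Filter.liminf_le_liminf (Filter.Eventually.of_forall fun n => hbn (ns n))
  have hmem : MemLp u.fst (ENNReal.ofReal s) μ :=
    ⟨Lp.aestronglyMeasurable _, hfin.trans_lt ENNReal.ofReal_lt_top⟩
  refine ⟨hmem, ?_⟩
  rw [eLpNorm_eq_ofReal_integral hs hmem, ENNReal.ofReal_le_ofReal_iff (by positivity)] at hfin
  have hP : 0 ≤ ∫ x, ‖u.fst x‖ ^ s ∂μ := powInt_nonneg s u
  have h4 := pow_le_pow_left₀ (by positivity) hfin 2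
  rw [mul_pow, ← Real.rpow_natCast, ← Real.rpow_natCast (C ^ (1 / 2 : ℝ)), ← Real.rpow_mul hC,
    ← Real.rpow_mul hP] at h4
  have e1 : s⁻¹ * ((2 : ℕ) : ℝ) = 2 / s := by push_cast; field_simp
  have e2 : (1 / 2 : ℝ) * ((2 : ℕ) : ℝ) = 1 := by norm_num
  rw [e1, e2, Real.rpow_one] at h4
  exact h4

theorem hasSobolev_H10_of_test {s C : ℝ} (hs : 0 < s) (hC : 0 ≤ C)
    (h : ∀ ψ : RN N → ℝ, IsTest D ψ →
      (∫ x, ‖ψ x‖ ^ s) ^ (2 / s) ≤ C * ∫ x, ‖fderiv ℝ ψ x‖ ^ 2) :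
    HasSobolev (H10 D) s C := by
  refine hasSobolev_of_dense hs hC fun u hu => ?_
  obtain ⟨w, φ, hw, hφ⟩ := exists_seq_H10 ⟨u, hu⟩
  refine ⟨fun n => (w n).1, (continuous_subtype_val.tendsto _).comp hw, fun n => ?_⟩
  obtain ⟨h1, h2, h3⟩ := hφ n
  refine ⟨(memLp_congr_ae h2).2 ((h1.memLp _).restrict D), ?_⟩
  rw [powInt_congr h2, norm_snd_sq_congr h3, h1.setIntegral_norm_rpow hs]
  simp only [norm_gradient]
  rw [h1.setIntegral_fderiv_sq]
  exact h (φ n) h1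

/-- Integration against a bounded coefficient is continuous on `L²`. -/
theorem continuous_integral_bilin {α G E K : Type*} [MeasurableSpace α] {μ : Measure α}
    [IsFiniteMeasure μ] [NormedAddCommGroup G] [NormedSpace ℝ G] [NormedAddCommGroup E]
    [NormedSpace ℝ E] [NormedAddCommGroup K] [NormedSpace ℝ K] (B : E →L[ℝ] G →L[ℝ] K)
    {c : α → E} (hc : AEStronglyMeasurable c μ) {M : ℝ} (hM : ∀ᵐ x ∂μ, ‖c x‖ ≤ M) :
    Continuous (fun f : Lp G 2 μ => ∫ x, B (c x) (f x) ∂μ) := by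
  rcases eq_or_ne μ 0 with rfl | hμ
  · simpa using continuous_const
  have hI : ∀ f : Lp G 2 μ, Integrable (fun x => f x) μ := fun f =>
    (Lp.memLp f).integrable (by norm_num)
  have hbd : ∀ f : Lp G 2 μ, ∀ᵐ x ∂μ, ‖B (c x) (f x)‖ ≤ ‖B‖ * M * ‖f x‖ := by
    intro f
    filter_upwards [hM] with x hx
    refine (B.le_opNorm₂ _ _).trans ?_
    gcongr
  have hint : ∀ f : Lp G 2 μ, Integrable (fun x => B (c x) (f x)) μ := fun f =>
    Integrable.mono' ((hI f).norm.const_mul _)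
      (B.aestronglyMeasurable_comp₂ hc (Lp.aestronglyMeasurable f)) (hbd f)
  let L : Lp G 2 μ →ₗ[ℝ] K :=
    { toFun := fun f => ∫ x, B (c x) (f x) ∂μ
      map_add' := by
        intro f g
        rw [← integral_add (hint f) (hint g)]
        refine integral_congr_ae ?_
        filter_upwards [Lp.coeFn_add f g] with x hx
        rw [hx]; simp
      map_smul' := by
        intro t f
        rw [RingHom.id_apply, ← integral_smul]
        refine integral_congr_ae ?_
        filter_upwards [Lp.coeFn_smul t f] with x hx
        rw [hx]; simp }
  refine (L.mkContinuous (‖B‖ * M * μ.real univ ^ (1 / 2 : ℝ)) fun f => ?_).continuous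
  have hM0 : 0 ≤ M := by
    have : (ae μ).NeBot := ae_neBot.2 hμ
    obtain ⟨x, hx⟩ := hM.exists
    exact (norm_nonneg _).trans hx
  refine (norm_integral_le_of_norm_le ((hI f).norm.const_mul _) (hbd f)).trans ?_
  rw [integral_const_mul, mul_assoc (‖B‖ * M)]
  refine mul_le_mul_of_nonneg_left ?_ (mul_nonneg (norm_nonneg B) hM0)
  have h2 := integral_rpow_le_of_memLp (μ := μ) (f := fun x => ‖f x‖) one_pos one_le_two
    (by simpa using (Lp.memLp f).norm)
  simp only [Real.rpow_one, Real.rpow_two, norm_norm] at h2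
  rw [← Lp_two_norm_sq, ← Real.rpow_natCast, ← Real.rpow_mul (norm_nonneg _)] at h2
  norm_num at h2
  norm_num
  linarith

end Closure

/-! ### Weak derivatives -/

section Weak

variable {N : ℕ} {D : Set (RN N)}

theorem isFiniteMeasure_restrict (hD : volume D ≠ ⊤) : IsFiniteMeasure (volume.restrict D) :=
  ⟨by simpa using hD.lt_top⟩

theorem IsTest.exists_bound {F : Type*} [NormedAddCommGroup F] [NormedSpace ℝ F] {φ : RN N → F}
    (h : IsTest D φ) : ∃ M, ∀ x, ‖φ x‖ ≤ M :=
  h.2.1.exists_bound_of_continuous h.continuous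

/-- Integration by parts for test functions. -/
theorem IsTest.integral_smul_fderiv {F : Type*} [NormedAddCommGroup F] [NormedSpace ℝ F]
    {φ : RN N → F} {χ : RN N → ℝ} (hφ : IsTest D φ) (hχ : IsTest univ χ) (v : RN N) :
    ∫ x, χ x • fderiv ℝ φ x v = -∫ x, fderiv ℝ χ x v • φ x := by
  have h1 := hφ.fderiv_apply v
  have h2 := hχ.fderiv_apply v
  refine integral_smul_fderiv_eq_neg_fderiv_smul_of_integrable (𝕜 := ℝ) ?_ ?_ ?_
    (fun x _ => hχ.differentiable x) (fun x _ => hφ.differentiable x)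
  · exact (h2.continuous.smul hφ.continuous).integrable_of_hasCompactSupport hφ.2.1.smul_left
  · exact (hχ.continuous.smul h1.continuous).integrable_of_hasCompactSupport h1.2.1.smul_left
  · exact (hχ.continuous.smul hφ.continuous).integrable_of_hasCompactSupport hφ.2.1.smul_left

/-- The second component of an element of `H10 D` is the weak gradient of the first one. -/
theorem H10_integral_snd (hD : volume D ≠ ⊤) (u : H10 D) {χ : RN N → ℝ} (hχ : IsTest univ χ)
    (j : Fin N) : ∫ x in D, χ x * u.1.snd x j
      = -∫ x in D, fderiv ℝ χ x (EuclideanSpace.single j 1) * u.1.fst x := by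
  have := isFiniteMeasure_restrict hD
  obtain ⟨w, φ, hw, hφ⟩ := exists_seq_H10 u
  have hχ' := hχ.fderiv_apply (EuclideanSpace.single j (1 : ℝ))
  obtain ⟨M, hM⟩ := hχ.exists_bound
  obtain ⟨M', hM'⟩ := hχ'.exists_bound
  have c1 := continuous_integral_bilin (μ := volume.restrict D)
    (ContinuousLinearMap.smulRight (1 : ℝ →L[ℝ] ℝ) (EuclideanSpace.proj j : RN N →L[ℝ] ℝ))
    hχ.continuous.aestronglyMeasurable (Filter.Eventually.of_forall hM)
  have c2 := continuous_integral_bilin (μ := volume.restrict D)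
    (ContinuousLinearMap.mul ℝ ℝ) hχ'.continuous.aestronglyMeasurable
    (Filter.Eventually.of_forall hM')
  have hw' : Filter.Tendsto (fun n => (w n).1) Filter.atTop (nhds u.1) :=
    (continuous_subtype_val.tendsto _).comp hw
  have t1 := ((c1.comp (WithLp.continuous_snd 2 _ _)).tendsto u.1).comp hw'
  have t2 := ((c2.comp (WithLp.continuous_fst 2 _ _)).tendsto u.1).comp hw'
  have hEq : ∀ n, ∫ x in D, χ x * (w n).1.snd x j
      = -∫ x in D, fderiv ℝ χ x (EuclideanSpace.single j 1) * (w n).1.fst x := by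
    intro n
    obtain ⟨h1, h2, h3⟩ := hφ n
    have e1 : ∫ x in D, χ x * (w n).1.snd x j
        = ∫ x in D, χ x • fderiv ℝ (φ n) x (EuclideanSpace.single j 1) := by
      refine integral_congr_ae ?_
      filter_upwards [h3] with x hx
      rw [hx, gradient_apply, smul_eq_mul]
    have e2 : ∫ x in D, fderiv ℝ χ x (EuclideanSpace.single j 1) * (w n).1.fst x
        = ∫ x in D, fderiv ℝ χ x (EuclideanSpace.single j 1) • φ n x := by
      refine integral_congr_ae ?_
      filter_upwards [h2] with x hx
      rw [hx, smul_eq_mul]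
    rw [e1, e2, setIntegral_eq_integral_of_forall_compl_eq_zero fun x hx => by
        rw [h1.fderiv_eq_zero hx]; simp,
      setIntegral_eq_integral_of_forall_compl_eq_zero fun x hx => by
        rw [h1.eq_zero hx]; simp, h1.integral_smul_fderiv hχ]
  refine tendsto_nhds_unique t1 ((t2.neg).congr fun n => ?_)
  simpa using (hEq n).symm

/-- The second component of an element `(u, W)` of `magSpace D A` is the weak magnetic gradient of
`u`; hence `u` determines `W`. -/
theorem magSpace_integral_snd (hD : volume D ≠ ⊤) {A : RN N → RN N}
    (hA : AEStronglyMeasurable A (volume.restrict D)) {C : ℝ}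
    (hC : ∀ᵐ x ∂(volume.restrict D), ‖A x‖ ≤ C)
    (u : magSpace D A) {χ : RN N → ℝ} (hχ : IsTest univ χ) (j : Fin N) :
    ∫ x in D, χ x • u.1.snd x j
      = ∫ x in D, (Complex.I * (fderiv ℝ χ x (EuclideanSpace.single j 1) : ℝ)
          - ((A x j : ℝ) : ℂ) * (χ x : ℝ)) * u.1.fst x := by
  have := isFiniteMeasure_restrict hD
  obtain ⟨w, φ, hw, hφ⟩ := exists_seq_magSpace u
  have hχ' := hχ.fderiv_apply (EuclideanSpace.single j (1 : ℝ))
  obtain ⟨M, hM⟩ := hχ.exists_bound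
  obtain ⟨M', hM'⟩ := hχ'.exists_bound
  have hAj : AEStronglyMeasurable (fun x => ((A x j : ℝ) : ℂ)) (volume.restrict D) :=
    (Complex.continuous_ofReal.comp (EuclideanSpace.proj (𝕜 := ℝ) j).continuous
      ).comp_aestronglyMeasurable hA
  have c1 := continuous_integral_bilin (μ := volume.restrict D)
    (ContinuousLinearMap.smulRight (1 : ℝ →L[ℝ] ℝ)
      ((EuclideanSpace.proj j : EuclideanSpace ℂ (Fin N) →L[ℂ] ℂ).restrictScalars ℝ))
    hχ.continuous.aestronglyMeasurable (Filter.Eventually.of_forall hM)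
  have hcm : AEStronglyMeasurable (fun x => Complex.I *
      ((fderiv ℝ χ x (EuclideanSpace.single j 1) : ℝ) : ℂ) - ((A x j : ℝ) : ℂ) * ((χ x : ℝ) : ℂ))
      (volume.restrict D) :=
    (aestronglyMeasurable_const.mul
      (Complex.continuous_ofReal.comp hχ'.continuous).aestronglyMeasurable).sub
      (hAj.mul (Complex.continuous_ofReal.comp hχ.continuous).aestronglyMeasurable)
  have hcb : ∀ᵐ x ∂(volume.restrict D), ‖Complex.I *
      ((fderiv ℝ χ x (EuclideanSpace.single j 1) : ℝ) : ℂ) - ((A x j : ℝ) : ℂ) * ((χ x : ℝ) : ℂ)‖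
      ≤ M' + C * M := by
    filter_upwards [hC] with x hx
    refine (norm_sub_le _ _).trans ?_
    rw [norm_mul, norm_mul, Complex.norm_I, one_mul, Complex.norm_real, Complex.norm_real,
      Complex.norm_real]
    have : ‖A x j‖ ≤ C := (PiLp.norm_apply_le _ _).trans hx
    have h0 : 0 ≤ C := (norm_nonneg _).trans hx
    gcongr
    · exact hM' x
    · exact hM x
  have c2 := continuous_integral_bilin (μ := volume.restrict D)
    (ContinuousLinearMap.mul ℝ ℂ) hcm hcb
  have hw' : Filter.Tendsto (fun n => (w n).1) Filter.atTop (nhds u.1) :=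
    (continuous_subtype_val.tendsto _).comp hw
  have t1 := ((c1.comp (WithLp.continuous_snd 2 _ _)).tendsto u.1).comp hw'
  have t2 := ((c2.comp (WithLp.continuous_fst 2 _ _)).tendsto u.1).comp hw'
  refine tendsto_nhds_unique t1 (t2.congr fun n => ?_)
  obtain ⟨h1, h2, h3⟩ := hφ n
  simp only [Function.comp_apply, ContinuousLinearMap.mul_apply']
  symm
  have hf1 := h1.fderiv_apply (EuclideanSpace.single j (1 : ℝ))
  have e1 : ∫ x in D, χ x • (w n).1.snd x j
      = ∫ x in D, (-Complex.I * (χ x • fderiv ℝ (φ n) x (EuclideanSpace.single j 1))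
          - ((A x j : ℝ) : ℂ) * (χ x : ℝ) * φ n x) := by
    refine integral_congr_ae ?_
    filter_upwards [h3] with x hx
    rw [hx]
    simp only [magGrad, Complex.real_smul]
    ring
  have e2 : ∫ x in D, (Complex.I * ((fderiv ℝ χ x (EuclideanSpace.single j 1) : ℝ) : ℂ)
        - ((A x j : ℝ) : ℂ) * ((χ x : ℝ) : ℂ)) * (w n).1.fst x
      = ∫ x in D, (Complex.I * (fderiv ℝ χ x (EuclideanSpace.single j 1) • φ n x)
          - ((A x j : ℝ) : ℂ) * (χ x : ℝ) * φ n x) := by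
    refine integral_congr_ae ?_
    filter_upwards [h2] with x hx
    rw [hx]
    simp only [Complex.real_smul]
    ring
  have i1 : Integrable (fun x => -Complex.I * (χ x • fderiv ℝ (φ n) x (EuclideanSpace.single j 1)))
      (volume.restrict D) :=
    (((hχ.continuous.smul hf1.continuous).integrable_of_hasCompactSupport
      hf1.2.1.smul_left).const_mul _).restrict
  have i2 : Integrable (fun x => Complex.I *
      (fderiv ℝ χ x (EuclideanSpace.single j 1) • φ n x)) (volume.restrict D) :=
    (((hχ'.continuous.smul h1.continuous).integrable_of_hasCompactSupport
      h1.2.1.smul_left).const_mul _).restrict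
  have i3 : Integrable (fun x => ((A x j : ℝ) : ℂ) * (χ x : ℝ) * φ n x) (volume.restrict D) := by
    refine Integrable.mono' ((h1.memLp 1).restrict D |>.integrable le_rfl |>.norm.const_mul (C * M))
      ((hAj.mul (Complex.continuous_ofReal.comp hχ.continuous).aestronglyMeasurable).mul
        h1.continuous.aestronglyMeasurable) ?_
    filter_upwards [hC] with x hx
    rw [norm_mul, norm_mul, Complex.norm_real, Complex.norm_real]
    have : ‖A x j‖ ≤ C := (PiLp.norm_apply_le _ _).trans hx
    have h0 : 0 ≤ C := (norm_nonneg _).trans hx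
    gcongr
    exact hM x
  refine Eq.trans ?_ (e1.trans ?_)
  · simp
  refine Eq.trans ?_ e2.symm
  rw [integral_sub i1 i3, integral_sub i2 i3]
  congr 1
  rw [integral_const_mul, integral_const_mul,
    setIntegral_eq_integral_of_forall_compl_eq_zero fun x hx => by
      rw [h1.fderiv_eq_zero hx]; simp,
    setIntegral_eq_integral_of_forall_compl_eq_zero fun x hx => by
      rw [h1.eq_zero hx]; simp, h1.integral_smul_fderiv hχ]
  ring

/-- The weak gradient of the zero function vanishes. -/
theorem H10_snd_eq_zero (hD : volume D ≠ ⊤) {u : H10 D} (hu : u.1.fst = 0) : u.1.snd = 0 := by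
  have := isFiniteMeasure_restrict hD
  have h0 : ∀ᵐ x ∂(volume.restrict D), u.1.fst x = 0 := by
    rw [hu]; exact Lp.coeFn_zero _ _ _
  have h : ∀ j, ∀ᵐ x ∂(volume.restrict D), u.1.snd x j = 0 := by
    intro j
    have hI : Integrable (fun x => u.1.snd x j) (volume.restrict D) :=
      (EuclideanSpace.proj j : RN N →L[ℝ] ℝ).integrable_comp
        ((Lp.memLp u.1.snd).integrable (by norm_num))
    refine ae_eq_zero_of_integral_contDiff_smul_eq_zero hI.locallyIntegrable fun χ hχ hχ' => ?_
    have := H10_integral_snd hD u ⟨hχ, hχ', subset_univ _⟩ j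
    simp only [smul_eq_mul]
    rw [this, neg_eq_zero]
    refine integral_eq_zero_of_ae ?_
    filter_upwards [h0] with x hx
    simp [hx]
  refine Lp.ext ?_
  filter_upwards [ae_all_iff.2 h, Lp.coeFn_zero (RN N) 2 (volume.restrict D)] with x hx h2
  rw [h2]
  ext j
  exact hx j

/-- The magnetic gradient is closable. -/
theorem magSpace_snd_eq_zero (hD : volume D ≠ ⊤) {A : RN N → RN N}
    (hA : AEStronglyMeasurable A (volume.restrict D)) {C : ℝ}
    (hC : ∀ᵐ x ∂(volume.restrict D), ‖A x‖ ≤ C) {u : magSpace D A} (hu : u.1.fst = 0) :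
    u.1.snd = 0 := by
  have := isFiniteMeasure_restrict hD
  have h0 : ∀ᵐ x ∂(volume.restrict D), u.1.fst x = 0 := by
    rw [hu]; exact Lp.coeFn_zero _ _ _
  have h : ∀ j, ∀ᵐ x ∂(volume.restrict D), u.1.snd x j = 0 := by
    intro j
    have hI : Integrable (fun x => u.1.snd x j) (volume.restrict D) :=
      (EuclideanSpace.proj j : EuclideanSpace ℂ (Fin N) →L[ℂ] ℂ).integrable_comp
        ((Lp.memLp u.1.snd).integrable (by norm_num))
    refine ae_eq_zero_of_integral_contDiff_smul_eq_zero hI.locallyIntegrable fun χ hχ hχ' => ?_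
    rw [magSpace_integral_snd hD hA hC u ⟨hχ, hχ', subset_univ _⟩ j]
    refine integral_eq_zero_of_ae ?_
    filter_upwards [h0] with x hx
    simp [hx]
  refine Lp.ext ?_
  filter_upwards [ae_all_iff.2 h, Lp.coeFn_zero (EuclideanSpace ℂ (Fin N)) 2
    (volume.restrict D)] with x hx h2
  rw [h2]
  ext j
  exact hx j

end Weak

/-! ### The best Sobolev constant -/

section Best

variable {N : ℕ} {Ω D : Set (RN N)}

theorem exists_hasSobolev_H10 (hN : 3 ≤ N) (D : Set (RN N)) :
    ∃ C : ℝ, 0 < C ∧ HasSobolev (H10 D) (critExp N) C := by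
  obtain ⟨C, hC, h⟩ := exists_sobolev_test hN
  exact ⟨C, hC, hasSobolev_H10_of_test (by linarith [two_lt_critExp hN]) hC.le fun ψ hψ =>
    h ψ (hψ.mono (subset_univ _))⟩

/-- A nonzero test function supported in a given ball. -/
theorem exists_test_ball (x : RN N) {ρ : ℝ} (hρ : 0 < ρ) :
    ∃ ψ : RN N → ℝ, IsTest (Metric.ball x ρ) ψ ∧ ψ x = 1 := by
  let f : ContDiffBump x := ⟨ρ / 4, ρ / 2, by linarith, by linarith⟩
  refine ⟨f, ⟨f.contDiff, f.hasCompactSupport, ?_⟩, 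
    f.one_of_mem_closedBall (Metric.mem_closedBall_self f.rIn_pos.le)⟩
  rw [f.tsupport_eq]
  exact Metric.closedBall_subset_ball (by simp only [f]; linarith)

theorem IsTest.integral_rpow_pos {ψ : RN N → ℝ} (h : IsTest D ψ) {x : RN N} (hx : ψ x ≠ 0)
    {q : ℝ} (hq : 0 < q) : 0 < ∫ x, ‖ψ x‖ ^ q := by
  refine Continuous.integral_pos_of_hasCompactSupport_nonneg_nonzero (x := x)
    (h.continuous.norm.rpow_const fun _ => Or.inr hq.le) ?_ (fun x => by positivity) ?_
  · exact h.2.1.norm.comp_left (g := fun t : ℝ => t ^ q) (Real.zero_rpow hq.ne')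
  · have : 0 < ‖ψ x‖ := norm_pos_iff.2 hx
    positivity

theorem powInt_eq_zero_iff {α F G : Type*} [MeasurableSpace α] {μ : Measure α}
    [NormedAddCommGroup F] [NormedAddCommGroup G] {q : ℝ} (hq : 0 < q)
    {w : WithLp 2 (Lp F 2 μ × Lp G 2 μ)} (h : MemLp w.fst (ENNReal.ofReal q) μ) :
    powInt q w = 0 ↔ w.fst = 0 := by
  rw [powInt, integral_eq_zero_iff_of_nonneg (fun x => by positivity)
    (integrable_norm_rpow_of_memLp hq h), Lp.eq_zero_iff_ae_eq_zero]
  constructor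
  · intro h
    filter_upwards [h] with x hx
    have := (Real.rpow_eq_zero_iff_of_nonneg (norm_nonneg _)).1 hx
    simpa using this.1
  · intro h
    filter_upwards [h] with x hx
    simp [hx, Real.zero_rpow hq.ne']

/-- The Sobolev constant of a domain of finite measure is positive, and it is the best constant in
the Sobolev inequality on `H10 Ω`. -/
theorem sobolevConst_spec (hN : 3 ≤ N) (hΩ : IsOpen Ω) (hne : Ω.Nonempty)
    (hfin : volume Ω ≠ ⊤) :
    0 < sobolevConst Ω ∧
    (∀ u : H10 Ω, sobolevConst Ω * powInt (critExp N) u.1 ^ (2 / critExp N) ≤ ‖u.1.snd‖ ^ 2) ∧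
    ∀ δ : ℝ, 0 < δ → ∃ u : H10 Ω, 0 < powInt (critExp N) u.1 ∧
      ‖u.1.snd‖ ^ 2 < (sobolevConst Ω + δ) * powInt (critExp N) u.1 ^ (2 / critExp N) := by
  have hs := two_lt_critExp hN
  have hs0 : 0 < critExp N := by linarith
  obtain ⟨C, hC, hX⟩ := exists_hasSobolev_H10 hN Ω
  set Q : Set ℝ := {q : ℝ | ∃ u : H10 Ω, u ≠ 0 ∧
    q = (∫ x in Ω, ‖u.1.snd x‖ ^ 2) / (∫ x in Ω, |u.1.fst x| ^ critExp N) ^ (2 / critExp N)}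
    with hQ
  have hSQ : sobolevConst Ω = sInf Q := rfl
  have hpos : ∀ u : H10 Ω, u ≠ 0 → 0 < powInt (critExp N) u.1 := by
    intro u hu
    refine lt_of_le_of_ne (powInt_nonneg _ _) fun h0 => hu ?_
    have h1 := (powInt_eq_zero_iff hs0 (hX u.1 u.2).1).1 h0.symm
    have h2 := H10_snd_eq_zero hfin h1
    refine Subtype.ext ((WithLp.ofLp_injective 2) ?_)
    exact Prod.ext h1 h2
  have hq : ∀ u : H10 Ω, (∫ x in Ω, ‖u.1.snd x‖ ^ 2)
      / (∫ x in Ω, |u.1.fst x| ^ critExp N) ^ (2 / critExp N)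
      = ‖u.1.snd‖ ^ 2 / powInt (critExp N) u.1 ^ (2 / critExp N) := by
    intro u
    rw [Lp_two_norm_sq]; rfl
  have hlow : ∀ q ∈ Q, 1 / C ≤ q := by
    rintro q ⟨u, hu, rfl⟩
    have := hpos u hu
    rw [hq, div_le_div_iff₀ hC (by positivity)]
    linarith [(hX u.1 u.2).2]
  have hbdd : BddBelow Q := ⟨1 / C, hlow⟩
  have hQne : Q.Nonempty := by
    obtain ⟨x, hx⟩ := hne
    obtain ⟨ρ, hρ, hb⟩ := Metric.isOpen_iff.1 hΩ x hx
    obtain ⟨ψ, hψ, h1⟩ := exists_test_ball x hρ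
    obtain ⟨u, -, hu, -⟩ := (hψ.mono hb).exists_H10
    refine ⟨_, u, ?_, rfl⟩
    rintro rfl
    have h2 := (hψ.mono hb).integral_rpow_pos (x := x) (by rw [h1]; exact one_ne_zero) hs0
    rw [← (hψ.mono hb).setIntegral_norm_rpow hs0, ← powInt_congr (q := critExp N) hu] at h2
    refine h2.ne' ((powInt_eq_zero_iff hs0 (hX _ (H10 Ω).zero_mem).1).2 rfl)
  have hS : 1 / C ≤ sobolevConst Ω := le_csInf hQne hlow
  refine ⟨lt_of_lt_of_le (by positivity) hS, fun u => ?_, fun δ hδ => ?_⟩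
  · by_cases hu : u = 0
    · have h0 : powInt (critExp N) u.1 = 0 := by
        rw [powInt_eq_zero_iff hs0 (hX u.1 u.2).1, hu]; rfl
      rw [h0, Real.zero_rpow (by positivity), mul_zero]
      positivity
    · have := hpos u hu
      have h1 : sobolevConst Ω ≤ ‖u.1.snd‖ ^ 2 / powInt (critExp N) u.1 ^ (2 / critExp N) :=
        csInf_le hbdd ⟨u, hu, (hq u).symm⟩
      rwa [le_div_iff₀ (by positivity)] at h1
  · obtain ⟨q, ⟨u, hu, rfl⟩, hlt⟩ := exists_lt_of_csInf_lt hQne (lt_add_of_pos_right (sInf Q) hδ)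
    have := hpos u hu
    refine ⟨u, this, ?_⟩
    rw [hq, div_lt_iff₀ (by positivity)] at hlt
    exact hlt

/-- The function `x ↦ ψ ((x - y) / t)`. -/
def rescale (ψ : RN N → ℝ) (y : RN N) (t : ℝ) (x : RN N) : ℝ := ψ (t⁻¹ • (x - y))

theorem fderiv_rescale {ψ : RN N → ℝ} (h : IsTest D ψ) (y : RN N) (t : ℝ) (x : RN N) :
    ‖fderiv ℝ (rescale ψ y t) x‖ ^ 2 = (t⁻¹) ^ 2 * ‖fderiv ℝ ψ (t⁻¹ • (x - y))‖ ^ 2 := by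
  have h1 : HasFDerivAt (fun x : RN N => t⁻¹ • (x - y)) (t⁻¹ • ContinuousLinearMap.id ℝ (RN N)) x :=
    ((hasFDerivAt_id x).sub_const y).const_smul t⁻¹
  have h2 := (h.differentiable (t⁻¹ • (x - y))).hasFDerivAt.comp x h1
  have h3 : fderiv ℝ (rescale ψ y t) x = t⁻¹ • fderiv ℝ ψ (t⁻¹ • (x - y)) := by
    rw [show rescale ψ y t = ψ ∘ fun x => t⁻¹ • (x - y) from rfl, h2.fderiv]
    ext v
    simp
  rw [h3, norm_smul, mul_pow, Real.norm_eq_abs, sq_abs]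

theorem integral_rescale (f : RN N → ℝ) (y : RN N) {t : ℝ} (ht : 0 < t) :
    ∫ x, f (t⁻¹ • (x - y)) = t ^ N * ∫ x, f x := by
  rw [integral_sub_right_eq_self (fun x => f (t⁻¹ • x)) y, Measure.integral_comp_inv_smul]
  simp [abs_of_pos ht]

theorem isTest_rescale {ψ : RN N → ℝ} (h : IsTest univ ψ) (y : RN N) {ρ : ℝ} (hρ : 0 < ρ) :
    ∃ t₀ : ℝ, 0 < t₀ ∧ ∀ t : ℝ, 0 < t → t ≤ t₀ → IsTest (Metric.ball y ρ) (rescale ψ y t) := by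
  obtain ⟨R, hR⟩ := h.2.1.isCompact.isBounded.subset_closedBall 0
  refine ⟨ρ / (2 * (|R| + 1)), by positivity, fun t ht htt => ?_⟩
  have hsupp : Function.support (rescale ψ y t) ⊆ Metric.closedBall y (ρ / 2) := by
    intro x hx
    have h1 : t⁻¹ • (x - y) ∈ Metric.closedBall (0 : RN N) R := hR (subset_tsupport _ hx)
    rw [mem_closedBall_zero_iff, norm_smul, norm_inv, Real.norm_of_nonneg ht.le,
      inv_mul_le_iff₀ ht] at h1
    rw [mem_closedBall_iff_norm]
    rw [le_div_iff₀ (by positivity)] at htt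
    nlinarith [le_abs_self R]
  have hts : tsupport (rescale ψ y t) ⊆ Metric.closedBall y (ρ / 2) :=
    closure_minimal hsupp Metric.isClosed_closedBall
  refine ⟨?_, HasCompactSupport.intro (isCompact_closedBall y (ρ / 2)) fun x hx => ?_,
    hts.trans (Metric.closedBall_subset_ball (by linarith))⟩
  · exact h.1.comp ((contDiff_id.sub contDiff_const).const_smul t⁻¹)
  · by_contra hne
    exact hx (hsupp hne)

theorem integral_rescale_rpow (ψ : RN N → ℝ) (y : RN N) {t : ℝ} (ht : 0 < t) (q : ℝ) :
    ∫ x, ‖rescale ψ y t x‖ ^ q = t ^ N * ∫ x, ‖ψ x‖ ^ q :=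
  integral_rescale (fun x => ‖ψ x‖ ^ q) y ht

theorem integral_rescale_fderiv {ψ : RN N → ℝ} (h : IsTest D ψ) (y : RN N) {t : ℝ} (ht : 0 < t) :
    ∫ x, ‖fderiv ℝ (rescale ψ y t) x‖ ^ 2 = (t⁻¹) ^ 2 * (t ^ N * ∫ x, ‖fderiv ℝ ψ x‖ ^ 2) := by
  simp only [fderiv_rescale h]
  rw [integral_const_mul, integral_rescale (fun x => ‖fderiv ℝ ψ x‖ ^ 2) y ht]

/-- The scaling `t^(N·2/2*) = t^(N-2)` behind the domain independence of the best constant. -/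
theorem rescale_rpow_two_div (hN : 3 ≤ N) {t I : ℝ} (ht : 0 < t) (hI : 0 ≤ I) :
    (t ^ N * I) ^ (2 / critExp N) = (t⁻¹) ^ 2 * (t ^ N * I ^ (2 / critExp N)) := by
  have : (3 : ℝ) ≤ N := by exact_mod_cast hN
  rw [Real.mul_rpow (by positivity) hI, ← Real.rpow_natCast, ← Real.rpow_mul ht.le,
    two_div_critExp hN]
  have e : (N : ℝ) * (1 - 2 / N) = N - 2 := by field_simp
  rw [e, Real.rpow_sub ht]
  have : t ^ (2 : ℝ) = t ^ 2 := Real.rpow_two t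
  rw [this]
  field_simp

/-- The constant `S` is the best Sobolev constant of `ℝ^N`, on test functions. -/
structure IsBestConst (N : ℕ) (S : ℝ) : Prop where
  pos : 0 < S
  le : ∀ ψ : RN N → ℝ, IsTest univ ψ →
    S * (∫ x, ‖ψ x‖ ^ critExp N) ^ (2 / critExp N) ≤ ∫ x, ‖fderiv ℝ ψ x‖ ^ 2
  exists_lt : ∀ δ : ℝ, 0 < δ → ∃ ψ : RN N → ℝ, IsTest univ ψ ∧ 0 < (∫ x, ‖ψ x‖ ^ critExp N) ∧
    ∫ x, ‖fderiv ℝ ψ x‖ ^ 2 < (S + δ) * (∫ x, ‖ψ x‖ ^ critExp N) ^ (2 / critExp N)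

/-- The best constant does not depend on the domain: a test function can be rescaled into any ball
without changing its Sobolev quotient. -/
theorem isBestConst_sobolevConst (hN : 3 ≤ N) (hΩ : IsOpen Ω) (hne : Ω.Nonempty)
    (hfin : volume Ω ≠ ⊤) : IsBestConst N (sobolevConst Ω) := by
  have hs := two_lt_critExp hN
  have hs0 : 0 < critExp N := by linarith
  obtain ⟨h1, h2, h3⟩ := sobolevConst_spec hN hΩ hne hfin
  refine ⟨h1, fun ψ hψ => ?_, fun δ hδ => ?_⟩
  · obtain ⟨x, hx⟩ := hne
    obtain ⟨ρ, hρ, hb⟩ := Metric.isOpen_iff.1 hΩ x hx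
    obtain ⟨t, ht, hT⟩ := isTest_rescale hψ x hρ
    have hψt := (hT t ht le_rfl).mono hb
    obtain ⟨u, -, hu1, hu2⟩ := hψt.exists_H10
    have h := h2 u
    rw [powInt_congr hu1, norm_snd_sq_congr hu2, hψt.setIntegral_norm_rpow hs0] at h
    simp only [norm_gradient] at h
    rw [hψt.setIntegral_fderiv_sq, integral_rescale_rpow _ _ ht, integral_rescale_fderiv hψ _ ht,
      rescale_rpow_two_div hN ht (integral_nonneg fun x => by positivity), mul_left_comm,
      mul_left_comm (sobolevConst Ω)] at h
    have := le_of_mul_le_mul_left h (by positivity)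
    exact le_of_mul_le_mul_left this (by positivity)
  · have := isFiniteMeasure_restrict hfin
    obtain ⟨u, hu1, hu2⟩ := h3 δ hδ
    obtain ⟨w, φ, hw, hφ⟩ := exists_seq_H10 u
    obtain ⟨C, hC, hX⟩ := exists_hasSobolev_H10 hN Ω
    have c1 := hX.continuous_powInt hC.le (by linarith : 1 ≤ critExp N) le_rfl
    have c2 : Continuous (fun v : H10 Ω => ‖v.1.snd‖ ^ 2) :=
      (((WithLp.continuous_snd 2 _ _).comp continuous_subtype_val).norm).pow 2
    have c3 : Continuous (fun v : H10 Ω => (sobolevConst Ω + δ) *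
        powInt (critExp N) v.1 ^ (2 / critExp N)) :=
      continuous_const.mul (c1.rpow_const fun _ => Or.inr (by positivity))
    have o1 := (c1.tendsto u).comp hw |>.eventually (lt_mem_nhds hu1)
    have o2 := (((c2.prodMk c3).tendsto u).comp hw).eventually
      ((isOpen_lt continuous_fst continuous_snd).mem_nhds hu2)
    obtain ⟨n, hn1, hn2⟩ := (o1.and o2).exists
    obtain ⟨k1, k2, k3⟩ := hφ n
    simp only [Function.comp_apply] at hn1 hn2
    rw [powInt_congr k2, norm_snd_sq_congr k3, k1.setIntegral_norm_rpow hs0] at hn2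
    rw [powInt_congr k2, k1.setIntegral_norm_rpow hs0] at hn1
    simp only [norm_gradient] at hn2
    rw [k1.setIntegral_fderiv_sq] at hn2
    exact ⟨φ n, k1.mono (subset_univ _), hn1, hn2⟩

end Best

/-! ### A barrier function -/

section Barrier

variable {N : ℕ} {D : Set (RN N)}

/-- The Laplacian `∑_j ∂_j ∂_j φ`. -/
def lap (φ : RN N → ℝ) (x : RN N) : ℝ :=
  ∑ j, fderiv ℝ (fun y => fderiv ℝ φ y (EuclideanSpace.single j 1)) x (EuclideanSpace.single j 1)

theorem IsTest.continuous_lap {φ : RN N → ℝ} (h : IsTest D φ) : Continuous (lap φ) :=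
  continuous_finsetSum _ fun _ _ => ((h.fderiv_apply _).fderiv_apply _).continuous

theorem inner_gradient_gradient (ψ φ : RN N → ℝ) (x : RN N) :
    inner ℝ (gradient ψ x) (gradient φ x) = ∑ j, fderiv ℝ φ x (EuclideanSpace.single j 1) *
      fderiv ℝ ψ x (EuclideanSpace.single j 1) := by
  simp only [PiLp.inner_apply, gradient_apply]
  rfl

theorem IsTest.integral_inner_gradient {ψ φ : RN N → ℝ} (hψ : IsTest D ψ) (hφ : IsTest univ φ) :
    ∫ x, inner ℝ (gradient ψ x) (gradient φ x) = -∫ x, lap φ x * ψ x := by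
  simp only [inner_gradient_gradient, lap, Finset.sum_mul]
  rw [integral_finsetSum, integral_finsetSum, ← Finset.sum_neg_distrib]
  · refine Finset.sum_congr rfl fun j _ => ?_
    have := hψ.integral_smul_fderiv (hφ.fderiv_apply (EuclideanSpace.single j 1))
      (EuclideanSpace.single j 1)
    simpa only [smul_eq_mul] using this
  · intro j _
    exact (((hφ.fderiv_apply _).fderiv_apply _).continuous.mul
      hψ.continuous).integrable_of_hasCompactSupport hψ.2.1.mul_left
  · intro j _
    exact ((hφ.fderiv_apply _).continuous.mul
      (hψ.fderiv_apply _).continuous).integrable_of_hasCompactSupport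
        (hψ.fderiv_apply _).2.1.mul_left

theorem H10_integral_inner_gradient (hD : volume D ≠ ⊤) (u : H10 D) {φ : RN N → ℝ}
    (hφ : IsTest univ φ) :
    ∫ x in D, inner ℝ (u.1.snd x) (gradient φ x) = -∫ x in D, lap φ x * u.1.fst x := by
  have := isFiniteMeasure_restrict hD
  have e : ∀ x, (inner ℝ (u.1.snd x) (gradient φ x) : ℝ)
      = ∑ j, fderiv ℝ φ x (EuclideanSpace.single j 1) * u.1.snd x j := by
    intro x
    simp only [PiLp.inner_apply, gradient_apply]
    rfl
  have i1 : ∀ j, Integrable (fun x => u.1.snd x j) (volume.restrict D) := fun j =>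
    (EuclideanSpace.proj j : RN N →L[ℝ] ℝ).integrable_comp
      ((Lp.memLp u.1.snd).integrable (by norm_num))
  have i2 : Integrable (fun x => u.1.fst x) (volume.restrict D) :=
    (Lp.memLp u.1.fst).integrable (by norm_num)
  simp only [e, lap, Finset.sum_mul]
  rw [integral_finsetSum, integral_finsetSum, ← Finset.sum_neg_distrib]
  · exact Finset.sum_congr rfl fun j _ => H10_integral_snd hD u (hφ.fderiv_apply _) j
  · intro j _
    have h := (hφ.fderiv_apply (EuclideanSpace.single j 1)).fderiv_apply
      (EuclideanSpace.single j (1 : ℝ))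
    obtain ⟨M, hM⟩ := h.exists_bound
    exact i2.bdd_mul h.continuous.aestronglyMeasurable (Filter.Eventually.of_forall hM)
  · intro j _
    have h := hφ.fderiv_apply (EuclideanSpace.single j (1 : ℝ))
    obtain ⟨M, hM⟩ := h.exists_bound
    exact (i1 j).bdd_mul h.continuous.aestronglyMeasurable (Filter.Eventually.of_forall hM)

/-- A nonnegative test function that coincides with the solution `e^{a x_j}` of `Δφ = a² φ` on a
ball. -/
theorem exists_barrier (a : ℝ) (j : Fin N) {ρ r : ℝ} (hρ : 0 ≤ ρ) (hr : ρ < r) :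
    ∃ φ : RN N → ℝ, IsTest (Metric.ball 0 r) φ ∧ (∀ x, 0 ≤ φ x) ∧
      ∀ x ∈ Metric.closedBall (0 : RN N) ρ,
        φ x = Real.exp (a * x j) ∧ lap φ x = a ^ 2 * Real.exp (a * x j) := by
  let f : ContDiffBump (0 : RN N) := ⟨(2 * ρ + r) / 3, (ρ + 2 * r) / 3, by linarith, by linarith⟩
  let g : RN N → ℝ := fun x => Real.exp (a * x j)
  have hg : ContDiff ℝ ∞ g :=
    (contDiff_const.mul (EuclideanSpace.proj j : RN N →L[ℝ] ℝ).contDiff).exp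
  have hgd : ∀ y k, fderiv ℝ g y (EuclideanSpace.single k 1) = if j = k then a * g y else 0 := by
    intro y k
    have h1 : HasFDerivAt (fun x : RN N => a * x j)
        (a • (EuclideanSpace.proj j : RN N →L[ℝ] ℝ)) y :=
      ((EuclideanSpace.proj j : RN N →L[ℝ] ℝ).hasFDerivAt).const_mul a
    rw [h1.exp.fderiv]
    by_cases hjk : j = k
    · subst hjk
      simp [g, mul_comm]
    · simp [hjk]
  have htest : IsTest (Metric.ball 0 r) (fun x => f x * g x) := by
    refine ⟨f.contDiff.mul hg, f.hasCompactSupport.mul_right, ?_⟩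
    refine (tsupport_mul_subset_left).trans ?_
    rw [f.tsupport_eq]
    exact Metric.closedBall_subset_ball (by simp only [f]; linarith)
  refine ⟨fun x => f x * g x, htest, fun x => mul_nonneg f.nonneg (Real.exp_pos _).le, ?_⟩
  intro x hx
  have hnear : ∀ y ∈ Metric.ball (0 : RN N) ((2 * ρ + r) / 3), f y * g y = g y := by
    intro y hy
    rw [f.one_of_mem_closedBall (Metric.ball_subset_closedBall hy), one_mul]
  have hxb : x ∈ Metric.ball (0 : RN N) ((2 * ρ + r) / 3) :=
    Metric.closedBall_subset_ball (by linarith) hx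
  refine ⟨hnear x hxb, ?_⟩
  have hev : ∀ y ∈ Metric.ball (0 : RN N) ((2 * ρ + r) / 3),
      (fun x => f x * g x) =ᶠ[nhds y] g := fun y hy =>
    Filter.eventually_of_mem (Metric.isOpen_ball.mem_nhds hy) hnear
  have hfd : ∀ k, (fun y => fderiv ℝ (fun x => f x * g x) y (EuclideanSpace.single k 1))
      =ᶠ[nhds x] fun y => if j = k then a * g y else 0 := by
    intro k
    filter_upwards [Metric.isOpen_ball.mem_nhds hxb] with y hy
    rw [(hev y hy).fderiv_eq, hgd]
  unfold lap
  have hterm : ∀ k, fderiv ℝ (fun y => fderiv ℝ (fun x => f x * g x) y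
      (EuclideanSpace.single k 1)) x (EuclideanSpace.single k 1)
      = if j = k then a ^ 2 * g x else 0 := by
    intro k
    rw [(hfd k).fderiv_eq]
    by_cases hjk : j = k
    · simp only [hjk, if_true]
      rw [fderiv_const_mul (hg.differentiable (by simp) x), _root_.smul_apply, hgd]
      simp [hjk, pow_two, mul_assoc]
    · simp [hjk]
  simp only [hterm]
  simp [g]

end Barrier

/-! ### Refined Sobolev inequalities -/

section Refined

variable {N : ℕ} {Ω : Set (RN N)} {S : ℝ}

theorem gradient_add_smul {ψ φ : RN N → ℝ} (hψ : Differentiable ℝ ψ) (hφ : Differentiable ℝ φ)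
    (t : ℝ) (x : RN N) : gradient (ψ + t • φ) x = gradient ψ x + t • gradient φ x := by
  rw [gradient, fderiv_add (hψ x) ((hφ.const_smul t) x), fderiv_const_smul (hφ x), map_add,
    map_smul]
  rfl

theorem IsTest.integral_gradient_add {ψ φ : RN N → ℝ} (hψ : IsTest univ ψ) (hφ : IsTest univ φ)
    (t : ℝ) : ∫ x, ‖fderiv ℝ (ψ + t • φ) x‖ ^ 2 = (∫ x, ‖fderiv ℝ ψ x‖ ^ 2)
      + 2 * t * (∫ x, inner ℝ (gradient ψ x) (gradient φ x))
      + t ^ 2 * ∫ x, ‖fderiv ℝ φ x‖ ^ 2 := by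
  have e : ∀ x, ‖fderiv ℝ (ψ + t • φ) x‖ ^ 2 = ‖fderiv ℝ ψ x‖ ^ 2
      + 2 * t * inner ℝ (gradient ψ x) (gradient φ x) + t ^ 2 * ‖fderiv ℝ φ x‖ ^ 2 := by
    intro x
    rw [← norm_gradient, gradient_add_smul hψ.differentiable hφ.differentiable,
      ← norm_gradient, ← norm_gradient, norm_add_sq_real, norm_smul, mul_pow, inner_smul_right,
      Real.norm_eq_abs, sq_abs]
    ring
  have i1 := hψ.integrable_fderiv_sq
  have i2 := hφ.integrable_fderiv_sq
  have i3 : Integrable (fun x => (inner ℝ (gradient ψ x) (gradient φ x) : ℝ)) volume := by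
    refine ((continuous_gradient hψ).inner (continuous_gradient hφ)).integrable_of_hasCompactSupport
      ?_
    refine HasCompactSupport.of_support_subset_isCompact (hψ.2.1.fderiv ℝ).isCompact ?_
    intro x hx
    refine subset_tsupport _ fun h0 => hx ?_
    simp only at h0 ⊢
    rw [gradient, h0, map_zero, inner_zero_left]
  simp only [e]
  have i13 : Integrable (fun x => ‖fderiv ℝ ψ x‖ ^ 2
      + 2 * t * inner ℝ (gradient ψ x) (gradient φ x)) volume := i1.add (i3.const_mul _)
  rw [integral_add i13 (i2.const_mul _), integral_add i1 (i3.const_mul _),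
    integral_const_mul, integral_const_mul]

/-- On a bounded domain the Sobolev inequality has a remainder term `(∫ ψ)²`. Adding to `ψ` a small
multiple of a fixed barrier `φ ≥ 0` with `Δφ > 0` on the domain increases the `L^{2*}` norm and
decreases the Dirichlet integral. -/
theorem exists_sobolev_remainder (hN : 3 ≤ N) (hS : IsBestConst N S)
    (hΩ : Bornology.IsBounded Ω) : ∃ c : ℝ, 0 < c ∧ ∀ ψ : RN N → ℝ, IsTest Ω ψ → (∀ x, 0 ≤ ψ x) →
      S * (∫ x, ‖ψ x‖ ^ critExp N) ^ (2 / critExp N) + c * (∫ x, ψ x) ^ 2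
        ≤ ∫ x, ‖fderiv ℝ ψ x‖ ^ 2 := by
  have hs0 : 0 < critExp N := by linarith [two_lt_critExp hN]
  obtain ⟨R, hR0, hR⟩ := hΩ.subset_closedBall_lt 0 0
  obtain ⟨φ, hφ, hφ0, hφR⟩ := exists_barrier 1 (⟨0, by omega⟩ : Fin N) hR0.le (lt_add_one R)
  set K := ∫ x, ‖fderiv ℝ φ x‖ ^ 2 with hK
  have hK0 : 0 ≤ K := integral_nonneg fun x => by positivity
  set m := Real.exp (-R) with hm
  have hm0 : 0 < m := Real.exp_pos _
  refine ⟨m ^ 2 / (K + 1), by positivity, fun ψ hψ hψ0 => ?_⟩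
  have hφu := hφ.mono (subset_univ _)
  have hψu := hψ.mono (subset_univ _)
  have hψi : Integrable ψ volume := hψ.continuous.integrable_of_hasCompactSupport hψ.2.1
  set I := ∫ x, ψ x with hI
  have hI0 : 0 ≤ I := integral_nonneg hψ0
  have hlap : m * I ≤ ∫ x, lap φ x * ψ x := by
    rw [hI, ← integral_const_mul]
    refine integral_mono (hψi.const_mul m)
      ((hφ.continuous_lap.mul hψ.continuous).integrable_of_hasCompactSupport hψ.2.1.mul_left) ?_
    intro x
    by_cases hx : x ∈ Ω
    · have hxR := hR hx
      simp only [(hφR x hxR).2]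
      refine mul_le_mul_of_nonneg_right ?_ (hψ0 x)
      rw [one_pow, one_mul, one_mul, hm, Real.exp_le_exp]
      have h1 : ‖x ⟨0, by omega⟩‖ ≤ ‖x‖ := PiLp.norm_apply_le x _
      rw [mem_closedBall_zero_iff] at hxR
      rw [Real.norm_eq_abs] at h1
      linarith [neg_abs_le (x ⟨0, by omega⟩)]
    · simp [hψ.eq_zero hx]
  set t := m * I / (K + 1) with ht
  have ht0 : 0 ≤ t := by positivity
  have hsum : IsTest univ (ψ + t • φ) := hψu.add (hφu.smul t)
  have h1 := hS.le _ hsum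
  rw [hψu.integral_gradient_add hφu, hψ.integral_inner_gradient hφu] at h1
  have h2 : (∫ x, ‖ψ x‖ ^ critExp N) ≤ ∫ x, ‖(ψ + t • φ) x‖ ^ critExp N := by
    refine integral_mono (hψ.integrable_norm_rpow hs0) (hsum.integrable_norm_rpow hs0) fun x => ?_
    have h3 : 0 ≤ t * φ x := mul_nonneg ht0 (hφ0 x)
    refine Real.rpow_le_rpow (norm_nonneg _) ?_ hs0.le
    simp only [Pi.add_apply, Pi.smul_apply, smul_eq_mul]
    rw [Real.norm_of_nonneg (hψ0 x), Real.norm_of_nonneg (add_nonneg (hψ0 x) h3)]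
    linarith
  have h3 : S * (∫ x, ‖ψ x‖ ^ critExp N) ^ (2 / critExp N)
      ≤ S * (∫ x, ‖(ψ + t • φ) x‖ ^ critExp N) ^ (2 / critExp N) := by
    have := hS.pos
    have : 0 ≤ ∫ x, ‖ψ x‖ ^ critExp N := integral_nonneg fun x => by positivity
    gcongr
  have h4 : m ^ 2 / (K + 1) * I ^ 2 ≤ 2 * t * (m * I) - t ^ 2 * K := by
    have e : m * I = t * (K + 1) := by rw [ht]; field_simp
    have e2 : m ^ 2 / (K + 1) * I ^ 2 = t * (m * I) := by rw [ht]; field_simp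
    rw [e2, e]
    nlinarith [sq_nonneg t]
  have h5 : 2 * t * (m * I) ≤ 2 * t * ∫ x, lap φ x * ψ x := by gcongr
  linarith

/-- The Sobolev inequality for the two parts `cos θ ψ` and `sin θ ψ` of `ψ`, with
`θ = l x_j + a`. -/
theorem sobolev_cos_sin (hS : IsBestConst N S) (l a : ℝ) (j : Fin N) {ψ : RN N → ℝ}
    (hψ : IsTest univ ψ) :
    S * (∫ x, ‖Real.cos (l * x j + a) * ψ x‖ ^ critExp N) ^ (2 / critExp N)
      + S * (∫ x, ‖Real.sin (l * x j + a) * ψ x‖ ^ critExp N) ^ (2 / critExp N)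
      ≤ (∫ x, ‖fderiv ℝ ψ x‖ ^ 2) + l ^ 2 * ∫ x, ‖ψ x‖ ^ 2 := by
  have hθ : ContDiff ℝ ∞ (fun x : RN N => l * x j + a) :=
    (contDiff_const.mul (EuclideanSpace.proj j : RN N →L[ℝ] ℝ).contDiff).add contDiff_const
  have hθd : ∀ x : RN N, HasFDerivAt (fun x : RN N => l * x j + a)
      (l • (EuclideanSpace.proj j : RN N →L[ℝ] ℝ)) x := fun x =>
    (((EuclideanSpace.proj j : RN N →L[ℝ] ℝ).hasFDerivAt).const_mul l).add_const a
  have mk : ∀ g : RN N → ℝ, ContDiff ℝ ∞ g → IsTest univ (fun x => g x * ψ x) := fun g hg =>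
    ⟨hg.mul hψ.1, hψ.2.1.mul_left, subset_univ _⟩
  have hc := mk _ hθ.cos
  have hs := mk _ hθ.sin
  have gmul : ∀ (g : RN N → ℝ) (b : ℝ) (x : RN N),
      HasFDerivAt g (b • (EuclideanSpace.proj j : RN N →L[ℝ] ℝ)) x →
      gradient (fun x => g x * ψ x) x
        = g x • gradient ψ x + (ψ x * b) • EuclideanSpace.single j (1 : ℝ) := by
    intro g b x hg
    have h2 : HasFDerivAt (fun x => g x * ψ x) _ x := hg.mul (hψ.differentiable x).hasFDerivAt
    ext k
    rw [gradient_apply, h2.fderiv]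
    simp only [_root_.add_apply, _root_.smul_apply, smul_eq_mul, PiLp.add_apply, PiLp.smul_apply,
      gradient_apply, PiLp.proj_apply, PiLp.single_apply, eq_comm (a := j)]
    by_cases hjk : k = j <;> simp [hjk]
  have e : ∀ x, ‖fderiv ℝ (fun x => Real.cos (l * x j + a) * ψ x) x‖ ^ 2
      + ‖fderiv ℝ (fun x => Real.sin (l * x j + a) * ψ x) x‖ ^ 2
      = ‖fderiv ℝ ψ x‖ ^ 2 + l ^ 2 * ‖ψ x‖ ^ 2 := by
    intro x
    have dc : HasFDerivAt (fun x : RN N => Real.cos (l * x j + a))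
        ((-Real.sin (l * x j + a) * l) • (EuclideanSpace.proj j : RN N →L[ℝ] ℝ)) x := by
      have := (hθd x).cos
      rwa [smul_smul] at this
    have ds : HasFDerivAt (fun x : RN N => Real.sin (l * x j + a))
        ((Real.cos (l * x j + a) * l) • (EuclideanSpace.proj j : RN N →L[ℝ] ℝ)) x := by
      have := (hθd x).sin
      rwa [smul_smul] at this
    rw [← norm_gradient, ← norm_gradient, ← norm_gradient, gmul _ _ x dc, gmul _ _ x ds,
      norm_add_sq_real, norm_add_sq_real]
    simp only [norm_smul, inner_smul_left, inner_smul_right, mul_pow, Real.norm_eq_abs, sq_abs,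
      PiLp.norm_single, abs_one, mul_one]
    have hcs := Real.sin_sq_add_cos_sq (l * x j + a)
    simp only [conj_trivial]
    linear_combination (‖gradient ψ x‖ ^ 2 + ψ x ^ 2 * l ^ 2) * hcs
  refine (add_le_add (hS.le _ hc) (hS.le _ hs)).trans (le_of_eq ?_)
  rw [← integral_add hc.integrable_fderiv_sq hs.integrable_fderiv_sq, ← integral_const_mul,
    ← integral_add hψ.integrable_fderiv_sq
      (((hψ.memLp 2).integrable_norm_pow (by simp)).const_mul _)]
  exact integral_congr_ae (Filter.Eventually.of_forall e)

end Refined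

/-! ### The diamagnetic inequality -/

section Diamagnetic

variable {N : ℕ} {Ω : Set (RN N)} {S : ℝ}

/-- The smooth approximation `(|φ|² + e²)^{1/2} - e` of `|φ|`. -/
def smoothAbs (e : ℝ) (φ : RN N → ℂ) (x : RN N) : ℝ := Real.sqrt (‖φ x‖ ^ 2 + e ^ 2) - e

theorem smoothAbs_nonneg {e : ℝ} (φ : RN N → ℂ) (x : RN N) :
    0 ≤ smoothAbs e φ x := by
  rw [smoothAbs, sub_nonneg]
  exact Real.le_sqrt_of_sq_le (by nlinarith [sq_nonneg ‖φ x‖])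

theorem smoothAbs_le {e : ℝ} (he : 0 ≤ e) (φ : RN N → ℂ) (x : RN N) : smoothAbs e φ x ≤ ‖φ x‖ := by
  rw [smoothAbs, sub_le_iff_le_add, Real.sqrt_le_left (by positivity)]
  nlinarith [norm_nonneg (φ x)]

theorem isTest_smoothAbs {e : ℝ} (he : 0 < e) {φ : RN N → ℂ} (h : IsTest Ω φ) :
    IsTest Ω (smoothAbs e φ) := by
  have hsupp : Function.support (smoothAbs e φ) ⊆ Function.support φ := by
    intro x hx h0
    refine hx ?_
    simp [smoothAbs, h0, Real.sqrt_sq he.le]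
  refine ⟨?_, h.2.1.mono hsupp, (closure_mono hsupp).trans h.2.2⟩
  exact (((h.1.norm_sq ℝ).add contDiff_const).sqrt fun x => by positivity).sub contDiff_const

/-- The diamagnetic inequality `|∇|φ|| ≤ |∇_A φ|`, for the smooth approximation of `|φ|`. -/
theorem norm_fderiv_smoothAbs_le {e : ℝ} (he : 0 < e) {φ : RN N → ℂ} (h : IsTest Ω φ)
    (A : RN N → RN N) (x : RN N) : ‖fderiv ℝ (smoothAbs e φ) x‖ ^ 2 ≤ ‖magGrad A φ x‖ ^ 2 := by
  rw [← norm_gradient, EuclideanSpace.norm_sq_eq, EuclideanSpace.norm_sq_eq]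
  refine Finset.sum_le_sum fun j _ => ?_
  rw [gradient_apply]
  set v := EuclideanSpace.single j (1 : ℝ) with hv
  have h1 : HasFDerivAt (smoothAbs e φ) _ x :=
    (((h.differentiable x).hasFDerivAt.norm_sq).add_const (e ^ 2)).sqrt
      (by positivity : ‖φ x‖ ^ 2 + e ^ 2 ≠ 0) |>.sub_const e
  rw [h1.fderiv]
  have hsq : 0 < Real.sqrt (‖φ x‖ ^ 2 + e ^ 2) := Real.sqrt_pos.2 (by positivity)
  have hle : ‖φ x‖ ≤ Real.sqrt (‖φ x‖ ^ 2 + e ^ 2) :=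
    Real.le_sqrt_of_sq_le (by nlinarith [sq_nonneg e])
  -- the real part of `conj φ ∂_j φ` only sees the gauge covariant derivative
  have key : |(inner ℝ (φ x) (fderiv ℝ φ x v) : ℝ)| ≤ ‖φ x‖ * ‖magGrad A φ x j‖ := by
    have e1 : (inner ℝ (φ x) (fderiv ℝ φ x v) : ℝ)
        = inner ℝ (φ x) (Complex.I * magGrad A φ x j) := by
      simp only [magGrad, Complex.inner, ← hv]
      have : Complex.I * (-Complex.I * fderiv ℝ φ x v - ((A x j : ℝ) : ℂ) * φ x)
          = fderiv ℝ φ x v - Complex.I * ((A x j : ℝ) : ℂ) * φ x := by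
        linear_combination (-fderiv ℝ φ x v) * Complex.I_mul_I
      rw [this]
      simp only [Complex.mul_re, Complex.sub_re, Complex.sub_im, Complex.mul_im, Complex.conj_re,
        Complex.conj_im, Complex.I_re, Complex.I_im, Complex.ofReal_re, Complex.ofReal_im]
      ring
    rw [e1]
    refine (abs_real_inner_le_norm _ _).trans (le_of_eq ?_)
    rw [norm_mul, Complex.norm_I, one_mul]
  refine pow_le_pow_left₀ (norm_nonneg _) ?_ 2
  have e2 : ((1 / (2 * Real.sqrt (‖φ x‖ ^ 2 + e ^ 2))) •
      (2 • (innerSL ℝ (φ x)).comp (fderiv ℝ φ x))) v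
      = inner ℝ (φ x) (fderiv ℝ φ x v) / Real.sqrt (‖φ x‖ ^ 2 + e ^ 2) := by
    simp
    field_simp
  rw [e2, norm_div, Real.norm_of_nonneg hsq.le, div_le_iff₀ hsq, Real.norm_eq_abs]
  refine key.trans ?_
  rw [mul_comm]
  gcongr

theorem tendsto_integral_smoothAbs {φ : RN N → ℂ} (h : IsTest Ω φ) {η : RN N → ℝ}
    (hη : Continuous η) (hη1 : ∀ x, |η x| ≤ 1) {q : ℝ} (hq : 0 < q) :
    Filter.Tendsto (fun e => ∫ x, ‖η x * smoothAbs e φ x‖ ^ q) (nhdsWithin 0 (Ioi 0))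
      (nhds (∫ x, ‖η x • φ x‖ ^ q)) := by
  refine tendsto_integral_filter_of_dominated_convergence (fun x => ‖φ x‖ ^ q) ?_ ?_
    (h.integrable_norm_rpow hq) ?_
  · filter_upwards [self_mem_nhdsWithin] with e he
    have := (isTest_smoothAbs he h).continuous
    exact ((hη.mul this).norm.rpow_const fun _ => Or.inr hq.le).aestronglyMeasurable
  · filter_upwards [self_mem_nhdsWithin] with e he
    refine Filter.Eventually.of_forall fun x => ?_
    rw [Real.norm_of_nonneg (by positivity)]
    refine Real.rpow_le_rpow (norm_nonneg _) ?_ hq.le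
    rw [norm_mul, Real.norm_eq_abs, Real.norm_of_nonneg (smoothAbs_nonneg φ x)]
    calc |η x| * smoothAbs e φ x ≤ 1 * smoothAbs e φ x :=
          mul_le_mul_of_nonneg_right (hη1 x) (smoothAbs_nonneg φ x)
      _ ≤ ‖φ x‖ := by rw [one_mul]; exact smoothAbs_le (le_of_lt he) φ x
  · refine Filter.Eventually.of_forall fun x => ?_
    have hc : Continuous (fun e : ℝ => ‖η x * smoothAbs e φ x‖ ^ q) := by
      unfold smoothAbs
      have : Continuous (fun e : ℝ => η x * (Real.sqrt (‖φ x‖ ^ 2 + e ^ 2) - e)) := by fun_prop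
      exact this.norm.rpow_const fun _ => Or.inr hq.le
    have := (hc.tendsto 0).mono_left (nhdsWithin_le_nhds (s := Ioi 0))
    convert this using 2
    simp [smoothAbs]

theorem IsTest.integral_smoothAbs_le {φ : RN N → ℂ} (h : IsTest Ω φ) {A : RN N → RN N}
    {w : MagPair Ω} (hw : w.snd =ᵐ[volume.restrict Ω] magGrad A φ) {e : ℝ} (he : 0 < e) :
    ∫ x, ‖fderiv ℝ (smoothAbs e φ) x‖ ^ 2 ≤ ‖w.snd‖ ^ 2 := by
  have ht := isTest_smoothAbs he h
  rw [Lp_two_norm_sq, ← ht.setIntegral_fderiv_sq]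
  refine integral_mono_ae ht.integrable_fderiv_sq.restrict
    ((Lp.memLp w.snd).integrable_norm_pow (by simp)) ?_
  filter_upwards [hw] with x hx
  rw [hx]
  exact norm_fderiv_smoothAbs_le he h A x

/-- `exists_sobolev_remainder` for the modulus of a complex test function, by the diamagnetic
inequality. -/
theorem sobolev_remainder_mag_test (hN : 3 ≤ N) {c : ℝ}
    (hc : ∀ ψ : RN N → ℝ, IsTest Ω ψ → (∀ x, 0 ≤ ψ x) →
      S * (∫ x, ‖ψ x‖ ^ critExp N) ^ (2 / critExp N) + c * (∫ x, ψ x) ^ 2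
        ≤ ∫ x, ‖fderiv ℝ ψ x‖ ^ 2)
    {φ : RN N → ℂ} (h : IsTest Ω φ) {A : RN N → RN N}
    {w : MagPair Ω} (hw1 : w.fst =ᵐ[volume.restrict Ω] φ)
    (hw : w.snd =ᵐ[volume.restrict Ω] magGrad A φ) :
    S * powInt (critExp N) w ^ (2 / critExp N) + c * (powInt 1 w) ^ 2 ≤ ‖w.snd‖ ^ 2 := by
  have hs0 : 0 < critExp N := by linarith [two_lt_critExp hN]
  rw [powInt_congr hw1, powInt_congr hw1, h.setIntegral_norm_rpow hs0,
    h.setIntegral_norm_rpow one_pos]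
  have t1 := tendsto_integral_smoothAbs h (η := fun _ => 1) continuous_const (by simp) hs0
  have t2 := tendsto_integral_smoothAbs h (η := fun _ => 1) continuous_const (by simp) one_pos
  simp only [one_mul, one_smul] at t1 t2
  have t3 := ((t1.rpow_const (p := 2 / critExp N) (Or.inr (by positivity))).const_mul S).add
    ((t2.pow 2).const_mul c)
  refine le_of_tendsto t3 ?_
  filter_upwards [self_mem_nhdsWithin] with e he
  have h1 := hc _ (isTest_smoothAbs he h) (smoothAbs_nonneg φ)
  have h2 : ∫ x, ‖smoothAbs e φ x‖ ^ (1 : ℝ) = ∫ x, smoothAbs e φ x := by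
    simp [abs_of_nonneg (smoothAbs_nonneg φ _)]
  rw [h2]
  exact h1.trans (h.integral_smoothAbs_le hw he)

/-- `sobolev_cos_sin` for the modulus of a complex test function, by the diamagnetic inequality. -/
theorem sobolev_cos_sin_mag_test (hN : 3 ≤ N) (hS : IsBestConst N S) (l a : ℝ) (j : Fin N)
    {φ : RN N → ℂ} (h : IsTest Ω φ) {A : RN N → RN N}
    {w : MagPair Ω} (hw1 : w.fst =ᵐ[volume.restrict Ω] φ)
    (hw : w.snd =ᵐ[volume.restrict Ω] magGrad A φ) :
    S * (∫ x in Ω, ‖Real.cos (l * x j + a) • w.fst x‖ ^ critExp N) ^ (2 / critExp N)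
      + S * (∫ x in Ω, ‖Real.sin (l * x j + a) • w.fst x‖ ^ critExp N) ^ (2 / critExp N)
      ≤ ‖w.snd‖ ^ 2 + l ^ 2 * ‖w.fst‖ ^ 2 := by
  have hs0 : 0 < critExp N := by linarith [two_lt_critExp hN]
  have e1 : ∀ η : RN N → ℝ, ∫ x in Ω, ‖η x • w.fst x‖ ^ critExp N
      = ∫ x, ‖η x • φ x‖ ^ critExp N := by
    intro η
    have : ∫ x in Ω, ‖η x • w.fst x‖ ^ critExp N = ∫ x in Ω, ‖η x • φ x‖ ^ critExp N := by
      refine integral_congr_ae ?_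
      filter_upwards [hw1] with x hx
      rw [hx]
    rw [this]
    refine setIntegral_eq_integral_of_forall_compl_eq_zero fun x hx => ?_
    rw [h.eq_zero hx, smul_zero, norm_zero, Real.zero_rpow hs0.ne']
  rw [e1, e1, norm_fst_sq_congr hw1]
  have e2 : ∫ x in Ω, ‖φ x‖ ^ 2 = ∫ x, ‖φ x‖ ^ (2 : ℝ) := by
    rw [← h.setIntegral_norm_rpow two_pos]
    simp
  rw [e2]
  have hj : Continuous (fun x : RN N => l * x j + a) := by fun_prop
  have t1 := tendsto_integral_smoothAbs h (Real.continuous_cos.comp hj)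
    (fun x => Real.abs_cos_le_one _) hs0
  have t2 := tendsto_integral_smoothAbs h (Real.continuous_sin.comp hj)
    (fun x => Real.abs_sin_le_one _) hs0
  have t3 := tendsto_integral_smoothAbs h (η := fun _ => 1) continuous_const (by simp) two_pos
  simp only [one_mul, one_smul] at t3
  have t4 := ((t1.rpow_const (p := 2 / critExp N) (Or.inr (by positivity))).const_mul S).add
    ((t2.rpow_const (p := 2 / critExp N) (Or.inr (by positivity))).const_mul S)
  refine le_of_tendsto_of_tendsto t4 ((t3.const_mul (l ^ 2)).const_add (‖w.snd‖ ^ 2)) ?_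
  filter_upwards [self_mem_nhdsWithin] with e he
  have h1 := sobolev_cos_sin hS l a j ((isTest_smoothAbs he h).mono (subset_univ _))
  refine h1.trans ?_
  have h2 := h.integral_smoothAbs_le hw he
  simp only [Real.rpow_two]
  linarith

/-- Multiplication by a function bounded by `1` preserves continuity of the `L^q` integrals. -/
theorem HasSobolev.continuous_integral_smul {α F G : Type*} [MeasurableSpace α] {μ : Measure α}
    [NormedAddCommGroup F] [InnerProductSpace ℝ F] [NormedAddCommGroup G] [InnerProductSpace ℝ G]
    [IsFiniteMeasure μ] {X : Submodule ℝ (WithLp 2 (Lp F 2 μ × Lp G 2 μ))} {s C : ℝ}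
    (hX : HasSobolev X s C) (hC : 0 ≤ C) (hs : 1 ≤ s) {η : α → ℝ} (hη : AEStronglyMeasurable η μ)
    (hη1 : ∀ x, |η x| ≤ 1) : Continuous (fun u : X => ∫ x, ‖η x • u.1.fst x‖ ^ s ∂μ) := by
  have : Fact (1 ≤ ENNReal.ofReal s) := ⟨by
    rw [← ENNReal.ofReal_one]; exact ENNReal.ofReal_le_ofReal hs⟩
  have hs0 : 0 < s := by linarith
  obtain ⟨j, hj⟩ := hX.exists_embedding hC hs0 le_rfl
  have hm : ∀ f : Lp F (ENNReal.ofReal s) μ, MemLp (fun x => η x • f x) (ENNReal.ofReal s) μ :=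
    fun f => (Lp.memLp f).of_le (hη.smul (Lp.aestronglyMeasurable f))
      (Filter.Eventually.of_forall fun x => by
        rw [norm_smul, Real.norm_eq_abs]
        exact mul_le_of_le_one_left (norm_nonneg _) (hη1 x))
  let M : Lp F (ENNReal.ofReal s) μ → Lp F (ENNReal.ofReal s) μ := fun f => (hm f).toLp _
  have hM : LipschitzWith 1 M := by
    refine LipschitzWith.mk_one fun f g => ?_
    rw [dist_eq_norm, dist_eq_norm]
    refine Lp.norm_le_norm_of_ae_le ?_
    filter_upwards [Lp.coeFn_sub (M f) (M g), (hm f).coeFn_toLp, (hm g).coeFn_toLp,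
      Lp.coeFn_sub f g] with x h1 h2 h3 h4
    have h2' : M f x = η x • f x := h2
    have h3' : M g x = η x • g x := h3
    rw [h1, h4, Pi.sub_apply, Pi.sub_apply, h2', h3', ← smul_sub, norm_smul, Real.norm_eq_abs]
    exact mul_le_of_le_one_left (norm_nonneg _) (hη1 x)
  have hcont : Continuous (fun u : X => ‖M (j u)‖ ^ s) :=
    (hM.continuous.comp j.continuous).norm.rpow_const fun _ => Or.inr hs0.le
  refine hcont.congr fun u => ?_
  rw [Lp_norm_rpow hs0]
  refine integral_congr_ae ?_
  filter_upwards [(hm (j u)).coeFn_toLp, hj u] with x h1 h2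
  have h1' : M (j u) x = η x • j u x := h1
  rw [h1', h2]

/-- The Sobolev inequality with best constant and the remainder term, on the magnetic space. -/
theorem exists_sobolev_remainder_mag (hN : 3 ≤ N) (hS : IsBestConst N S)
    (hΩ : Bornology.IsBounded Ω) (A : RN N → RN N) :
    HasSobolev (magSpace Ω A) (critExp N) S⁻¹ ∧ ∃ c : ℝ, 0 < c ∧ ∀ u : magSpace Ω A,
      S * powInt (critExp N) u.1 ^ (2 / critExp N) + c * (powInt 1 u.1) ^ 2 ≤ ‖u.1.snd‖ ^ 2 := by
  have hs2 := two_lt_critExp hN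
  have hs0 : 0 < critExp N := by linarith
  have := isFiniteMeasure_restrict hΩ.measure_lt_top.ne
  obtain ⟨c, hc, h⟩ := exists_sobolev_remainder hN hS hΩ
  have hSp := hS.pos
  have hX : HasSobolev (magSpace Ω A) (critExp N) S⁻¹ := by
    refine hasSobolev_of_dense hs0 (inv_nonneg.2 hS.pos.le) fun u hu => ?_
    obtain ⟨w, φ, hw, hφ⟩ := exists_seq_magSpace ⟨u, hu⟩
    refine ⟨fun n => (w n).1, (continuous_subtype_val.tendsto _).comp hw, fun n => ?_⟩
    obtain ⟨h1, h2, h3⟩ := hφ n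
    refine ⟨(memLp_congr_ae h2).2 ((h1.memLp _).restrict Ω), ?_⟩
    have h4 := sobolev_remainder_mag_test hN h h1 h2 h3
    rw [inv_mul_eq_div, le_div_iff₀ hSp]
    nlinarith [mul_nonneg hc.le (sq_nonneg (powInt 1 (w n).1))]
  refine ⟨hX, c, hc, fun u => ?_⟩
  obtain ⟨w, φ, hw, hφ⟩ := exists_seq_magSpace u
  have hC : 0 ≤ S⁻¹ := inv_nonneg.2 hS.pos.le
  have c1 := hX.continuous_powInt hC (by linarith : 1 ≤ critExp N) le_rfl
  have c2 := hX.continuous_powInt hC le_rfl (by linarith : 1 ≤ critExp N)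
  have c3 : Continuous (fun v : magSpace Ω A => ‖v.1.snd‖ ^ 2) :=
    (((WithLp.continuous_snd 2 _ _).comp continuous_subtype_val).norm).pow 2
  have c4 : Continuous (fun v : magSpace Ω A =>
      S * powInt (critExp N) v.1 ^ (2 / critExp N) + c * (powInt 1 v.1) ^ 2) :=
    (continuous_const.mul (c1.rpow_const fun _ => Or.inr (by positivity))).add
      (continuous_const.mul (c2.pow 2))
  refine le_of_tendsto_of_tendsto' ((c4.tendsto u).comp hw) ((c3.tendsto u).comp hw) fun n => ?_
  obtain ⟨h1, h2, h3⟩ := hφ n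
  exact sobolev_remainder_mag_test hN h h1 h2 h3

theorem sobolev_cos_sin_mag (hN : 3 ≤ N) (hS : IsBestConst N S)
    (hΩ : Bornology.IsBounded Ω) {A : RN N → RN N} (l a : ℝ) (j : Fin N) (u : magSpace Ω A) :
    S * (∫ x in Ω, ‖Real.cos (l * x j + a) • u.1.fst x‖ ^ critExp N) ^ (2 / critExp N)
      + S * (∫ x in Ω, ‖Real.sin (l * x j + a) • u.1.fst x‖ ^ critExp N) ^ (2 / critExp N)
      ≤ ‖u.1.snd‖ ^ 2 + l ^ 2 * ‖u.1.fst‖ ^ 2 := by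
  have hs2 := two_lt_critExp hN
  have hs0 : 0 < critExp N := by linarith
  have := isFiniteMeasure_restrict hΩ.measure_lt_top.ne
  have hX := (exists_sobolev_remainder_mag hN hS hΩ A).1
  obtain ⟨w, φ, hw, hφ⟩ := exists_seq_magSpace u
  have hC : 0 ≤ S⁻¹ := inv_nonneg.2 hS.pos.le
  have hj : Continuous (fun x : RN N => l * x j + a) := by fun_prop
  have c1 := hX.continuous_integral_smul hC (by linarith : 1 ≤ critExp N)
    (Real.continuous_cos.comp hj).aestronglyMeasurable (fun x => Real.abs_cos_le_one _)
  have c2 := hX.continuous_integral_smul hC (by linarith : 1 ≤ critExp N)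
    (Real.continuous_sin.comp hj).aestronglyMeasurable (fun x => Real.abs_sin_le_one _)
  have c3 : Continuous (fun v : magSpace Ω A => ‖v.1.snd‖ ^ 2 + l ^ 2 * ‖v.1.fst‖ ^ 2) :=
    ((((WithLp.continuous_snd 2 _ _).comp continuous_subtype_val).norm).pow 2).add
      (continuous_const.mul
        ((((WithLp.continuous_fst 2 _ _).comp continuous_subtype_val).norm).pow 2))
  have c4 := ((c1.rpow_const (p := 2 / critExp N) fun _ => Or.inr (by positivity)).const_mul S).add
    ((c2.rpow_const (p := 2 / critExp N) fun _ => Or.inr (by positivity)).const_mul S)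
  refine le_of_tendsto_of_tendsto' ((c4.tendsto u).comp hw) ((c3.tendsto u).comp hw) fun n => ?_
  obtain ⟨h1, h2, h3⟩ := hφ n
  exact sobolev_cos_sin_mag_test hN hS l a j h1 h2 h3

end Diamagnetic

/-! ### Asymptotics of low energy Nehari points as `p` tends to the critical exponent -/

section Asymptotics

/-- Below the threshold `K` the power `t ^ b` is controlled by `t ^ a`, above it by `t ^ c`. -/
theorem rpow_le_interpolation {a b c K t : ℝ} (hab : a ≤ b) (hbc : b ≤ c) (hb : 0 < b) (hK : 0 < K)
    (ht : 0 ≤ t) : t ^ b ≤ K ^ (b - a) * t ^ a + K ^ (b - c) * t ^ c := by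
  rcases ht.eq_or_lt with rfl | ht
  · rw [Real.zero_rpow hb.ne']
    have := Real.rpow_nonneg (le_refl (0:ℝ)) a
    have := Real.rpow_nonneg (le_refl (0:ℝ)) c
    positivity
  rcases le_total t K with h | h
  · have h1 : t ^ b = t ^ (b - a) * t ^ a := by rw [← Real.rpow_add ht]; congr 1; ring
    have h2 : t ^ (b - a) ≤ K ^ (b - a) := Real.rpow_le_rpow ht.le h (by linarith)
    have h3 : 0 ≤ K ^ (b - c) * t ^ c := by positivity
    rw [h1]
    nlinarith [Real.rpow_nonneg ht.le a]
  · have h1 : t ^ b = t ^ (b - c) * t ^ c := by rw [← Real.rpow_add ht]; congr 1; ring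
    have h2 : t ^ (b - c) ≤ K ^ (b - c) := Real.rpow_le_rpow_of_nonpos hK h (by linarith)
    have h3 : 0 ≤ K ^ (b - a) * t ^ a := by positivity
    rw [h1]
    nlinarith [Real.rpow_nonneg ht.le c]

theorem eventually_exists_Ico {s l : ℝ} (hl : l < s) {P : ℝ → Prop} (h : ∀ᶠ p in nhds s, P p) :
    ∃ p₀ ∈ Ioo l s, ∀ p ∈ Ico p₀ s, P p := by
  obtain ⟨e, he, hb⟩ := Metric.eventually_nhds_iff.1 h
  refine ⟨max (s - e / 2) ((l + s) / 2), ⟨?_, ?_⟩, ?_⟩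
  · exact lt_max_of_lt_right (by linarith)
  · exact max_lt (by linarith) (by linarith)
  · rintro p ⟨hp1, hp2⟩
    refine hb ?_
    have := (le_max_left _ _).trans hp1
    rw [Real.dist_eq, abs_lt]
    constructor <;> linarith

/-- A Nehari point `T = ∫ |u|^p` of energy close to `S^{N/2}/N` is an almost optimal function of the
Sobolev inequality `S X ≤ T`. -/
theorem nehari_asymptotics {N : ℕ} (hN : 3 ≤ N) {S V η : ℝ} (hS : 0 < S) (hV : 0 < V) (hη : 0 < η) :
    ∃ δ : ℝ, 0 < δ ∧ ∃ p₀ ∈ Ioo 2 (critExp N), ∀ p ∈ Ico p₀ (critExp N), ∀ X T : ℝ, 0 < X →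
      S * X ≤ T → T ≤ X ^ (p / 2) * V ^ (1 - p / critExp N) →
      (1 / 2 - 1 / p) * T ≤ 1 / (N : ℝ) * S ^ ((N : ℝ) / 2) + δ →
      T ≤ (S + η) * X ∧ S ^ ((N : ℝ) / 2 - 1) / 2 ≤ X ∧ T ≤ 2 * S ^ ((N : ℝ) / 2) := by
  set s := critExp N with hs
  have hs2 : 2 < s := two_lt_critExp hN
  have hN0 : (0 : ℝ) < N := by have : (3 : ℝ) ≤ N := by exact_mod_cast hN
                               linarith
  have hone : 1 / 2 - 1 / s = 1 / (N : ℝ) := by rw [hs, one_div_critExp hN]; ring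
  let L : ℝ → ℝ := fun p => (S * V ^ (p / s - 1)) ^ (2 / (p - 2))
  let U : ℝ × ℝ → ℝ := fun z => (1 / (N : ℝ) * S ^ ((N : ℝ) / 2) + z.2) / (1 / 2 - 1 / z.1)
  have hLs : L s = S ^ ((N : ℝ) / 2 - 1) := by
    have h1 : 2 / (s - 2) = (N : ℝ) / 2 - 1 := by
      have := critExp_div hN
      rw [← hs] at this
      have hs' : s - 2 ≠ 0 := by linarith
      rw [← this]
      field_simp
      ring
    simp only [L]
    rw [div_self (by linarith), sub_self, Real.rpow_zero, mul_one, h1]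
  have hUs : U (s, 0) = S ^ ((N : ℝ) / 2) := by
    simp only [U]
    rw [hone]
    field_simp
    ring
  have hSS : S * S ^ ((N : ℝ) / 2 - 1) = S ^ ((N : ℝ) / 2) := by
    rw [mul_comm, ← Real.rpow_add_one hS.ne']
    congr 1; ring
  have hLc : ContinuousAt (fun z : ℝ × ℝ => L z.1) (s, 0) := by
    have h1 : ContinuousAt (fun z : ℝ × ℝ => S * V ^ (z.1 / s - 1)) (s, 0) := by
      refine continuousAt_const.mul (ContinuousAt.rpow continuousAt_const ?_ (Or.inl hV.ne'))
      exact (continuousAt_fst.div_const s).sub continuousAt_const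
    have h2 : ContinuousAt (fun z : ℝ × ℝ => 2 / (z.1 - 2)) (s, 0) :=
      continuousAt_const.div (continuousAt_fst.sub continuousAt_const) (by simp; linarith)
    exact h1.rpow h2 (Or.inl (by positivity))
  have hUc : ContinuousAt U (s, 0) := by
    refine ((continuousAt_const.add continuousAt_snd).div (continuousAt_const.sub
      (continuousAt_const.div continuousAt_fst (by simp; linarith))) ?_)
    simp only
    rw [hone]
    positivity
  have hSp : 0 < S ^ ((N : ℝ) / 2 - 1) := by positivity
  have hSp2 : 0 < S ^ ((N : ℝ) / 2) := by positivity
  have e1 : ∀ᶠ z in nhds (s, (0 : ℝ)), U z < (S + η) * L z.1 :=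
    hUc.eventually_lt (continuousAt_const.mul hLc) (by
      simp only [hUs, hLs]
      nlinarith)
  have e2 : ∀ᶠ z in nhds (s, (0 : ℝ)), S ^ ((N : ℝ) / 2 - 1) / 2 < L z.1 :=
    continuousAt_const.eventually_lt hLc (by simp only [hLs]; linarith)
  have e3 : ∀ᶠ z in nhds (s, (0 : ℝ)), U z < 2 * S ^ ((N : ℝ) / 2) :=
    hUc.eventually_lt continuousAt_const (by simp only [hUs]; linarith)
  have e := e1.and (e2.and e3)
  rw [nhds_prod_eq, Filter.eventually_prod_iff] at e
  obtain ⟨pa, ha, pb, hb, hab⟩ := e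
  obtain ⟨δ, hδ1, hδ⟩ := ((hb.filter_mono nhdsWithin_le_nhds).and
    (self_mem_nhdsWithin : Ioi (0:ℝ) ∈ nhdsWithin 0 (Ioi 0))).exists
  obtain ⟨p₀, hp₀, hp₁⟩ := eventually_exists_Ico hs2 ha
  refine ⟨δ, hδ, p₀, hp₀, fun p hp X T hX h1 h2 h3 => ?_⟩
  obtain ⟨k1, k2, k3⟩ := hab (hp₁ p hp) hδ1
  simp only at k1 k2 k3
  have hp2 : 2 < p := hp₀.1.trans_le hp.1
  have hcoef : 0 < 1 / 2 - 1 / p := by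
    rw [sub_pos]; exact one_div_lt_one_div_of_lt two_pos hp2
  have hTU : T ≤ U (p, δ) := by
    simp only [U]
    rw [le_div_iff₀ hcoef]
    linarith
  have hLX : L p ≤ X := by
    have h4 : S * V ^ (p / s - 1) ≤ X ^ ((p - 2) / 2) := by
      have h5 : S * X ≤ X ^ ((p - 2) / 2) * X * V ^ (1 - p / s) := by
        rw [← Real.rpow_add_one hX.ne']
        have : (p - 2) / 2 + 1 = p / 2 := by ring
        rw [this]
        exact h1.trans h2
      have h6 : V ^ (p / s - 1) = (V ^ (1 - p / s))⁻¹ := by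
        rw [← Real.rpow_neg hV.le]; congr 1; ring
      have h7 : 0 < V ^ (1 - p / s) := by positivity
      rw [h6, ← div_eq_mul_inv, div_le_iff₀ h7]
      refine le_of_mul_le_mul_right ?_ hX
      linarith
    have h8 := Real.rpow_le_rpow (by positivity) h4
      (by apply div_nonneg two_pos.le; linarith : (0:ℝ) ≤ 2 / (p - 2))
    rw [← Real.rpow_mul hX.le] at h8
    have h9 : (p - 2) / 2 * (2 / (p - 2)) = 1 := by
      have : p - 2 ≠ 0 := by linarith
      field_simp
    rwa [h9, Real.rpow_one] at h8
  refine ⟨?_, k2.le.trans hLX, hTU.trans k3.le⟩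
  calc T ≤ U (p, δ) := hTU
    _ ≤ (S + η) * L p := k1.le
    _ ≤ (S + η) * X := by gcongr

variable {N : ℕ} {Ω : Set (RN N)} {S : ℝ}

theorem powInt_critExp_pos (hN : 3 ≤ N) {A : RN N → RN N} {C κ p : ℝ}
    (hX : HasSobolev (magSpace Ω A) (critExp N) C) (hp : 0 < p) {u : magSpace Ω A} (hu : u ≠ 0)
    (hT : quadForm κ u.1 = powInt p u.1) : 0 < powInt (critExp N) u.1 := by
  have hs0 : 0 < critExp N := by linarith [two_lt_critExp hN]
  refine lt_of_le_of_ne (powInt_nonneg _ _) fun h0 => hu ?_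
  have h1 := (powInt_eq_zero_iff hs0 (hX u.1 u.2).1).1 h0.symm
  have h2 : powInt p u.1 = 0 := by
    rw [powInt]
    refine integral_eq_zero_of_ae ?_
    filter_upwards [Lp.eq_zero_iff_ae_eq_zero.1 h1] with x hx
    simp [hx, Real.zero_rpow hp.ne']
  have h3 : u.1.snd = 0 := by
    rw [h2, quadForm, h1, norm_zero] at hT
    have : ‖u.1.snd‖ ^ 2 = 0 := by linarith
    simpa using this
  refine Subtype.ext ((WithLp.ofLp_injective 2) ?_)
  exact Prod.ext h1 h3

/-- Low energy Nehari points are almost optimal for the Sobolev inequality and small in `L²`. -/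
theorem nehari_almost_optimal (hN : 3 ≤ N) (hS : IsBestConst N S) (hΩ : Bornology.IsBounded Ω)
    (A : RN N → RN N) {κ : ℝ} (hκ : 0 ≤ κ) {ε : ℝ} (hε : 0 < ε) :
    ∃ δ : ℝ, 0 < δ ∧ ∃ p₀ ∈ Ioo 2 (critExp N), ∀ p ∈ Ico p₀ (critExp N), ∀ u : magSpace Ω A,
      u ≠ 0 → quadForm κ u.1 = powInt p u.1 →
      (1 / 2 - 1 / p) * quadForm κ u.1 ≤ 1 / (N : ℝ) * S ^ ((N : ℝ) / 2) + δ →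
      ‖u.1.fst‖ ^ 2 ≤ ε ∧
      ‖u.1.snd‖ ^ 2 ≤ (S + ε) * powInt (critExp N) u.1 ^ (2 / critExp N) ∧
      S ^ ((N : ℝ) / 2 - 1) / 2 ≤ powInt (critExp N) u.1 ^ (2 / critExp N) := by
  set s := critExp N with hs
  have hs2 : 2 < s := two_lt_critExp hN
  have hs0 : 0 < s := by linarith
  have hSp := hS.pos
  have hfin := isFiniteMeasure_restrict hΩ.measure_lt_top.ne
  obtain ⟨hX, c, hc, hrem⟩ := exists_sobolev_remainder_mag hN hS hΩ A
  set X₁ := 2 * S ^ ((N : ℝ) / 2) / S with hX₁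
  have hX₁0 : 0 < X₁ := by positivity
  set B := X₁ ^ (s / 2) with hB
  have hB0 : 0 < B := by positivity
  -- the level `K` splits `|u|²` into a part controlled by `‖u‖₁` and one controlled by `‖u‖_s`
  obtain ⟨K, hK0, hKB⟩ : ∃ K : ℝ, 0 < K ∧ K ^ (2 - s) * B ≤ ε / 2 := by
    refine ⟨(2 * B / ε) ^ (1 / (s - 2)), by positivity, ?_⟩
    rw [← Real.rpow_mul (by positivity)]
    have e1 : 1 / (s - 2) * (2 - s) = -1 := by
      have : s - 2 ≠ 0 := by linarith
      field_simp
      ring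
    rw [e1, Real.rpow_neg_one]
    apply le_of_eq
    field_simp
  set η := min ε (c * (ε / (2 * K)) ^ 2 / X₁) with hη
  have hη0 : 0 < η := lt_min hε (by positivity)
  obtain ⟨δ, hδ, p₀, hp₀, H⟩ := nehari_asymptotics hN hSp
    (by positivity : 0 < (volume.restrict Ω).real univ + 1) hη0
  refine ⟨δ, hδ, p₀, hp₀, fun p hp u hu hT hE => ?_⟩
  have hp2 : 2 < p := hp₀.1.trans_le hp.1
  have hp0 : 0 < p := by linarith
  have hPpos := powInt_critExp_pos hN hX hp0 hu hT
  set X := powInt s u.1 ^ (2 / s) with hXdef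
  have hXpos : 0 < X := by positivity
  have hsnd : ‖u.1.snd‖ ^ 2 ≤ quadForm κ u.1 := by
    unfold quadForm
    have : 0 ≤ κ * ‖u.1.fst‖ ^ 2 := by positivity
    linarith
  have hr := hrem u
  have h1 : S * X ≤ quadForm κ u.1 := by
    nlinarith [mul_nonneg hc.le (sq_nonneg (powInt 1 u.1))]
  have h2 : quadForm κ u.1 ≤ X ^ (p / 2) * ((volume.restrict Ω).real univ + 1) ^ (1 - p / s) := by
    rw [hT]
    refine (integral_rpow_le_of_memLp hp0 hp.2.le (hX u.1 u.2).1).trans ?_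
    have e1 : X ^ (p / 2) = powInt s u.1 ^ (p / s) := by
      rw [hXdef, ← Real.rpow_mul hPpos.le]; congr 1; field_simp
    rw [e1]
    refine mul_le_mul_of_nonneg_left ?_ (by positivity)
    refine Real.rpow_le_rpow measureReal_nonneg (by linarith) ?_
    rw [sub_nonneg, div_le_one hs0]
    exact hp.2.le
  obtain ⟨k1, k2, k3⟩ := H p hp X _ hXpos h1 h2 hE
  have hXle : X ≤ X₁ := by
    rw [hX₁, le_div_iff₀ hSp]; linarith
  refine ⟨?_, ?_, k2⟩
  · have hI0 := powInt_nonneg 1 u.1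
    have hI : powInt 1 u.1 ≤ ε / (2 * K) := by
      have h3 : c * powInt 1 u.1 ^ 2 ≤ η * X := by nlinarith
      have h4 : η * X ≤ c * (ε / (2 * K)) ^ 2 := by
        calc η * X ≤ (c * (ε / (2 * K)) ^ 2 / X₁) * X₁ := by
              gcongr
              exact min_le_right _ _
          _ = _ := by field_simp
      have h5 : powInt 1 u.1 ^ 2 ≤ (ε / (2 * K)) ^ 2 := le_of_mul_le_mul_left (h3.trans h4) hc
      exact (sq_le_sq₀ hI0 (by positivity)).1 h5
    have hPs : powInt s u.1 ≤ B := by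
      have e1 : powInt s u.1 = X ^ (s / 2) := by
        rw [hXdef, ← Real.rpow_mul hPpos.le]
        have : 2 / s * (s / 2) = 1 := by field_simp
        rw [this, Real.rpow_one]
      rw [e1]
      exact Real.rpow_le_rpow hXpos.le hXle (by positivity)
    have i1 := integrable_norm_rpow_of_memLp one_pos (hX.memLp (by linarith : (1:ℝ) ≤ s) u.2)
    have is := integrable_norm_rpow_of_memLp hs0 (hX.memLp le_rfl u.2)
    have h6 : ‖u.1.fst‖ ^ 2 ≤ K * powInt 1 u.1 + K ^ (2 - s) * powInt s u.1 := by
      rw [Lp_two_norm_sq, powInt, powInt, ← integral_const_mul, ← integral_const_mul,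
        ← integral_add (i1.const_mul _) (is.const_mul _)]
      refine integral_mono ((Lp.memLp u.1.fst).integrable_norm_pow (by simp))
        ((i1.const_mul _).add (is.const_mul _)) fun x => ?_
      have := rpow_le_interpolation one_le_two hs2.le two_pos hK0 (norm_nonneg (u.1.fst x))
      have e1 : (2 : ℝ) - 1 = 1 := by norm_num
      rw [e1, Real.rpow_one K, Real.rpow_two] at this
      exact this
    calc ‖u.1.fst‖ ^ 2 ≤ K * powInt 1 u.1 + K ^ (2 - s) * powInt s u.1 := h6
      _ ≤ K * (ε / (2 * K)) + K ^ (2 - s) * B := by gcongr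
      _ ≤ ε / 2 + ε / 2 := by
          refine add_le_add (le_of_eq ?_) hKB
          field_simp
      _ = ε := by ring
  · refine hsnd.trans (k1.trans ?_)
    gcongr
    exact min_le_left _ _

end Asymptotics

/-! ### Concentration and the barycenter -/

section Variance

/-- `t ^ q - c t²` is convex on `[a, 1]` for a suitable `c > 0`: strong convexity of `t ^ q`. -/
theorem exists_strong_convex_rpow {q a : ℝ} (hq : 1 < q) (ha : 0 < a) :
    ∃ c : ℝ, 0 < c ∧ ConvexOn ℝ (Icc a 1) (fun t => t ^ q - c * t ^ 2) := by
  set m := min (a ^ (q - 2)) 1 with hm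
  have hm0 : 0 < m := lt_min (by positivity) one_pos
  refine ⟨q * (q - 1) * m / 2, by have : 0 < q - 1 := by linarith
                                  positivity, ?_⟩
  set c := q * (q - 1) * m / 2 with hc
  have hd1 : ∀ t : ℝ, 0 < t → HasDerivAt (fun t : ℝ => t ^ q - c * t ^ 2)
      (q * t ^ (q - 1) - c * (2 * t)) t := by
    intro t ht
    have h1 := Real.hasDerivAt_rpow_const (x := t) (p := q) (Or.inl ht.ne')
    have h2 : HasDerivAt (fun t : ℝ => c * t ^ 2) (c * (2 * t)) t := by
      simpa using (hasDerivAt_pow 2 t).const_mul c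
    exact h1.sub h2
  have hd2 : ∀ t : ℝ, 0 < t → HasDerivAt (fun t : ℝ => q * t ^ (q - 1) - c * (2 * t))
      (q * ((q - 1) * t ^ (q - 2)) - c * 2) t := by
    intro t ht
    have h1 := Real.hasDerivAt_rpow_const (x := t) (p := q - 1) (Or.inl ht.ne')
    have e : q - 1 - 1 = q - 2 := by ring
    rw [e] at h1
    have h2 : HasDerivAt (fun t : ℝ => c * (2 * t)) (c * 2) t := by
      simpa using ((hasDerivAt_id t).const_mul 2).const_mul c
    exact (h1.const_mul q).sub h2
  have hint : ∀ t ∈ interior (Icc a 1), 0 < t ∧ a ≤ t ∧ t ≤ 1 := by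
    intro t ht
    rw [interior_Icc] at ht
    exact ⟨ha.trans ht.1, ht.1.le, ht.2.le⟩
  refine convexOn_of_hasDerivWithinAt2_nonneg (convex_Icc a 1) ?_
    (fun t ht => (hd1 t (hint t ht).1).hasDerivWithinAt)
    (fun t ht => (hd2 t (hint t ht).1).hasDerivWithinAt) ?_
  · exact fun t ht => (hd1 t (ha.trans_le ht.1)).continuousAt.continuousWithinAt
  · intro t ht
    obtain ⟨h0, h1, h2⟩ := hint t ht
    have hmt : m ≤ t ^ (q - 2) := by
      rcases le_total 0 (q - 2) with h | h
      · exact (min_le_left _ _).trans (Real.rpow_le_rpow ha.le h1 h)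
      · exact (min_le_right _ _).trans (Real.one_le_rpow_of_pos_of_le_one_of_nonpos h0 h2 h)
    have : 0 < q * (q - 1) := mul_pos (by linarith) (by linarith)
    rw [hc]
    nlinarith

variable {α : Type*} [MeasurableSpace α]

/-- The equality case of Minkowski's inequality, quantitatively: if `‖g‖_q + ‖1 - g‖_q` is close to
`1` on a probability space, then `g` has small variance. -/
theorem exists_variance_bound {q a : ℝ} (hq : 1 < q) (ha : 0 < a) :
    ∃ C : ℝ, 0 < C ∧ ∀ (ν : Measure α) [IsProbabilityMeasure ν] (g : α → ℝ),
      AEStronglyMeasurable g ν → (∀ᵐ x ∂ν, g x ∈ Icc a (1 - a)) → ∀ δ : ℝ, 0 ≤ δ → δ ≤ 1 →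
      (∫ x, g x ^ q ∂ν) ^ (1 / q) + (∫ x, (1 - g x) ^ q ∂ν) ^ (1 / q) ≤ 1 + δ →
      ∫ x, (g x - ∫ y, g y ∂ν) ^ 2 ∂ν ≤ C * δ := by
  obtain ⟨c, hc, hconv⟩ := exists_strong_convex_rpow hq ha
  have hq0 : 0 < q := by linarith
  refine ⟨q * 2 ^ (q - 1) / c, by positivity, fun ν _ g hg hgI δ hδ hδ1 h => ?_⟩
  have hcont : ContinuousOn (fun t : ℝ => t ^ q - c * t ^ 2) (Icc a 1) :=
    ((Real.continuous_rpow_const hq0.le).sub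
      (continuous_const.mul (continuous_pow 2))).continuousOn
  -- Jensen's inequality for the strongly convex function `t ^ q`
  have key : ∀ f : α → ℝ, AEStronglyMeasurable f ν → (∀ᵐ x ∂ν, f x ∈ Icc a 1) →
      (∫ x, f x ∂ν) ^ q + c * ∫ x, (f x - ∫ y, f y ∂ν) ^ 2 ∂ν ≤ ∫ x, f x ^ q ∂ν := by
    intro f hf hfI
    have hb : ∀ᵐ x ∂ν, ‖f x‖ ≤ 1 := by
      filter_upwards [hfI] with x hx
      rw [Real.norm_of_nonneg (ha.le.trans hx.1)]; exact hx.2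
    have i1 : Integrable f ν := Integrable.of_bound hf 1 hb
    have i2 : Integrable (fun x => f x ^ 2) ν := by
      refine Integrable.of_bound (hf.pow 2) 1 ?_
      filter_upwards [hb] with x hx
      rw [norm_pow]; exact pow_le_one₀ (norm_nonneg _) hx
    have i3 : Integrable (fun x => f x ^ q) ν := by
      refine Integrable.of_bound (hf.aemeasurable.pow_const q).aestronglyMeasurable 1 ?_
      filter_upwards [hfI] with x hx
      have h0 := ha.le.trans hx.1
      rw [Real.norm_of_nonneg (by positivity)]; exact Real.rpow_le_one h0 hx.2 hq0.le
    have hJ := hconv.map_integral_le hcont isClosed_Icc hfI i1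
      (i3.sub (i2.const_mul c) : Integrable ((fun t : ℝ => t ^ q - c * t ^ 2) ∘ f) ν)
    have e1 : ∫ x, (f x ^ q - c * f x ^ 2) ∂ν = (∫ x, f x ^ q ∂ν) - c * ∫ x, f x ^ 2 ∂ν := by
      rw [integral_sub i3 (i2.const_mul c), integral_const_mul]
    change _ ≤ ∫ x, (f x ^ q - c * f x ^ 2) ∂ν at hJ
    rw [e1] at hJ
    have e2 : ∫ x, (f x - ∫ y, f y ∂ν) ^ 2 ∂ν = (∫ x, f x ^ 2 ∂ν) - (∫ y, f y ∂ν) ^ 2 := by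
      set m := ∫ y, f y ∂ν with hm
      have e3 : ∀ x, (f x - m) ^ 2 = f x ^ 2 - 2 * m * f x + m ^ 2 := fun x => by ring
      simp only [e3]
      have i4 : Integrable (fun x => f x ^ 2 - 2 * m * f x) ν := i2.sub (i1.const_mul _)
      rw [integral_add i4 (integrable_const _), integral_sub i2 (i1.const_mul _),
        integral_const_mul, ← hm]
      simp
      ring
    rw [e2]
    linarith
  set m := ∫ y, g y ∂ν with hm
  set W := ∫ x, (g x - m) ^ 2 ∂ν with hW
  have hW0 : 0 ≤ W := integral_nonneg fun x => sq_nonneg _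
  have hgI1 : ∀ᵐ x ∂ν, g x ∈ Icc a 1 := by
    filter_upwards [hgI] with x hx using ⟨hx.1, by linarith [hx.2]⟩
  have hgI2 : ∀ᵐ x ∂ν, 1 - g x ∈ Icc a 1 := by
    filter_upwards [hgI] with x hx using ⟨by linarith [hx.2], by linarith [hx.1]⟩
  have hgi : Integrable g ν := Integrable.of_bound hg 1 (by
    filter_upwards [hgI1] with x hx
    rw [Real.norm_of_nonneg (ha.le.trans hx.1)]; exact hx.2)
  have k1 := key g hg hgI1
  have k2 := key (fun x => 1 - g x) (aestronglyMeasurable_const.sub hg) hgI2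
  have hm1 : ∫ x, (1 - g x) ∂ν = 1 - m := by
    rw [integral_sub (integrable_const _) hgi, ← hm]; simp
  rw [hm1] at k2
  have hm0 : 0 ≤ m := integral_nonneg_of_ae (by
    filter_upwards [hgI1] with x hx using ha.le.trans hx.1)
  have hm2 : 0 ≤ 1 - m := by
    rw [← hm1]
    exact integral_nonneg_of_ae (by filter_upwards [hgI2] with x hx using ha.le.trans hx.1)
  have hv : 0 ≤ c * ∫ x, (1 - g x - (1 - m)) ^ 2 ∂ν :=
    mul_nonneg hc.le (integral_nonneg fun x => sq_nonneg _)
  have l2 : 1 - m ≤ (∫ x, (1 - g x) ^ q ∂ν) ^ (1 / q) := by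
    have := Real.rpow_le_rpow (by positivity : 0 ≤ (1 - m) ^ q) (by linarith :
      (1 - m) ^ q ≤ ∫ x, (1 - g x) ^ q ∂ν) (by positivity : 0 ≤ 1 / q)
    rwa [← Real.rpow_mul hm2, mul_one_div_cancel hq0.ne', Real.rpow_one] at this
  have hG0 : 0 ≤ ∫ x, g x ^ q ∂ν := le_trans (by positivity) k1
  have l1 : ∫ x, g x ^ q ∂ν ≤ (m + δ) ^ q := by
    have h1 : (∫ x, g x ^ q ∂ν) ^ (1 / q) ≤ m + δ := by linarith
    have := Real.rpow_le_rpow (by positivity) h1 hq0.le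
    rwa [← Real.rpow_mul hG0, one_div_mul_cancel hq0.ne', Real.rpow_one] at this
  have l3 : (m + δ) ^ q ≤ m ^ q + q * 2 ^ (q - 1) * δ := by
    have hcv := (convexOn_rpow hq.le)
    rcases hδ.eq_or_lt with rfl | hδp
    · simp
    have hs := hcv.slope_le_of_hasDerivAt (x := m) (y := m + δ) hm0
      (add_nonneg hm0 hδ : (0:ℝ) ≤ m + δ) (by linarith)
      (Real.hasDerivAt_rpow_const (Or.inr hq.le))
    rw [slope_def_field, add_sub_cancel_left, div_le_iff₀ hδp] at hs
    have : (m + δ) ^ (q - 1) ≤ 2 ^ (q - 1) :=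
      Real.rpow_le_rpow (by positivity) (by linarith) (by linarith)
    have : q * (m + δ) ^ (q - 1) * δ ≤ q * 2 ^ (q - 1) * δ := by gcongr
    linarith
  rw [div_mul_eq_mul_div, le_div_iff₀ hc]
  linarith

/-- The probability measure with density proportional to `f`. -/
def weighted (μ : Measure α) (f : α → ℝ) : Measure α :=
  μ.withDensity fun x => (((∫ y, f y ∂μ)⁻¹ * f x).toNNReal : ℝ≥0∞)

theorem integral_weighted {μ : Measure α} {f : α → ℝ} (hf : AEMeasurable f μ) (hf0 : ∀ x, 0 ≤ f x)
    {E : Type*} [NormedAddCommGroup E] [NormedSpace ℝ E] (g : α → E) :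
    ∫ x, g x ∂(weighted μ f) = (∫ y, f y ∂μ)⁻¹ • ∫ x, f x • g x ∂μ := by
  have hI : 0 ≤ (∫ y, f y ∂μ)⁻¹ := inv_nonneg.2 (integral_nonneg hf0)
  rw [weighted, integral_withDensity_eq_integral_smul₀ (hf.const_mul _).real_toNNReal,
    ← integral_smul]
  refine integral_congr_ae (Filter.Eventually.of_forall fun x => ?_)
  simp only [NNReal.smul_def, Real.coe_toNNReal _ (mul_nonneg hI (hf0 x)), mul_smul]

theorem isProbabilityMeasure_weighted {μ : Measure α} {f : α → ℝ} (hf : Integrable f μ)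
    (hf0 : ∀ x, 0 ≤ f x) (hpos : 0 < ∫ y, f y ∂μ) : IsProbabilityMeasure (weighted μ f) := by
  refine ⟨?_⟩
  rw [weighted, withDensity_apply _ MeasurableSet.univ, Measure.restrict_univ]
  have h := ofReal_integral_eq_lintegral_ofReal (hf.const_mul (∫ y, f y ∂μ)⁻¹)
    (Filter.Eventually.of_forall fun x => mul_nonneg (inv_nonneg.2 hpos.le) (hf0 x))
  rw [integral_const_mul, inv_mul_cancel₀ hpos.ne', ENNReal.ofReal_one] at h
  exact h.symm

theorem weighted_absolutelyContinuous (μ : Measure α) (f : α → ℝ) : weighted μ f ≪ μ :=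
  withDensity_absolutelyContinuous _ _

/-- The sine has an inverse with Lipschitz constant at most `4` on `[-π/4, π/4]`. -/
theorem abs_sub_le_of_sin {a b : ℝ} (ha : |a| ≤ Real.pi / 4) (hb : |b| ≤ Real.pi / 4) :
    |a - b| ≤ 4 * |Real.sin a - Real.sin b| := by
  have hpi := Real.pi_pos
  have hpi4 := Real.pi_le_four
  rw [abs_le] at ha hb
  have hcos : (1 : ℝ) / 2 ≤ Real.cos ((a + b) / 2) := by
    rw [← Real.cos_pi_div_three, ← Real.cos_abs ((a + b) / 2)]
    refine Real.cos_le_cos_of_nonneg_of_le_pi (abs_nonneg _) (by linarith) ?_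
    rw [abs_le]; constructor <;> linarith
  have hsin : 2 / Real.pi * |(a - b) / 2| ≤ |Real.sin ((a - b) / 2)| :=
    Real.mul_abs_le_abs_sin (abs_le.2 ⟨by linarith, by linarith⟩)
  rw [Real.sin_sub_sin, abs_mul, abs_mul, abs_two,
    abs_of_pos (by linarith : 0 < Real.cos ((a + b) / 2))]
  have h1 : |(a - b) / 2| = |a - b| / 2 := by rw [abs_div, abs_two]
  have h2 : 1 / 2 ≤ 2 / Real.pi := by rw [div_le_div_iff₀ two_pos hpi]; linarith
  have h3 : |a - b| / 4 ≤ |Real.sin ((a - b) / 2)| := by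
    rw [h1] at hsin
    nlinarith [abs_nonneg (a - b)]
  nlinarith [abs_nonneg (Real.sin ((a - b) / 2))]

end Variance

section Barycenter

variable {N : ℕ} {Ω : Set (RN N)} {S : ℝ}

theorem cos_sq_eq_half_sub_sin (t : ℝ) :
    Real.cos (t + Real.pi / 4) ^ 2 = (1 - Real.sin (2 * t)) / 2 := by
  rw [Real.cos_sq, show 2 * (t + Real.pi / 4) = 2 * t + Real.pi / 2 by ring,
    Real.cos_add_pi_div_two]
  ring

theorem abs_sin_le_of_abs_le {t : ℝ} (ht : |t| ≤ Real.pi / 4) :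
    |Real.sin t| ≤ Real.sin (Real.pi / 4) := by
  have hpi := Real.pi_pos
  rw [abs_le] at ht ⊢
  constructor
  · rw [← Real.sin_neg]
    exact Real.sin_le_sin_of_le_of_le_pi_div_two (by linarith) (by linarith) ht.1
  · exact Real.sin_le_sin_of_le_of_le_pi_div_two (by linarith) (by linarith) ht.2

theorem exists_sin_eq_of_abs_le {y : ℝ} (hy : |y| ≤ Real.sin (Real.pi / 4)) :
    ∃ b : ℝ, |b| ≤ Real.pi / 4 ∧ Real.sin b = y := by
  have hpi := Real.pi_pos
  have h := intermediate_value_Icc (by linarith : -(Real.pi / 4) ≤ Real.pi / 4)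
    Real.continuous_sin.continuousOn
  rw [Real.sin_neg] at h
  obtain ⟨b, hb, hb2⟩ := h (abs_le.1 hy)
  exact ⟨b, abs_le.2 hb, hb2⟩

set_option maxHeartbeats 800000 in
/-- Functions with almost optimal Sobolev quotient and small `L²` norm concentrate: each coordinate
has small variance under the probability measure with density proportional to `|u|^{2*}`. The
cut-offs `cos θ`, `sin θ` with `θ` affine turn near-optimality into near-equality in Minkowski's
inequality for `cos² θ` and `sin² θ`. -/
theorem exists_concentration (hN : 3 ≤ N) (hS : IsBestConst N S) (hΩ : Bornology.IsBounded Ω)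
    (hΩo : MeasurableSet Ω) {m₀ ρ : ℝ} (hm₀ : 0 < m₀) (hρ : 0 < ρ) :
    ∃ ε : ℝ, 0 < ε ∧ ∀ (A : RN N → RN N) (u : magSpace Ω A), ‖u.1.fst‖ ^ 2 ≤ ε →
      ‖u.1.snd‖ ^ 2 ≤ (S + ε) * powInt (critExp N) u.1 ^ (2 / critExp N) →
      m₀ ≤ powInt (critExp N) u.1 ^ (2 / critExp N) → ∀ j : Fin N, ∃ z : ℝ,
      ∫ x, (x j - z) ^ 2 ∂(weighted (volume.restrict Ω) fun x => ‖u.1.fst x‖ ^ critExp N) ≤ ρ := by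
  have hs2 := two_lt_critExp hN
  have hpi := Real.pi_pos
  have hS0 := hS.pos
  obtain ⟨R, hR, hΩR⟩ : ∃ R : ℝ, 0 < R ∧ ∀ x ∈ Ω, ‖x‖ ≤ R := hΩ.exists_pos_norm_le
  set l := Real.pi / (8 * R) with hl
  have hl0 : 0 < l := by positivity
  set a := (1 - Real.sin (Real.pi / 4)) / 2 with ha
  have ha0 : 0 < a := by
    rw [ha, Real.sin_pi_div_four]
    have : Real.sqrt 2 < 2 := by
      rw [Real.sqrt_lt' two_pos]; norm_num
    linarith
  have hq : 1 < critExp N / 2 := by linarith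
  obtain ⟨C, hC, hvar⟩ := exists_variance_bound (α := RN N) hq ha0
  set K := 1 / S + l ^ 2 / (S * m₀) with hK
  have hK0 : 0 < K := by positivity
  set ε := min (1 / K) (ρ / (K * C * (4 / l) ^ 2)) with hε
  have hε0 : 0 < ε := by positivity
  refine ⟨ε, hε0, fun A u h1 h2 h3 j => ?_⟩
  set f : RN N → ℝ := fun x => ‖u.1.fst x‖ ^ critExp N with hf
  have hf0 : ∀ x, 0 ≤ f x := fun x => by positivity
  set X := powInt (critExp N) u.1 ^ (2 / critExp N) with hX
  have hX0 : 0 < X := hm₀.trans_le h3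
  have hPf : powInt (critExp N) u.1 = ∫ x in Ω, f x := rfl
  have hPpos : 0 < ∫ x in Ω, f x := by
    rcases (powInt_nonneg (critExp N) u.1).eq_or_lt with h | h
    · rw [hX, ← h, Real.zero_rpow (by positivity)] at hX0
      exact absurd hX0 (lt_irrefl _)
    · exact h
  have hsob := exists_sobolev_remainder_mag hN hS hΩ A
  have hfi : Integrable f (volume.restrict Ω) :=
    integrable_norm_rpow_of_memLp (by linarith) (hsob.1 u.1 u.2).1
  set ν := weighted (volume.restrict Ω) f with hν
  have : IsProbabilityMeasure ν := isProbabilityMeasure_weighted hfi hf0 hPpos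
  have haeΩ : ∀ᵐ x ∂ν, x ∈ Ω :=
    (weighted_absolutelyContinuous _ f).ae_le (ae_restrict_mem hΩo)
  have hxj : ∀ x ∈ Ω, |2 * (l * x j)| ≤ Real.pi / 4 := by
    intro x hx
    have h4 : |x j| ≤ R := (PiLp.norm_apply_le x j).trans (hΩR x hx)
    rw [abs_mul, abs_mul, abs_two, abs_of_pos hl0]
    calc 2 * (l * |x j|) ≤ 2 * (l * R) := by gcongr
      _ = Real.pi / 4 := by rw [hl]; field_simp; ring
  set g : RN N → ℝ := fun x => Real.cos (l * x j + Real.pi / 4) ^ 2 with hg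
  have hgc : Continuous g := by fun_prop
  have hg1 : ∀ x, 1 - g x = Real.sin (l * x j + Real.pi / 4) ^ 2 := fun x => by
    simp only [hg]; linarith [Real.sin_sq_add_cos_sq (l * x j + Real.pi / 4)]
  have hgI : ∀ᵐ x ∂ν, g x ∈ Icc a (1 - a) := by
    filter_upwards [haeΩ] with x hx
    have h5 := abs_le.1 (abs_sin_le_of_abs_le (hxj x hx))
    simp only [hg, cos_sq_eq_half_sub_sin, ha]
    constructor <;> linarith [h5.1, h5.2]
  -- the cut-off integrals in terms of the probability measure
  have hcut : ∀ η : RN N → ℝ, (∫ x in Ω, ‖η x • u.1.fst x‖ ^ critExp N) ^ (2 / critExp N)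
      = X * (∫ x, (η x ^ 2) ^ (critExp N / 2) ∂ν) ^ (1 / (critExp N / 2)) := by
    intro η
    have e1 : ∫ x in Ω, ‖η x • u.1.fst x‖ ^ critExp N
        = (∫ x in Ω, f x) * ∫ x, (η x ^ 2) ^ (critExp N / 2) ∂ν := by
      rw [hν, integral_weighted hfi.aemeasurable hf0, smul_eq_mul, ← mul_assoc,
        mul_inv_cancel₀ hPpos.ne', one_mul]
      refine integral_congr_ae (Filter.Eventually.of_forall fun x => ?_)
      simp only [hf]
      rw [norm_smul, Real.mul_rpow (norm_nonneg _) (norm_nonneg _), smul_eq_mul, mul_comm,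
        Real.norm_eq_abs, ← sq_abs, ← Real.rpow_natCast, ← Real.rpow_mul (abs_nonneg _)]
      congr 2
      push_cast; ring
    rw [e1, Real.mul_rpow hPpos.le (integral_nonneg fun x => by positivity), hX, hPf, one_div_div]
  have hmain := sobolev_cos_sin_mag hN hS hΩ l (Real.pi / 4) j u
  rw [hcut (fun x => Real.cos (l * x j + Real.pi / 4)),
    hcut (fun x => Real.sin (l * x j + Real.pi / 4))] at hmain
  have hδ := hvar ν g hgc.aestronglyMeasurable hgI (K * ε) (by positivity)
    (by
      calc K * ε ≤ K * (1 / K) := by gcongr; exact min_le_left _ _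
        _ = 1 := by field_simp)
    (by
      simp only [hg1]
      set G1 := (∫ x, g x ^ (critExp N / 2) ∂ν) ^ (1 / (critExp N / 2))
      set G2 := (∫ x, (Real.sin (l * x j + Real.pi / 4) ^ 2) ^ (critExp N / 2) ∂ν) ^
        (1 / (critExp N / 2))
      have h6 : S * X * (G1 + G2) ≤ S * X * (1 + K * ε) := by
        have h7 : l ^ 2 * ‖u.1.fst‖ ^ 2 ≤ l ^ 2 * ε := by gcongr
        have h8 : l ^ 2 * ε ≤ l ^ 2 * ε * (X / m₀) :=
          le_mul_of_one_le_right (by positivity) ((one_le_div hm₀).2 h3)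
        have h9 : S * X * (1 + K * ε) = (S + ε) * X + l ^ 2 * ε * (X / m₀) := by
          rw [hK]; field_simp; ring
        rw [h9]
        calc S * X * (G1 + G2) = S * (X * G1) + S * (X * G2) := by ring
          _ ≤ _ := hmain
          _ ≤ _ := by linarith
      exact le_of_mul_le_mul_left h6 (by positivity))
  set m := ∫ x, g x ∂ν with hm
  have hgi : Integrable g ν := Integrable.of_bound hgc.aestronglyMeasurable 1 (by
    filter_upwards [hgI] with x hx
    rw [Real.norm_of_nonneg (ha0.le.trans hx.1)]; linarith [hx.2])
  have hmI : a ≤ m ∧ m ≤ 1 - a := by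
    have e1 := integral_mono_ae (integrable_const a) hgi (hgI.mono fun x hx => hx.1)
    have e2 := integral_mono_ae hgi (integrable_const (1 - a)) (hgI.mono fun x hx => hx.2)
    simp only [integral_const, probReal_univ, one_smul] at e1 e2
    exact ⟨e1, e2⟩
  obtain ⟨b, hb, hb2⟩ := exists_sin_eq_of_abs_le (y := 1 - 2 * m) (by
    rw [abs_le]; constructor <;> linarith [hmI.1, hmI.2])
  refine ⟨b / (2 * l), ?_⟩
  have hpt : ∀ᵐ x ∂ν, (x j - b / (2 * l)) ^ 2 ≤ (4 / l) ^ 2 * (g x - m) ^ 2 := by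
    filter_upwards [haeΩ] with x hx
    have h10 := abs_sub_le_of_sin (hxj x hx) hb
    rw [hb2] at h10
    have h11 : Real.sin (2 * (l * x j)) - (1 - 2 * m) = -2 * (g x - m) := by
      simp only [hg, cos_sq_eq_half_sub_sin]; ring
    have h12 : 2 * (l * x j) - b = 2 * l * (x j - b / (2 * l)) := by field_simp
    rw [h11, h12, abs_mul (2 * l), abs_mul (-2), abs_of_pos (by positivity : 0 < 2 * l)] at h10
    rw [← mul_pow, ← sq_abs, ← sq_abs (4 / l * (g x - m)), abs_mul,
      abs_of_pos (by positivity : 0 < 4 / l)]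
    refine pow_le_pow_left₀ (abs_nonneg _) ?_ 2
    rw [div_mul_eq_mul_div, le_div_iff₀ hl0]
    have : |(-2 : ℝ)| = 2 := by norm_num
    rw [this] at h10
    linarith
  have hint2 : Integrable (fun x => (4 / l) ^ 2 * (g x - m) ^ 2) ν := by
    refine Integrable.const_mul (Integrable.of_bound (C := 1)
      ((hgc.sub continuous_const).pow 2).aestronglyMeasurable ?_) _
    filter_upwards [hgI] with x hx
    change ‖(g x - m) ^ 2‖ ≤ 1
    rw [norm_pow, Real.norm_eq_abs]
    refine pow_le_one₀ (abs_nonneg _) (abs_le.2 ⟨?_, ?_⟩) <;> linarith [hx.1, hx.2, hmI.1, hmI.2]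
  calc ∫ x, (x j - b / (2 * l)) ^ 2 ∂ν ≤ ∫ x, (4 / l) ^ 2 * (g x - m) ^ 2 ∂ν :=
        integral_mono_of_nonneg (Filter.Eventually.of_forall fun x => sq_nonneg _) hint2 hpt
    _ = (4 / l) ^ 2 * ∫ x, (g x - m) ^ 2 ∂ν := integral_const_mul _ _
    _ ≤ (4 / l) ^ 2 * (C * (K * ε)) := by gcongr
    _ ≤ (4 / l) ^ 2 * (C * (K * (ρ / (K * C * (4 / l) ^ 2)))) := by
        gcongr; exact min_le_right _ _
    _ = ρ := by field_simp

/-- A concentrated probability measure on `Ω` has its mean close to `Ω`. -/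
theorem infDist_integral_le (hΩ : Bornology.IsBounded Ω) {ν : Measure (RN N)}
    [IsProbabilityMeasure ν] (hν : ∀ᵐ x ∂ν, x ∈ Ω) {r : ℝ} (hr : 0 < r) {z : Fin N → ℝ}
    (hz : ∀ j, ∫ x, (x j - z j) ^ 2 ∂ν ≤ r ^ 2 / (4 * (N + 1))) :
    Metric.infDist (∫ x, x ∂ν) Ω ≤ r := by
  obtain ⟨R, hR, hΩR⟩ : ∃ R : ℝ, 0 < R ∧ ∀ x ∈ Ω, ‖x‖ ≤ R := hΩ.exists_pos_norm_le
  set w : RN N := WithLp.toLp 2 z with hw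
  have hi : Integrable (fun x : RN N => x) ν :=
    Integrable.of_bound continuous_id.aestronglyMeasurable R (hν.mono hΩR)
  have hiw : Integrable (fun x : RN N => x - w) ν := hi.sub (integrable_const w)
  have hij : ∀ j, Integrable (fun x : RN N => (x j - z j) ^ 2) ν := by
    intro j
    refine Integrable.of_bound (C := (R + |z j|) ^ 2) (by fun_prop) ?_
    filter_upwards [hν] with x hx
    rw [norm_pow, Real.norm_eq_abs]
    refine pow_le_pow_left₀ (abs_nonneg _) ((abs_sub _ _).trans ?_) 2
    have : |x j| ≤ R := (PiLp.norm_apply_le x j).trans (hΩR x hx)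
    linarith
  have hsq : ∀ x : RN N, ‖x - w‖ ^ 2 = ∑ j, (x j - z j) ^ 2 := by
    intro x
    rw [EuclideanSpace.norm_sq_eq]
    simp [hw]
  have h1 : ∫ x, ‖x - w‖ ^ 2 ∂ν ≤ r ^ 2 / 4 := by
    simp only [hsq]
    rw [integral_finsetSum _ fun j _ => hij j]
    refine (Finset.sum_le_sum fun j _ => hz j).trans ?_
    rw [Finset.sum_const, Finset.card_univ, Fintype.card_fin, nsmul_eq_mul,
      mul_div_assoc', div_le_div_iff₀ (by positivity) (by positivity)]
    nlinarith [sq_nonneg r]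
  have hi2 : Integrable (fun x => ‖x - w‖ ^ 2) ν := by
    simp only [hsq]; exact integrable_finsetSum _ fun j _ => hij j
  have h2 : ∫ x, ‖x - w‖ ∂ν ≤ r / 2 := by
    have : ∫ x, ‖x - w‖ ∂ν ≤ ∫ x, (r / 4 + r⁻¹ * ‖x - w‖ ^ 2) ∂ν := by
      refine integral_mono hiw.norm ((integrable_const _).add (hi2.const_mul _)) fun x => ?_
      have e : r / 4 + r⁻¹ * ‖x - w‖ ^ 2 - ‖x - w‖ = r⁻¹ * (‖x - w‖ - r / 2) ^ 2 := by
        field_simp; ring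
      have : 0 ≤ r⁻¹ * (‖x - w‖ - r / 2) ^ 2 := by positivity
      simp only
      linarith
    rw [integral_add (integrable_const _) (hi2.const_mul _), integral_const_mul,
      integral_const, probReal_univ, one_smul] at this
    have h3 : r⁻¹ * ∫ x, ‖x - w‖ ^ 2 ∂ν ≤ r⁻¹ * (r ^ 2 / 4) := by gcongr
    have h4 : r⁻¹ * (r ^ 2 / 4) = r / 4 := by field_simp
    linarith
  set β := ∫ x, x ∂ν with hβ
  have h5 : ‖β - w‖ ≤ r / 2 := by
    have : β - w = ∫ x, (x - w) ∂ν := by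
      rw [integral_sub hi (integrable_const w)]; simp [hβ]
    rw [this]
    exact (norm_integral_le_integral_norm _).trans h2
  have h6 : ∫ _x, Metric.infDist β Ω ∂ν ≤ ∫ x, (‖β - w‖ + ‖x - w‖) ∂ν := by
    refine integral_mono_ae (integrable_const _) ((integrable_const _).add hiw.norm) ?_
    filter_upwards [hν] with x hx
    refine (Metric.infDist_le_dist_of_mem hx).trans ?_
    rw [dist_eq_norm, show β - x = (β - w) - (x - w) by abel]
    exact norm_sub_le _ _
  rw [integral_add (integrable_const _) hiw.norm] at h6
  simp only [integral_const, probReal_univ, one_smul] at h6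
  linarith

/-- A low energy Nehari point is almost optimal for the Sobolev inequality and small in `L²`, so
each coordinate has small variance under the weight `|u|^{2*}`, whose barycenter is then close to
`Ω`. -/
theorem exists_barycenterProp (hN : 3 ≤ N) (hΩo : IsOpen Ω) (hne : Ω.Nonempty)
    (hΩ : Bornology.IsBounded Ω) (A : RN N → RN N) {r κ : ℝ} (hr : 0 < r) (hκ : 0 ≤ κ) :
    ∃ ε : ℝ, 0 < ε ∧ ∃ pstar ∈ Ioo (2 : ℝ) (critExp N), BarycenterProp Ω A r κ ε pstar := by
  have hfin : volume Ω ≠ ⊤ := hΩ.measure_lt_top.ne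
  have hS := isBestConst_sobolevConst hN hΩo hne hfin
  set S := sobolevConst Ω with hSdef
  have hS0 := hS.pos
  have hsob := (exists_sobolev_remainder_mag hN hS hΩ A).1
  obtain ⟨ε₁, hε₁, hconc⟩ := exists_concentration hN hS hΩ hΩo.measurableSet
    (m₀ := S ^ ((N : ℝ) / 2 - 1) / 2) (ρ := r ^ 2 / (4 * (N + 1))) (by positivity) (by positivity)
  obtain ⟨δ, hδ, p₀, hp₀, hopt⟩ := nehari_almost_optimal hN hS hΩ A hκ hε₁
  refine ⟨δ, hδ, p₀, hp₀, fun p hp u hu hE => ?_⟩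
  have hp2 : 2 < p := hp₀.1.trans_le hp.1
  rw [mem_magNehari_iff hfin hsob (by positivity) hp2 hp.2.le] at hu
  rw [magEnergy_eq] at hE
  simp only [pairEnergy_eq_of_nehari hu.2] at hE
  obtain ⟨h1, h2, h3⟩ := hopt p hp u hu.1 hu.2 hE
  choose z hz using hconc A u h1 h2 h3
  have hpos := powInt_critExp_pos hN hsob (by linarith) hu.1 hu.2
  have hs2 := two_lt_critExp hN
  have hfi : Integrable (fun x => ‖u.1.fst x‖ ^ critExp N) (volume.restrict Ω) :=
    integrable_norm_rpow_of_memLp (by linarith) (hsob u.1 u.2).1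
  have hf0 : ∀ x, 0 ≤ ‖u.1.fst x‖ ^ critExp N := fun x => by positivity
  have := isProbabilityMeasure_weighted hfi hf0 hpos
  have hb : barycenter u
      = ∫ x, x ∂(weighted (volume.restrict Ω) fun x => ‖u.1.fst x‖ ^ critExp N) := by
    rw [integral_weighted hfi.aemeasurable hf0]; rfl
  change Metric.infDist (barycenter u) Ω ≤ r
  rw [hb]
  exact infDist_integral_le hΩ ((weighted_absolutelyContinuous _ _).ae_le
    (ae_restrict_mem hΩo.measurableSet)) hr hz

end Barycenter

/-! ### Transplanting functions on a ball into the magnetic space -/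

section Bump

variable {N : ℕ} {Ω : Set (RN N)} {r : ℝ}

/-- The translate `φ (x - y)` multiplied by the phase `e^{i b · x}`. -/
def modulate (b y : RN N) (φ : RN N → ℝ) (x : RN N) : ℂ :=
  Complex.exp (Complex.I * ((∑ j, b j * x j : ℝ) : ℂ)) * ((φ (x - y) : ℝ) : ℂ)

theorem norm_phase (s : ℝ) : ‖Complex.exp (Complex.I * (s : ℂ))‖ = 1 := by
  rw [mul_comm]; exact Complex.norm_exp_ofReal_mul_I s

theorem norm_modulate (b y : RN N) (φ : RN N → ℝ) (x : RN N) :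
    ‖modulate b y φ x‖ = ‖φ (x - y)‖ := by
  rw [modulate, norm_mul, norm_phase, one_mul, Complex.norm_real]

theorem modulate_sub (b y : RN N) (φ ψ : RN N → ℝ) :
    modulate b y (φ - ψ) = modulate b y φ - modulate b y ψ := by
  ext x
  simp only [modulate, Pi.sub_apply]
  push_cast
  ring

theorem hasFDerivAt_phase (b x : RN N) :
    HasFDerivAt (fun x : RN N => Complex.exp (Complex.I * ((∑ j, b j * x j : ℝ) : ℂ)))
      ((Complex.exp (Complex.I * ((∑ j, b j * x j : ℝ) : ℂ)) * Complex.I) •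
        Complex.ofRealCLM.comp (∑ j, b j • (EuclideanSpace.proj j : RN N →L[ℝ] ℝ))) x := by
  set L : RN N →L[ℝ] ℂ := Complex.ofRealCLM.comp
    (∑ j, b j • (EuclideanSpace.proj j : RN N →L[ℝ] ℝ)) with hL
  have e : ∀ x : RN N, ((∑ j, b j * x j : ℝ) : ℂ) = L x := by
    intro x
    simp [hL]
  simp only [e]
  have h := ((L.hasFDerivAt (x := x)).const_mul Complex.I).cexp
  rwa [smul_smul] at h

theorem contDiff_phase (b : RN N) :
    ContDiff ℝ ∞ (fun x : RN N => Complex.exp (Complex.I * ((∑ j, b j * x j : ℝ) : ℂ))) := by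
  refine ContDiff.cexp (contDiff_const.mul (Complex.ofRealCLM.contDiff.comp
    (f := fun x : RN N => ∑ j, b j * x j) ?_))
  exact ContDiff.sum fun j _ => contDiff_const.mul
    (EuclideanSpace.proj j : RN N →L[ℝ] ℝ).contDiff

theorem isTest_modulate {φ : RN N → ℝ} (h : IsTest (Metric.ball 0 r) φ) {y : RN N}
    (hy : Metric.ball y r ⊆ Ω) (b : RN N) : IsTest Ω (modulate b y φ) := by
  have hsub : tsupport (modulate b y φ) ⊆ (fun x => x - y) ⁻¹' tsupport φ := by
    refine closure_minimal ?_ ((isClosed_tsupport φ).preimage (by fun_prop))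
    intro x hx
    refine subset_tsupport _ ?_
    intro h0
    refine hx ?_
    simp [modulate, h0]
  refine ⟨?_, ?_, ?_⟩
  · exact (contDiff_phase b).mul (Complex.ofRealCLM.contDiff.comp
      (h.1.comp (contDiff_id.sub contDiff_const)))
  · have hK : IsCompact ((fun x => x - y) ⁻¹' tsupport φ) := by
      have := (Homeomorph.subRight y).isCompact_preimage (s := tsupport φ)
      exact this.2 h.2.1
    exact hK.of_isClosed_subset (isClosed_tsupport _) hsub
  · intro x hx
    refine hy ?_
    have := h.2.2 (hsub hx)
    simpa [dist_eq_norm] using this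

/-- The phase `e^{i b·x}` shifts the potential by the constant `b`, and the gradient of the real
amplitude contributes the orthogonal part. -/
theorem magGrad_modulate {φ : RN N → ℝ} (h : IsTest (Metric.ball 0 r) φ) (A : RN N → RN N)
    (b y x : RN N) : ‖magGrad A (modulate b y φ) x‖ ^ 2
      = ‖fderiv ℝ φ (x - y)‖ ^ 2 + ‖b - A x‖ ^ 2 * φ (x - y) ^ 2 := by
  have hd : HasFDerivAt (fun x => ((φ (x - y) : ℝ) : ℂ))
      (Complex.ofRealCLM.comp (fderiv ℝ φ (x - y))) x := by
    have h1 : HasFDerivAt (fun x => φ (x - y)) (fderiv ℝ φ (x - y)) x := by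
      have := (h.differentiable (x - y)).hasFDerivAt.comp x
        ((hasFDerivAt_id x).sub_const y)
      rwa [ContinuousLinearMap.comp_id] at this
    exact Complex.ofRealCLM.hasFDerivAt.comp x h1
  have hm : HasFDerivAt (modulate b y φ) _ x := (hasFDerivAt_phase b x).mul hd
  rw [EuclideanSpace.norm_sq_eq, EuclideanSpace.norm_sq_eq, ← norm_gradient,
    EuclideanSpace.norm_sq_eq, Finset.sum_mul, ← Finset.sum_add_distrib]
  refine Finset.sum_congr rfl fun j _ => ?_
  set z := Complex.exp (Complex.I * ((∑ j, b j * x j : ℝ) : ℂ)) with hz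
  have e : magGrad A (modulate b y φ) x j
      = z * (((b j - A x j) * φ (x - y) : ℝ)
        + (-(fderiv ℝ φ (x - y) (EuclideanSpace.single j 1)) : ℝ) * Complex.I) := by
    simp only [magGrad, hm.fderiv]
    have e1 : (∑ k, b k • (EuclideanSpace.proj k : RN N →L[ℝ] ℝ)) (EuclideanSpace.single j 1)
        = b j := by
      simp
    simp only [_root_.add_apply, _root_.smul_apply, ContinuousLinearMap.comp_apply, e1,
      Complex.ofRealCLM_apply, smul_eq_mul, modulate, ← hz]
    push_cast
    linear_combination (-(z * (b j) * φ (x - y))) * Complex.I_sq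
  rw [e, norm_mul, hz, norm_phase, one_mul, ← Complex.normSq_eq_norm_sq, Complex.normSq_add_mul_I,
    Real.norm_eq_abs, Real.norm_eq_abs, sq_abs, sq_abs, gradient_apply, PiLp.sub_apply]
  ring

/-- Change of variables between `B_r(y)` and `B_r(0)`. -/
theorem setIntegral_sub_ball (f : RN N → ℝ) (y : RN N) (hy : Metric.ball y r ⊆ Ω) :
    ∫ x in Ω, (Metric.ball y r).indicator (fun x => f (x - y)) x
      = ∫ x in Metric.ball 0 r, f x := by
  rw [setIntegral_indicator Metric.isOpen_ball.measurableSet, inter_eq_self_of_subset_right hy,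
    ← integral_indicator Metric.isOpen_ball.measurableSet,
    ← integral_indicator Metric.isOpen_ball.measurableSet,
    ← integral_sub_right_eq_self ((Metric.ball (0 : RN N) r).indicator f) y]
  refine integral_congr_ae (Filter.Eventually.of_forall fun x => ?_)
  simp [indicator, dist_eq_norm]

theorem exists_magSpace_of_test {A : RN N → RN N}
    (hA : AEStronglyMeasurable A (volume.restrict Ω)) {C : ℝ}
    (hC : ∀ᵐ x ∂volume.restrict Ω, ‖A x‖ ≤ C)
    {φ : RN N → ℂ} (h : IsTest Ω φ) :
    ∃ w : magSpace Ω A, w.1.fst =ᵐ[volume.restrict Ω] φ ∧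
      w.1.snd =ᵐ[volume.restrict Ω] magGrad A φ := by
  have h1 : MemLp φ 2 (volume.restrict Ω) := (h.memLp 2).restrict Ω
  have h2 : MemLp (magGrad A φ) 2 (volume.restrict Ω) := by
    refine MemLp.of_eval_piLp fun j => ?_
    have h3 : MemLp (fun x => fderiv ℝ φ x (EuclideanSpace.single j 1)) 2 (volume.restrict Ω) :=
      ((h.fderiv_apply _).memLp 2).restrict Ω
    have h4 : MemLp (fun x => ((A x j : ℝ) : ℂ) * φ x) 2 (volume.restrict Ω) := by
      have hAj : AEStronglyMeasurable (fun x => ((A x j : ℝ) : ℂ)) (volume.restrict Ω) :=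
        (Complex.continuous_ofReal.comp
          (EuclideanSpace.proj j : RN N →L[ℝ] ℝ).continuous).comp_aestronglyMeasurable hA
      refine MemLp.of_le_mul h1 (hAj.mul h1.aestronglyMeasurable) (c := C) ?_
      filter_upwards [hC] with x hx
      rw [norm_mul, Complex.norm_real]
      gcongr
      exact (PiLp.norm_apply_le (A x) j).trans hx
    exact (h3.const_mul (-Complex.I)).sub h4
  let w : MagPair Ω := WithLp.toLp 2 (h1.toLp φ, h2.toLp _)
  have hw1 : w.fst =ᵐ[volume.restrict Ω] φ := h1.coeFn_toLp
  have hw2 : w.snd =ᵐ[volume.restrict Ω] magGrad A φ := h2.coeFn_toLp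
  exact ⟨⟨w, Submodule.le_topologicalClosure _ ⟨φ, h, hw1, hw2⟩⟩, hw1, hw2⟩

/-- The magnetic energy of a modulated test function in terms of the Dirichlet integral. -/
theorem norm_sq_modulate_le (hΩ : MeasurableSet Ω) {A : RN N → RN N} {b y : RN N} {K : ℝ}
    (hK : ∀ x ∈ Ω, ‖b - A x‖ ≤ K)
    (hy : Metric.ball y r ⊆ Ω) {φ : RN N → ℝ} (h : IsTest (Metric.ball 0 r) φ)
    {v : RealPair (Metric.ball (0 : RN N) r)} {w : MagPair Ω}
    (hv1 : v.fst =ᵐ[volume.restrict (Metric.ball 0 r)] φ)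
    (hv2 : v.snd =ᵐ[volume.restrict (Metric.ball 0 r)] gradient φ)
    (hw1 : w.fst =ᵐ[volume.restrict Ω] modulate b y φ)
    (hw2 : w.snd =ᵐ[volume.restrict Ω] magGrad A (modulate b y φ)) :
    ‖w.fst‖ ^ 2 = ‖v.fst‖ ^ 2 ∧ ‖w.snd‖ ^ 2 ≤ ‖v.snd‖ ^ 2 + K ^ 2 * ‖v.fst‖ ^ 2 := by
  have hout : ∀ x, x ∉ Metric.ball y r → x - y ∉ Metric.ball (0 : RN N) r := by
    intro x hx; simpa [dist_eq_norm] using hx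
  rw [norm_fst_sq_congr hw1, norm_snd_sq_congr hw2, norm_fst_sq_congr hv1, norm_snd_sq_congr hv2]
  have e1 : ∫ x in Metric.ball (0 : RN N) r, ‖φ x‖ ^ 2
      = ∫ x in Ω, ‖modulate b y φ x‖ ^ 2 := by
    rw [← setIntegral_sub_ball (fun x => ‖φ x‖ ^ 2) y hy]
    refine integral_congr_ae (Filter.Eventually.of_forall fun x => ?_)
    by_cases hx : x ∈ Metric.ball y r
    · simp [hx, norm_modulate]
    · simp [hx, norm_modulate, h.eq_zero (hout x hx)]
  have i1 : Integrable (fun x => ‖fderiv ℝ φ (x - y)‖ ^ 2) (volume.restrict Ω) :=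
    (h.integrable_fderiv_sq.comp_sub_right y).restrict
  have i2 : Integrable (fun x => ‖modulate b y φ x‖ ^ 2) (volume.restrict Ω) :=
    ((isTest_modulate h hy b).memLp 2).restrict Ω |>.integrable_norm_pow (by simp)
  have e2 : ∫ x in Metric.ball (0 : RN N) r, ‖gradient φ x‖ ^ 2
      = ∫ x in Ω, ‖fderiv ℝ φ (x - y)‖ ^ 2 := by
    simp only [norm_gradient]
    rw [← setIntegral_sub_ball (fun x => ‖fderiv ℝ φ x‖ ^ 2) y hy]
    refine integral_congr_ae (Filter.Eventually.of_forall fun x => ?_)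
    by_cases hx : x ∈ Metric.ball y r
    · simp [hx]
    · simp [hx, h.fderiv_eq_zero (hout x hx)]
  refine ⟨e1.symm, ?_⟩
  rw [e1, e2, ← integral_const_mul, ← integral_add i1 (i2.const_mul _)]
  refine integral_mono_of_nonneg (Filter.Eventually.of_forall fun x => by positivity)
    (i1.add (i2.const_mul _)) ?_
  filter_upwards [ae_restrict_mem hΩ] with x hx
  rw [magGrad_modulate h, norm_modulate, Real.norm_eq_abs, sq_abs]
  have := hK x hx
  gcongr

/-- A sequence converging in `L²` has a subsequence converging almost everywhere. -/
theorem exists_subseq_tendsto_ae {α F : Type*} [MeasurableSpace α] {μ : Measure α}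
    [NormedAddCommGroup F] {f : ℕ → Lp F 2 μ} {g : Lp F 2 μ}
    (h : Filter.Tendsto f Filter.atTop (nhds g)) : ∃ ns : ℕ → ℕ, StrictMono ns ∧
      ∀ᵐ x ∂μ, Filter.Tendsto (fun k => f (ns k) x) Filter.atTop (nhds (g x)) :=
  (tendstoInMeasure_of_tendsto_Lp h).exists_seq_tendsto_ae

theorem tendsto_fst {α F G : Type*} [MeasurableSpace α] {μ : Measure α}
    [NormedAddCommGroup F] [NormedAddCommGroup G] {f : ℕ → WithLp 2 (Lp F 2 μ × Lp G 2 μ)}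
    {g : WithLp 2 (Lp F 2 μ × Lp G 2 μ)} (h : Filter.Tendsto f Filter.atTop (nhds g)) :
    Filter.Tendsto (fun n => (f n).fst) Filter.atTop (nhds g.fst) :=
  ((WithLp.prod_continuous_ofLp 2 _ _).fst.tendsto g).comp h

theorem tendsto_snd {α F G : Type*} [MeasurableSpace α] {μ : Measure α}
    [NormedAddCommGroup F] [NormedAddCommGroup G] {f : ℕ → WithLp 2 (Lp F 2 μ × Lp G 2 μ)}
    {g : WithLp 2 (Lp F 2 μ × Lp G 2 μ)} (h : Filter.Tendsto f Filter.atTop (nhds g)) :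
    Filter.Tendsto (fun n => (f n).snd) Filter.atTop (nhds g.snd) :=
  ((WithLp.prod_continuous_ofLp 2 _ _).snd.tendsto g).comp h

/-- The transplanted function `bump A u 1 y` belongs to the magnetic space. Only the oscillation
`K` of the potential around `A y` enters its energy. -/
theorem exists_bump (hΩ : MeasurableSet Ω) {A : RN N → RN N}
    (hA : AEStronglyMeasurable A (volume.restrict Ω)) {C : ℝ} (hC : ∀ x ∈ Ω, ‖A x‖ ≤ C)
    {y : RN N} {K : ℝ} (hK : ∀ x ∈ Ω, ‖A y - A x‖ ≤ K)
    (hy : Metric.ball y r ⊆ Ω) (u : H10 (Metric.ball (0 : RN N) r)) :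
    ∃ w : magSpace Ω A, w.1.fst =ᵐ[volume.restrict Ω] bump A u 1 y ∧
      ‖w.1.snd‖ ^ 2 ≤ ‖u.1.snd‖ ^ 2 + K ^ 2 * ‖u.1.fst‖ ^ 2 := by
  obtain ⟨v, φ, hv, hφ⟩ := exists_seq_H10 u
  have hCae : ∀ᵐ x ∂volume.restrict Ω, ‖A x‖ ≤ C := (ae_restrict_mem hΩ).mono hC
  choose w hw1 hw2 using fun n =>
    exists_magSpace_of_test hA hCae (isTest_modulate (hφ n).1 hy (A y))
  have hbound := fun n => norm_sq_modulate_le hΩ hK hy (hφ n).1 (hφ n).2.1 (hφ n).2.2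
    (hw1 n) (hw2 n)
  have hdiff : ∀ n m, ‖(w n).1 - (w m).1‖ ^ 2 ≤ (1 + K ^ 2) * ‖v n - v m‖ ^ 2 := by
    intro n m
    have hT : IsTest (Metric.ball 0 r) (φ n - φ m) := by
      have := (hφ n).1.add ((hφ m).1.smul (-1))
      rwa [neg_one_smul, ← sub_eq_add_neg] at this
    have hdn := (hφ n).1.differentiable
    have hdm := (hφ m).1.differentiable
    have h1 : ((v n).1 - (v m).1).fst =ᵐ[volume.restrict (Metric.ball 0 r)] (φ n - φ m) :=
      (Lp.coeFn_sub _ _).trans ((hφ n).2.1.sub (hφ m).2.1)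
    have h2 : ((v n).1 - (v m).1).snd =ᵐ[volume.restrict (Metric.ball 0 r)]
        gradient (φ n - φ m) := by
      refine (Lp.coeFn_sub _ _).trans (((hφ n).2.2.sub (hφ m).2.2).trans
        (Filter.Eventually.of_forall fun x => ?_))
      simp [gradient, fderiv_sub (hdn x) (hdm x)]
    have h3 : ((w n).1 - (w m).1).fst =ᵐ[volume.restrict Ω] modulate (A y) y (φ n - φ m) := by
      rw [modulate_sub]
      exact (Lp.coeFn_sub _ _).trans ((hw1 n).sub (hw1 m))
    have h4 : ((w n).1 - (w m).1).snd =ᵐ[volume.restrict Ω]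
        magGrad A (modulate (A y) y (φ n - φ m)) := by
      refine (Lp.coeFn_sub _ _).trans (((hw2 n).sub (hw2 m)).trans
        (Filter.Eventually.of_forall fun x => ?_))
      rw [modulate_sub]
      ext j
      simp only [magGrad, Pi.sub_apply, PiLp.sub_apply,
        fderiv_sub ((isTest_modulate (hφ n).1 hy (A y)).differentiable x)
          ((isTest_modulate (hφ m).1 hy (A y)).differentiable x), _root_.sub_apply]
      ring
    have h5 := norm_sq_modulate_le hΩ hK hy hT h1 h2 h3 h4
    have h6 : ‖v n - v m‖ ^ 2 = ‖((v n).1 - (v m).1).fst‖ ^ 2 + ‖((v n).1 - (v m).1).snd‖ ^ 2 :=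
      WithLp.prod_norm_sq_eq_of_L2 _
    rw [WithLp.prod_norm_sq_eq_of_L2, h6, h5.1]
    nlinarith [h5.2, sq_nonneg ‖((v n).1 - (v m).1).fst‖, sq_nonneg ‖((v n).1 - (v m).1).snd‖,
      mul_nonneg (sq_nonneg K) (sq_nonneg ‖((v n).1 - (v m).1).snd‖)]
  have hcau : CauchySeq fun n => (w n).1 := by
    rw [Metric.cauchySeq_iff']
    intro ε hε
    obtain ⟨n₀, hn₀⟩ := (Metric.cauchySeq_iff'.1 hv.cauchySeq) (ε / (1 + K ^ 2))
      (by positivity)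
    refine ⟨n₀, fun n hn => ?_⟩
    have h1 := hn₀ n hn
    rw [dist_eq_norm] at h1 ⊢
    refine lt_of_pow_lt_pow_left₀ 2 hε.le ((hdiff n n₀).trans_lt ?_)
    calc (1 + K ^ 2) * ‖v n - v n₀‖ ^ 2 < (1 + K ^ 2) * (ε / (1 + K ^ 2)) ^ 2 := by gcongr
      _ = ε ^ 2 / (1 + K ^ 2) := by field_simp
      _ ≤ ε ^ 2 := div_le_self (by positivity) (by nlinarith [sq_nonneg K])
  obtain ⟨W, hW⟩ := cauchySeq_tendsto_of_complete hcau
  have hWm : W ∈ magSpace Ω A :=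
    (Submodule.isClosed_topologicalClosure _).mem_of_tendsto hW
      (Filter.Eventually.of_forall fun n => (w n).2)
  have hv' : Filter.Tendsto (fun n => (v n).1) Filter.atTop (nhds u.1) :=
    (continuous_subtype_val.tendsto u).comp hv
  refine ⟨⟨W, hWm⟩, ?_, ?_⟩
  · obtain ⟨ns, hns, hae⟩ := exists_subseq_tendsto_ae (tendsto_fst hv')
    obtain ⟨ms, hms, hae'⟩ := exists_subseq_tendsto_ae
      ((tendsto_fst hW).comp hns.tendsto_atTop)
    have hpt : ∀ᵐ x ∂volume, x ∈ Metric.ball y r →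
        Filter.Tendsto (fun k => φ (ns (ms k)) (x - y)) Filter.atTop (nhds (u.1.fst (x - y))) := by
      have h1 : ∀ᵐ x ∂volume.restrict (Metric.ball (0 : RN N) r),
          Filter.Tendsto (fun k => φ (ns (ms k)) x) Filter.atTop (nhds (u.1.fst x)) := by
        filter_upwards [hae, ae_all_iff.2 fun n => (hφ n).2.1] with x hx hx2
        simp only [hx2] at hx
        exact hx.comp hms.tendsto_atTop
      rw [ae_restrict_iff' Metric.isOpen_ball.measurableSet] at h1
      have h2 := (measurePreserving_sub_right volume y).quasiMeasurePreserving.ae h1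
      filter_upwards [h2] with x hx hxb
      exact hx (by simpa [dist_eq_norm] using hxb)
    filter_upwards [hae', ae_all_iff.2 hw1, ae_restrict_of_ae hpt] with x h1 h2 h3
    simp only [Function.comp_apply, h2] at h1
    refine tendsto_nhds_unique h1 ?_
    by_cases hx : x ∈ Metric.ball y r
    · simp only [bump, hx, if_true, modulate, Complex.ofReal_one, one_mul]
      exact ((Complex.continuous_ofReal.tendsto _).comp (h3 hx)).const_mul _
    · have hx' : x - y ∉ Metric.ball (0 : RN N) r := by simpa [dist_eq_norm] using hx
      simp [bump, hx, modulate, (hφ _).1.eq_zero hx']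
  · refine le_of_tendsto_of_tendsto' ((tendsto_snd hW).norm.pow 2)
      (((tendsto_snd hv').norm.pow 2).add (((tendsto_fst hv').norm.pow 2).const_mul (K ^ 2)))
      fun n => (hbound n).2

theorem norm_bump (A : RN N → RN N) (u : H10 (Metric.ball (0 : RN N) r)) {t : ℝ} (ht : 0 ≤ t)
    (y x : RN N) :
    ‖bump A u t y x‖ = (Metric.ball y r).indicator (fun x => t * ‖u.1.fst (x - y)‖) x := by
  by_cases hx : x ∈ Metric.ball y r
  · simp only [bump, hx, if_true, indicator_of_mem, norm_mul, norm_phase, Complex.norm_real,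
      Real.norm_of_nonneg ht, mul_one]
  · simp [bump, hx]

theorem bump_eq_smul (A : RN N → RN N) (u : H10 (Metric.ball (0 : RN N) r)) (t : ℝ)
    (y x : RN N) : bump A u t y x = t • bump A u 1 y x := by
  by_cases hx : x ∈ Metric.ball y r
  · simp only [bump, hx, if_true, Complex.real_smul, Complex.ofReal_one, one_mul, mul_assoc]
  · simp [bump, hx]

theorem powInt_bump {A : RN N → RN N} {y : RN N} (hy : Metric.ball y r ⊆ Ω)
    {u : H10 (Metric.ball (0 : RN N) r)} {w : MagPair Ω} {t : ℝ} (ht : 0 ≤ t)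
    (hw : w.fst =ᵐ[volume.restrict Ω] bump A u t y) {q : ℝ} (hq : 0 < q) :
    powInt q w = t ^ q * powInt q u.1 := by
  rw [powInt_congr hw]
  unfold powInt
  rw [← integral_const_mul, ← setIntegral_sub_ball (fun x => t ^ q * ‖u.1.fst x‖ ^ q) y hy]
  refine integral_congr_ae (Filter.Eventually.of_forall fun x => ?_)
  simp only [norm_bump A u ht]
  by_cases hx : x ∈ Metric.ball y r
  · simp [hx, Real.mul_rpow ht]
  · simp [hx, Real.zero_rpow hq.ne']

theorem norm_fst_bump {A : RN N → RN N} {y : RN N} (hy : Metric.ball y r ⊆ Ω)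
    {u : H10 (Metric.ball (0 : RN N) r)} {w : MagPair Ω} {t : ℝ} (ht : 0 ≤ t)
    (hw : w.fst =ᵐ[volume.restrict Ω] bump A u t y) :
    ‖w.fst‖ ^ 2 = t ^ 2 * ‖u.1.fst‖ ^ 2 := by
  have h := powInt_bump hy ht hw two_pos
  simp only [powInt, Real.rpow_two] at h
  rw [Lp_two_norm_sq, Lp_two_norm_sq]
  exact h

theorem ball_subset_of_mem_innerSet (hΩ : IsOpen Ω) (hr : 0 < r) {y : RN N}
    (hy : y ∈ innerSet Ω r) : Metric.ball y r ⊆ Ω := by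
  refine (convex_ball y r).isPreconnected.subset_left_of_subset_union hΩ
    isClosed_closure.isOpen_compl (disjoint_compl_right.mono_left subset_closure |>.mono_right
      subset_rfl) ?_ ⟨y, Metric.mem_ball_self hr, hy.1⟩
  intro x hx
  by_contra hxn
  have hxf : x ∈ frontier Ω := by
    rw [hΩ.frontier_eq]
    simp only [mem_union, mem_compl_iff, not_or, not_not] at hxn
    exact ⟨hxn.2, hxn.1⟩
  have h1 := Metric.infDist_le_dist_of_mem (x := y) hxf
  rw [dist_comm] at h1
  exact absurd (hy.2.trans h1) (not_le.2 hx)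

end Bump

/-! ### The map `Φ` and the ground state level -/

section Phi

variable {N : ℕ} {Ω : Set (RN N)} {r κ p s Cs : ℝ} {A : RN N → RN N}

theorem HasSobolev.powInt_pos {α F G : Type*} [MeasurableSpace α] {μ : Measure α}
    [NormedAddCommGroup F] [InnerProductSpace ℝ F] [NormedAddCommGroup G] [InnerProductSpace ℝ G]
    [IsFiniteMeasure μ] {X : Submodule ℝ (WithLp 2 (Lp F 2 μ × Lp G 2 μ))}
    (hX : HasSobolev X s Cs) (hp : 0 < p) (hps : p ≤ s) {w : WithLp 2 (Lp F 2 μ × Lp G 2 μ)}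
    (hw : w ∈ X) (h0 : w.fst ≠ 0) : 0 < powInt p w :=
  (powInt_nonneg p w).lt_of_ne' fun h =>
    h0 ((powInt_eq_zero_iff hp (hX.memLp hps hw)).1 h)

theorem HasSobolev.quadForm_pos {α F G : Type*} [MeasurableSpace α] {μ : Measure α}
    [NormedAddCommGroup F] [InnerProductSpace ℝ F] [NormedAddCommGroup G] [InnerProductSpace ℝ G]
    [IsFiniteMeasure μ] {X : Submodule ℝ (WithLp 2 (Lp F 2 μ × Lp G 2 μ))}
    (hX : HasSobolev X s Cs) (hs : 0 < s) (hκ : 0 ≤ κ) {w : WithLp 2 (Lp F 2 μ × Lp G 2 μ)}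
    (hw : w ∈ X) (h0 : w.fst ≠ 0) : 0 < quadForm κ w := by
  have h1 := (hX w hw).2
  have h2 : 0 < powInt s w ^ (2 / s) := Real.rpow_pos_of_pos (hX.powInt_pos hs le_rfl hw h0) _
  have h3 : 0 < ‖w.snd‖ ^ 2 := by
    refine (sq_nonneg _).lt_of_ne' fun h4 => ?_
    rw [h4, mul_zero] at h1
    linarith
  unfold quadForm
  positivity

/-- An element of the magnetic space is determined by its first component. -/
theorem magSpace_ext (hD : volume Ω ≠ ⊤) (hA : AEStronglyMeasurable A (volume.restrict Ω)) {C : ℝ}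
    (hC : ∀ᵐ x ∂(volume.restrict Ω), ‖A x‖ ≤ C) {v w : magSpace Ω A}
    (h : v.1.fst = w.1.fst) : v = w := by
  have h1 : (v - w).1.fst = 0 := by
    rw [Submodule.coe_sub, WithLp.sub_fst, h, sub_self]
  have h2 := magSpace_snd_eq_zero hD hA hC h1
  rw [Submodule.coe_sub, WithLp.sub_snd, sub_eq_zero] at h2
  exact Subtype.ext ((WithLp.equiv 2 _).injective (Prod.ext h h2))

theorem H10_ext {D : Set (RN N)} (hD : volume D ≠ ⊤) {v w : H10 D}
    (h : v.1.fst = w.1.fst) : v = w := by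
  have h1 : (v - w).1.fst = 0 := by
    rw [Submodule.coe_sub, WithLp.sub_fst, h, sub_self]
  have h2 := H10_snd_eq_zero hD h1
  rw [Submodule.coe_sub, WithLp.sub_snd, sub_eq_zero] at h2
  exact Subtype.ext ((WithLp.equiv 2 _).injective (Prod.ext h h2))

theorem H10_fst_ne_zero {D : Set (RN N)} (hD : volume D ≠ ⊤) {u : H10 D} (hu : u ≠ 0) :
    u.1.fst ≠ 0 := fun h => hu (H10_ext hD h)

theorem H10_powInt_pos {D : Set (RN N)} (hD : volume D ≠ ⊤) (hX : HasSobolev (H10 D) s Cs)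
    (hp : 0 < p) (hps : p ≤ s) {u : H10 D} (hu : u ≠ 0) : 0 < powInt p u.1 := by
  have := isFiniteMeasure_restrict hD
  exact hX.powInt_pos hp hps u.2 (H10_fst_ne_zero hD hu)

theorem H10_quadForm_pos {D : Set (RN N)} (hD : volume D ≠ ⊤) (hX : HasSobolev (H10 D) s Cs)
    (hs : 0 < s) (hκ : 0 ≤ κ) {u : H10 D} (hu : u ≠ 0) : 0 < quadForm κ u.1 :=
  have := isFiniteMeasure_restrict hD
  hX.quadForm_pos hs hκ u.2 (H10_fst_ne_zero hD hu)

set_option maxHeartbeats 400000 in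
/-- The functions `bump A u t y` with `t > 0` meet the Nehari manifold exactly once, at a point
whose energy exceeds that of `u` at most by a factor governed by the oscillation of `A`. -/
theorem existsUnique_bump (hΩ : MeasurableSet Ω) (hfin : volume Ω ≠ ⊤)
    (hA : AEStronglyMeasurable A (volume.restrict Ω)) {C : ℝ} (hC : ∀ x ∈ Ω, ‖A x‖ ≤ C)
    (hX : HasSobolev (magSpace Ω A) s Cs) (hCs : 0 ≤ Cs) (hκ : 0 ≤ κ) (hp : 2 < p) (hps : p ≤ s)
    {u : H10 (Metric.ball (0 : RN N) r)} (hP : 0 < powInt p u.1)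
    (hu : quadForm κ u.1 = powInt p u.1) {y : RN N} (hyΩ : y ∈ Ω) (hy : Metric.ball y r ⊆ Ω) :
    (∃! v : magSpace Ω A, v ∈ magNehari Ω A κ p ∧
      ∃ t : ℝ, 0 < t ∧ v.1.fst =ᵐ[volume.restrict Ω] bump A u t y) ∧
    ∀ v : magSpace Ω A, v ∈ magNehari Ω A κ p →
      (∃ t : ℝ, 0 < t ∧ v.1.fst =ᵐ[volume.restrict Ω] bump A u t y) →
      magEnergy Ω A κ p v ≤ (1 / 2 - 1 / p) * quadForm κ u.1 *
        (1 + (2 * C) ^ 2 * ‖u.1.fst‖ ^ 2 / quadForm κ u.1) ^ (p / (p - 2)) := by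
  have hCae : ∀ᵐ x ∂volume.restrict Ω, ‖A x‖ ≤ C := (ae_restrict_mem hΩ).mono hC
  have hK : ∀ x ∈ Ω, ‖A y - A x‖ ≤ 2 * C := fun x hx => by
    refine (norm_sub_le _ _).trans ?_
    linarith [hC x hx, hC y hyΩ]
  obtain ⟨w, hw1, hw2⟩ := exists_bump hΩ hA hC hK hy u
  have hPw : powInt p w.1 = powInt p u.1 := by
    rw [powInt_bump hy zero_le_one hw1 (by linarith), Real.one_rpow, one_mul]
  have hPw0 : 0 < powInt p w.1 := hPw ▸ hP
  have hfin' := isFiniteMeasure_restrict hfin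
  have hw0 : w.1.fst ≠ 0 := by
    intro h
    rw [(powInt_eq_zero_iff (by linarith) (hX.memLp hps w.2)).2 h] at hPw0
    exact lt_irrefl _ hPw0
  have hTw0 : 0 < quadForm κ w.1 := hX.quadForm_pos (by linarith) hκ w.2 hw0
  have hrep : ∀ (v : magSpace Ω A) (t : ℝ), v.1.fst =ᵐ[volume.restrict Ω] bump A u t y →
      v = t • w := by
    intro v t hv
    refine magSpace_ext hfin hA hCae ?_
    refine Lp.ext (hv.trans (Filter.EventuallyEq.symm ?_))
    rw [Submodule.coe_smul, WithLp.smul_fst]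
    filter_upwards [Lp.coeFn_smul t w.1.fst, hw1] with x h1 h2
    rw [h1, Pi.smul_apply, h2, ← bump_eq_smul]
  have hne : ∀ t : ℝ, 0 < t → t • w ≠ 0 := by
    intro t ht h
    rcases smul_eq_zero.1 h with h | h
    · exact ht.ne' h
    · exact hw0 (by rw [h]; rfl)
  have hnehari : ∀ t : ℝ, 0 < t → (t • w ∈ magNehari Ω A κ p ↔
      t = (quadForm κ w.1 / powInt p w.1) ^ (1 / (p - 2))) := by
    intro t ht
    rw [mem_magNehari_iff hfin hX hCs hp hps, Submodule.coe_smul,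
      quadForm_smul_eq_powInt_smul_iff hp ht hPw0 hTw0]
    exact and_iff_right (hne t ht)
  set t₀ := (quadForm κ w.1 / powInt p w.1) ^ (1 / (p - 2)) with ht₀
  have ht₀pos : 0 < t₀ := by positivity
  refine ⟨⟨t₀ • w, ⟨(hnehari t₀ ht₀pos).2 rfl, t₀, ht₀pos, ?_⟩, ?_⟩, ?_⟩
  · rw [Submodule.coe_smul, WithLp.smul_fst]
    filter_upwards [Lp.coeFn_smul t₀ w.1.fst, hw1] with x h1 h2
    rw [h1, Pi.smul_apply, h2, ← bump_eq_smul]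
  · rintro v ⟨hv, t, ht, hvt⟩
    have h1 := hrep v t hvt
    rw [h1] at hv ⊢
    rw [(hnehari t ht).1 hv]
  · rintro v hv ⟨t, ht, hvt⟩
    have h1 := hrep v t hvt
    rw [h1] at hv ⊢
    have h2 := ((mem_magNehari_iff hfin hX hCs hp hps _).1 hv).2
    rw [magEnergy_eq]
    simp only [pairEnergy_eq_of_nehari h2]
    rw [Submodule.coe_smul] at h2 ⊢
    rw [quadForm_smul_of_nehari hp ht hPw0 hTw0 h2, hPw, ← hu, mul_assoc]
    have hT : 0 < quadForm κ u.1 := hu ▸ hP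
    have hp1 : 0 < 1 / 2 - 1 / p := by
      rw [sub_pos]; exact one_div_lt_one_div_of_lt two_pos hp
    refine mul_le_mul_of_nonneg_left ?_ hp1.le
    have h3 : quadForm κ w.1 ≤ quadForm κ u.1 + (2 * C) ^ 2 * ‖u.1.fst‖ ^ 2 := by
      unfold quadForm
      rw [norm_fst_bump hy zero_le_one hw1]
      linarith
    set T := quadForm κ u.1 with hTdef
    have hp2 : 0 < p - 2 := by linarith
    calc (quadForm κ w.1 / T ^ (2 / p)) ^ (p / (p - 2))
        ≤ ((T + (2 * C) ^ 2 * ‖u.1.fst‖ ^ 2) / T ^ (2 / p)) ^ (p / (p - 2)) := by gcongr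
      _ = (T ^ ((p - 2) / p) * (1 + (2 * C) ^ 2 * ‖u.1.fst‖ ^ 2 / T)) ^ (p / (p - 2)) := by
          congr 1
          have e : T ^ ((p - 2) / p) = T / T ^ (2 / p) := by
            rw [show (p - 2) / p = 1 - 2 / p by field_simp, Real.rpow_sub hT, Real.rpow_one]
          rw [e]; field_simp
      _ = T * (1 + (2 * C) ^ 2 * ‖u.1.fst‖ ^ 2 / T) ^ (p / (p - 2)) := by
          rw [Real.mul_rpow (by positivity) (by positivity), ← Real.rpow_mul hT.le,
            show (p - 2) / p * (p / (p - 2)) = 1 by field_simp, Real.rpow_one]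

/-- The ground state level is not larger than the level of any fibre. -/
theorem groundLevel_le_of_ne_zero {D : Set (RN N)} (hD : volume D ≠ ⊤)
    (hX : HasSobolev (H10 D) s Cs) (hCs : 0 ≤ Cs) (hκ : 0 ≤ κ) (hp : 2 < p) (hps : p ≤ s)
    {v : H10 D} (hv : v ≠ 0) :
    groundLevel D κ p
      ≤ (1 / 2 - 1 / p) * (quadForm κ v.1 / powInt p v.1 ^ (2 / p)) ^ (p / (p - 2)) := by
  have hP := H10_powInt_pos hD hX (by linarith) hps hv
  have hT := H10_quadForm_pos hD hX (by linarith) hκ hv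
  set t := (quadForm κ v.1 / powInt p v.1) ^ (1 / (p - 2)) with ht
  have ht0 : 0 < t := by positivity
  have h1 := (quadForm_smul_eq_powInt_smul_iff hp ht0 hP hT).2 ht
  have hmem : t • v ∈ realNehari D κ p := by
    rw [mem_realNehari_iff hD hX hCs hp hps]
    exact ⟨smul_ne_zero ht0.ne' hv, h1⟩
  have hp1 : 0 < 1 / 2 - 1 / p := by
    rw [sub_pos]; exact one_div_lt_one_div_of_lt two_pos hp
  have hb : BddBelow (realEnergy D κ p '' realNehari D κ p) := by
    refine ⟨0, ?_⟩
    rintro _ ⟨w, hw, rfl⟩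
    rw [mem_realNehari_iff hD hX hCs hp hps] at hw
    rw [realEnergy_eq]
    simp only [pairEnergy_eq_of_nehari hw.2]
    exact mul_nonneg hp1.le (quadForm_nonneg hκ _)
  refine (csInf_le hb ⟨t • v, hmem, rfl⟩).trans (le_of_eq ?_)
  rw [realEnergy_eq]
  simp only [Submodule.coe_smul]
  rw [pairEnergy_eq_of_nehari h1, quadForm_smul_of_nehari hp ht0 hP hT h1]

theorem IsTest.continuousAt_integral_rpow {D : Set (RN N)} {ψ : RN N → ℝ} (h : IsTest D ψ) {q : ℝ}
    (hq : 1 < q) : ContinuousAt (fun p : ℝ => ∫ x, ‖ψ x‖ ^ p) q := by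
  refine tendsto_integral_filter_of_dominated_convergence
    (fun x => ‖ψ x‖ ^ (1 : ℝ) + ‖ψ x‖ ^ (q + 1)) ?_ ?_
    ((h.integrable_norm_rpow one_pos).add (h.integrable_norm_rpow (by linarith))) ?_
  · filter_upwards [lt_mem_nhds hq] with p hp
    exact (h.integrable_norm_rpow (by linarith)).aestronglyMeasurable
  · filter_upwards [lt_mem_nhds hq, gt_mem_nhds (lt_add_one q)] with p hp hp2
    refine Filter.Eventually.of_forall fun x => ?_
    rw [Real.norm_of_nonneg (by positivity)]
    have := rpow_le_interpolation hp.le hp2.le (by linarith) one_pos (norm_nonneg (ψ x))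
    simpa using this
  · refine Filter.Eventually.of_forall fun x => ?_
    exact (Real.continuousAt_const_rpow' (by linarith)).tendsto

/-- The ground state level is at most `S^{N/2}/N` in the limit `p → 2*`: an almost optimal function
of the Sobolev inequality, rescaled so much that the mass term is negligible, is projected on the
Nehari manifold. -/
theorem groundLevel_le (hN : 3 ≤ N) {S : ℝ} (hS : IsBestConst N S) (hr : 0 < r) (hκ : 0 ≤ κ)
    {δ : ℝ} (hδ : 0 < δ) : ∃ p₀ ∈ Ioo 2 (critExp N), ∀ p ∈ Ico p₀ (critExp N),
      groundLevel (Metric.ball (0 : RN N) r) κ p ≤ 1 / (N : ℝ) * S ^ ((N : ℝ) / 2) + δ := by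
  have hs2 := two_lt_critExp hN
  have hS0 := hS.pos
  have hN0 : (0 : ℝ) < N := by positivity
  -- a value above `S` whose level is still admissible
  obtain ⟨S', hS', hS'δ⟩ : ∃ S' : ℝ, S < S' ∧
      1 / (N : ℝ) * S' ^ ((N : ℝ) / 2) < 1 / (N : ℝ) * S ^ ((N : ℝ) / 2) + δ := by
    have hc : ContinuousAt (fun z : ℝ => 1 / (N : ℝ) * z ^ ((N : ℝ) / 2)) S :=
      continuousAt_const.mul (Real.continuousAt_rpow_const _ _ (Or.inl hS0.ne'))
    have h1 := hc.eventually_lt_const (lt_add_of_pos_right _ hδ)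
    have h2 := (h1.filter_mono nhdsWithin_le_nhds).and (self_mem_nhdsWithin (s := Ioi S))
    obtain ⟨S', h3, h4⟩ := h2.exists
    exact ⟨S', h4, h3⟩
  obtain ⟨ψ, hψ, hψ0, hψS⟩ := hS.exists_lt ((S' - S) / 2) (by linarith)
  set I := ∫ x, ‖ψ x‖ ^ critExp N with hI
  set X := I ^ (2 / critExp N) with hX
  have hX0 : 0 < X := by positivity
  obtain ⟨t₀, ht₀, htest⟩ := isTest_rescale hψ (0 : RN N) hr
  set M := ∫ x, ‖ψ x‖ ^ (2 : ℝ) with hM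
  have hM0 : 0 ≤ M := integral_nonneg fun x => by positivity
  obtain ⟨t, ht, htt₀, htM⟩ : ∃ t : ℝ, 0 < t ∧ t ≤ t₀ ∧ κ * t ^ 2 * M ≤ (S' - S) / 2 * X := by
    have hc : ContinuousAt (fun t : ℝ => κ * t ^ 2 * M) 0 := by fun_prop
    have h0 : (fun t : ℝ => κ * t ^ 2 * M) 0 < (S' - S) / 2 * X := by
      have : 0 < (S' - S) / 2 * X := mul_pos (by linarith) hX0
      simpa using this
    have h1 := hc.eventually_lt_const h0
    have h2 := ((h1.and (gt_mem_nhds ht₀)).filter_mono nhdsWithin_le_nhds).and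
      (self_mem_nhdsWithin (s := Ioi (0 : ℝ)))
    obtain ⟨t, h3, h4⟩ := h2.exists
    exact ⟨t, h4, h3.2.le, h3.1.le⟩
  set φ := rescale ψ 0 t with hφ
  have hφt : IsTest (Metric.ball 0 r) φ := htest t ht htt₀
  obtain ⟨v, -, hv1, hv2⟩ := hφt.exists_H10
  have hsnd : ‖v.1.snd‖ ^ 2 = (t⁻¹) ^ 2 * (t ^ N * ∫ x, ‖fderiv ℝ ψ x‖ ^ 2) := by
    rw [norm_snd_sq_congr hv2, ← integral_rescale_fderiv hψ 0 ht, ← hφt.setIntegral_fderiv_sq]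
    simp only [norm_gradient]
  have hpow : ∀ q : ℝ, 0 < q → powInt q v.1 = t ^ N * ∫ x, ‖ψ x‖ ^ q := by
    intro q hq
    rw [powInt_congr hv1, hφt.setIntegral_norm_rpow hq, integral_rescale_rpow ψ 0 ht]
  have hfst : ‖v.1.fst‖ ^ 2 = t ^ N * M := by
    have h1 := hpow 2 two_pos
    simp only [powInt, Real.rpow_two] at h1
    rw [Lp_two_norm_sq, h1, hM]
    simp only [Real.rpow_two]
  have hPX : powInt (critExp N) v.1 ^ (2 / critExp N) = (t⁻¹) ^ 2 * (t ^ N * X) := by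
    rw [hpow _ (by linarith), rescale_rpow_two_div hN ht hψ0.le]
  have hquot : quadForm κ v.1 / powInt (critExp N) v.1 ^ (2 / critExp N) ≤ S' := by
    rw [div_le_iff₀ (by rw [hPX]; positivity), hPX, quadForm, hsnd, hfst]
    have h1 : (t⁻¹) ^ 2 * (t ^ N * ∫ x, ‖fderiv ℝ ψ x‖ ^ 2) + κ * (t ^ N * M)
        = (t⁻¹) ^ 2 * t ^ N * ((∫ x, ‖fderiv ℝ ψ x‖ ^ 2) + κ * t ^ 2 * M) := by
      field_simp
    rw [h1]
    calc (t⁻¹) ^ 2 * t ^ N * ((∫ x, ‖fderiv ℝ ψ x‖ ^ 2) + κ * t ^ 2 * M)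
        ≤ (t⁻¹) ^ 2 * t ^ N * ((S + (S' - S) / 2) * X + (S' - S) / 2 * X) := by gcongr
      _ = S' * ((t⁻¹) ^ 2 * (t ^ N * X)) := by ring
  have hball : volume (Metric.ball (0 : RN N) r) ≠ ⊤ := Metric.isBounded_ball.measure_lt_top.ne
  obtain ⟨Cs, hCs, hsob⟩ := exists_hasSobolev_H10 hN (Metric.ball (0 : RN N) r)
  have hv0 : v ≠ 0 := by
    intro h
    have h1 := hpow (critExp N) (by linarith)
    rw [h] at h1
    have h2 : powInt (critExp N) (0 : H10 (Metric.ball (0 : RN N) r)).1 = 0 := by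
      have h0 : (0 : Lp ℝ 2 (volume.restrict (Metric.ball (0 : RN N) r)))
          =ᵐ[volume.restrict (Metric.ball (0 : RN N) r)] 0 := Lp.coeFn_zero _ _ _
      rw [powInt_congr (f := 0) h0]
      simp [Real.zero_rpow (by linarith : critExp N ≠ 0)]
    rw [h2] at h1
    have : 0 < t ^ N * ∫ x, ‖ψ x‖ ^ critExp N := by positivity
    linarith
  have hPs := H10_powInt_pos hball hsob (by linarith : 0 < critExp N) le_rfl hv0
  have hT : 0 < quadForm κ v.1 := H10_quadForm_pos hball hsob (by linarith) hκ hv0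
  -- continuity of the level of the fibre in the exponent
  have hcont : ContinuousAt (fun p : ℝ => (1 / 2 - 1 / p) *
      (quadForm κ v.1 / (t ^ N * ∫ x, ‖ψ x‖ ^ p) ^ (2 / p)) ^ (p / (p - 2))) (critExp N) := by
    have hs0 : critExp N ≠ 0 := by linarith
    have hQ := (hψ.continuousAt_integral_rpow (by linarith : 1 < critExp N)).const_mul (t ^ N)
    have hQ0 : t ^ N * ∫ x, ‖ψ x‖ ^ critExp N ≠ 0 := by positivity
    have hden := hQ.rpow (continuousAt_const.div continuousAt_id hs0 :
      ContinuousAt (fun p : ℝ => 2 / p) (critExp N)) (Or.inl hQ0)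
    have hden0 : (t ^ N * ∫ x, ‖ψ x‖ ^ critExp N) ^ (2 / critExp N) ≠ 0 := by positivity
    have hq := (continuousAt_const (y := quadForm κ v.1)).div hden hden0
    refine (continuousAt_const.sub (continuousAt_const.div continuousAt_id hs0)).mul
      (hq.rpow (continuousAt_id.div (continuousAt_id.sub continuousAt_const)
        (by linarith)) (Or.inl ?_))
    exact (div_pos hT (by positivity)).ne'
  have hlim : (1 / 2 - 1 / critExp N) * (quadForm κ v.1 /
      (t ^ N * ∫ x, ‖ψ x‖ ^ critExp N) ^ (2 / critExp N)) ^ (critExp N / (critExp N - 2))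
      < 1 / (N : ℝ) * S ^ ((N : ℝ) / 2) + δ := by
    refine lt_of_le_of_lt ?_ hS'δ
    rw [← hpow _ (by linarith), critExp_div hN, one_div_critExp hN,
      show (1 : ℝ) / 2 - (1 / 2 - 1 / N) = 1 / N by ring]
    gcongr
  obtain ⟨p₀, hp₀, hall⟩ := eventually_exists_Ico hs2 (hcont.eventually_lt_const hlim)
  refine ⟨p₀, hp₀, fun p hp => ?_⟩
  have hp2 : 2 < p := hp₀.1.trans_le hp.1
  refine (groundLevel_le_of_ne_zero hball hsob hCs.le hκ hp2 hp.2.le hv0).trans ?_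
  rw [hpow p (by linarith)]
  exact (hall p hp).le

/-- Ground states have a small `L²` norm compared with their energy when `p` is close to `2*`: they
embed in the space without magnetic field, where almost optimal functions have small `L²` norm. -/
theorem norm_fst_le_of_nehari (hN : 3 ≤ N) {S : ℝ} (hS : IsBestConst N S) (hr : 0 < r)
    (hκ : 0 ≤ κ) {η : ℝ} (hη : 0 < η) :
    ∃ δ : ℝ, 0 < δ ∧ ∃ p₀ ∈ Ioo 2 (critExp N), ∀ p ∈ Ico p₀ (critExp N),
      ∀ u : H10 (Metric.ball (0 : RN N) r), u ≠ 0 → quadForm κ u.1 = powInt p u.1 →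
      (1 / 2 - 1 / p) * quadForm κ u.1 ≤ 1 / (N : ℝ) * S ^ ((N : ℝ) / 2) + δ →
      ‖u.1.fst‖ ^ 2 ≤ η * quadForm κ u.1 := by
  have hS0 := hS.pos
  have hs2 := two_lt_critExp hN
  set m₀ := S ^ ((N : ℝ) / 2 - 1) / 2 with hm₀
  have hm₀pos : 0 < m₀ := by positivity
  have hbd : Bornology.IsBounded (Metric.ball (0 : RN N) r) := Metric.isBounded_ball
  have hball : volume (Metric.ball (0 : RN N) r) ≠ ⊤ := hbd.measure_lt_top.ne
  obtain ⟨δ, hδ, p₀, hp₀, hopt⟩ := nehari_almost_optimal hN hS hbd (fun _ => (0 : RN N)) hκ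
    (by positivity : 0 < η * (S * m₀))
  have hsob := (exists_sobolev_remainder_mag hN hS hbd (fun _ => (0 : RN N))).1
  obtain ⟨Cs, hCs, hsobR⟩ := exists_hasSobolev_H10 hN (Metric.ball (0 : RN N) r)
  refine ⟨δ, hδ, p₀, hp₀, fun p hp u hu0 hu hE => ?_⟩
  have hp2 : 2 < p := hp₀.1.trans_le hp.1
  have hp1 : 0 < 1 / 2 - 1 / p := by
    rw [sub_pos]; exact one_div_lt_one_div_of_lt two_pos hp2
  have hP := H10_powInt_pos hball hsobR (by linarith) hp.2.le hu0
  obtain ⟨hex, hen⟩ := existsUnique_bump (A := fun _ => (0 : RN N)) (C := 0)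
    Metric.isOpen_ball.measurableSet hball aestronglyMeasurable_const
    (by simp) hsob (by positivity) hκ hp2 hp.2.le hP hu
    (Metric.mem_ball_self hr) subset_rfl
  obtain ⟨v, ⟨hv, t, ht, hvt⟩, -⟩ := hex
  have hvE := hen v hv ⟨t, ht, hvt⟩
  rw [mem_magNehari_iff hball hsob (by positivity) hp2 hp.2.le] at hv
  rw [magEnergy_eq] at hvE
  simp only [pairEnergy_eq_of_nehari hv.2, mul_zero, ne_eq, OfNat.ofNat_ne_zero,
    not_false_eq_true, zero_pow, zero_mul, zero_div, add_zero, Real.one_rpow, mul_one] at hvE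
  obtain ⟨h1, -, h3⟩ := hopt p hp v hv.1 hv.2 (hvE.trans hE)
  have hle : quadForm κ v.1 ≤ quadForm κ u.1 := le_of_mul_le_mul_left hvE hp1
  have hpow : quadForm κ v.1 = t ^ p * quadForm κ u.1 := by
    rw [hv.2, hu, powInt_bump subset_rfl ht.le hvt (by linarith)]
  have hT : 0 < quadForm κ u.1 := hu ▸ hP
  have ht1 : t ^ p ≤ 1 := by
    rw [hpow] at hle
    exact le_of_mul_le_mul_right (by linarith) hT
  have ht2 : t ^ p ≤ t ^ 2 := by
    have h4 : t ≤ 1 := by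
      by_contra h
      exact absurd (Real.one_lt_rpow (not_le.1 h) (by linarith)) (not_lt.2 ht1)
    rw [← Real.rpow_two]
    exact Real.rpow_le_rpow_of_exponent_ge ht h4 hp2.le
  have hlow : S * m₀ ≤ quadForm κ v.1 := by
    have h5 := (hsob v.1 v.2).2
    have h6 : S * powInt (critExp N) v.1 ^ (2 / critExp N) ≤ ‖v.1.snd‖ ^ 2 := by
      calc _ ≤ S * (S⁻¹ * ‖v.1.snd‖ ^ 2) := by gcongr
        _ = _ := by field_simp
    calc S * m₀ ≤ S * powInt (critExp N) v.1 ^ (2 / critExp N) := by gcongr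
      _ ≤ ‖v.1.snd‖ ^ 2 := h6
      _ ≤ quadForm κ v.1 := le_add_of_nonneg_right (by positivity)
  have h7 : t ^ 2 * ‖u.1.fst‖ ^ 2 ≤ t ^ 2 * (η * quadForm κ u.1) := by
    rw [← norm_fst_bump subset_rfl ht.le hvt]
    calc ‖v.1.fst‖ ^ 2 ≤ η * (S * m₀) := h1
      _ ≤ η * (t ^ p * quadForm κ u.1) := by rw [← hpow]; gcongr
      _ ≤ η * (t ^ 2 * quadForm κ u.1) := by gcongr
      _ = t ^ 2 * (η * quadForm κ u.1) := by ring
  exact le_of_mul_le_mul_left h7 (by positivity)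

end Phi

section Level

variable {N : ℕ} {Ω : Set (RN N)} {r κ : ℝ} {A : RN N → RN N}

theorem existsUnique_isPhi_of_pointwise {p : ℝ} {u : H10 (Metric.ball (0 : RN N) r)}
    (h : ∀ y ∈ innerSet Ω r, ∃! v : magSpace Ω A, v ∈ magNehari Ω A κ p ∧
      ∃ t : ℝ, 0 < t ∧ v.1.fst =ᵐ[volume.restrict Ω] bump A u t y) :
    ∃! Φ : innerSet Ω r → magSpace Ω A, IsPhi Ω A κ p u Φ := by
  choose Φ hΦ hΦu using fun y : innerSet Ω r => h y.1 y.2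
  exact ⟨Φ, fun y => hΦ y, fun Ψ hΨ => funext fun y => hΦu y _ (hΨ y)⟩

/-- As the ground state is small in `L²` for `p` near the critical exponent, the potential raises
the energy of its transplants only a little above the ground state level. -/
theorem exists_phi_level (hN : 3 ≤ N) (hΩo : IsOpen Ω) (hne : Ω.Nonempty)
    (hΩ : Bornology.IsBounded Ω) (hA : AEStronglyMeasurable A (volume.restrict Ω))
    {C : ℝ} (hC : ∀ x ∈ Ω, ‖A x‖ ≤ C) (hr : 0 < r) (hκ : 0 ≤ κ) {ε : ℝ} (hε : 0 < ε) :
    ∃ pbar ∈ Ioo (2 : ℝ) (critExp N), ∀ p ∈ Ico pbar (critExp N),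
      ∀ u : H10 (Metric.ball (0 : RN N) r), IsGroundState r κ p u →
        (∃! Φ : innerSet Ω r → magSpace Ω A, IsPhi Ω A κ p u Φ) ∧
        ∀ Φ : innerSet Ω r → magSpace Ω A, IsPhi Ω A κ p u Φ →
          range Φ ⊆ magNehariSublevel Ω A κ p
            (1 / (N : ℝ) * sobolevConst Ω ^ ((N : ℝ) / 2) + ε) := by
  have hfin : volume Ω ≠ ⊤ := hΩ.measure_lt_top.ne
  have hS := isBestConst_sobolevConst hN hΩo hne hfin
  set S := sobolevConst Ω with hSdef
  have hS0 := hS.pos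
  have hs2 := two_lt_critExp hN
  have hsob := (exists_sobolev_remainder_mag hN hS hΩ A).1
  have hball : volume (Metric.ball (0 : RN N) r) ≠ ⊤ := Metric.isBounded_ball.measure_lt_top.ne
  obtain ⟨Cs, hCs, hsobR⟩ := exists_hasSobolev_H10 hN (Metric.ball (0 : RN N) r)
  set E₀ := 1 / (N : ℝ) * S ^ ((N : ℝ) / 2) with hE₀
  have hE₀0 : 0 < E₀ := by positivity
  -- the exponent `p / (p - 2)` stays bounded away from `p = 2`
  set m := (2 + critExp N) / 2 with hm
  have hm2 : 2 < m := by rw [hm]; linarith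
  have hms : m < critExp N := by rw [hm]; linarith
  set Q := critExp N / (m - 2) with hQ
  have hQ0 : 0 < Q := div_pos (by linarith) (by linarith)
  obtain ⟨η, hη, hηε⟩ : ∃ η : ℝ, 0 < η ∧
      (E₀ + η) * (1 + (2 * C) ^ 2 * η) ^ Q < E₀ + ε := by
    have hc : ContinuousAt (fun η : ℝ => (E₀ + η) * (1 + (2 * C) ^ 2 * η) ^ Q) 0 := by
      refine (continuousAt_const.add continuousAt_id).mul
        (ContinuousAt.rpow_const (by fun_prop) (Or.inr hQ0.le))
    have h0 : (fun η : ℝ => (E₀ + η) * (1 + (2 * C) ^ 2 * η) ^ Q) 0 < E₀ + ε := by simpa using hε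
    have h2 := ((hc.eventually_lt_const h0).filter_mono nhdsWithin_le_nhds).and
      (self_mem_nhdsWithin (s := Ioi (0 : ℝ)))
    obtain ⟨η, h3, h4⟩ := h2.exists
    exact ⟨η, h4, h3⟩
  obtain ⟨δ, hδ, p₁, hp₁, hsmall⟩ := norm_fst_le_of_nehari (r := r) hN hS hr hκ hη
  obtain ⟨p₂, hp₂, hlevel⟩ := groundLevel_le hN hS hr hκ (lt_min hη hδ)
  refine ⟨max m (max p₁ p₂), ⟨hm2.trans_le (le_max_left _ _),
    max_lt hms (max_lt hp₁.2 hp₂.2)⟩, fun p hp u hu => ?_⟩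
  have hpm : m ≤ p := (le_max_left _ _).trans hp.1
  have hpp₁ : p₁ ≤ p := (le_max_left _ _).trans ((le_max_right _ _).trans hp.1)
  have hpp₂ : p₂ ≤ p := (le_max_right _ _).trans ((le_max_right _ _).trans hp.1)
  have hp2 : 2 < p := hm2.trans_le hpm
  have hlev := hlevel p ⟨hpp₂, hp.2⟩
  obtain ⟨hu1, hu2, -⟩ := hu
  rw [mem_realNehari_iff hball hsobR hCs.le hp2 hp.2.le] at hu1
  rw [← hu2, realEnergy_eq] at hlev
  simp only [pairEnergy_eq_of_nehari hu1.2] at hlev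
  have hT := H10_quadForm_pos hball hsobR (by linarith) hκ hu1.1
  have hP := H10_powInt_pos hball hsobR (by linarith) hp.2.le hu1.1
  have hfst := hsmall p ⟨hpp₁, hp.2⟩ u hu1.1 hu1.2
    (hlev.trans (by gcongr; exact min_le_right _ _))
  have key := fun (y : RN N) (hy : y ∈ innerSet Ω r) =>
    existsUnique_bump hΩo.measurableSet hfin hA hC hsob (by positivity) hκ hp2 hp.2.le hP hu1.2
      hy.1 (ball_subset_of_mem_innerSet hΩo hr hy)
  refine ⟨existsUnique_isPhi_of_pointwise fun y hy => (key y hy).1, ?_⟩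
  rintro Φ hΦ _ ⟨y, rfl⟩
  refine ⟨(hΦ y).1, ((key y y.2).2 _ (hΦ y).1 (hΦ y).2).trans ?_⟩
  have h1 : ‖u.1.fst‖ ^ 2 / quadForm κ u.1 ≤ η := by rwa [div_le_iff₀ hT]
  have h2 : p / (p - 2) ≤ Q := by
    rw [hQ]
    exact div_le_div₀ (by linarith) hp.2.le (by linarith) (by linarith)
  rw [mul_div_assoc]
  have h3 : (1 : ℝ) ≤ 1 + (2 * C) ^ 2 * η := le_add_of_nonneg_right (by positivity)
  calc (1 / 2 - 1 / p) * quadForm κ u.1 *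
        (1 + (2 * C) ^ 2 * (‖u.1.fst‖ ^ 2 / quadForm κ u.1)) ^ (p / (p - 2))
      ≤ (E₀ + η) * (1 + (2 * C) ^ 2 * η) ^ (p / (p - 2)) := by
        refine mul_le_mul (hlev.trans (by gcongr; exact min_le_left _ _)) ?_ (by positivity)
          (by positivity)
        refine Real.rpow_le_rpow (by positivity) (by gcongr)
          (div_nonneg (by linarith) (by linarith))
    _ ≤ (E₀ + η) * (1 + (2 * C) ^ 2 * η) ^ Q := by
        gcongr
    _ ≤ E₀ + ε := hηε.le

end Level

/-! ### Compactness of the embedding of `H¹₀` in `L²` -/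

section Rellich

variable {N : ℕ} {D : Set (RN N)}

theorem sq_integral_le {α : Type*} [MeasurableSpace α] {ν : Measure α} [IsProbabilityMeasure ν]
    {f : α → ℝ} (h1 : Integrable f ν) (h2 : Integrable (fun x => f x ^ 2) ν) :
    (∫ x, f x ∂ν) ^ 2 ≤ ∫ x, f x ^ 2 ∂ν := by
  set m := ∫ x, f x ∂ν with hm
  have h : 0 ≤ ∫ x, (f x - m) ^ 2 ∂ν := integral_nonneg fun x => sq_nonneg _
  have e : ∀ x, (f x - m) ^ 2 = f x ^ 2 - 2 * m * f x + m ^ 2 := fun x => by ring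
  simp only [e] at h
  have i4 : Integrable (fun x => f x ^ 2 - 2 * m * f x) ν := h2.sub (h1.const_mul _)
  rw [integral_add i4 (integrable_const _), integral_sub h2 (h1.const_mul _),
    integral_const_mul, ← hm, integral_const, probReal_univ, one_smul] at h
  linarith

/-- Averages of translates: if each `F (·, h)` has integral at most `I`, then so has the average. -/
theorem integral_integral_le_of_le {β : Type*} [MeasurableSpace β] [TopologicalSpace β]
    [BorelSpace β] [SecondCountableTopology β] {ν : Measure β} [IsProbabilityMeasure ν]
    {F : RN N → β → ℝ} (hF : Continuous (Function.uncurry F)) (hF0 : ∀ x h, 0 ≤ F x h)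
    (hi : ∀ h, Integrable (fun x => F x h) volume) {I : ℝ}
    (hI : ∀ᵐ h ∂ν, ∫ x, F x h ≤ I) :
    Integrable (fun x => ∫ h, F x h ∂ν) volume ∧ ∫ x, ∫ h, F x h ∂ν ≤ I := by
  have hm : AEStronglyMeasurable (Function.uncurry F) (volume.prod ν) := hF.aestronglyMeasurable
  have hmI : AEStronglyMeasurable (fun h => ∫ x, F x h) ν :=
    (hF.aestronglyMeasurable (μ := volume.prod ν)).prod_swap.integral_prod_right'
  have hIi : Integrable (fun h => ∫ x, F x h) ν := by
    refine Integrable.of_bound hmI I ?_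
    filter_upwards [hI] with h hh
    rwa [Real.norm_of_nonneg (integral_nonneg fun x => hF0 x h)]
  have hint : Integrable (Function.uncurry F) (volume.prod ν) := by
    rw [integrable_prod_iff' hm]
    refine ⟨Filter.Eventually.of_forall fun h => hi h, ?_⟩
    simpa only [Function.uncurry_apply_pair, Real.norm_of_nonneg (hF0 _ _)] using hIi
  refine ⟨hint.integral_prod_left, ?_⟩
  rw [integral_integral_swap hint]
  calc ∫ h, (∫ x, F x h) ∂ν ≤ ∫ _h, I ∂ν := integral_mono_ae hIi (integrable_const I) hI
    _ = I := by simp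

/-- Translations are Lipschitz in `L²` with constant the norm of the gradient. -/
theorem IsTest.integral_translate_sub_sq_le {φ : RN N → ℝ} (hφ : IsTest D φ) (h : RN N) :
    ∫ x, (φ (x + h) - φ x) ^ 2 ≤ ‖h‖ ^ 2 * ∫ x, ‖fderiv ℝ φ x‖ ^ 2 := by
  set ν : Measure ℝ := volume.restrict (Ioc 0 1) with hν
  have : IsProbabilityMeasure ν := ⟨by simp [hν]⟩
  have hdc : Continuous (fderiv ℝ φ) := hφ.contDiff_fderiv.continuous
  set F : RN N → ℝ → ℝ := fun x t => ‖h‖ ^ 2 * ‖fderiv ℝ φ (x + t • h)‖ ^ 2 with hF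
  have hFc : Continuous (Function.uncurry F) := by
    simp only [hF, Function.uncurry_def]; fun_prop
  have hFi : ∀ t, Integrable (fun x => F x t) volume := fun t =>
    (hφ.integrable_fderiv_sq.comp_add_right (t • h)).const_mul _
  have hFI : ∀ t, ∫ x, F x t = ‖h‖ ^ 2 * ∫ x, ‖fderiv ℝ φ x‖ ^ 2 := fun t => by
    simp only [hF]
    rw [integral_const_mul, integral_add_right_eq_self (fun x => ‖fderiv ℝ φ x‖ ^ 2) (t • h)]
  obtain ⟨h1, h2⟩ := integral_integral_le_of_le (ν := ν) hFc (fun x t => by positivity) hFi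
    (Filter.Eventually.of_forall fun t => (hFI t).le)
  refine le_trans (integral_mono_of_nonneg (Filter.Eventually.of_forall fun x => sq_nonneg _) h1
    (Filter.Eventually.of_forall fun x => ?_)) h2
  have hg : Continuous fun t : ℝ => fderiv ℝ φ (x + t • h) h := by fun_prop
  have hftc : φ (x + h) - φ x = ∫ t, fderiv ℝ φ (x + t • h) h ∂ν := by
    have hd : ∀ t ∈ uIcc (0 : ℝ) 1, HasDerivAt (fun t : ℝ => φ (x + t • h))
        (fderiv ℝ φ (x + t • h) h) t := by
      intro t _
      have e1 : HasDerivAt (fun t : ℝ => x + t • h) h t := by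
        simpa using ((hasDerivAt_id t).smul_const h).const_add x
      exact (hφ.differentiable (x + t • h)).hasFDerivAt.comp_hasDerivAt t e1
    have := intervalIntegral.integral_eq_sub_of_hasDerivAt hd (hg.intervalIntegrable 0 1)
    rw [intervalIntegral.integral_of_le zero_le_one] at this
    rw [this]; simp
  have hi : ∀ g : ℝ → ℝ, Continuous g → Integrable g ν := fun g hg =>
    (hg.integrableOn_Icc).mono_set Ioc_subset_Icc_self
  simp only
  rw [hftc]
  refine (sq_integral_le (hi _ hg) (hi _ (hg.pow 2))).trans ?_
  refine integral_mono (hi _ (hg.pow 2)) (hi _ (by fun_prop)) fun t => ?_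
  simp only [hF]
  rw [← mul_pow, ← sq_abs, mul_comm]
  refine pow_le_pow_left₀ (abs_nonneg _) ?_ 2
  exact (fderiv ℝ φ (x + t • h)).le_opNorm h

/-- Test functions are close in `L²` to their averages at small scale. -/
theorem IsTest.integral_sub_average_sq_le {φ : RN N → ℝ} (hφ : IsTest D φ) {ν : Measure (RN N)}
    [IsProbabilityMeasure ν] {δ : ℝ} (hν : ∀ᵐ h ∂ν, ‖h‖ ≤ δ) :
    Integrable (fun x => (φ x - ∫ h, φ (x + h) ∂ν) ^ 2) volume ∧
    ∫ x, (φ x - ∫ h, φ (x + h) ∂ν) ^ 2 ≤ δ ^ 2 * ∫ x, ‖fderiv ℝ φ x‖ ^ 2 := by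
  have hφc := hφ.continuous
  obtain ⟨M, hM⟩ := hφ.exists_bound
  set F : RN N → RN N → ℝ := fun x h => (φ (x + h) - φ x) ^ 2 with hF
  have hFc : Continuous (Function.uncurry F) := by
    simp only [hF, Function.uncurry_def]; fun_prop
  have hφ2 : MemLp φ 2 volume := hφ.memLp 2
  have hFi : ∀ h, Integrable (fun x => F x h) volume := fun h =>
    ((hφ2.comp_measurePreserving (measurePreserving_add_right volume h)).sub hφ2).integrable_sq
  obtain ⟨h1, h2⟩ := integral_integral_le_of_le (ν := ν) (I := δ ^ 2 * ∫ x, ‖fderiv ℝ φ x‖ ^ 2)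
    hFc (fun x t => sq_nonneg _) hFi (by
      filter_upwards [hν] with h hh
      refine (hφ.integral_translate_sub_sq_le h).trans ?_
      gcongr)
  have hpt : ∀ x, (φ x - ∫ h, φ (x + h) ∂ν) ^ 2 ≤ ∫ h, F x h ∂ν := by
    intro x
    have hb : ∀ g : RN N → ℝ, Continuous g → (∀ h, ‖g h‖ ≤ M) → Integrable g ν := fun g hg hgM =>
      Integrable.of_bound hg.aestronglyMeasurable M (Filter.Eventually.of_forall hgM)
    have i1 : Integrable (fun h => φ (x + h)) ν := hb _ (by fun_prop) fun h => hM _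
    have i2 : Integrable (fun h => φ (x + h) - φ x) ν := i1.sub (integrable_const _)
    have i3 : Integrable (fun h => (φ (x + h) - φ x) ^ 2) ν := by
      refine Integrable.of_bound (C := (2 * M) ^ 2) (by fun_prop)
        (Filter.Eventually.of_forall fun h => ?_)
      rw [norm_pow]
      refine pow_le_pow_left₀ (norm_nonneg _) ((norm_sub_le _ _).trans ?_) 2
      linarith [hM (x + h), hM x]
    have e : φ x - ∫ h, φ (x + h) ∂ν = -∫ h, (φ (x + h) - φ x) ∂ν := by
      rw [integral_sub i1 (integrable_const _)]; simp
    rw [e, neg_sq]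
    exact sq_integral_le i2 i3
  have hmeas : AEStronglyMeasurable (fun x => (φ x - ∫ h, φ (x + h) ∂ν) ^ 2) volume := by
    have : StronglyMeasurable fun x => ∫ h, φ (x + h) ∂ν := by
      have hc : Continuous (Function.uncurry fun x h : RN N => φ (x + h)) := by
        simp only [Function.uncurry_def]; fun_prop
      exact hc.stronglyMeasurable.integral_prod_right
    exact ((hφc.stronglyMeasurable.sub this).pow 2).aestronglyMeasurable
  have hint : Integrable (fun x => (φ x - ∫ h, φ (x + h) ∂ν) ^ 2) volume := by
    refine h1.mono' hmeas (Filter.Eventually.of_forall fun x => ?_)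
    rw [Real.norm_of_nonneg (sq_nonneg _)]
    exact hpt x
  exact ⟨hint, (integral_mono hint h1 hpt).trans h2⟩

/-- A bounded sequence in a separable Hilbert space has a weakly convergent subsequence. -/
theorem exists_weak_subseq {H : Type*} [NormedAddCommGroup H] [InnerProductSpace ℝ H]
    [CompleteSpace H] [TopologicalSpace.SeparableSpace H] {f : ℕ → H} {M : ℝ}
    (hf : ∀ n, ‖f n‖ ≤ M) : ∃ ns : ℕ → ℕ, StrictMono ns ∧
      ∀ g : H, ∃ a : ℝ, Filter.Tendsto (fun k => inner ℝ (f (ns k)) g) Filter.atTop (nhds a) := by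
  have hc := WeakDual.isSeqCompact_closedBall ℝ H (0 : StrongDual ℝ H) M
  obtain ⟨a, -, ns, hns, hlim⟩ := hc (x := fun n =>
    WeakDual.toStrongDual.symm (InnerProductSpace.toDual ℝ H (f n))) (fun n => by
      simpa using hf n)
  refine ⟨ns, hns, fun g => ⟨a g, ?_⟩⟩
  exact ((WeakBilin.eval_continuous _ g).tendsto a).comp hlim

/-- Rellich's theorem for sequences of test functions. -/
theorem exists_cauchy_subseq (hD : volume D ≠ ⊤) {w : ℕ → H10 D}
    {φ : ℕ → RN N → ℝ} (hφ : ∀ n, IsTest D (φ n) ∧ (w n).1.fst =ᵐ[volume.restrict D] φ n ∧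
      (w n).1.snd =ᵐ[volume.restrict D] gradient (φ n)) {M : ℝ}
    (hM1 : ∀ n, ‖(w n).1.fst‖ ≤ M) (hM2 : ∀ n, ‖(w n).1.snd‖ ≤ M) :
    ∃ ns : ℕ → ℕ, StrictMono ns ∧ CauchySeq fun k => (w (ns k)).1.fst := by
  have hfinD := isFiniteMeasure_restrict hD
  have hM0 : 0 ≤ M := (norm_nonneg _).trans (hM1 0)
  have : Fact ((2 : ℝ≥0∞) ≠ ⊤) := ⟨by simp⟩
  have : SecondCountableTopology (Lp ℝ 2 (volume.restrict D)) := inferInstance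
  obtain ⟨ns, hns, hweak⟩ := exists_weak_subseq hM1
  refine ⟨ns, hns, ?_⟩
  have key : ∀ δ : ℝ, 0 < δ → ∃ e : ℕ → ℝ, Filter.Tendsto e Filter.atTop (nhds 0) ∧
      ∀ k l, ‖(w (ns k)).1.fst - (w (ns l)).1.fst‖ ^ 2
        ≤ 4 * (2 * (δ ^ 2 * M ^ 2) + e k + e l) := by
    intro δ hδ
    set V := volume.real (Metric.ball (0 : RN N) δ) with hV
    have hVpos : 0 < V := ENNReal.toReal_pos (Metric.measure_ball_pos volume _ hδ).ne'
      Metric.isBounded_ball.measure_lt_top.ne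
    set ν : Measure (RN N) := ProbabilityTheory.cond volume (Metric.ball (0 : RN N) δ) with hν
    have hνp : IsProbabilityMeasure ν := ProbabilityTheory.cond_isProbabilityMeasure_of_finite
      (Metric.measure_ball_pos volume _ hδ).ne' Metric.isBounded_ball.measure_lt_top.ne
    have hνae : ∀ᵐ h ∂ν, ‖h‖ ≤ δ := by
      have : ∀ᵐ h ∂ν, h ∈ Metric.ball (0 : RN N) δ :=
        ProbabilityTheory.ae_cond_mem Metric.isOpen_ball.measurableSet
      filter_upwards [this] with h hh
      exact (mem_ball_zero_iff.1 hh).le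
    set Av : ℕ → RN N → ℝ := fun k x => ∫ h, φ (ns k) (x + h) ∂ν with hAv
    have hAvm : ∀ k, StronglyMeasurable (Av k) := fun k => by
      have hc : Continuous (Function.uncurry fun x h : RN N => φ (ns k) (x + h)) := by
        have := (hφ (ns k)).1.continuous
        simp only [Function.uncurry_def]; fun_prop
      exact hc.stronglyMeasurable.integral_prod_right
    -- the averages are pairings with fixed elements of `L²`
    have hpair : ∀ x, ∃ g : Lp ℝ 2 (volume.restrict D), ‖g‖ ≤ Real.sqrt (volume.real D) / V ∧
        ∀ k, Av k x = inner ℝ ((w (ns k)).1.fst) g := by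
      intro x
      have hgm : MemLp ((Metric.ball x δ).indicator fun _ => V⁻¹) 2 (volume.restrict D) :=
        (memLp_const V⁻¹).indicator Metric.isOpen_ball.measurableSet
      refine ⟨hgm.toLp _, ?_, fun k => ?_⟩
      · rw [le_div_iff₀ hVpos]
        refine Real.le_sqrt_of_sq_le ?_
        rw [mul_pow, Lp_two_norm_sq, ← integral_mul_const]
        have e : ∀ᵐ z ∂volume.restrict D, ‖hgm.toLp _ z‖ ^ 2 * V ^ 2 ≤ (1 : ℝ) := by
          filter_upwards [hgm.coeFn_toLp] with z hz
          rw [hz, Real.norm_eq_abs, sq_abs]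
          by_cases hzb : z ∈ Metric.ball x δ
          · rw [indicator_of_mem hzb, ← mul_pow, inv_mul_cancel₀ hVpos.ne', one_pow]
          · rw [indicator_of_notMem hzb]; simp
        refine (integral_mono_of_nonneg (Filter.Eventually.of_forall fun z => by positivity)
          (integrable_const (1 : ℝ)) e).trans (le_of_eq ?_)
        simp [measureReal_def]
      · rw [L2.inner_def]
        have e : ∀ᵐ z ∂volume.restrict D, inner ℝ ((w (ns k)).1.fst z) (hgm.toLp _ z)
            = (Metric.ball x δ).indicator (fun z => V⁻¹ * φ (ns k) z) z := by
          filter_upwards [hgm.coeFn_toLp, (hφ (ns k)).2.1] with z h1 h2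
          rw [h1, h2]
          by_cases hzb : z ∈ Metric.ball x δ
          · rw [indicator_of_mem hzb, indicator_of_mem hzb]; simp
          · rw [indicator_of_notMem hzb, indicator_of_notMem hzb]; simp
        rw [integral_congr_ae e, setIntegral_eq_integral_of_forall_compl_eq_zero
          (fun z hz => by simp [(hφ (ns k)).1.eq_zero hz]),
          integral_indicator Metric.isOpen_ball.measurableSet, integral_const_mul]
        simp only [hAv]
        rw [hν, ProbabilityTheory.cond, integral_smul_measure, ENNReal.toReal_inv]
        change V⁻¹ • _ = V⁻¹ * _
        rw [smul_eq_mul, ← integral_indicator Metric.isOpen_ball.measurableSet,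
          ← integral_indicator Metric.isOpen_ball.measurableSet,
          ← integral_add_left_eq_self ((Metric.ball x δ).indicator (φ (ns k))) x]
        congr 2
        ext z
        simp [indicator, dist_eq_norm]
    choose g hg1 hg2 using hpair
    choose a ha using fun x => hweak (g x)
    have hlim : ∀ x, Filter.Tendsto (fun k => Av k x) Filter.atTop (nhds (a x)) := fun x => by
      simp only [hg2 x]; exact ha x
    set K := M * (Real.sqrt (volume.real D) / V) with hK
    have hbd : ∀ k x, |Av k x| ≤ K := fun k x => by
      rw [hg2 x k]
      refine (abs_real_inner_le_norm _ _).trans ?_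
      exact mul_le_mul (hM1 _) (hg1 x) (norm_nonneg _) hM0
    have hbda : ∀ x, |a x| ≤ K := fun x =>
      le_of_tendsto' (hlim x).abs fun k => hbd k x
    have ham : Measurable a :=
      measurable_of_tendsto_metrizable (fun k => (hAvm k).measurable)
        (tendsto_pi_nhds.2 hlim)
    have hdom : ∀ k x, ‖(Av k x - a x) ^ 2‖ ≤ (2 * K) ^ 2 := fun k x => by
      rw [norm_pow, Real.norm_eq_abs]
      refine pow_le_pow_left₀ (abs_nonneg _) ((abs_sub _ _).trans ?_) 2
      linarith [hbd k x, hbda x]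
    have hi2 : ∀ k, Integrable (fun x => (Av k x - a x) ^ 2) (volume.restrict D) := fun k =>
      Integrable.of_bound (((hAvm k).measurable.sub ham).pow_const 2).aestronglyMeasurable
        ((2 * K) ^ 2) (Filter.Eventually.of_forall (hdom k))
    refine ⟨fun k => ∫ x in D, (Av k x - a x) ^ 2, ?_, fun k l => ?_⟩
    · have := tendsto_integral_of_dominated_convergence (μ := volume.restrict D)
        (F := fun k x => (Av k x - a x) ^ 2) (f := fun _ => (0 : ℝ)) (fun _ => (2 * K) ^ 2)
        (fun k => (hi2 k).aestronglyMeasurable) (integrable_const _)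
        (fun k => Filter.Eventually.of_forall (hdom k))
        (Filter.Eventually.of_forall fun x => by
          have := ((hlim x).sub_const (a x)).pow 2
          simpa using this)
      simpa using this
    · have hav := fun k => (hφ (ns k)).1.integral_sub_average_sq_le hνae
      have hgrad : ∀ k, ∫ x in D, (φ (ns k) x - Av k x) ^ 2 ≤ δ ^ 2 * M ^ 2 := fun k => by
        calc ∫ x in D, (φ (ns k) x - Av k x) ^ 2 ≤ ∫ x, (φ (ns k) x - Av k x) ^ 2 :=
              setIntegral_le_integral (hav k).1 (Filter.Eventually.of_forall fun x => sq_nonneg _)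
          _ ≤ δ ^ 2 * ∫ x, ‖fderiv ℝ (φ (ns k)) x‖ ^ 2 := (hav k).2
          _ = δ ^ 2 * ‖(w (ns k)).1.snd‖ ^ 2 := by
              rw [norm_snd_sq_congr (hφ (ns k)).2.2, ← (hφ (ns k)).1.setIntegral_fderiv_sq]
              simp only [norm_gradient]
          _ ≤ δ ^ 2 * M ^ 2 := by gcongr; exact hM2 _
      have hi1 := fun k => (hav k).1.restrict (s := D)
      have e1 : ‖(w (ns k)).1.fst - (w (ns l)).1.fst‖ ^ 2
          = ∫ x in D, (φ (ns k) x - φ (ns l) x) ^ 2 := by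
        rw [Lp_two_norm_sq]
        refine integral_congr_ae ?_
        filter_upwards [Lp.coeFn_sub (w (ns k)).1.fst (w (ns l)).1.fst, (hφ (ns k)).2.1,
          (hφ (ns l)).2.1] with x h1 h2 h3
        rw [h1, Pi.sub_apply, h2, h3, Real.norm_eq_abs, sq_abs]
      rw [e1]
      have e2 : ∫ x in D, (φ (ns k) x - φ (ns l) x) ^ 2
          ≤ ∫ x in D, 4 * (((φ (ns k) x - Av k x) ^ 2 + (φ (ns l) x - Av l x) ^ 2)
            + ((Av k x - a x) ^ 2 + (Av l x - a x) ^ 2)) := by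
        refine integral_mono_of_nonneg (Filter.Eventually.of_forall fun x => sq_nonneg _)
          ((((hi1 k).add (hi1 l)).add ((hi2 k).add (hi2 l))).const_mul 4)
          (Filter.Eventually.of_forall fun x => ?_)
        simp only
        set p := φ (ns k) x - Av k x
        set q := φ (ns l) x - Av l x
        set b := Av k x - a x
        set c := Av l x - a x
        have : φ (ns k) x - φ (ns l) x = p - q + b - c := by ring
        rw [this]
        nlinarith [sq_nonneg (p + q), sq_nonneg (p - b), sq_nonneg (p + c), sq_nonneg (q + b),
          sq_nonneg (q - c), sq_nonneg (b + c)]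
      have j1 : Integrable (fun x => (φ (ns k) x - Av k x) ^ 2 + (φ (ns l) x - Av l x) ^ 2)
        (volume.restrict D) := (hi1 k).add (hi1 l)
      have j2 : Integrable (fun x => (Av k x - a x) ^ 2 + (Av l x - a x) ^ 2)
        (volume.restrict D) := (hi2 k).add (hi2 l)
      rw [integral_const_mul, integral_add j1 j2, integral_add (hi1 k) (hi1 l),
        integral_add (hi2 k) (hi2 l)] at e2
      refine e2.trans ?_
      have := hgrad k
      have := hgrad l
      linarith
  rw [Metric.cauchySeq_iff']
  intro ε hε
  obtain ⟨e, he, hkl⟩ := key (ε / (4 * (M + 1))) (by positivity)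
  have h1 := he.eventually_lt_const (show (0 : ℝ) < ε ^ 2 / 32 by positivity)
  obtain ⟨n₀, hn₀⟩ := Filter.eventually_atTop.1 h1
  refine ⟨n₀, fun n hn => ?_⟩
  rw [dist_eq_norm]
  refine lt_of_pow_lt_pow_left₀ 2 hε.le ((hkl n n₀).trans_lt ?_)
  have h2 : (ε / (4 * (M + 1))) ^ 2 * M ^ 2 ≤ ε ^ 2 / 16 := by
    rw [div_pow, mul_pow, div_mul_eq_mul_div, div_le_div_iff₀ (by positivity) (by positivity)]
    have : M ^ 2 ≤ (M + 1) ^ 2 := by gcongr; linarith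
    nlinarith [sq_nonneg ε]
  have := hn₀ n hn
  have := hn₀ n₀ le_rfl
  nlinarith

end Rellich

/-! ### Minimisers of the Sobolev quotient -/

section Minimizers

variable {N : ℕ} {D : Set (RN N)} {s C κ p : ℝ}

theorem isClosed_H10 (D : Set (RN N)) : IsClosed (H10 D : Set (RealPair D)) :=
  Submodule.isClosed_topologicalClosure _

theorem exists_tendsto_H10 {w : ℕ → H10 D} (hw : CauchySeq fun n => (w n).1) :
    ∃ W : H10 D, Filter.Tendsto w Filter.atTop (nhds W) := by
  obtain ⟨W, hW⟩ := cauchySeq_tendsto_of_complete hw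
  exact ⟨⟨W, (isClosed_H10 D).mem_of_tendsto hW (Filter.Eventually.of_forall fun n => (w n).2)⟩,
    tendsto_subtype_rng.2 hW⟩

/-- Rellich's theorem: bounded sequences in `H¹₀` have subsequences converging in `L²`. -/
theorem exists_subseq_tendsto_fst (hD : volume D ≠ ⊤) {w : ℕ → H10 D}
    {M : ℝ} (hM : ∀ n, ‖w n‖ ≤ M) : ∃ ns : ℕ → ℕ, StrictMono ns ∧ ∃ f : Lp ℝ 2 (volume.restrict D),
      Filter.Tendsto (fun k => (w (ns k)).1.fst) Filter.atTop (nhds f) := by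
  have happ : ∀ n : ℕ, ∃ (g : H10 D) (φ : RN N → ℝ), ‖g - w n‖ ≤ 1 / ((n : ℝ) + 1) ∧ IsTest D φ ∧
      g.1.fst =ᵐ[volume.restrict D] φ ∧ g.1.snd =ᵐ[volume.restrict D] gradient φ := by
    intro n
    obtain ⟨v, φ, hv, hφ⟩ := exists_seq_H10 (w n)
    obtain ⟨k, hk⟩ := ((Metric.tendsto_nhds.1 hv) (1 / ((n : ℝ) + 1)) (by positivity)).exists
    rw [dist_eq_norm] at hk
    exact ⟨v k, φ k, hk.le, hφ k⟩
  choose g φ hg hφ using happ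
  have hgM : ∀ n, ‖(g n).1‖ ≤ M + 1 := by
    intro n
    have h1 : ‖g n‖ ≤ ‖g n - w n‖ + ‖w n‖ := by
      simpa using norm_add_le (g n - w n) (w n)
    have h2 : 1 / ((n : ℝ) + 1) ≤ 1 := by
      rw [div_le_one (by positivity)]; linarith [(Nat.cast_nonneg n : (0 : ℝ) ≤ n)]
    have h3 : ‖(g n).1‖ = ‖g n‖ := rfl
    rw [h3]
    linarith [hg n, hM n]
  obtain ⟨ns, hns, hc⟩ := exists_cauchy_subseq hD hφ
    (fun n => (WithLp.norm_fst_le _ _).trans (hgM n))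
    (fun n => (WithLp.norm_snd_le _ _).trans (hgM n))
  obtain ⟨f, hf⟩ := cauchySeq_tendsto_of_complete hc
  refine ⟨ns, hns, f, ?_⟩
  have h0 : Filter.Tendsto (fun k => (g (ns k)).1.fst - (w (ns k)).1.fst) Filter.atTop
      (nhds 0) := by
    refine squeeze_zero_norm (a := fun k => 1 / ((ns k : ℝ) + 1)) (fun k => ?_)
      (tendsto_one_div_add_atTop_nhds_zero_nat.comp hns.tendsto_atTop)
    exact (WithLp.norm_fst_le _ ((g (ns k)).1 - (w (ns k)).1)).trans (hg _)
  simpa using hf.sub h0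

theorem HasSobolev.norm_fst_sq_le {α F G : Type*} [MeasurableSpace α] {μ : Measure α}
    [NormedAddCommGroup F] [InnerProductSpace ℝ F] [NormedAddCommGroup G] [InnerProductSpace ℝ G]
    [IsFiniteMeasure μ] {X : Submodule ℝ (WithLp 2 (Lp F 2 μ × Lp G 2 μ))}
    (hX : HasSobolev X s C) (hs : 2 ≤ s) {w : WithLp 2 (Lp F 2 μ × Lp G 2 μ)} (hw : w ∈ X) :
    ‖w.fst‖ ^ 2 ≤ C * μ.real univ ^ (1 - 2 / s) * ‖w.snd‖ ^ 2 := by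
  have h1 := integral_rpow_le_of_memLp two_pos hs (hX w hw).1
  simp only [Real.rpow_two] at h1
  rw [← Lp_two_norm_sq] at h1
  refine h1.trans ?_
  have h2 := (hX w hw).2
  unfold powInt at h2
  calc _ ≤ C * ‖w.snd‖ ^ 2 * μ.real univ ^ (1 - 2 / s) := by gcongr
    _ = _ := by ring

theorem powInt_le_interpolation {α F G : Type*} [MeasurableSpace α] {μ : Measure α}
    [NormedAddCommGroup F] [NormedAddCommGroup G]
    {w : WithLp 2 (Lp F 2 μ × Lp G 2 μ)} (hp : 2 ≤ p) (hps : p ≤ s)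
    (hw : MemLp w.fst (ENNReal.ofReal s) μ) {K : ℝ} (hK : 0 < K) :
    powInt p w ≤ K ^ (p - 2) * ‖w.fst‖ ^ 2 + K ^ (p - s) * powInt s w := by
  have i1 : Integrable (fun x => ‖w.fst x‖ ^ (2 : ℝ)) μ := by
    simp only [Real.rpow_two]
    exact (Lp.memLp w.fst).integrable_norm_pow (by simp)
  have i2 : Integrable (fun x => ‖w.fst x‖ ^ s) μ :=
    integrable_norm_rpow_of_memLp (by linarith) hw
  rw [Lp_two_norm_sq]
  unfold powInt
  simp only [← Real.rpow_two]
  rw [← integral_const_mul, ← integral_const_mul, ← integral_add (i1.const_mul _) (i2.const_mul _)]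
  exact integral_mono_of_nonneg (Filter.Eventually.of_forall fun x => by positivity)
    ((i1.const_mul _).add (i2.const_mul _)) (Filter.Eventually.of_forall fun x =>
      rpow_le_interpolation hp hps (by linarith) hK (norm_nonneg _))

/-- Convergence in `L²` of a bounded sequence in a Sobolev space implies convergence in `L^p` for
subcritical `p`. -/
theorem HasSobolev.tendsto_embedding {α F G : Type*} [MeasurableSpace α] {μ : Measure α}
    [NormedAddCommGroup F] [InnerProductSpace ℝ F] [CompleteSpace F]
    [NormedAddCommGroup G] [InnerProductSpace ℝ G]
    [IsFiniteMeasure μ] {X : Submodule ℝ (WithLp 2 (Lp F 2 μ × Lp G 2 μ))}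
    (hX : HasSobolev X s C) (hC : 0 ≤ C) (hp : 2 < p) (hps : p < s)
    [Fact (1 ≤ ENNReal.ofReal p)] {j : X →L[ℝ] Lp F (ENNReal.ofReal p) μ}
    (hj : ∀ u : X, j u =ᵐ[μ] u.1.fst) {g : ℕ → X} {M : ℝ} (hM : ∀ n, ‖g n‖ ≤ M) {f : Lp F 2 μ}
    (hf : Filter.Tendsto (fun n => (g n).1.fst) Filter.atTop (nhds f)) :
    ∃ V : Lp F (ENNReal.ofReal p) μ, Filter.Tendsto (fun n => j (g n)) Filter.atTop (nhds V) ∧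
      V =ᵐ[μ] f := by
  have hs0 : 0 < s := by linarith
  have hM0 : 0 ≤ M := (norm_nonneg _).trans (hM 0)
  have hpow : ∀ u : X, ‖j u‖ ^ p = powInt p u.1 := fun u => by
    rw [Lp_norm_rpow (by linarith)]
    exact integral_congr_ae ((hj u).fun_comp fun z => ‖z‖ ^ p)
  have hpS : ∀ u : X, powInt s u.1 ≤ (C * ‖u‖ ^ 2) ^ (s / 2) := fun u => by
    have h1 := (hX u.1 u.2).2
    have h2 : powInt s u.1 ^ (2 / s) ≤ C * ‖u‖ ^ 2 :=
      h1.trans (by gcongr; exact WithLp.norm_snd_le _ u.1)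
    have h3 := Real.rpow_le_rpow (Real.rpow_nonneg (powInt_nonneg s u.1) _) h2
      (by positivity : 0 ≤ s / 2)
    rwa [← Real.rpow_mul (powInt_nonneg s u.1), show 2 / s * (s / 2) = 1 by field_simp,
      Real.rpow_one] at h3
  set L := (C * (2 * M) ^ 2) ^ (s / 2) with hL
  have hL0 : 0 ≤ L := by positivity
  have hcau : CauchySeq fun n => j (g n) := by
    rw [Metric.cauchySeq_iff']
    intro ε hε
    -- choose `K` so large that the critical part of the interpolation is small
    obtain ⟨K, hK1, hK2⟩ : ∃ K : ℝ, 0 < K ∧ K ^ (p - s) * L < ε ^ p / 2 := by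
      have h1 : Filter.Tendsto (fun K : ℝ => K ^ (p - s) * L) Filter.atTop (nhds (0 * L)) := by
        have := tendsto_rpow_neg_atTop (by linarith : 0 < s - p)
        rw [neg_sub] at this
        exact this.mul_const L
      rw [zero_mul] at h1
      have h2 := (h1.eventually_lt_const (show (0 : ℝ) < ε ^ p / 2 by positivity)).and
        (Filter.eventually_gt_atTop 0)
      obtain ⟨K, h3, h4⟩ := h2.exists
      exact ⟨K, h4, h3⟩
    obtain ⟨n₀, hn₀⟩ := Metric.cauchySeq_iff'.1 hf.cauchySeq
      (Real.sqrt (ε ^ p / (4 * K ^ (p - 2)))) (by positivity)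
    refine ⟨n₀, fun n hn => ?_⟩
    rw [dist_eq_norm, ← map_sub]
    rw [← Real.rpow_lt_rpow_iff (norm_nonneg _) hε.le (by linarith : 0 < p), hpow]
    have h1 := powInt_le_interpolation hp.le hps.le (hX _ (g n - g n₀).2).1 hK1
    have h2 : powInt s (g n - g n₀).1 ≤ L := by
      refine (hpS _).trans ?_
      rw [hL]
      have : ‖g n - g n₀‖ ≤ 2 * M := (norm_sub_le _ _).trans (by linarith [hM n, hM n₀])
      gcongr
    have h3 : ‖(g n - g n₀).1.fst‖ ^ 2 ≤ ε ^ p / (4 * K ^ (p - 2)) := by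
      have h4 := hn₀ n hn
      rw [dist_eq_norm] at h4
      have h5 := pow_le_pow_left₀ (norm_nonneg _) h4.le 2
      rwa [Real.sq_sqrt (by positivity)] at h5
    have h4 : K ^ (p - 2) * ‖(g n - g n₀).1.fst‖ ^ 2 ≤ ε ^ p / 4 := by
      calc _ ≤ K ^ (p - 2) * (ε ^ p / (4 * K ^ (p - 2))) := by gcongr
        _ = ε ^ p / 4 := by field_simp
    have h5 : K ^ (p - s) * powInt s (g n - g n₀).1 ≤ K ^ (p - s) * L := by gcongr
    have : 0 < ε ^ p := by positivity
    linarith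
  obtain ⟨V, hV⟩ := cauchySeq_tendsto_of_complete hcau
  refine ⟨V, hV, ?_⟩
  obtain ⟨ns, hns, h1⟩ := exists_subseq_tendsto_ae hf
  obtain ⟨ms, hms, h2⟩ := (tendstoInMeasure_of_tendsto_Lp
    (hV.comp hns.tendsto_atTop)).exists_seq_tendsto_ae
  filter_upwards [h1, h2, ae_all_iff.2 fun n => hj (g n)] with x hx1 hx2 hx3
  simp only [Function.comp_apply, hx3] at hx2
  exact tendsto_nhds_unique hx2 (hx1.comp hms.tendsto_atTop)

/-- The infimum of the quotient `∫ (|∇u|² + κ u²) / (∫ |u|^p)^{2/p}` over `H¹₀(D) \ {0}`. -/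
def minQuot (D : Set (RN N)) (κ p : ℝ) : ℝ :=
  sInf {q : ℝ | ∃ u : H10 D, u ≠ 0 ∧ q = quadForm κ u.1 / powInt p u.1 ^ (2 / p)}

/-- `u` minimises the quotient, normalised by `∫ |u|^p = 1`. -/
def IsMinimizer (κ p : ℝ) (u : H10 D) : Prop := quadForm κ u.1 = minQuot D κ p ∧ powInt p u.1 = 1

theorem powInt_zero {α F G : Type*} [MeasurableSpace α] {μ : Measure α}
    [NormedAddCommGroup F] [NormedAddCommGroup G] {q : ℝ} (hq : 0 < q) :
    powInt q (0 : WithLp 2 (Lp F 2 μ × Lp G 2 μ)) = 0 := by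
  have h : (0 : WithLp 2 (Lp F 2 μ × Lp G 2 μ)).fst =ᵐ[μ] (0 : α → F) := Lp.coeFn_zero _ _ _
  rw [powInt_congr h]
  simp [Real.zero_rpow hq.ne']

theorem minQuot_mul_le (hD : volume D ≠ ⊤) (hX : HasSobolev (H10 D) s C) (hκ : 0 ≤ κ)
    (hp : 2 < p) (hps : p ≤ s) (u : H10 D) :
    minQuot D κ p * powInt p u.1 ^ (2 / p) ≤ quadForm κ u.1 := by
  by_cases hu : u = 0
  · rw [hu, Submodule.coe_zero, powInt_zero (by linarith), Real.zero_rpow (by positivity), mul_zero]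
    exact quadForm_nonneg hκ _
  have hP := H10_powInt_pos hD hX (by linarith) hps hu
  rw [← le_div_iff₀ (by positivity)]
  refine csInf_le ⟨0, ?_⟩ ⟨u, hu, rfl⟩
  rintro _ ⟨v, -, rfl⟩
  have := powInt_nonneg p v.1
  have := quadForm_nonneg hκ v.1
  positivity

/-- The parallelogram identity turns convergence of an almost minimising sequence in the weaker
norms into convergence in the norm of the space. -/
theorem cauchySeq_of_almost_minimal {α F G E : Type*} [MeasurableSpace α] {μ : Measure α}
    [NormedAddCommGroup F] [InnerProductSpace ℝ F] [NormedAddCommGroup G] [InnerProductSpace ℝ G]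
    [NormedAddCommGroup E] [NormedSpace ℝ E]
    {X : Submodule ℝ (WithLp 2 (Lp F 2 μ × Lp G 2 μ))} (hκ : 0 ≤ κ) {lam : ℝ} {j : X →L[ℝ] E}
    (hlow : ∀ u : X, lam * ‖j u‖ ^ 2 ≤ quadForm κ u.1) {g : ℕ → X} {b : ℕ → ℝ}
    (hgb : ∀ n, quadForm κ (g n).1 ≤ b n) (hb : Filter.Tendsto b Filter.atTop (nhds lam))
    {f : Lp F 2 μ} (hf : Filter.Tendsto (fun n => (g n).1.fst) Filter.atTop (nhds f)) {V : E}
    (hV : Filter.Tendsto (fun n => j (g n)) Filter.atTop (nhds V)) (hV1 : ‖V‖ = 1) :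
    CauchySeq fun n => (g n).1 := by
  rw [cauchySeq_iff_tendsto_dist_atTop_0]
  have hfc := cauchySeq_iff_tendsto_dist_atTop_0.1 hf.cauchySeq
  have hfst : Filter.Tendsto (Prod.fst : ℕ × ℕ → ℕ) Filter.atTop Filter.atTop := by
    rw [← Filter.prod_atTop_atTop_eq]; exact Filter.tendsto_fst
  have hsnd : Filter.Tendsto (Prod.snd : ℕ × ℕ → ℕ) Filter.atTop Filter.atTop := by
    rw [← Filter.prod_atTop_atTop_eq]; exact Filter.tendsto_snd
  have hRlim : Filter.Tendsto (fun n : ℕ × ℕ => 2 * (b n.1 + b n.2)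
      - lam * ‖j (g n.1) + j (g n.2)‖ ^ 2) Filter.atTop (nhds 0) := by
    have e1 := (((hb.comp hfst).add (hb.comp hsnd)).const_mul 2).sub
      (((((hV.comp hfst).add (hV.comp hsnd)).norm).pow 2).const_mul lam)
    have e2 : ‖V + V‖ = 2 := by rw [← two_smul ℝ V, norm_smul, hV1]; simp
    rw [e2, show 2 * (lam + lam) - lam * 2 ^ 2 = 0 by ring] at e1
    exact e1
  have hmaj : ∀ n : ℕ × ℕ, dist (g n.1).1 (g n.2).1
      ≤ Real.sqrt (dist (g n.1).1.fst (g n.2).1.fst ^ 2 + (2 * (b n.1 + b n.2)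
        - lam * ‖j (g n.1) + j (g n.2)‖ ^ 2)) := fun n => by
    refine Real.le_sqrt_of_sq_le ?_
    rw [dist_eq_norm, dist_eq_norm, WithLp.prod_norm_sq_eq_of_L2]
    have h2 := quadForm_parallelogram κ (g n.1).1 (g n.2).1
    have h3 := hlow (g n.1 + g n.2)
    rw [map_add, Submodule.coe_add] at h3
    have h4 : ‖((g n.1).1 - (g n.2).1).snd‖ ^ 2 ≤ quadForm κ ((g n.1).1 - (g n.2).1) :=
      le_add_of_nonneg_right (by positivity)
    rw [WithLp.sub_fst]
    linarith [hgb n.1, hgb n.2]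
  refine squeeze_zero (fun n => dist_nonneg) hmaj ?_
  have h6 := ((hfc.pow 2).add hRlim).sqrt
  simpa using h6

/-- Almost minimising sequences whose `L²` limit is normalised converge to a minimiser; here the
parallelogram identity replaces weak lower semicontinuity. -/
theorem exists_minimizer_of_seq (hD : volume D ≠ ⊤)
    (hX : HasSobolev (H10 D) s C) (hC : 0 ≤ C) (hκ : 0 ≤ κ) (hp : 2 < p) (hps : p < s)
    {g : ℕ → H10 D} {b : ℕ → ℝ} (hgb : ∀ n, quadForm κ (g n).1 ≤ b n)
    (hb : Filter.Tendsto b Filter.atTop (nhds (minQuot D κ p))) :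
    ∃ ns : ℕ → ℕ, StrictMono ns ∧ ∃ f : Lp ℝ 2 (volume.restrict D),
      Filter.Tendsto (fun k => (g (ns k)).1.fst) Filter.atTop (nhds f) ∧
      Filter.Tendsto (fun k => powInt p (g (ns k)).1) Filter.atTop
        (nhds (∫ x in D, ‖f x‖ ^ p)) ∧
      (∫ x in D, ‖f x‖ ^ p = 1 → ∃ w : H10 D, w.1.fst = f ∧ IsMinimizer κ p w) := by
  have hfinD := isFiniteMeasure_restrict hD
  have hp0 : 0 < p := by linarith
  -- boundedness in `H¹₀`
  obtain ⟨M₀, hM₀⟩ := hb.bddAbove_range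
  have hbM : ∀ n, b n ≤ M₀ := fun n => hM₀ ⟨n, rfl⟩
  set K := C * (volume.restrict D).real univ ^ (1 - 2 / s) with hK
  have hK0 : 0 ≤ K := by positivity
  have hsnd : ∀ n, ‖(g n).1.snd‖ ^ 2 ≤ M₀ := fun n => by
    refine le_trans ?_ ((hgb n).trans (hbM n))
    exact le_add_of_nonneg_right (by positivity)
  have hbound : ∀ n, ‖g n‖ ≤ Real.sqrt ((K + 1) * M₀) := fun n => by
    refine Real.le_sqrt_of_sq_le ?_
    have h1 : ‖g n‖ ^ 2 = ‖(g n).1.fst‖ ^ 2 + ‖(g n).1.snd‖ ^ 2 := WithLp.prod_norm_sq_eq_of_L2 _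
    have h2 := hX.norm_fst_sq_le (by linarith) (g n).2
    rw [h1]
    calc _ ≤ K * ‖(g n).1.snd‖ ^ 2 + ‖(g n).1.snd‖ ^ 2 := by gcongr
      _ = (K + 1) * ‖(g n).1.snd‖ ^ 2 := by ring
      _ ≤ _ := by gcongr; exact hsnd n
  obtain ⟨ns, hns, f, hf⟩ := exists_subseq_tendsto_fst hD hbound
  have hfact : Fact (1 ≤ ENNReal.ofReal p) := ⟨by
    rw [← ENNReal.ofReal_one]; exact ENNReal.ofReal_le_ofReal (by linarith)⟩
  obtain ⟨j, hj⟩ := hX.exists_embedding hC hp0 hps.le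
  obtain ⟨V, hV, hVf⟩ := hX.tendsto_embedding hC hp hps hj (fun k => hbound (ns k)) hf
  have hpow : ∀ u : H10 D, ‖j u‖ ^ p = powInt p u.1 := fun u => by
    rw [Lp_norm_rpow hp0]
    exact integral_congr_ae ((hj u).fun_comp fun z => ‖z‖ ^ p)
  have hVpow : ‖V‖ ^ p = ∫ x in D, ‖f x‖ ^ p := by
    rw [Lp_norm_rpow hp0]
    exact integral_congr_ae (hVf.fun_comp fun z => ‖z‖ ^ p)
  have hPlim : Filter.Tendsto (fun k => powInt p (g (ns k)).1) Filter.atTop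
      (nhds (∫ x in D, ‖f x‖ ^ p)) := by
    rw [← hVpow]
    simp only [← hpow]
    exact hV.norm.rpow_const (Or.inr hp0.le)
  refine ⟨ns, hns, f, hf, hPlim, fun h1 => ?_⟩
  have hV1 : ‖V‖ = 1 := by
    rw [h1] at hVpow
    rwa [← Real.one_rpow p, Real.rpow_left_inj (norm_nonneg _) zero_le_one hp0.ne'] at hVpow
  set lam := minQuot D κ p with hlam
  have hlow : ∀ u : H10 D, lam * ‖j u‖ ^ 2 ≤ quadForm κ u.1 := fun u => by
    have h2 := minQuot_mul_le hD hX hκ hp hps.le u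
    rwa [← hpow, ← Real.rpow_mul (norm_nonneg _), show p * (2 / p) = 2 by field_simp,
      Real.rpow_two] at h2
  have hcau : CauchySeq fun k => (g (ns k)).1 :=
    cauchySeq_of_almost_minimal hκ hlow (fun k => hgb (ns k)) (hb.comp hns.tendsto_atTop) hf hV hV1
  obtain ⟨W, hW⟩ := exists_tendsto_H10 hcau
  have hW' : Filter.Tendsto (fun k => (g (ns k)).1) Filter.atTop (nhds W.1) :=
    (continuous_subtype_val.tendsto W).comp hW
  have hWf : W.1.fst = f := tendsto_nhds_unique (tendsto_fst hW') hf
  have hWP : powInt p W.1 = 1 := by rw [← h1, ← hWf]; rfl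
  refine ⟨W, hWf, le_antisymm ?_ ?_, hWP⟩
  · have h2 : Filter.Tendsto (fun k => quadForm κ (g (ns k)).1) Filter.atTop
        (nhds (quadForm κ W.1)) :=
      ((differentiable_quadForm (H10 D) κ).continuous.tendsto W).comp hW
    exact le_of_tendsto_of_tendsto' h2 (hb.comp hns.tendsto_atTop) fun k => hgb _
  · have h2 := minQuot_mul_le hD hX hκ hp hps.le W
    rwa [hWP, Real.one_rpow, mul_one] at h2

/-- The Sobolev quotient of a subcritical exponent attains its minimum. -/
theorem exists_minimizer (hD : volume D ≠ ⊤)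
    (hX : HasSobolev (H10 D) s C) (hC : 0 ≤ C) (hκ : 0 ≤ κ) (hp : 2 < p) (hps : p < s)
    (hne : ∃ u : H10 D, u ≠ 0) : ∃ w : H10 D, IsMinimizer κ p w := by
  obtain ⟨u₀, hu₀⟩ := hne
  have hp0 : 0 < p := by linarith
  have hseq : ∀ n : ℕ, ∃ g : H10 D, powInt p g.1 = 1 ∧
      quadForm κ g.1 ≤ minQuot D κ p + 1 / ((n : ℝ) + 1) := by
    intro n
    have h0 : (0 : ℝ) < 1 / ((n : ℝ) + 1) := by positivity
    obtain ⟨_, ⟨u, hu, rfl⟩, hlt⟩ := Real.lt_sInf_add_pos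
      (s := {q : ℝ | ∃ u : H10 D, u ≠ 0 ∧ q = quadForm κ u.1 / powInt p u.1 ^ (2 / p)})
      ⟨_, u₀, hu₀, rfl⟩ h0
    have hP := H10_powInt_pos hD hX hp0 hps.le hu
    refine ⟨(powInt p u.1 ^ (-(1 / p))) • u, ?_, ?_⟩
    · rw [Submodule.coe_smul, powInt_smul p (by positivity), ← Real.rpow_mul hP.le,
        show -(1 / p) * p = -1 by field_simp, Real.rpow_neg_one, inv_mul_cancel₀ hP.ne']
    · rw [Submodule.coe_smul, quadForm_smul, ← Real.rpow_natCast, ← Real.rpow_mul hP.le]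
      have e : powInt p u.1 ^ (-(1 / p) * ((2 : ℕ) : ℝ)) * quadForm κ u.1
          = quadForm κ u.1 / powInt p u.1 ^ (2 / p) := by
        rw [show -(1 / p) * ((2 : ℕ) : ℝ) = -(2 / p) by push_cast; ring, Real.rpow_neg hP.le]
        field_simp
      rw [e]
      exact hlt.le
  choose g hg1 hg2 using hseq
  obtain ⟨ns, hns, f, hf, hPlim, hmin⟩ := exists_minimizer_of_seq hD hX hC hκ hp hps hg2 (by
    simpa using tendsto_one_div_add_atTop_nhds_zero_nat.const_add (minQuot D κ p))
  simp only [hg1] at hPlim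
  obtain ⟨w, -, hw⟩ := hmin (tendsto_nhds_unique hPlim tendsto_const_nhds)
  exact ⟨w, hw⟩

/-- Almost minimising sequences converging almost everywhere to a normalised function: the limit
is a minimiser. -/
theorem exists_minimizer_of_ae_tendsto (hD : volume D ≠ ⊤)
    (hX : HasSobolev (H10 D) s C) (hC : 0 ≤ C) (hκ : 0 ≤ κ) (hp : 2 < p) (hps : p < s)
    {g : ℕ → H10 D} {b : ℕ → ℝ} (hgb : ∀ n, quadForm κ (g n).1 ≤ b n)
    (hb : Filter.Tendsto b Filter.atTop (nhds (minQuot D κ p))) {U : RN N → ℝ}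
    (hU : ∀ᵐ x ∂volume.restrict D, Filter.Tendsto (fun n => (g n).1.fst x) Filter.atTop
      (nhds (U x))) (hU1 : ∫ x in D, ‖U x‖ ^ p = 1) :
    ∃ w : H10 D, w.1.fst =ᵐ[volume.restrict D] U ∧ IsMinimizer κ p w := by
  obtain ⟨ns, hns, f, hf, -, hmin⟩ := exists_minimizer_of_seq hD hX hC hκ hp hps hgb hb
  obtain ⟨ms, hms, h2⟩ := exists_subseq_tendsto_ae hf
  have hfU : f =ᵐ[volume.restrict D] U := by
    filter_upwards [h2, hU] with x hx1 hx2
    exact tendsto_nhds_unique hx1 (hx2.comp (hns.comp hms).tendsto_atTop)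
  obtain ⟨w, hw, hw2⟩ := hmin (by
    rw [← hU1]; exact integral_congr_ae (hfU.fun_comp fun z => ‖z‖ ^ p))
  exact ⟨w, by rw [hw]; exact hfU, hw2⟩

/-- Among the minimisers there is one with least second moment `∫ u² |x|²`. -/
theorem exists_minimizer_second_moment (hDm : MeasurableSet D) (hDb : Bornology.IsBounded D)
    (hX : HasSobolev (H10 D) s C) (hC : 0 ≤ C) (hκ : 0 ≤ κ) (hp : 2 < p) (hps : p < s)
    (hne : ∃ u : H10 D, u ≠ 0) : ∃ w : H10 D, IsMinimizer κ p w ∧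
      ∀ v : H10 D, IsMinimizer κ p v →
        ∫ x in D, ‖x‖ ^ 2 * w.1.fst x ^ 2 ≤ ∫ x in D, ‖x‖ ^ 2 * v.1.fst x ^ 2 := by
  have hD : volume D ≠ ⊤ := hDb.measure_lt_top.ne
  obtain ⟨w₀, hw₀⟩ := exists_minimizer hD hX hC hκ hp hps hne
  set V : H10 D → ℝ := fun u => ∫ x in D, ‖x‖ ^ 2 * u.1.fst x ^ 2 with hV
  set A := V '' {u | IsMinimizer κ p u} with hA
  have hAne : A.Nonempty := ⟨_, w₀, hw₀, rfl⟩
  have hAb : BddBelow A := ⟨0, by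
    rintro _ ⟨u, -, rfl⟩
    exact integral_nonneg fun x => by positivity⟩
  obtain ⟨a, -, ha, haA⟩ := exists_seq_tendsto_sInf hAne hAb
  choose u hu hua using haA
  obtain ⟨ns, hns, f, hf, hPlim, hmin⟩ := exists_minimizer_of_seq hD hX hC hκ hp hps
    (g := u) (b := fun _ => minQuot D κ p) (fun n => (hu n).1.le) tendsto_const_nhds
  have hone : ∀ n, powInt p (u n).1 = 1 := fun n => (hu n).2
  simp only [hone] at hPlim
  obtain ⟨w, hwf, hw⟩ := hmin (tendsto_nhds_unique hPlim tendsto_const_nhds)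
  refine ⟨w, hw, fun v hv => ?_⟩
  -- the second moment is continuous in `L²`
  obtain ⟨R, hR, hDR⟩ : ∃ R : ℝ, 0 < R ∧ ∀ x ∈ D, ‖x‖ ≤ R := hDb.exists_pos_norm_le
  have hmem : ∀ f : Lp ℝ 2 (volume.restrict D), MemLp (fun x => ‖x‖ * f x) 2
      (volume.restrict D) := fun f => by
    refine MemLp.of_le_mul (c := R) (Lp.memLp f)
      (continuous_norm.aestronglyMeasurable.mul (Lp.aestronglyMeasurable f)) ?_
    filter_upwards [ae_restrict_mem hDm] with x hx
    rw [norm_mul, norm_norm]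
    gcongr
    exact hDR x hx
  have hlim : Filter.Tendsto (fun k => V (u (ns k))) Filter.atTop (nhds (V w)) := by
    let m : Lp ℝ 2 (volume.restrict D) → Lp ℝ 2 (volume.restrict D) := fun f => (hmem f).toLp _
    have hmV : ∀ v : H10 D, V v = ‖m v.1.fst‖ ^ 2 := fun v => by
      rw [Lp_two_norm_sq]
      refine integral_congr_ae ?_
      filter_upwards [(hmem v.1.fst).coeFn_toLp] with x hx
      rw [hx, norm_mul, norm_norm, mul_pow, Real.norm_eq_abs, sq_abs]
    have hmL : ∀ f g : Lp ℝ 2 (volume.restrict D), ‖m f - m g‖ ≤ R * ‖f - g‖ := fun f g => by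
      refine Lp.norm_le_mul_norm_of_ae_le_mul ?_
      filter_upwards [(hmem f).coeFn_toLp, (hmem g).coeFn_toLp, Lp.coeFn_sub (m f) (m g),
        Lp.coeFn_sub f g, ae_restrict_mem hDm] with x h1 h2 h3 h4 hx
      rw [h3, h4, Pi.sub_apply, Pi.sub_apply, h1, h2, ← mul_sub, norm_mul, norm_norm]
      gcongr
      exact hDR x hx
    simp only [hmV]
    have hmt : Filter.Tendsto (fun k => m (u (ns k)).1.fst) Filter.atTop (nhds (m w.1.fst)) := by
      rw [tendsto_iff_norm_sub_tendsto_zero] at hf ⊢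
      rw [hwf]
      refine squeeze_zero (fun k => norm_nonneg _) (fun k => hmL _ _) ?_
      simpa using hf.const_mul R
    exact hmt.norm.pow 2
  have hVw : V w = sInf A := tendsto_nhds_unique hlim (by
    simp only [hua]; exact ha.comp hns.tendsto_atTop)
  change V w ≤ V v
  rw [hVw]
  exact csInf_le hAb ⟨v, hv, rfl⟩

/-- If `v` minimises `T - λ P^{2/p}`, where `T` is the quadratic form and `P` the integral of the
`p`-th power, and `T v = P v`, then `v` is a critical point of the energy. -/
theorem HasSobolev.fderiv_pairEnergy_eq_zero {α F G : Type*} [MeasurableSpace α] {μ : Measure α}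
    [NormedAddCommGroup F] [InnerProductSpace ℝ F] [NormedAddCommGroup G] [InnerProductSpace ℝ G]
    [IsFiniteMeasure μ] {X : Submodule ℝ (WithLp 2 (Lp F 2 μ × Lp G 2 μ))}
    (hX : HasSobolev X s C) (hC : 0 ≤ C) (hp : 2 < p) (hps : p ≤ s) {lam : ℝ} {v : X}
    (hP : 0 < powInt p v.1) (hv : quadForm κ v.1 = powInt p v.1)
    (hlam : lam * powInt p v.1 ^ (2 / p) = quadForm κ v.1)
    (hle : ∀ w : X, lam * powInt p w.1 ^ (2 / p) ≤ quadForm κ w.1) :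
    fderiv ℝ (fun u : X => pairEnergy κ p u.1) v = 0 := by
  rw [hX.fderiv_pairEnergy hC κ hp hps]
  have dT := (differentiable_quadForm X κ v).hasFDerivAt
  have dP := (hX.differentiable_powInt hC hp hps v).hasFDerivAt
  generalize fderiv ℝ (fun u : X => quadForm κ u.1) v = T' at dT ⊢
  generalize fderiv ℝ (fun u : X => powInt p u.1) v = P' at dP ⊢
  have hmin : IsLocalMin (fun w : X => quadForm κ w.1 - lam * powInt p w.1 ^ (2 / p)) v := by
    refine Filter.Eventually.of_forall fun w => ?_
    simp only
    rw [hlam, sub_self, sub_nonneg]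
    exact hle w
  have hd := dT.sub ((dP.rpow_const (p := 2 / p) (Or.inl hP.ne')).const_mul lam)
  have h0 := hmin.hasFDerivAt_eq_zero hd
  have hcoef : lam * (2 / p * powInt p v.1 ^ (2 / p - 1)) = 2 / p := by
    rw [Real.rpow_sub hP, Real.rpow_one]
    rw [hv] at hlam
    field_simp
    rw [hlam]
  rw [smul_smul, hcoef, sub_eq_zero] at h0
  rw [h0, smul_smul, show (1 / 2 : ℝ) * (2 / p) = 1 / p by field_simp, sub_self]

set_option maxHeartbeats 1000000 in
/-- A minimiser of the quotient, suitably scaled, is a critical point at the ground state level. -/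
theorem IsMinimizer.exists_critical (hD : volume D ≠ ⊤) (hX : HasSobolev (H10 D) s C)
    (hC : 0 ≤ C) (hκ : 0 ≤ κ) (hp : 2 < p) (hps : p ≤ s) {u : H10 D} (hu : IsMinimizer κ p u) :
    ∃ t : ℝ, 0 < t ∧ t • u ∈ realNehari D κ p ∧ realEnergy D κ p (t • u) = groundLevel D κ p ∧
      fderiv ℝ (realEnergy D κ p) (t • u) = 0 := by
  have hfinD := isFiniteMeasure_restrict hD
  have hp0 : 0 < p := by linarith
  have hp1 : 0 < 1 / 2 - 1 / p := by
    rw [sub_pos]; exact one_div_lt_one_div_of_lt two_pos hp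
  have hu0 : u ≠ 0 := by
    intro h
    have := hu.2
    rw [h, Submodule.coe_zero, powInt_zero hp0] at this
    exact zero_ne_one this
  have hT := H10_quadForm_pos hD hX (by linarith) hκ hu0
  have hP : 0 < powInt p u.1 := by rw [hu.2]; exact one_pos
  set lam := minQuot D κ p with hlam
  have hlam0 : 0 < lam := by rw [hlam, ← hu.1]; exact hT
  set t := (quadForm κ u.1 / powInt p u.1) ^ (1 / (p - 2)) with ht
  have ht0 : 0 < t := by positivity
  have hneh := (quadForm_smul_eq_powInt_smul_iff hp ht0 hP hT).2 ht
  have hval := quadForm_smul_of_nehari hp ht0 hP hT hneh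
  rw [hu.2, Real.one_rpow, div_one, hu.1] at hval
  set v := t • u with hv
  have hvneh : quadForm κ v.1 = powInt p v.1 := hneh
  have hv0 : v ≠ 0 := smul_ne_zero ht0.ne' hu0
  have hmem : v ∈ realNehari D κ p := by
    rw [mem_realNehari_iff hD hX hC hp hps]; exact ⟨hv0, hvneh⟩
  have hTv : quadForm κ v.1 = lam ^ (p / (p - 2)) := hval
  have hTv0 : 0 < quadForm κ v.1 := by rw [hTv]; positivity
  have hPv0 : 0 < powInt p v.1 := hvneh ▸ hTv0
  have hEv : realEnergy D κ p v = (1 / 2 - 1 / p) * lam ^ (p / (p - 2)) := by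
    rw [realEnergy_eq]
    simp only [pairEnergy_eq_of_nehari hvneh, hTv]
  refine ⟨t, ht0, hmem, ?_, ?_⟩
  · refine le_antisymm ?_ ?_
    · rw [hEv]
      refine le_csInf ⟨_, v, hmem, rfl⟩ ?_
      rintro _ ⟨w, hw, rfl⟩
      rw [mem_realNehari_iff hD hX hC hp hps] at hw
      rw [realEnergy_eq]
      simp only [pairEnergy_eq_of_nehari hw.2]
      refine mul_le_mul_of_nonneg_left ?_ hp1.le
      have hTw := H10_quadForm_pos hD hX (by linarith) hκ hw.1
      have h1 := minQuot_mul_le hD hX hκ hp hps w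
      rw [← hw.2] at h1
      set T := quadForm κ w.1 with hTdef
      have h2 : lam ≤ T ^ ((p - 2) / p) := by
        rw [show (p - 2) / p = 1 - 2 / p by field_simp, Real.rpow_sub hTw, Real.rpow_one,
          le_div_iff₀ (by positivity)]
        exact h1
      have h3 := Real.rpow_le_rpow hlam0.le h2
        (div_nonneg hp0.le (by linarith) : 0 ≤ p / (p - 2))
      have hp2 : p - 2 ≠ 0 := by linarith
      rwa [← Real.rpow_mul hTw.le, show (p - 2) / p * (p / (p - 2)) = 1 by field_simp,
        Real.rpow_one] at h3
    · have hb : BddBelow (realEnergy D κ p '' realNehari D κ p) := by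
        refine ⟨0, ?_⟩
        rintro _ ⟨w, hw, rfl⟩
        rw [mem_realNehari_iff hD hX hC hp hps] at hw
        rw [realEnergy_eq]
        simp only [pairEnergy_eq_of_nehari hw.2]
        exact mul_nonneg hp1.le (quadForm_nonneg hκ _)
      exact csInf_le hb ⟨v, hmem, rfl⟩
  · have hlamP : lam * powInt p v.1 ^ (2 / p) = quadForm κ v.1 := by
      have hp2 : p - 2 ≠ 0 := by linarith
      rw [← hvneh, hTv, ← Real.rpow_mul hlam0.le]
      have e : p / (p - 2) = 1 + p / (p - 2) * (2 / p) := by field_simp; ring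
      conv_rhs => rw [e]
      rw [Real.rpow_add hlam0, Real.rpow_one]
    rw [realEnergy_eq]
    exact hX.fderiv_pairEnergy_eq_zero hC hp hps hPv0 hvneh hlamP
      (minQuot_mul_le hD hX hκ hp hps)

end Minimizers

/-! ### Smoothed positive parts -/

section SoftPos

/-- A smooth approximation of `max t 0`, vanishing for `t ≤ ε` and with slope in `[0, 1]`. -/
def softPos (ε t : ℝ) : ℝ := ∫ s in (0 : ℝ)..t, Real.smoothTransition (s / ε - 1)

variable {ε : ℝ}

theorem continuous_softPos_slope (ε : ℝ) :
    Continuous fun s : ℝ => Real.smoothTransition (s / ε - 1) :=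
  Real.smoothTransition.continuous.comp (by fun_prop)

theorem hasDerivAt_softPos (ε t : ℝ) :
    HasDerivAt (softPos ε) (Real.smoothTransition (t / ε - 1)) t :=
  intervalIntegral.integral_hasDerivAt_right
    ((continuous_softPos_slope ε).intervalIntegrable _ _)
    ((continuous_softPos_slope ε).stronglyMeasurableAtFilter _ _)
    (continuous_softPos_slope ε).continuousAt

theorem contDiff_softPos (ε : ℝ) : ContDiff ℝ ∞ (softPos ε) := by
  rw [contDiff_infty_iff_deriv]
  refine ⟨fun t => (hasDerivAt_softPos ε t).differentiableAt, ?_⟩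
  have : deriv (softPos ε) = fun t => Real.smoothTransition (t / ε - 1) :=
    funext fun t => (hasDerivAt_softPos ε t).deriv
  rw [this]
  exact Real.smoothTransition.contDiff.comp (by fun_prop)

theorem softPos_eq_zero (hε : 0 < ε) {t : ℝ} (ht : t ≤ ε) : softPos ε t = 0 := by
  unfold softPos
  rw [intervalIntegral.integral_congr (g := fun _ => (0 : ℝ))]
  · simp
  · intro s hs
    refine Real.smoothTransition.zero_of_nonpos ?_
    rw [sub_nonpos, div_le_one hε]
    exact hs.2.trans (max_le hε.le ht)

theorem softPos_nonneg (hε : 0 < ε) (t : ℝ) : 0 ≤ softPos ε t := by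
  rcases le_total t ε with h | h
  · exact (softPos_eq_zero hε h).ge
  · exact intervalIntegral.integral_nonneg (hε.le.trans h) fun s _ =>
      Real.smoothTransition.nonneg _

theorem softPos_le (hε : 0 < ε) (t : ℝ) : softPos ε t ≤ max t 0 := by
  rcases le_total t ε with h | h
  · rw [softPos_eq_zero hε h]; exact le_max_right _ _
  · refine le_trans ?_ (le_max_left _ _)
    have := intervalIntegral.integral_mono_on (hε.le.trans h)
      ((continuous_softPos_slope ε).intervalIntegrable 0 t)
      (intervalIntegrable_const (μ := volume) (c := (1 : ℝ)))
      (fun s _ => Real.smoothTransition.le_one _)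
    simpa [softPos] using this

theorem le_softPos (hε : 0 < ε) (t : ℝ) : max t 0 - 2 * ε ≤ softPos ε t := by
  have h0 := softPos_nonneg hε t
  rcases le_total t (2 * ε) with h | h
  · have : max t 0 ≤ 2 * ε := max_le h (by linarith)
    linarith
  · have h1 : softPos ε t = softPos ε (2 * ε) + ∫ s in (2 * ε)..t,
        Real.smoothTransition (s / ε - 1) :=
      (intervalIntegral.integral_add_adjacent_intervals
        ((continuous_softPos_slope ε).intervalIntegrable _ _)
        ((continuous_softPos_slope ε).intervalIntegrable _ _)).symm
    have h2 : ∫ s in (2 * ε)..t, Real.smoothTransition (s / ε - 1) = t - 2 * ε := by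
      rw [intervalIntegral.integral_congr (g := fun _ => (1 : ℝ))]
      · simp
      · intro s hs
        refine Real.smoothTransition.one_of_one_le ?_
        rw [uIcc_of_le h] at hs
        have : 2 ≤ s / ε := by rw [le_div_iff₀ hε]; exact hs.1
        linarith
    have h3 := softPos_nonneg hε (2 * ε)
    rw [max_eq_left (by linarith)]
    linarith

theorem tendsto_softPos {e t : ℕ → ℝ} (he0 : ∀ n, 0 < e n)
    (he : Filter.Tendsto e Filter.atTop (nhds 0)) {t₀ : ℝ}
    (ht : Filter.Tendsto t Filter.atTop (nhds t₀)) :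
    Filter.Tendsto (fun n => softPos (e n) (t n)) Filter.atTop (nhds (max t₀ 0)) := by
  have h1 : Filter.Tendsto (fun n => max (t n) 0) Filter.atTop (nhds (max t₀ 0)) :=
    ht.max tendsto_const_nhds
  refine tendsto_of_tendsto_of_tendsto_of_le_of_le (g := fun n => max (t n) 0 - 2 * e n)
    (h := fun n => max (t n) 0) ?_ h1 (fun n => le_softPos (he0 n) _)
    (fun n => softPos_le (he0 n) _)
  simpa using h1.sub (he.const_mul 2)

variable {N : ℕ} {D : Set (RN N)}

/-- Composition with smooth contractions fixing zero keeps test functions, and does not increase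
their energy densities. -/
theorem IsTest.comp_left {φ : RN N → ℝ} (hφ : IsTest D φ) {θ : ℝ → ℝ} (hθ : ContDiff ℝ ∞ θ)
    (h0 : θ 0 = 0) : IsTest D (θ ∘ φ) :=
  ⟨hθ.comp hφ.1, hφ.2.1.comp_left h0, (tsupport_comp_subset h0 φ).trans hφ.2.2⟩

theorem norm_fderiv_comp_le {φ : RN N → ℝ} {x : RN N} (hφ : DifferentiableAt ℝ φ x) {θ : ℝ → ℝ}
    {θ' : ℝ} (hθ : HasDerivAt θ θ' (φ x)) (h1 : |θ'| ≤ 1) :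
    ‖fderiv ℝ (θ ∘ φ) x‖ ≤ ‖fderiv ℝ φ x‖ := by
  rw [(hθ.comp_hasFDerivAt x hφ.hasFDerivAt).fderiv, norm_smul, Real.norm_eq_abs]
  exact mul_le_of_le_one_left (norm_nonneg _) h1

/-- A smooth approximation of the absolute value. -/
def softAbs (ε t : ℝ) : ℝ := softPos ε t + softPos ε (-t)

theorem contDiff_softAbs (ε : ℝ) : ContDiff ℝ ∞ (softAbs ε) :=
  (contDiff_softPos ε).add ((contDiff_softPos ε).comp contDiff_neg)

theorem hasDerivAt_softAbs (ε t : ℝ) : HasDerivAt (softAbs ε)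
    (Real.smoothTransition (t / ε - 1) - Real.smoothTransition (-t / ε - 1)) t := by
  have h := (hasDerivAt_softPos ε t).add
    ((hasDerivAt_softPos ε (-t)).comp t (hasDerivAt_neg t))
  rw [mul_neg_one, ← sub_eq_add_neg] at h
  exact h

theorem abs_sub_le_one_of_unit {a b : ℝ} (ha : 0 ≤ a) (ha1 : a ≤ 1) (hb : 0 ≤ b) (hb1 : b ≤ 1) :
    |a - b| ≤ 1 := by
  rw [abs_le]; constructor <;> linarith

theorem softAbs_nonneg (hε : 0 < ε) (t : ℝ) : 0 ≤ softAbs ε t :=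
  add_nonneg (softPos_nonneg hε _) (softPos_nonneg hε _)

theorem softAbs_le (hε : 0 < ε) (t : ℝ) : softAbs ε t ≤ |t| := by
  have h1 := softPos_le hε t
  have h2 := softPos_le hε (-t)
  unfold softAbs
  rcases le_total 0 t with h | h
  · rw [max_eq_left h] at h1; rw [max_eq_right (by linarith)] at h2
    rw [abs_of_nonneg h]; linarith
  · rw [max_eq_right h] at h1; rw [max_eq_left (by linarith)] at h2
    rw [abs_of_nonpos h]; linarith

theorem tendsto_softAbs {e t : ℕ → ℝ} (he0 : ∀ n, 0 < e n)
    (he : Filter.Tendsto e Filter.atTop (nhds 0)) {t₀ : ℝ}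
    (ht : Filter.Tendsto t Filter.atTop (nhds t₀)) :
    Filter.Tendsto (fun n => softAbs (e n) (t n)) Filter.atTop (nhds |t₀|) := by
  have h := (tendsto_softPos he0 he ht).add (tendsto_softPos he0 he ht.neg)
  have e1 : max t₀ 0 + max (-t₀) 0 = |t₀| := by
    rcases le_total 0 t₀ with h | h
    · rw [max_eq_left h, max_eq_right (by linarith), abs_of_nonneg h, add_zero]
    · rw [max_eq_right h, max_eq_left (by linarith), abs_of_nonpos h, zero_add]
  rwa [e1] at h

/-- The energy `∫ |∇φ|² + κ φ²` of a test function. -/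
def testEnergy (κ : ℝ) (φ : RN N → ℝ) : ℝ := (∫ x, ‖fderiv ℝ φ x‖ ^ 2) + κ * ∫ x, φ x ^ 2

theorem IsTest.integrable_sq {φ : RN N → ℝ} (h : IsTest D φ) : Integrable (fun x => φ x ^ 2) :=
  (h.memLp 2).integrable_sq

theorem quadForm_eq_testEnergy {φ : RN N → ℝ} (h : IsTest D φ) (κ : ℝ) {w : RealPair D}
    (h1 : w.fst =ᵐ[volume.restrict D] φ) (h2 : w.snd =ᵐ[volume.restrict D] gradient φ) :
    quadForm κ w = testEnergy κ φ := by
  unfold quadForm testEnergy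
  rw [norm_fst_sq_congr h1, norm_snd_sq_congr h2, ← h.setIntegral_fderiv_sq]
  simp only [norm_gradient]
  congr 2
  have := h.setIntegral_norm_rpow two_pos
  simpa only [Real.rpow_two, Real.norm_eq_abs, sq_abs] using this

theorem testEnergy_mono {κ : ℝ} (hκ : 0 ≤ κ) {φ ψ : RN N → ℝ} (hψ : IsTest D ψ)
    (h1 : ∀ x, ‖fderiv ℝ φ x‖ ≤ ‖fderiv ℝ ψ x‖) (h2 : ∀ x, |φ x| ≤ |ψ x|) :
    testEnergy κ φ ≤ testEnergy κ ψ := by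
  unfold testEnergy
  have e1 : ∫ x, ‖fderiv ℝ φ x‖ ^ 2 ≤ ∫ x, ‖fderiv ℝ ψ x‖ ^ 2 :=
    integral_mono_of_nonneg (Filter.Eventually.of_forall fun x => by positivity)
      hψ.integrable_fderiv_sq (Filter.Eventually.of_forall fun x =>
        pow_le_pow_left₀ (norm_nonneg _) (h1 x) 2)
  have e2 : ∫ x, φ x ^ 2 ≤ ∫ x, ψ x ^ 2 :=
    integral_mono_of_nonneg (Filter.Eventually.of_forall fun x => by positivity)
      hψ.integrable_sq (Filter.Eventually.of_forall fun x => sq_le_sq.2 (h2 x))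
  gcongr

theorem testEnergy_softAbs_le {κ : ℝ} (hκ : 0 ≤ κ) (hε : 0 < ε) {φ : RN N → ℝ}
    (hφ : IsTest D φ) : testEnergy κ (softAbs ε ∘ φ) ≤ testEnergy κ φ :=
  testEnergy_mono hκ hφ
    (fun x => norm_fderiv_comp_le (hφ.differentiable x) (hasDerivAt_softAbs ε (φ x))
      (abs_sub_le_one_of_unit (Real.smoothTransition.nonneg _) (Real.smoothTransition.le_one _)
        (Real.smoothTransition.nonneg _) (Real.smoothTransition.le_one _)))
    (fun x => by
      rw [Function.comp_apply, abs_of_nonneg (softAbs_nonneg hε _)]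
      exact softAbs_le hε _)

theorem isTest_softAbs (hε : 0 < ε) {φ : RN N → ℝ} (hφ : IsTest D φ) :
    IsTest D (softAbs ε ∘ φ) :=
  hφ.comp_left (contDiff_softAbs ε) (by
    simp [softAbs, softPos_eq_zero hε hε.le])

end SoftPos

/-! ### Polarization -/

section Polarization

/-- A reflection of `ℝ^N` in an affine hyperplane, written as `x ↦ lin x + shift`, together with a
continuous function `height` that changes sign under the reflection and whose zeros are fixed
points. The half-space singled out by the reflection is `{height < 0}`. -/
structure Folding (N : ℕ) where
  lin : RN N ≃ₗᵢ[ℝ] RN N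
  shift : RN N
  height : RN N → ℝ
  continuous_height : Continuous height
  involutive : ∀ x, lin (lin x + shift) + shift = x
  height_map : ∀ x, height (lin x + shift) = -height x
  map_of_height_eq_zero : ∀ x, height x = 0 → lin x + shift = x

namespace Folding

variable {N : ℕ} (σ : Folding N) {D : Set (RN N)}

/-- The reflection itself. -/
def map (x : RN N) : RN N := σ.lin x + σ.shift

theorem map_map (x : RN N) : σ.map (σ.map x) = x := σ.involutive x

theorem height_map' (x : RN N) : σ.height (σ.map x) = -σ.height x := σ.height_map x

theorem contDiff_map : ContDiff ℝ ∞ σ.map :=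
  (σ.lin.contDiff).add contDiff_const

theorem continuous_map : Continuous σ.map := σ.contDiff_map.continuous

theorem measurePreserving_map : MeasurePreserving σ.map (volume : Measure (RN N)) volume :=
  (measurePreserving_add_right volume σ.shift).comp σ.lin.measurePreserving

/-- The reflection as a homeomorphism. -/
def homeo : RN N ≃ₜ RN N where
  toFun := σ.map
  invFun := σ.map
  left_inv := σ.map_map
  right_inv := σ.map_map
  continuous_toFun := σ.continuous_map
  continuous_invFun := σ.continuous_map

theorem integral_map (f : RN N → ℝ) : ∫ x, f (σ.map x) = ∫ x, f x :=
  σ.measurePreserving_map.integral_comp σ.homeo.measurableEmbedding f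

theorem integrable_map {f : RN N → ℝ} (hf : Integrable f) : Integrable fun x => f (σ.map x) :=
  σ.measurePreserving_map.integrable_comp_of_integrable hf

theorem isTest_comp {φ : RN N → ℝ} (h : IsTest univ φ) : IsTest univ (φ ∘ σ.map) :=
  ⟨h.1.comp σ.contDiff_map, h.2.1.comp_homeomorph σ.homeo, subset_univ _⟩

theorem norm_fderiv_comp {φ : RN N → ℝ} (h : IsTest D φ) (x : RN N) :
    ‖fderiv ℝ (φ ∘ σ.map) x‖ = ‖fderiv ℝ φ (σ.map x)‖ := by
  have h1 : HasFDerivAt σ.map (σ.lin.toContinuousLinearEquiv : RN N →L[ℝ] RN N) x :=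
    (σ.lin.toContinuousLinearEquiv.hasFDerivAt).add_const _
  rw [((h.differentiable (σ.map x)).hasFDerivAt.comp x h1).fderiv]
  exact ContinuousLinearMap.opNorm_comp_linearIsometryEquiv _ σ.lin

theorem testEnergy_comp {κ : ℝ} {φ : RN N → ℝ} (h : IsTest D φ) :
    testEnergy κ (φ ∘ σ.map) = testEnergy κ φ := by
  unfold testEnergy
  simp only [σ.norm_fderiv_comp h, Function.comp_apply]
  rw [σ.integral_map (fun x => ‖fderiv ℝ φ x‖ ^ 2), σ.integral_map (fun x => φ x ^ 2)]

/-- Even and odd functions are orthogonal for the energy. -/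
theorem testEnergy_add_of_even_odd {κ : ℝ} {a b : RN N → ℝ} (ha : IsTest univ a)
    (hb : IsTest univ b) (hae : ∀ x, a (σ.map x) = a x) (hbo : ∀ x, b (σ.map x) = -b x) :
    testEnergy κ (a + b) = testEnergy κ a + testEnergy κ b := by
  have e1 : a + (-1 : ℝ) • b = (a + b) ∘ σ.map := by
    ext x
    simp [hae, hbo]
  have h1 : testEnergy κ (a + (-1 : ℝ) • b) = testEnergy κ (a + b) := by
    rw [e1, σ.testEnergy_comp (ha.add hb)]
  have g1 := ha.integral_gradient_add hb 1
  have g2 := ha.integral_gradient_add hb (-1)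
  rw [one_smul] at g1
  have i1 := ha.integrable_sq
  have i2 := hb.integrable_sq
  have i3 : Integrable (fun x => a x * b x) := (ha.memLp 2).integrable_mul (hb.memLp 2)
  have q : ∀ t : ℝ, ∫ x, (a + t • b) x ^ 2
      = (∫ x, a x ^ 2) + 2 * t * (∫ x, a x * b x) + t ^ 2 * ∫ x, b x ^ 2 := by
    intro t
    have e : ∀ x, (a + t • b) x ^ 2 = a x ^ 2 + 2 * t * (a x * b x) + t ^ 2 * b x ^ 2 := by
      intro x
      simp only [Pi.add_apply, Pi.smul_apply, smul_eq_mul]; ring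
    simp only [e]
    have i4 : Integrable (fun x => a x ^ 2 + 2 * t * (a x * b x)) := i1.add (i3.const_mul _)
    rw [integral_add i4 (i2.const_mul _), integral_add i1 (i3.const_mul _),
      integral_const_mul, integral_const_mul]
  have q1 := q 1
  have q2 := q (-1)
  rw [one_smul] at q1
  unfold testEnergy at h1 ⊢
  rw [g2, q2, g1, q1] at h1
  rw [g1, q1]
  linarith

/-- The polarization of `U`: the larger of the two values of `U` at `x` and at its mirror image is
moved to the half-space `{height < 0}`. -/
def polarize (U : RN N → ℝ) (x : RN N) : ℝ :=
  if σ.height x < 0 then max (U x) (U (σ.map x)) else min (U x) (U (σ.map x))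

/-- The odd part of the smoothed polarization of `f`. -/
def softOdd (ε : ℝ) (f : RN N → ℝ) (x : RN N) : ℝ :=
  if σ.height x < 0 then (f x - f (σ.map x)) / 2 + softPos ε (f (σ.map x) - f x)
  else (f x - f (σ.map x)) / 2 - softPos ε (f x - f (σ.map x))

/-- A smoothed polarization. -/
def softPolarize (ε : ℝ) (f : RN N → ℝ) (x : RN N) : ℝ :=
  (f x + f (σ.map x)) / 2 + σ.softOdd ε f x

variable {ε : ℝ}

theorem softPolarize_of_neg (f : RN N → ℝ) {x : RN N} (hx : σ.height x < 0) :
    σ.softPolarize ε f x = f x + softPos ε (f (σ.map x) - f x) := by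
  simp only [softPolarize, softOdd, hx, if_true]; ring

theorem softPolarize_of_nonneg (f : RN N → ℝ) {x : RN N} (hx : ¬ σ.height x < 0) :
    σ.softPolarize ε f x = f x - softPos ε (f x - f (σ.map x)) := by
  simp only [softPolarize, softOdd, hx, if_false]; ring

theorem tendsto_softPolarize {e : ℕ → ℝ} (he0 : ∀ n, 0 < e n)
    (he : Filter.Tendsto e Filter.atTop (nhds 0)) {f : ℕ → RN N → ℝ} {U : RN N → ℝ} {x : RN N}
    (h1 : Filter.Tendsto (fun n => f n x) Filter.atTop (nhds (U x)))
    (h2 : Filter.Tendsto (fun n => f n (σ.map x)) Filter.atTop (nhds (U (σ.map x)))) :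
    Filter.Tendsto (fun n => σ.softPolarize (e n) (f n) x) Filter.atTop
      (nhds (σ.polarize U x)) := by
  by_cases hx : σ.height x < 0
  · simp only [σ.softPolarize_of_neg _ hx, polarize, hx, if_true]
    have := h1.add (tendsto_softPos he0 he (h2.sub h1))
    have e1 : U x + max (U (σ.map x) - U x) 0 = max (U x) (U (σ.map x)) := by
      rcases le_total (U x) (U (σ.map x)) with h | h
      · rw [max_eq_left (by linarith), max_eq_right h]; ring
      · rw [max_eq_right (by linarith), max_eq_left h]; ring
    rwa [e1] at this
  · simp only [σ.softPolarize_of_nonneg _ hx, polarize, hx, if_false]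
    have := h1.sub (tendsto_softPos he0 he (h1.sub h2))
    have e1 : U x - max (U x - U (σ.map x)) 0 = min (U x) (U (σ.map x)) := by
      rcases le_total (U x) (U (σ.map x)) with h | h
      · rw [max_eq_right (by linarith), min_eq_left h]; ring
      · rw [max_eq_left (by linarith), min_eq_right h]; ring
    rwa [e1] at this

/-- Near each point the odd part of the smoothed polarization is a smooth contraction of the odd
part of `f`. -/
theorem softOdd_eventuallyEq (hε : 0 < ε) {f : RN N → ℝ} (hf : Continuous f) (x : RN N) :
    ∃ (θ θ' : ℝ → ℝ), ContDiff ℝ ∞ θ ∧ (∀ s, HasDerivAt θ (θ' s) s) ∧ (∀ s, |θ' s| ≤ 1) ∧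
      (∀ s, |θ s| ≤ |s|) ∧
      σ.softOdd ε f =ᶠ[nhds x] θ ∘ fun z => (f z - f (σ.map z)) / 2 := by
  have hη : ContDiff ℝ ∞ fun s : ℝ => s + softPos ε (-2 * s) :=
    contDiff_id.add ((contDiff_softPos ε).comp (contDiff_const.mul contDiff_id))
  have hη' : ∀ s : ℝ, HasDerivAt (fun s : ℝ => s + softPos ε (-2 * s))
      (1 + Real.smoothTransition (-2 * s / ε - 1) * (-2)) s := fun s => by
    have h1 : HasDerivAt (fun s : ℝ => -2 * s) (-2) s := by
      simpa using (hasDerivAt_id s).const_mul (-2 : ℝ)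
    exact (hasDerivAt_id s).add ((hasDerivAt_softPos ε (-2 * s)).comp s h1)
  have hη1 : ∀ s : ℝ, |1 + Real.smoothTransition (-2 * s / ε - 1) * (-2)| ≤ 1 := fun s => by
    have h1 := Real.smoothTransition.nonneg (-2 * s / ε - 1)
    have h2 := Real.smoothTransition.le_one (-2 * s / ε - 1)
    rw [abs_le]; constructor <;> linarith
  have hηb : ∀ s : ℝ, |s + softPos ε (-2 * s)| ≤ |s| := fun s => by
    have h1 := softPos_nonneg hε (-2 * s)
    have h2 := softPos_le hε (-2 * s)
    rcases le_total 0 s with h | h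
    · rw [max_eq_right (by linarith)] at h2
      have : softPos ε (-2 * s) = 0 := le_antisymm h2 h1
      rw [this, add_zero]
    · rw [max_eq_left (by linarith)] at h2
      rw [abs_of_nonpos h, abs_le]; constructor <;> linarith
  have hfσ : Continuous fun z => f (σ.map z) := hf.comp σ.continuous_map
  rcases lt_trichotomy (σ.height x) 0 with hx | hx | hx
  · refine ⟨_, _, hη, hη', hη1, hηb, ?_⟩
    filter_upwards [σ.continuous_height.continuousAt.eventually_lt_const hx] with z hz
    simp only [softOdd, hz, if_true, Function.comp_apply]
    congr 2; ring
  · -- on the mirror the odd part vanishes, so the smoothing is inactive nearby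
    refine ⟨id, fun _ => 1, contDiff_id, fun s => hasDerivAt_id s, fun s => by simp,
      fun s => le_rfl, ?_⟩
    have h0 : f x - f (σ.map x) = 0 := by
      rw [map, σ.map_of_height_eq_zero x hx, sub_self]
    have hc : ContinuousAt (fun z => |f z - f (σ.map z)|) x := (hf.sub hfσ).abs.continuousAt
    have hlt : (fun z => |f z - f (σ.map z)|) x < ε := by simpa [h0] using hε
    filter_upwards [hc.eventually_lt_const hlt] with z hz
    rw [abs_lt] at hz
    simp only [softOdd, Function.comp_apply, id]
    rw [softPos_eq_zero hε (by linarith), softPos_eq_zero hε (by linarith)]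
    simp
  · refine ⟨fun s => -(-s + softPos ε (-2 * -s)),
      fun s => (1 + Real.smoothTransition (-2 * -s / ε - 1) * (-2)), ?_, ?_, ?_, ?_, ?_⟩
    · exact (hη.comp contDiff_neg).neg
    · intro s
      have := ((hη' (-s)).comp s (hasDerivAt_neg s)).neg
      rw [mul_neg_one, neg_neg] at this
      exact this
    · intro s; exact hη1 (-s)
    · intro s
      have := hηb (-s)
      rwa [abs_neg, ← abs_neg (-s + _)] at *
    · filter_upwards [σ.continuous_height.continuousAt.eventually_const_lt hx] with z hz
      simp only [softOdd, not_lt.2 hz.le, if_false, Function.comp_apply]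
      have : -2 * -((f z - f (σ.map z)) / 2) = f z - f (σ.map z) := by ring
      rw [this]; ring

theorem contDiff_softOdd (hε : 0 < ε) {f : RN N → ℝ} (hf : IsTest D f) :
    ContDiff ℝ ∞ (σ.softOdd ε f) := by
  rw [contDiff_iff_contDiffAt]
  intro x
  obtain ⟨θ, θ', hθ, -, -, -, h⟩ := σ.softOdd_eventuallyEq hε hf.continuous x
  have h1 : ContDiff ℝ ∞ fun z => (f z - f (σ.map z)) / 2 :=
    (hf.1.sub (hf.1.comp σ.contDiff_map)).div_const 2
  exact (hθ.comp h1).contDiffAt.congr_of_eventuallyEq h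

/-- If `σ` moves no point of the half-space outside `D` into `D`, the smoothed polarization of a
nonnegative test function in `D` is a test function in `D`. -/
theorem isTest_softPolarize (hε : 0 < ε) {f : RN N → ℝ} (hf : IsTest D f) (hf0 : ∀ x, 0 ≤ f x)
    (hD : ∀ x, σ.height x ≤ 0 → σ.map x ∈ D → x ∈ D) : IsTest D (σ.softPolarize ε f) := by
  have hsub : tsupport (σ.softPolarize ε f)
      ⊆ tsupport f ∪ ({x | σ.height x ≤ 0} ∩ σ.map ⁻¹' tsupport f) := by
    refine closure_minimal ?_ ((isClosed_tsupport f).union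
      ((isClosed_le σ.continuous_height continuous_const).inter
        ((isClosed_tsupport f).preimage σ.continuous_map)))
    intro x hx
    by_contra hn
    simp only [mem_union, mem_inter_iff, mem_ofPred_eq, mem_preimage, not_or, not_and] at hn
    have h1 : f x = 0 := image_eq_zero_of_notMem_tsupport hn.1
    refine hx ?_
    by_cases hxn : σ.height x < 0
    · have h2 : f (σ.map x) = 0 := image_eq_zero_of_notMem_tsupport (hn.2 hxn.le)
      rw [σ.softPolarize_of_neg f hxn, h1, h2, softPos_eq_zero hε (by linarith), add_zero]
    · rw [σ.softPolarize_of_nonneg f hxn, h1, softPos_eq_zero hε (by linarith [hf0 (σ.map x)]),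
        sub_zero]
  refine ⟨?_, ?_, ?_⟩
  · exact ((hf.1.add (hf.1.comp σ.contDiff_map)).div_const 2).add (σ.contDiff_softOdd hε hf)
  · have hK : IsCompact (tsupport f ∪ σ.map ⁻¹' tsupport f) :=
      IsCompact.union hf.2.1 (σ.homeo.isCompact_preimage.2 hf.2.1)
    exact hK.of_isClosed_subset (isClosed_tsupport _)
      (hsub.trans (union_subset_union_right _ inter_subset_right))
  · intro x hx
    rcases hsub hx with h | h
    · exact hf.2.2 h
    · exact hD x h.1 (hf.2.2 h.2)

/-- Polarization does not increase the energy: it keeps the even part and contracts the odd part. -/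
theorem testEnergy_softPolarize_le (hε : 0 < ε) {κ : ℝ} (hκ : 0 ≤ κ) {f : RN N → ℝ}
    (hf : IsTest D f) : testEnergy κ (σ.softPolarize ε f) ≤ testEnergy κ f := by
  have hfu : IsTest univ f := hf.mono (subset_univ _)
  have hfσ := σ.isTest_comp hfu
  set a : RN N → ℝ := fun x => (f x + f (σ.map x)) / 2 with ha
  set b : RN N → ℝ := fun x => (f x - f (σ.map x)) / 2 with hb
  have hat : IsTest univ a := by
    have := (hfu.add hfσ).smul (1 / 2)
    convert this using 1
    ext x; simp [ha]; ring
  have hbt : IsTest univ b := by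
    have := (hfu.add (hfσ.smul (-1))).smul (1 / 2)
    convert this using 1
    ext x; simp [hb]; ring
  set q := σ.softOdd ε f with hq
  have hqle : ∀ x, |q x| ≤ |b x| := by
    intro x
    obtain ⟨θ, θ', -, -, -, h1, h⟩ := σ.softOdd_eventuallyEq hε hf.continuous x
    rw [hq, h.eq_of_nhds]
    exact h1 _
  have hqd : ∀ x, ‖fderiv ℝ q x‖ ≤ ‖fderiv ℝ b x‖ := by
    intro x
    obtain ⟨θ, θ', -, h2, h3, -, h⟩ := σ.softOdd_eventuallyEq hε hf.continuous x
    rw [hq, h.fderiv_eq]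
    exact norm_fderiv_comp_le (hbt.differentiable x) (h2 _) (h3 _)
  have hqt : IsTest univ q := by
    refine ⟨σ.contDiff_softOdd hε hf, ?_, subset_univ _⟩
    refine hbt.2.1.mono fun x hx => ?_
    intro h0
    have := hqle x
    rw [h0, abs_zero] at this
    exact hx (abs_nonpos_iff.1 this)
  have hae : ∀ x, a (σ.map x) = a x := fun x => by simp only [ha, σ.map_map]; ring
  have hbo : ∀ x, b (σ.map x) = -b x := fun x => by simp only [hb, σ.map_map]; ring
  have hqo : ∀ x, q (σ.map x) = -q x := fun x => by
    simp only [hq, softOdd, σ.map_map, σ.height_map']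
    rcases lt_trichotomy (σ.height x) 0 with h | h | h
    · rw [if_neg (by linarith), if_pos h]; ring
    · have hx : σ.map x = x := σ.map_of_height_eq_zero x h
      rw [hx]; simp [softPos_eq_zero hε hε.le]
    · rw [if_pos (by linarith), if_neg (by linarith)]; ring
  have e1 : σ.softPolarize ε f = a + q := rfl
  have e2 : f = a + b := by ext x; simp only [ha, hb, Pi.add_apply]; ring
  rw [e1, σ.testEnergy_add_of_even_odd hat hqt hae hqo]
  conv_rhs => rw [e2, σ.testEnergy_add_of_even_odd hat hbt hae hbo]
  gcongr
  exact testEnergy_mono hκ hbt hqd hqle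

end Folding

end Polarization

section PolarizedMinimizers

variable {N : ℕ} {D : Set (RN N)} {s C κ p : ℝ}

/-- Test functions which almost minimise and converge almost everywhere to a normalised function:
the limit is a minimiser. -/
theorem exists_minimizer_of_test_seq (hD : volume D ≠ ⊤)
    (hX : HasSobolev (H10 D) s C) (hC : 0 ≤ C) (hκ : 0 ≤ κ) (hp : 2 < p) (hps : p < s)
    {g : ℕ → RN N → ℝ} {b : ℕ → ℝ} (hg : ∀ n, IsTest D (g n))
    (hgb : ∀ n, testEnergy κ (g n) ≤ b n)
    (hb : Filter.Tendsto b Filter.atTop (nhds (minQuot D κ p))) {U : RN N → ℝ}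
    (hU : ∀ᵐ x ∂volume.restrict D, Filter.Tendsto (fun n => g n x) Filter.atTop (nhds (U x)))
    (hU1 : ∫ x in D, ‖U x‖ ^ p = 1) :
    ∃ w : H10 D, w.1.fst =ᵐ[volume.restrict D] U ∧ IsMinimizer κ p w := by
  choose w _ hw1 hw2 using fun n => (hg n).exists_H10
  refine exists_minimizer_of_ae_tendsto hD hX hC hκ hp hps (g := w) (b := b) (fun n => ?_) hb
    ?_ hU1
  · rw [quadForm_eq_testEnergy (hg n) κ (hw1 n) (hw2 n)]
    exact hgb n
  · filter_upwards [hU, ae_all_iff.2 hw1] with x h1 h2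
    simpa only [h2] using h1

/-- The absolute value of an element of `H¹₀(D)`, extended by zero. -/
def absExt (u : H10 D) : RN N → ℝ := D.indicator fun x => |u.1.fst x|

theorem absExt_nonneg (u : H10 D) (x : RN N) : 0 ≤ absExt u x :=
  indicator_nonneg (fun _ _ => abs_nonneg _) x

theorem absExt_eq_zero (u : H10 D) {x : RN N} (hx : x ∉ D) : absExt u x = 0 :=
  indicator_of_notMem hx _

theorem absExt_of_mem (u : H10 D) {x : RN N} (hx : x ∈ D) : absExt u x = |u.1.fst x| :=
  indicator_of_mem hx _

theorem measurable_absExt (hDm : MeasurableSet D) (u : H10 D) : Measurable (absExt u) :=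
  (Lp.stronglyMeasurable u.1.fst).measurable.abs.indicator hDm

theorem integral_absExt_rpow (hDm : MeasurableSet D) (u : H10 D) {q : ℝ} (hq : 0 < q) :
    ∫ x, absExt u x ^ q = powInt q u.1 := by
  unfold powInt
  rw [← integral_indicator hDm]
  congr 1
  ext x
  by_cases hx : x ∈ D
  · rw [absExt_of_mem u hx, indicator_of_mem hx, Real.norm_eq_abs]
  · rw [absExt_eq_zero u hx, indicator_of_notMem hx, Real.zero_rpow hq.ne']

theorem integrable_absExt_rpow (hDm : MeasurableSet D) (u : H10 D) {q : ℝ} (hq : 0 < q)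
    (hu : MemLp u.1.fst (ENNReal.ofReal q) (volume.restrict D)) :
    Integrable fun x => absExt u x ^ q := by
  have h := integrable_norm_rpow_of_memLp hq hu
  rw [← IntegrableOn, ← integrable_indicator_iff hDm] at h
  refine h.congr (Filter.Eventually.of_forall fun x => ?_)
  by_cases hx : x ∈ D
  · simp only [absExt_of_mem u hx, indicator_of_mem hx, Real.norm_eq_abs]
  · simp only [absExt_eq_zero u hx, indicator_of_notMem hx, Real.zero_rpow hq.ne']

/-- A minimiser is approached by nonnegative test functions with almost minimal energy. -/
theorem IsMinimizer.exists_nonneg_seq (hDm : MeasurableSet D) (hκ : 0 ≤ κ) {u : H10 D}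
    (hu : IsMinimizer κ p u) : ∃ (f : ℕ → RN N → ℝ) (b : ℕ → ℝ), (∀ n, IsTest D (f n)) ∧
      (∀ n x, 0 ≤ f n x) ∧ (∀ n, testEnergy κ (f n) ≤ b n) ∧
      Filter.Tendsto b Filter.atTop (nhds (minQuot D κ p)) ∧
      ∀ᵐ x ∂volume, Filter.Tendsto (fun n => f n x) Filter.atTop (nhds (absExt u x)) := by
  obtain ⟨w, φ, hw, hφ⟩ := exists_seq_H10 u
  have hw' : Filter.Tendsto (fun n => (w n).1) Filter.atTop (nhds u.1) :=
    (continuous_subtype_val.tendsto u).comp hw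
  obtain ⟨ns, hns, hae⟩ := exists_subseq_tendsto_ae (tendsto_fst hw')
  set e : ℕ → ℝ := fun n => 1 / ((n : ℝ) + 1) with he
  have he0 : ∀ n, 0 < e n := fun n => by simp only [he]; positivity
  refine ⟨fun n => softAbs (e n) ∘ φ (ns n), fun n => quadForm κ (w (ns n)).1,
    fun n => isTest_softAbs (he0 n) (hφ _).1, fun n x => softAbs_nonneg (he0 n) _, fun n => ?_,
    ?_, ?_⟩
  · change testEnergy κ (softAbs (e n) ∘ φ (ns n)) ≤ quadForm κ (w (ns n)).1
    rw [quadForm_eq_testEnergy (hφ _).1 κ (hφ _).2.1 (hφ _).2.2]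
    exact testEnergy_softAbs_le hκ (he0 n) (hφ _).1
  · rw [← hu.1]
    exact ((differentiable_quadForm (H10 D) κ).continuous.tendsto u).comp
      (hw.comp hns.tendsto_atTop)
  · have h1 : ∀ᵐ x ∂volume.restrict D,
        Filter.Tendsto (fun n => φ (ns n) x) Filter.atTop (nhds (u.1.fst x)) := by
      filter_upwards [hae, ae_all_iff.2 fun n => (hφ n).2.1] with x hx1 hx2
      simpa only [hx2] using hx1
    rw [ae_restrict_iff' hDm] at h1
    filter_upwards [h1] with x hx
    simp only [Function.comp_apply]
    by_cases hxD : x ∈ D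
    · rw [absExt_of_mem u hxD]
      exact tendsto_softAbs he0 tendsto_one_div_add_atTop_nhds_zero_nat (hx hxD)
    · rw [absExt_eq_zero u hxD]
      refine tendsto_const_nhds.congr fun n => ?_
      rw [(hφ _).1.eq_zero hxD]
      simp [softAbs, softPos_eq_zero (he0 n) (he0 n).le]

theorem IsMinimizer.exists_abs (hDm : MeasurableSet D) (hD : volume D ≠ ⊤)
    (hX : HasSobolev (H10 D) s C) (hC : 0 ≤ C) (hκ : 0 ≤ κ) (hp : 2 < p) (hps : p < s)
    {u : H10 D} (hu : IsMinimizer κ p u) :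
    ∃ w : H10 D, w.1.fst =ᵐ[volume.restrict D] absExt u ∧ IsMinimizer κ p w := by
  obtain ⟨f, b, hf, -, hfb, hb, hlim⟩ := hu.exists_nonneg_seq hDm hκ
  refine exists_minimizer_of_test_seq hD hX hC hκ hp hps hf hfb hb
    (ae_restrict_of_ae hlim) ?_
  rw [← hu.2]
  refine integral_congr_ae ?_
  filter_upwards [ae_restrict_mem hDm] with x hx
  simp only [absExt_of_mem u hx, norm_abs_eq_norm]

namespace Folding

variable (σ : Folding N)

theorem integral_eq_half {F : RN N → ℝ} (hF : Integrable F) :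
    ∫ x, F x = 1 / 2 * ∫ x, (F x + F (σ.map x)) := by
  rw [integral_add hF (σ.integrable_map hF), σ.integral_map]; ring

theorem measurable_polarize {U : RN N → ℝ} (hU : Measurable U) : Measurable (σ.polarize U) := by
  have hUσ : Measurable fun x => U (σ.map x) := hU.comp σ.continuous_map.measurable
  exact Measurable.ite (measurableSet_lt σ.continuous_height.measurable measurable_const)
    (hU.max hUσ) (hU.min hUσ)

theorem polarize_nonneg {U : RN N → ℝ} (hU : ∀ x, 0 ≤ U x) (x : RN N) : 0 ≤ σ.polarize U x := by
  unfold polarize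
  split_ifs
  · exact (hU x).trans (le_max_left _ _)
  · exact le_min (hU x) (hU _)

theorem polarize_eq_zero (hD : ∀ x, σ.height x ≤ 0 → σ.map x ∈ D → x ∈ D) {U : RN N → ℝ}
    (hU : ∀ x, 0 ≤ U x) (hU0 : ∀ x, x ∉ D → U x = 0) {x : RN N} (hx : x ∉ D) :
    σ.polarize U x = 0 := by
  unfold polarize
  split_ifs with h
  · rw [hU0 x hx, hU0 _ fun h2 => hx (hD x h.le h2), max_self]
  · rw [hU0 x hx, min_eq_left (hU _)]

/-- Polarization permutes the two values of `U` at mirror points. -/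
theorem polarize_pair (U : RN N → ℝ) (x : RN N) :
    (σ.polarize U x = U x ∧ σ.polarize U (σ.map x) = U (σ.map x)) ∨
    (σ.polarize U x = U (σ.map x) ∧ σ.polarize U (σ.map x) = U x) := by
  simp only [polarize, σ.map_map, σ.height_map']
  rcases lt_trichotomy (σ.height x) 0 with h | h | h
  · rw [if_pos h, if_neg (by linarith)]
    rcases le_total (U x) (U (σ.map x)) with h1 | h1
    · right; exact ⟨max_eq_right h1, min_eq_right h1⟩
    · left; exact ⟨max_eq_left h1, min_eq_left h1⟩
  · have hx : σ.map x = x := σ.map_of_height_eq_zero x h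
    rw [hx, h]; simp
  · rw [if_neg (by linarith), if_pos (by linarith)]
    rcases le_total (U x) (U (σ.map x)) with h1 | h1
    · left; exact ⟨min_eq_left h1, max_eq_left h1⟩
    · right; exact ⟨min_eq_right h1, max_eq_right h1⟩

theorem integrable_polarize {U : RN N → ℝ} (hU : Measurable U) {F : ℝ → ℝ} (hF : Measurable F)
    (hi : Integrable fun x => F (U x)) : Integrable fun x => F (σ.polarize U x) := by
  refine (hi.norm.add (σ.integrable_map hi).norm).mono'
    (hF.comp (σ.measurable_polarize hU)).aestronglyMeasurable
    (Filter.Eventually.of_forall fun x => ?_)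
  simp only [Pi.add_apply]
  rcases σ.polarize_pair U x with h | h <;> rw [h.1]
  · exact le_add_of_nonneg_right (norm_nonneg _)
  · exact le_add_of_nonneg_left (norm_nonneg _)

theorem integral_polarize {U : RN N → ℝ} (hU : Measurable U) {F : ℝ → ℝ} (hF : Measurable F)
    (hi : Integrable fun x => F (U x)) : ∫ x, F (σ.polarize U x) = ∫ x, F (U x) := by
  rw [σ.integral_eq_half (σ.integrable_polarize hU hF hi), σ.integral_eq_half hi]
  congr 2
  ext x
  rcases σ.polarize_pair U x with h | h <;> rw [h.1, h.2]
  ring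

/-- Polarization decreases the second moment strictly unless it has no effect. -/
theorem second_moment_defect (hw : ∀ x, σ.height x < 0 → ‖x‖ < ‖σ.map x‖) {U : RN N → ℝ}
    (hU : ∀ x, 0 ≤ U x) (x : RN N) :
    0 ≤ (‖x‖ ^ 2 * U x ^ 2 + ‖σ.map x‖ ^ 2 * U (σ.map x) ^ 2)
      - (‖x‖ ^ 2 * σ.polarize U x ^ 2 + ‖σ.map x‖ ^ 2 * σ.polarize U (σ.map x) ^ 2) ∧
    ((‖x‖ ^ 2 * U x ^ 2 + ‖σ.map x‖ ^ 2 * U (σ.map x) ^ 2)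
      - (‖x‖ ^ 2 * σ.polarize U x ^ 2 + ‖σ.map x‖ ^ 2 * σ.polarize U (σ.map x) ^ 2) = 0 →
      σ.height x < 0 → U (σ.map x) ≤ U x) := by
  simp only [polarize, σ.map_map, σ.height_map']
  have h0 := hU x
  have h0' := hU (σ.map x)
  rcases lt_trichotomy (σ.height x) 0 with h | h | h
  · rw [if_pos h, if_neg (by linarith)]
    have hlt : ‖x‖ ^ 2 < ‖σ.map x‖ ^ 2 := pow_lt_pow_left₀ (hw x h) (norm_nonneg _) two_ne_zero
    rcases le_or_gt (U (σ.map x)) (U x) with h1 | h1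
    · rw [max_eq_left h1, min_eq_left h1]
      exact ⟨by linarith, fun _ _ => h1⟩
    · rw [max_eq_right h1.le, min_eq_right h1.le]
      have h2 : 0 < U (σ.map x) ^ 2 - U x ^ 2 := by nlinarith
      have h3 := mul_pos (sub_pos.2 hlt) h2
      constructor
      · nlinarith
      · intro h4; nlinarith
  · have hx : σ.map x = x := σ.map_of_height_eq_zero x h
    rw [hx, h]; simp
  · rw [if_neg (by linarith), if_pos (by linarith)]
    have hlt : ‖σ.map x‖ ^ 2 < ‖x‖ ^ 2 := by
      have := hw (σ.map x) (by rw [σ.height_map']; linarith)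
      rw [σ.map_map] at this
      exact pow_lt_pow_left₀ this (norm_nonneg _) two_ne_zero
    refine ⟨?_, fun _ h4 => absurd h4 (by linarith)⟩
    rcases le_total (U (σ.map x)) (U x) with h1 | h1
    · rw [max_eq_right h1, min_eq_right h1]
      have h2 : 0 ≤ U x ^ 2 - U (σ.map x) ^ 2 := by nlinarith
      have h3 := mul_nonneg (sub_pos.2 hlt).le h2
      nlinarith
    · rw [max_eq_left h1, min_eq_left h1]; linarith

end Folding

/-- A minimiser with least second moment is larger on the side of the origin of each mirror. -/
theorem IsMinimizer.absExt_map_le (hDm : MeasurableSet D) (hDb : Bornology.IsBounded D)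
    (hX : HasSobolev (H10 D) s C) (hC : 0 ≤ C) (hκ : 0 ≤ κ) (hp : 2 < p) (hps : p < s)
    {u : H10 D} (hu : IsMinimizer κ p u)
    (hleast : ∀ v : H10 D, IsMinimizer κ p v →
      ∫ x in D, ‖x‖ ^ 2 * u.1.fst x ^ 2 ≤ ∫ x in D, ‖x‖ ^ 2 * v.1.fst x ^ 2)
    (σ : Folding N) (hσD : ∀ x, σ.height x ≤ 0 → σ.map x ∈ D → x ∈ D)
    (hσ : ∀ x, σ.height x < 0 → ‖x‖ < ‖σ.map x‖) :
    ∀ᵐ x ∂volume, σ.height x < 0 → absExt u (σ.map x) ≤ absExt u x := by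
  have hD : volume D ≠ ⊤ := hDb.measure_lt_top.ne
  have hfinD := isFiniteMeasure_restrict hD
  have hp0 : 0 < p := by linarith
  set U := absExt u with hU
  have hUm := measurable_absExt hDm u
  have hU0 := absExt_nonneg u
  set PU := σ.polarize U with hPU
  have hPU0 : ∀ x, 0 ≤ PU x := σ.polarize_nonneg hU0
  have hPUz : ∀ x, x ∉ D → PU x = 0 := fun x hx =>
    σ.polarize_eq_zero hσD hU0 (fun x hx => absExt_eq_zero u hx) hx
  have hPUm : Measurable PU := σ.measurable_polarize hUm
  -- the polarized function is again a minimiser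
  obtain ⟨f, b, hf, hf0, hfb, hb, hlim⟩ := hu.exists_nonneg_seq hDm hκ
  set e : ℕ → ℝ := fun n => 1 / ((n : ℝ) + 1) with he
  have he0 : ∀ n, 0 < e n := fun n => by simp only [he]; positivity
  have hlimσ : ∀ᵐ x ∂volume, Filter.Tendsto (fun n => f n (σ.map x)) Filter.atTop
      (nhds (U (σ.map x))) := σ.measurePreserving_map.quasiMeasurePreserving.ae hlim
  have hpow : ∫ x in D, ‖PU x‖ ^ p = 1 := by
    rw [setIntegral_eq_integral_of_forall_compl_eq_zero fun x hx => by
      rw [hPUz x hx, norm_zero, Real.zero_rpow hp0.ne']]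
    simp only [Real.norm_of_nonneg (hPU0 _)]
    rw [σ.integral_polarize (F := fun t => t ^ p) hUm (by fun_prop)
      (integrable_absExt_rpow hDm u hp0 (hX.memLp hps.le u.2)), integral_absExt_rpow hDm u hp0,
      hu.2]
  obtain ⟨w, hwf, hw⟩ := exists_minimizer_of_test_seq hD hX hC hκ hp hps
    (fun n => σ.isTest_softPolarize (he0 n) (hf n) (hf0 n) hσD)
    (fun n => (σ.testEnergy_softPolarize_le (he0 n) hκ (hf n)).trans (hfb n)) hb
    (U := PU) (ae_restrict_of_ae (by
      filter_upwards [hlim, hlimσ] with x h1 h2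
      exact σ.tendsto_softPolarize he0 tendsto_one_div_add_atTop_nhds_zero_nat h1 h2)) hpow
  -- comparison of the second moments
  obtain ⟨R, hR, hDR⟩ : ∃ R : ℝ, 0 < R ∧ ∀ x ∈ D, ‖x‖ ≤ R := hDb.exists_pos_norm_le
  have hmom : ∀ G : RN N → ℝ, Measurable G → (∀ x, x ∉ D → G x = 0) →
      Integrable (fun x => G x ^ 2) → Integrable (fun x => ‖x‖ ^ 2 * G x ^ 2) := by
    intro G hGm hG0 hGi
    refine (hGi.const_mul (R ^ 2)).mono' (by fun_prop) (Filter.Eventually.of_forall fun x => ?_)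
    rw [Real.norm_of_nonneg (by positivity)]
    by_cases hx : x ∈ D
    · have := hDR x hx
      gcongr
    · rw [hG0 x hx]; simp
  have hU2 : Integrable fun x => U x ^ 2 := by
    have := integrable_absExt_rpow hDm u two_pos (hX.memLp (by linarith) u.2)
    simpa only [Real.rpow_two] using this
  have hPU2 : Integrable fun x => PU x ^ 2 :=
    σ.integrable_polarize (F := fun t => t ^ 2) hUm (by fun_prop) hU2
  have i1 := hmom U hUm (fun x hx => absExt_eq_zero u hx) hU2
  have i2 := hmom PU hPUm hPUz hPU2
  have hle : ∫ x, ‖x‖ ^ 2 * U x ^ 2 ≤ ∫ x, ‖x‖ ^ 2 * PU x ^ 2 := by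
    have h1 := hleast w hw
    have h2 : ∫ x in D, ‖x‖ ^ 2 * u.1.fst x ^ 2 = ∫ x, ‖x‖ ^ 2 * U x ^ 2 := by
      have h : ∫ x in D, ‖x‖ ^ 2 * U x ^ 2 = ∫ x, ‖x‖ ^ 2 * U x ^ 2 :=
        setIntegral_eq_integral_of_forall_compl_eq_zero fun x hx => by
          rw [hU, absExt_eq_zero u hx]; simp
      rw [← h]
      refine setIntegral_congr_fun hDm fun x hx => ?_
      simp only [hU, absExt_of_mem u hx, sq_abs]
    have h3 : ∫ x in D, ‖x‖ ^ 2 * w.1.fst x ^ 2 = ∫ x, ‖x‖ ^ 2 * PU x ^ 2 := by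
      have h : ∫ x in D, ‖x‖ ^ 2 * PU x ^ 2 = ∫ x, ‖x‖ ^ 2 * PU x ^ 2 :=
        setIntegral_eq_integral_of_forall_compl_eq_zero fun x hx => by
          rw [hPUz x hx]; simp
      rw [← h]
      refine integral_congr_ae ?_
      filter_upwards [hwf] with x hx
      rw [hx]
    rwa [h2, h3] at h1
  have j1 := i1.add (σ.integrable_map i1)
  have j2 := i2.add (σ.integrable_map i2)
  have hG0 := fun x => (σ.second_moment_defect hσ hU0 x).1
  have hGint : ∫ x, ((‖x‖ ^ 2 * U x ^ 2 + ‖σ.map x‖ ^ 2 * U (σ.map x) ^ 2)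
      - (‖x‖ ^ 2 * PU x ^ 2 + ‖σ.map x‖ ^ 2 * PU (σ.map x) ^ 2)) = 0 := by
    refine le_antisymm ?_ (integral_nonneg hG0)
    have e1 := σ.integral_eq_half i1
    have e2 := σ.integral_eq_half i2
    have e3 := integral_sub j1 j2
    simp only [Pi.add_apply] at e3
    rw [e3]
    linarith
  have hGae := (integral_eq_zero_iff_of_nonneg hG0 (j1.sub j2)).1 hGint
  filter_upwards [hGae] with x hx
  exact (σ.second_moment_defect hσ hU0 x).2 hx

end PolarizedMinimizers

/-! ### Radial symmetry -/

section RadialSymmetry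

variable {N : ℕ}

theorem reflection_orthogonal_singleton_apply (d v : RN N) :
    (ℝ ∙ d)ᗮ.reflection v = v - (2 * (inner ℝ d v / ‖d‖ ^ 2)) • d := by
  rw [Submodule.reflection_orthogonal_apply, Submodule.reflection_singleton_apply]
  simp only [RCLike.ofReal_real_eq_id, id, two_smul, two_mul, add_smul]
  abel

/-- The reflection in the bisector of `x` and `y`; if `‖x‖ < ‖y‖`, the half-space that it singles
out is the one containing `0` and `x`. -/
theorem Folding.exists_swap {x y : RN N} (hxy : ‖x‖ < ‖y‖) : ∃ σ : Folding N,
    σ.map x = y ∧ σ.height x < 0 ∧ ∀ z, σ.height z < 0 → ‖z‖ < ‖σ.map z‖ := by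
  set d : RN N := y - x with hd
  set m : RN N := (1 / 2 : ℝ) • (x + y) with hm
  have hd0 : d ≠ 0 := fun h => hxy.ne (by rw [sub_eq_zero.1 h])
  have hdn : 0 < ‖d‖ ^ 2 := by positivity
  have hdm : inner ℝ d m = (‖y‖ ^ 2 - ‖x‖ ^ 2) / 2 := by
    rw [hd, hm, inner_smul_right, inner_add_right, inner_sub_left, inner_sub_left,
      real_inner_self_eq_norm_sq, real_inner_self_eq_norm_sq, real_inner_comm x y]
    ring
  have hdm0 : 0 < inner ℝ d m := by
    rw [hdm]
    have := pow_lt_pow_left₀ hxy (norm_nonneg x) two_ne_zero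
    linarith
  have hR := reflection_orthogonal_singleton_apply d
  set R := (ℝ ∙ d)ᗮ.reflection with hRdef
  have hRd : R d = -d := by
    rw [hR, real_inner_self_eq_norm_sq, div_self hdn.ne']
    simp only [mul_one, two_smul]; abel
  have hmap : ∀ z, R z + (m - R m) = z - (2 * (inner ℝ d (z - m) / ‖d‖ ^ 2)) • d := by
    intro z
    have : R z + (m - R m) = R (z - m) + m := by rw [map_sub]; abel
    rw [this, hR]; abel
  have hheight : ∀ z, inner ℝ d (R z + (m - R m) - m) = -inner ℝ d (z - m) := by
    intro z
    rw [hmap, sub_right_comm, inner_sub_right, inner_smul_right, real_inner_self_eq_norm_sq]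
    field_simp
    ring
  have hxm : x - m = -((1 / 2 : ℝ) • d) := by rw [hm, hd]; module
  have hx : inner ℝ d (x - m) = -(‖d‖ ^ 2 / 2) := by
    rw [hxm, inner_neg_right, inner_smul_right, real_inner_self_eq_norm_sq]; ring
  refine ⟨{ lin := R, shift := m - R m, height := fun z => inner ℝ d (z - m)
            continuous_height := by fun_prop
            involutive := fun z => ?_
            height_map := hheight
            map_of_height_eq_zero := fun z hz => ?_ }, ?_, ?_, ?_⟩
  · have : R (R z) = z := Submodule.reflection_reflection _ z
    rw [map_add, map_sub, this, show R (R m) = m from Submodule.reflection_reflection _ m]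
    abel
  · rw [hmap, hz]; simp
  · change R x + (m - R m) = y
    have : -(‖d‖ ^ 2 / 2) / ‖d‖ ^ 2 = -(1 / 2) := by field_simp
    rw [hmap, hx, this, hd]
    module
  · change inner ℝ d (x - m) < 0
    rw [hx]; linarith
  · intro z hz
    change inner ℝ d (z - m) < 0 at hz
    change ‖z‖ < ‖R z + (m - R m)‖
    rw [hmap]
    refine lt_of_pow_lt_pow_left₀ 2 (norm_nonneg _) ?_
    rw [norm_sub_sq_real, inner_smul_right, norm_smul, mul_pow, Real.norm_eq_abs, sq_abs,
      real_inner_comm d z]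
    set k := inner ℝ d (z - m) with hk
    have hdz : inner ℝ d z = k + inner ℝ d m := by rw [hk, inner_sub_right]; ring
    rw [hdz]
    have e : ‖z‖ ^ 2 - 2 * (2 * (k / ‖d‖ ^ 2) * (k + inner ℝ d m))
        + (2 * (k / ‖d‖ ^ 2)) ^ 2 * ‖d‖ ^ 2
        = ‖z‖ ^ 2 + 4 * (-k / ‖d‖ ^ 2) * inner ℝ d m := by
      field_simp
      ring
    rw [e]
    have : 0 < -k / ‖d‖ ^ 2 := div_pos (by linarith) hdn
    have := mul_pos this hdm0
    linarith

/-- A function that is almost everywhere at least as large as its mirror image on the near side of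
every mirror not through the origin is decreasing in `‖x‖` on a set of full measure: at Lebesgue
points its values are compared by means of small balls exchanged by a reflection. -/
theorem ae_antitone_norm {U : RN N → ℝ} (hU : Integrable U)
    (h : ∀ σ : Folding N, (∀ z, σ.height z < 0 → ‖z‖ < ‖σ.map z‖) →
      ∀ᵐ z ∂volume, σ.height z < 0 → U (σ.map z) ≤ U z) :
    ∃ G : Set (RN N), (∀ᵐ x ∂volume, x ∈ G) ∧ ∀ x ∈ G, ∀ y ∈ G, ‖x‖ < ‖y‖ → U y ≤ U x := by
  refine ⟨{x | Filter.Tendsto (fun δ : ℝ => ⨍ z in Metric.closedBall x δ, U z)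
    (nhdsWithin 0 (Ioi 0)) (nhds (U x))}, ?_, ?_⟩
  · filter_upwards
      [IsUnifLocDoublingMeasure.ae_tendsto_average volume hU.locallyIntegrable 1] with x hx
    refine hx (fun _ => x) (fun δ => δ) Filter.tendsto_id ?_
    filter_upwards [self_mem_nhdsWithin] with δ hδ
    have : (0 : ℝ) < δ := hδ
    exact Metric.mem_closedBall_self (by linarith)
  · intro x hx y hy hxy
    obtain ⟨σ, hσ1, hσ2, hσ3⟩ := Folding.exists_swap hxy
    refine le_of_tendsto_of_tendsto hy hx ?_
    have hopen : {z | σ.height z < 0} ∈ nhds x :=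
      (isOpen_lt σ.continuous_height continuous_const).mem_nhds hσ2
    obtain ⟨ρ, hρ, hball⟩ := Metric.mem_nhds_iff.1 hopen
    filter_upwards [Ioo_mem_nhdsGT hρ] with δ hδ
    have hpre : σ.map ⁻¹' Metric.closedBall y δ = Metric.closedBall x δ := by
      ext z
      have : dist (σ.map z) (σ.map x) = dist z x := by
        simp only [Folding.map, dist_add_right, σ.lin.dist_map]
      simp only [mem_preimage, Metric.mem_closedBall]
      rw [← hσ1, this]
    have hvol : volume.real (Metric.closedBall y δ) = volume.real (Metric.closedBall x δ) := by
      rw [Measure.real, Measure.real, ← hpre,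
        σ.measurePreserving_map.measure_preimage_emb σ.homeo.measurableEmbedding]
    rw [setAverage_eq, setAverage_eq, hvol,
      ← σ.measurePreserving_map.setIntegral_preimage_emb σ.homeo.measurableEmbedding U, hpre]
    refine smul_le_smul_of_nonneg_left ?_ (inv_nonneg.2 measureReal_nonneg)
    refine setIntegral_mono_ae_restrict (σ.integrable_map hU).integrableOn hU.integrableOn ?_
    rw [Filter.EventuallyLE, ae_restrict_iff' measurableSet_closedBall]
    filter_upwards [h σ hσ3] with z hz hzb
    exact hz (hball (Metric.closedBall_subset_ball hδ.2 hzb))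

/-- A function that decreases with `‖x‖` on a set of full measure is a function of `‖x‖` almost
everywhere: the corresponding decreasing function of the radius has at most countably many jumps,
and spheres are null sets. -/
theorem exists_radial_of_ae_antitone_norm [Nontrivial (RN N)] {U : RN N → ℝ} {G : Set (RN N)}
    (hG : ∀ᵐ x ∂volume, x ∈ G) (h : ∀ x ∈ G, ∀ y ∈ G, ‖x‖ < ‖y‖ → U y ≤ U x) :
    ∃ g : ℝ → ℝ, ∀ᵐ x ∂volume, U x = g ‖x‖ := by
  -- `arctan` makes the suprema finite; the value `-2` keeps the sets nonempty
  set K : ℝ → Set ℝ := fun ρ => insert (-2) ((fun y => Real.arctan (U y)) '' {y ∈ G | ρ < ‖y‖})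
    with hK
  have hlow : ∀ t, -2 ≤ Real.arctan t := fun t => by
    have := Real.neg_pi_div_two_lt_arctan t
    have := Real.pi_le_four
    linarith
  have hbdd : ∀ ρ, BddAbove (K ρ) := by
    intro ρ
    refine ⟨2, ?_⟩
    rintro _ (rfl | ⟨y, -, rfl⟩)
    · norm_num
    · have := Real.arctan_lt_pi_div_two (U y)
      have := Real.pi_le_four
      simp only
      linarith
  have hne : ∀ ρ, (K ρ).Nonempty := fun ρ => insert_nonempty _ _
  set k : ℝ → ℝ := fun ρ => sSup (K ρ) with hk
  have hanti : Antitone k := by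
    intro a b hab
    refine csSup_le_csSup (hbdd a) (hne b) (insert_subset_insert (image_mono ?_))
    exact fun y hy => ⟨hy.1, hab.trans_lt hy.2⟩
  have hk1 : ∀ x ∈ G, k ‖x‖ ≤ Real.arctan (U x) := by
    intro x hx
    refine csSup_le (hne _) ?_
    rintro _ (rfl | ⟨y, hy, rfl⟩)
    · exact hlow _
    · exact Real.arctan_mono (h x hx y hy.1 hy.2)
  have hk2 : ∀ x ∈ G, ∀ ρ < ‖x‖, Real.arctan (U x) ≤ k ρ := fun x hx ρ hρ =>
    le_csSup (hbdd ρ) (mem_insert_of_mem _ ⟨x, ⟨hx, hρ⟩, rfl⟩)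
  have hnull : ∀ᵐ x ∂(volume : Measure (RN N)), ContinuousAt k ‖x‖ := by
    have : volume (⋃ ρ ∈ {ρ | ¬ ContinuousAt k ρ}, Metric.sphere (0 : RN N) ρ) = 0 :=
      (measure_biUnion_null_iff hanti.countable_not_continuousAt).2 fun ρ _ =>
        Measure.addHaar_sphere _ _ _
    rw [ae_iff]
    refine measure_mono_null (fun x hx => ?_) this
    exact mem_biUnion (show ‖x‖ ∈ {ρ | ¬ ContinuousAt k ρ} from hx) (by simp)
  refine ⟨fun ρ => Real.tan (k ρ), ?_⟩
  filter_upwards [hG, hnull] with x hx hc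
  have : Real.arctan (U x) ≤ k ‖x‖ := by
    refine ge_of_tendsto (hc.tendsto.mono_left (nhdsWithin_le_nhds (s := Iio ‖x‖))) ?_
    filter_upwards [self_mem_nhdsWithin] with ρ hρ
    exact hk2 x hx ρ hρ
  rw [← le_antisymm this (hk1 x hx), Real.tan_arctan]

end RadialSymmetry

/-! ### Existence of a ground state on the ball -/

section GroundState

variable {N : ℕ} {s C κ p r : ℝ}

theorem integrable_lap_mul {D : Set (RN N)} (hD : volume D ≠ ⊤) (w : H10 D) {φ : RN N → ℝ}
    (hφ : IsTest univ φ) : Integrable (fun x => lap φ x * w.1.fst x) (volume.restrict D) := by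
  have := isFiniteMeasure_restrict hD
  have i : Integrable (fun x => w.1.fst x) (volume.restrict D) :=
    (Lp.memLp w.1.fst).integrable (by norm_num)
  simp only [lap, Finset.sum_mul]
  refine integrable_finsetSum _ fun j _ => ?_
  have h := (hφ.fderiv_apply (EuclideanSpace.single j 1)).fderiv_apply
    (EuclideanSpace.single j (1 : ℝ))
  obtain ⟨M, hM⟩ := h.exists_bound
  exact i.bdd_mul h.continuous.aestronglyMeasurable (Filter.Eventually.of_forall hM)

/-- First variation of the quadratic form in the direction of a test function. -/
theorem quadForm_add_smul_test {D : Set (RN N)} (hD : volume D ≠ ⊤) (w v : H10 D) {φ : RN N → ℝ}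
    (hφ : IsTest univ φ) (h1 : v.1.fst =ᵐ[volume.restrict D] φ)
    (h2 : v.1.snd =ᵐ[volume.restrict D] gradient φ) (t : ℝ) :
    quadForm κ (w + t • v).1 = quadForm κ w.1
      + 2 * t * (∫ x in D, (κ * φ x - lap φ x) * w.1.fst x) + t ^ 2 * quadForm κ v.1 := by
  have e1 : inner ℝ w.1.snd v.1.snd = -∫ x in D, lap φ x * w.1.fst x := by
    rw [← H10_integral_inner_gradient hD w hφ, L2.inner_def]
    refine integral_congr_ae ?_
    filter_upwards [h2] with x hx
    rw [hx]
  have e2 : inner ℝ w.1.fst v.1.fst = ∫ x in D, φ x * w.1.fst x := by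
    rw [L2.inner_def]
    refine integral_congr_ae ?_
    filter_upwards [h1] with x hx
    rw [hx]
    simp
  have i1 : Integrable (fun x => φ x * w.1.fst x) (volume.restrict D) :=
    ((hφ.memLp 2).restrict D).integrable_mul (Lp.memLp w.1.fst)
  have i2 := integrable_lap_mul hD w hφ
  have e3 : ∫ x in D, (κ * φ x - lap φ x) * w.1.fst x
      = κ * inner ℝ w.1.fst v.1.fst + inner ℝ w.1.snd v.1.snd := by
    rw [e1, e2, ← integral_const_mul, ← sub_eq_add_neg, ← integral_sub (i1.const_mul κ) i2]
    refine integral_congr_ae (Filter.Eventually.of_forall fun x => ?_)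
    simp only; ring
  rw [e3]
  simp only [quadForm]
  change ‖w.1.snd + t • v.1.snd‖ ^ 2 + κ * ‖w.1.fst + t • v.1.fst‖ ^ 2 = _
  rw [norm_add_sq_real, norm_add_sq_real, inner_smul_right, inner_smul_right, norm_smul,
    norm_smul, mul_pow, mul_pow, Real.norm_eq_abs, sq_abs]
  ring

/-- A nonnegative minimiser on the ball that decreases with `‖x‖` is positive: otherwise it would
vanish outside a smaller ball, and adding a small multiple of a function that equals `exp (a x_j)`
with `a² > κ` on that ball would decrease the quadratic form and increase the `L^p` norm. -/
theorem IsMinimizer.ae_pos_of_antitone [Nonempty (Fin N)]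
    (hX : HasSobolev (H10 (Metric.ball (0 : RN N) r)) s C)
    (hκ : 0 ≤ κ) (hp : 2 < p) (hps : p ≤ s) {w : H10 (Metric.ball (0 : RN N) r)}
    (hw : IsMinimizer κ p w) {U : RN N → ℝ}
    (hwU : w.1.fst =ᵐ[volume.restrict (Metric.ball 0 r)] U) (hU0 : ∀ x, 0 ≤ U x)
    {G : Set (RN N)} (hG : ∀ᵐ x ∂volume, x ∈ G)
    (hGU : ∀ x ∈ G, ∀ y ∈ G, ‖x‖ < ‖y‖ → U y ≤ U x) :
    ∀ᵐ x ∂volume.restrict (Metric.ball (0 : RN N) r), 0 < w.1.fst x := by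
  have hD : volume (Metric.ball (0 : RN N) r) ≠ ⊤ := measure_ball_lt_top.ne
  have hp0 : 0 < p := by linarith
  by_contra hcon
  obtain ⟨z, hzG, hzr, hz0⟩ : ∃ z ∈ G, ‖z‖ < r ∧ U z = 0 := by
    by_contra hno
    push Not at hno
    refine hcon ?_
    filter_upwards [hwU, ae_restrict_mem measurableSet_ball, ae_restrict_of_ae hG] with x hx hxr hxG
    rw [hx]
    exact lt_of_le_of_ne (hU0 x) (Ne.symm (hno x hxG (by simpa using hxr)))
  have hout : ∀ᵐ x ∂volume.restrict (Metric.ball (0 : RN N) r), ‖z‖ < ‖x‖ → w.1.fst x = 0 := by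
    filter_upwards [hwU, ae_restrict_of_ae hG] with x hx hxG hxz
    rw [hx]
    exact le_antisymm (hz0 ▸ hGU z hzG x hxG hxz) (hU0 x)
  have hw0 : ∀ᵐ x ∂volume.restrict (Metric.ball (0 : RN N) r), 0 ≤ w.1.fst x := by
    filter_upwards [hwU] with x hx
    rw [hx]; exact hU0 x
  obtain ⟨j⟩ := ‹Nonempty (Fin N)›
  set a : ℝ := Real.sqrt κ + 1 with ha
  have haκ : κ < a ^ 2 := by
    have h1 := Real.sq_sqrt hκ
    have h2 := Real.sqrt_nonneg κ
    nlinarith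
  obtain ⟨φ, hφ, hφ0, hφe⟩ := exists_barrier a j (norm_nonneg z) hzr
  obtain ⟨v, -, hv1, hv2⟩ := hφ.exists_H10
  set c : ℝ := ∫ x in Metric.ball (0 : RN N) r, (κ * φ x - lap φ x) * w.1.fst x with hc
  have hce : ∀ᵐ x ∂volume.restrict (Metric.ball (0 : RN N) r),
      (κ * φ x - lap φ x) * w.1.fst x = -((a ^ 2 - κ) * Real.exp (a * x j) * w.1.fst x) := by
    filter_upwards [hout] with x hx
    by_cases hxz : ‖z‖ < ‖x‖
    · rw [hx hxz]; simp
    · obtain ⟨e1, e2⟩ := hφe x (by simpa using not_lt.1 hxz)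
      rw [e1, e2]; ring
  have hquad := quadForm_add_smul_test (κ := κ) hD w v (hφ.mono (subset_univ _)) hv1 hv2
  rw [← hc] at hquad
  have hc0 : c < 0 := by
    have hpos : ∀ x : RN N, 0 < (a ^ 2 - κ) * Real.exp (a * x j) := fun x =>
      mul_pos (by linarith) (Real.exp_pos _)
    have hnn : 0 ≤ᵐ[volume.restrict (Metric.ball (0 : RN N) r)]
        fun x => (a ^ 2 - κ) * Real.exp (a * x j) * w.1.fst x := by
      filter_upwards [hw0] with x hx
      exact mul_nonneg (hpos x).le hx
    rw [hc, integral_congr_ae hce, integral_neg, neg_lt_zero]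
    refine lt_of_le_of_ne (integral_nonneg_of_ae hnn) fun h => ?_
    have hint : Integrable (fun x => (a ^ 2 - κ) * Real.exp (a * x j) * w.1.fst x)
        (volume.restrict (Metric.ball (0 : RN N) r)) := by
      have i1 : Integrable (fun x => φ x * w.1.fst x) (volume.restrict (Metric.ball 0 r)) :=
        ((hφ.memLp 2).restrict _).integrable_mul (Lp.memLp w.1.fst)
      have i2 := integrable_lap_mul hD w (hφ.mono (subset_univ _))
      refine (i2.sub (i1.const_mul κ)).congr ?_
      filter_upwards [hce] with x hx
      rw [Pi.sub_apply, ← neg_eq_iff_eq_neg.2 hx]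
      ring
    have h0 := (integral_eq_zero_iff_of_nonneg_ae hnn hint).1 h.symm
    have : powInt p w.1 = 0 := by
      unfold powInt
      rw [integral_eq_zero_of_ae]
      filter_upwards [h0] with x hx
      have : w.1.fst x = 0 := (mul_eq_zero.1 hx).resolve_left (hpos x).ne'
      simp [this, Real.zero_rpow hp0.ne']
    rw [hw.2] at this
    exact one_ne_zero this
  -- a step at which the linear term dominates
  set Q := quadForm κ v.1 with hQ
  have hQ0 : 0 ≤ Q := quadForm_nonneg hκ _
  set t : ℝ := -c / (Q + 1) with ht
  have ht0 : 0 < t := div_pos (by linarith) (by linarith)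
  have hlt : quadForm κ (w + t • v).1 < minQuot (Metric.ball (0 : RN N) r) κ p := by
    have e : t * (Q + 1) = -c := div_mul_cancel₀ _ (by linarith)
    rw [hquad, hw.1]
    nlinarith [mul_pos ht0 ht0, mul_pos ht0 (neg_pos.2 hc0)]
  have hpow : 1 ≤ powInt p (w + t • v).1 := by
    have := isFiniteMeasure_restrict hD
    rw [← hw.2]
    refine integral_mono_ae (integrable_norm_rpow_of_memLp hp0 (hX.memLp hps w.2))
      (integrable_norm_rpow_of_memLp hp0 (hX.memLp hps (w + t • v).2)) ?_
    have hadd : (w + t • v).1.fst =ᵐ[volume.restrict (Metric.ball (0 : RN N) r)]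
        fun x => w.1.fst x + t * v.1.fst x := by
      filter_upwards [Lp.coeFn_add w.1.fst (t • v.1.fst), Lp.coeFn_smul t v.1.fst] with x h1 h2
      change (w.1.fst + t • v.1.fst) x = _
      rw [h1, Pi.add_apply, h2]; rfl
    filter_upwards [hadd, hw0, hv1] with x hx hx0 hxv
    rw [hx, hxv]
    have := mul_nonneg ht0.le (hφ0 x)
    refine Real.rpow_le_rpow (norm_nonneg _) ?_ hp0.le
    rw [Real.norm_of_nonneg hx0, Real.norm_of_nonneg (by linarith)]
    linarith
  have h1 := minQuot_mul_le hD hX hκ hp hps (w + t • v)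
  have h2 : 0 ≤ minQuot (Metric.ball (0 : RN N) r) κ p := hw.1 ▸ quadForm_nonneg hκ _
  have h3 : 1 ≤ powInt p (w + t • v).1 ^ (2 / p) := Real.one_le_rpow hpow (by positivity)
  nlinarith

/-- A ground state exists for every subcritical exponent. The minimiser of the Sobolev quotient
with the least second moment is unchanged by polarization, so its modulus is radial and decreasing;
a dilation puts it on the Nehari manifold. -/
theorem exists_isGroundState (hN : 3 ≤ N) (hr : 0 < r) (hκ : 0 ≤ κ) (hp : 2 < p)
    (hps : p < critExp N) :
    ∃ u : H10 (Metric.ball (0 : RN N) r), IsGroundState r κ p u := by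
  have : Nonempty (Fin N) := ⟨⟨0, by omega⟩⟩
  have : Nontrivial (RN N) := inferInstance
  set D := Metric.ball (0 : RN N) r with hDdef
  have hDm : MeasurableSet D := measurableSet_ball
  have hDb : Bornology.IsBounded D := Metric.isBounded_ball
  have hD : volume D ≠ ⊤ := measure_ball_lt_top.ne
  have : IsFiniteMeasure (volume.restrict D) := ⟨by simpa using hD.lt_top⟩
  obtain ⟨C, hC, hX⟩ := exists_hasSobolev_H10 hN D
  have hne : ∃ u : H10 D, u ≠ 0 := by
    obtain ⟨ψ, hψ, hψ0⟩ := exists_test_ball (0 : RN N) hr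
    obtain ⟨u, -, hu, -⟩ := hψ.exists_H10
    refine ⟨u, fun h0 => ?_⟩
    have h1 : powInt 2 u.1 = 0 := by rw [h0]; exact powInt_zero two_pos
    have h2 := hψ.integral_rpow_pos (x := 0) (by rw [hψ0]; exact one_ne_zero) two_pos
    have h3 : powInt 2 u.1 = ∫ x, ‖ψ x‖ ^ (2 : ℝ) := by
      rw [← setIntegral_eq_integral_of_forall_compl_eq_zero (s := D) fun x hx => by
        rw [hψ.eq_zero hx]; simp]
      refine integral_congr_ae ?_
      filter_upwards [hu] with x hx
      rw [hx]
    linarith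
  obtain ⟨m, hm, hleast⟩ := exists_minimizer_second_moment hDm hDb hX hC.le hκ hp hps hne
  have hUi : Integrable (absExt m) := by
    have := integrable_absExt_rpow hDm m one_pos (hX.memLp (q := 1) (by linarith) m.2)
    simpa only [Real.rpow_one] using this
  obtain ⟨G, hG, hGU⟩ := ae_antitone_norm hUi fun σ hσ => by
    refine hm.absExt_map_le hDm hDb hX hC.le hκ hp hps hleast σ (fun x hx hxD => ?_) hσ
    rw [hDdef, mem_ball_zero_iff] at hxD ⊢
    rcases hx.lt_or_eq with h | h
    · exact (hσ x h).trans hxD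
    · rwa [Folding.map, σ.map_of_height_eq_zero x h] at hxD
  obtain ⟨g, hg⟩ := exists_radial_of_ae_antitone_norm hG hGU
  obtain ⟨w, hwU, hw⟩ := hm.exists_abs hDm hD hX hC.le hκ hp hps
  have hpos := hw.ae_pos_of_antitone hX hκ hp hps.le hwU (absExt_nonneg m) hG hGU
  obtain ⟨t, ht, h1, h2, h3⟩ := hw.exists_critical hD hX hC.le hκ hp hps.le
  have hsm : (t • w).1.fst =ᵐ[volume.restrict D] fun x => t * w.1.fst x :=
    Lp.coeFn_smul t w.1.fst
  refine ⟨t • w, h1, h2, h3, ?_, fun ρ => t * g ρ, ?_⟩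
  · filter_upwards [hsm, hpos] with x hx hx0
    rw [hx]; exact mul_pos ht hx0
  · filter_upwards [hsm, hwU, ae_restrict_of_ae hg] with x hx hx1 hx2
    rw [hx, hx1, hx2]

end GroundState

end MagneticNehari

end

theorem mainTheorem4 (N : ℕ) (hN : 3 ≤ N)
    (Ω : Set (EuclideanSpace ℝ (Fin N))) (hΩ_open : IsOpen Ω) (hΩ_conn : IsConnected Ω)
    (hΩ_bdd : Bornology.IsBounded Ω)
    (A : EuclideanSpace ℝ (Fin N) → EuclideanSpace ℝ (Fin N))
    (hA_meas : AEStronglyMeasurable A (volume.restrict Ω))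
    (hA_bdd : ∃ C : ℝ, ∀ x ∈ Ω, ‖A x‖ ≤ C)
    (r : ℝ) (hr : 0 < r) (κ : ℝ) (hκ : 0 ≤ κ) :
    (∃ ε : ℝ, 0 < ε ∧ ∃ pstar ∈ Ioo (2 : ℝ) (critExp N), BarycenterProp Ω A r κ ε pstar) ∧
    (∀ ε : ℝ, 0 < ε → ∀ pstar ∈ Ioo (2 : ℝ) (critExp N), BarycenterProp Ω A r κ ε pstar →
      ∃ pbar ∈ Ioo (2 : ℝ) (critExp N), ∀ p ∈ Ico pbar (critExp N),
        (∃ u : H10 (Metric.ball (0 : EuclideanSpace ℝ (Fin N)) r), IsGroundState r κ p u) ∧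
        (∀ u : H10 (Metric.ball (0 : EuclideanSpace ℝ (Fin N)) r), IsGroundState r κ p u →
          (∃! Φ : innerSet Ω r → magSpace Ω A, IsPhi Ω A κ p u Φ) ∧
          ∀ Φ : innerSet Ω r → magSpace Ω A, IsPhi Ω A κ p u Φ →
            range Φ ⊆ magNehariSublevel Ω A κ p
              (1 / (N : ℝ) * sobolevConst Ω ^ ((N : ℝ) / 2) + ε)) ∧
        barycenter '' magNehariSublevel Ω A κ p
            (1 / (N : ℝ) * sobolevConst Ω ^ ((N : ℝ) / 2) + ε) ⊆ outerSet Ω r) := by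
  have hne : Ω.Nonempty := hΩ_conn.nonempty
  obtain ⟨C, hC⟩ := hA_bdd
  refine ⟨exists_barycenterProp hN hΩ_open hne hΩ_bdd A hr hκ, fun ε hε pstar hpstar hB => ?_⟩
  obtain ⟨pbar, hpbar, hphi⟩ := exists_phi_level hN hΩ_open hne hΩ_bdd hA_meas hC hr hκ hε
  refine ⟨max pbar pstar, ⟨lt_max_of_lt_left hpbar.1, max_lt hpbar.2 hpstar.2⟩, fun p hp => ?_⟩
  have hp2 : 2 < p := (lt_max_of_lt_left hpbar.1).trans_le hp.1
  refine ⟨exists_isGroundState hN hr hκ hp2 hp.2,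
    fun u hu => hphi p ⟨(le_max_left _ _).trans hp.1, hp.2⟩ u hu, ?_⟩
  rintro _ ⟨u, ⟨hu, hE⟩, rfl⟩
  exact hB p ⟨(le_max_right _ _).trans hp.1, hp.2⟩ u hu hE
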